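/- **Conventions.** For $r,s\in\mathbb R$ with $r-s\in\mathbb Z$ write $z^r\bar z^s=|z|^{2s}z^{r-s}$. $\mathbb C((p,\bar p,|p|^{\mathbb R}))$ is the space of formal series $\sum_{r,s\in\mathbb R}a_{r,s}p^r\bar p^s$ with $a_{r,s}\in\mathbb C$, $a_{r,s}=0$ unless $r-s\in\mathbb Z$, at most countably many nonzero coefficients, and exponents $r,s$ bounded below. $F_{0,1,\infty}$ is the space of real analytic functions $f:\mathbb{CP}^1\setminus\{0,1,\infty\}\to\mathbb C$ with conformal singularities at $\alpha=0,1,\infty$: for every holomorphic chart $\chi$ with $\chi(\alpha)=0$ there is a series in $\mathbb C((p,\bar p,|p|^{\mathbb R}))$, denoted $j(\chi,f)$, which converges absolutely to $f(\chi^{-1}(p))$ on some annulus $0<|p|<R$. Let $Y_2=\{(z_1,z_2)\in\mathbb C^2: z_1\ne z_2,\ z_1\neq 0,\ z_2\ne0\}$ and let $\mathrm{GCor}_2$ be the space of functions on $Y_2$ spanned by $$\mu=z_1^{\alpha_1}\bar z_1^{\beta_1}z_2^{\alpha_2}\bar z_2^{\beta_2}(z_1-z_2)^{\alpha_{12}}(\bar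 z_1-\bar z_2)^{\beta_{12}}f(z_2/z_1),$$ with $f\in F_{0,1,\infty}$ and real exponents such that $\alpha_1-\beta_1,\alpha_2-\beta_2,\alpha_{12}-\beta_{12}\in\mathbb Z$. The expansions are the linear maps given on such $\mu$ by $$\mu|_{|z_1|>|z_2|}=z_1^{\alpha_1+\alpha_{12}}\bar z_1^{\beta_1+\beta_{12}}z_2^{\alpha_2}\bar z_2^{\beta_2}\,(1-w)^{\alpha_{12}}(1-\bar w)^{\beta_{12}}\,j(p,f)(w),\quad w=z_2/z_1,$$ $$\mu|_{|z_2|>|z_1|}=(-1)^{\alpha_{12}-\beta_{12}}z_1^{\alpha_1}\bar z_1^{\beta_1}z_2^{\alpha_2+\alpha_{12}}\bar z_2^{\beta_2+\beta_{12}}\,(1-w)^{\alpha_{12}}(1-\bar w)^{\beta_{12}}\,j(p^{-1},f)(w),\quad w=z_1/z_2,$$ $$\mu|_{|z_2|>|z_1-z_2|}=z_2^{\alpha_1+\alpha_2}\bar z_2^{\beta_1+\beta_2}z_0^{\alpha_{12}}\bar z_0^{\beta_{12}}\,(1+w)^{\alpha_1}(1+\bar w)^{\beta_1}\,j(1-p^{-1},f)(-w),\quad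 w=z_0/z_2,$$ where $z_0=z_1-z_2$ and the powers of $1\pm w$, $1\pm\bar w$ are expanded as binomial series in $w,\bar w$. **Full vertex algebras.** A full vertex algebra is an $\mathbb R^2$-graded complex vector space $F=\bigoplus_{h,\bar h}F_{h,\bar h}$ with a vector $\mathbf 1\in F_{0,0}$ and a linear map $a\mapsto Y(a,\underline z)=\sum_{r,s\in\mathbb R}a(r,s)z^{-r-1}\bar z^{-s-1}$, $a(r,s)\in\mathrm{End}\,F$, where for each $a$ at most countably many $a(r,s)$ are nonzero and $a(r,s)=0$ unless $r-s\in\mathbb Z$, such that: - (FV1) for all $a,b$ there is $N$ with $a(r,s)b=0$ whenever $r\ge N$ or $s\ge N$; - (FV2) $F_{h,\bar h}=0$ unless $h-\bar h\in\mathbb Z$; - (FV3) $Y(a,\underline z)\mathbf 1\in F[[z,\bar z]]$ and $a(-1,-1)\mathbf 1=a$; - (FV4) $Y(\mathbf 1,\underline z)=\mathrm{id}$; - (FV5) for all $a,b,c\in F$ and $u\in F^\vee=\bigoplus F_{h,\bar h}^*$ there is $\mu\in\mathrm{GCor}_2$ with $u(Y(a,\underline z_1)Y(b,\underline z_2)c)=\mu|_{|z_1|>|z_2|}$,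 $u(Y(Y(a,\underline z_0)b,\underline z_2)c)=\mu|_{|z_2|>|z_1-z_2|}$ and $u(Y(b,\underline z_2)Y(a,\underline z_1)c)=\mu|_{|z_2|>|z_1|}$; - (FV6) $a(r,s)b\in F_{h+h'-r-1,\bar h+\bar h'-s-1}$ for $a\in F_{h,\bar h}$, $b\in F_{h',\bar h'}$. Put $Da=a(-2,-1)\mathbf 1$ and $\bar Da=a(-1,-2)\mathbf 1$. A full vertex operator algebra (full VOA) is a full vertex algebra with vectors $\omega,\bar\omega$ such that $\bar D\omega=0$ and $D\bar\omega=0$, and such that the operators $L(n)=\omega(n+1,-1)$ and $\bar L(n)=\bar\omega(-1,n+1)$ satisfy: $[L(m),L(n)]=(m-n)L(m+n)+\frac{m^3-m}{12}\delta_{m+n,0}\,c$ and $[\bar L(m),\bar L(n)]=(m-n)\bar L(m+n)+\frac{m^3-m}{12}\delta_{m+n,0}\,\bar c$ for some $c,\bar c\in\mathbb C$; $D=L(-1)$, $\bar D=\bar L(-1)$; $L(0)=h$ and $\bar L(0)=\bar h$ on $F_{h,\bar h}$; each $F_{h,\bar h}$ is finite-dimensional; and there is $N\in\mathbb R$ with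 $F_{h,\bar h}=0$ whenever $h\le N$ or $\bar h\le N$. It is *self-dual* if there is a linear isomorphism of $F$ onto $F^\vee$ which intertwines $Y$ with the action $$\langle Y_{F^\vee}(a,\underline z)u,v\rangle=\langle u,\,Y(e^{zL(1)+\bar z\bar L(1)}(-1)^{h-\bar h}z^{-2h}\bar z^{-2\bar h}a,\ \underline z^{-1})v\rangle\qquad(a\in F_{h,\bar h}),$$ that is, if $F\cong F^\vee$ as $F$-modules. It is *QP-generated* if $F$ is generated, as a module over the Lie algebra $\mathrm{sl}_2\oplus\mathrm{sl}_2$ spanned by $L(i),\bar L(i)$, $i=-1,0,1$, by the quasi-primary vectors, i.e. the vectors $v\in F_{h,\bar h}$ with $L(1)v=\bar L(1)v=0$. **The construction.** Let $L$ be a non-degenerate even lattice: a free abelian group of finite rank with a symmetric bilinear form $(-,-):L\times L\to\mathbb Z$ such that $(\alpha,\alpha)\in2\mathbb Z$ for all $\alpha$, whose extension to $H_L=L\otimes_{\mathbb Z}\mathbb R$ is non-degenerate. Let $P(H_L)$ be the set of $p\in\mathrm{End}\,H_L$ with $p^2=p$ and $\ker p\perp\ker(1-p)$, and let $P_>(H_L)\subset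 P(H_L)$ be the subset of those $p$ for which $\ker(1-p)$ is positive definite and $\ker p$ is negative definite. For $p\in P(H_L)$ put $\bar p=1-p$, $H_l=\ker\bar p$, $H_r=\ker p$ and $(h,h')_p=(ph,ph')-(\bar ph,\bar ph')$. Let $\mathbb C[\hat L]=\bigoplus_{\alpha\in L}\mathbb Ce_\alpha$ be a twisted group algebra of $L$, that is, an $L$-graded associative algebra with unit $e_0$, such that $e_\alpha e_\beta\ne0$ and $e_\alpha e_\beta=(-1)^{(\alpha,\beta)}e_\beta e_\alpha$. Let $$F_{L,H_L,p}=S\Bigl(\bigoplus_{n\ge0}(H_L\otimes_{\mathbb R}\mathbb C)t^{-n-1}\Bigr)\otimes\mathbb C[\hat L]$$ be the module over the Heisenberg Lie algebra of $(H_L\otimes\mathbb C,(-,-)_p)$ induced from $\mathbb C[\hat L]$, on which the central element acts by $1$, where $h(n)e_\alpha=0$ for $n\ge1$ and $h(0)e_\alpha=(h,\alpha)_pe_\alpha$; here $h(n)$ denotes the action of $h\otimes t^n$, so that $[h(m),h'(n)]=m\,\delta_{m+n,0}(h,h')_p$. For $h\in H_L$ let $$E^{\pm}(h,\underline z)=\exp\Bigl(-\sum_{\pm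 n\ge1}\bigl(\tfrac{(ph)(n)}{n}z^{-n}+\tfrac{(\bar ph)(n)}{n}\bar z^{-n}\bigr)\Bigr).$$ The map $Y$ is determined by $$Y(e_\alpha,\underline z)=E^-(\alpha,\underline z)E^+(\alpha,\underline z)\,l_{e_\alpha}z^{p\alpha}\bar z^{\bar p\alpha},\qquad l_{e_\alpha}z^{p\alpha}\bar z^{\bar p\alpha}e_\beta=z^{(p\alpha,p\beta)_p}\bar z^{(\bar p\alpha,\bar p\beta)_p}e_\alpha e_\beta,$$ $$Y(h(-n-1)v,\underline z)=\tfrac1{n!}\bigl(\partial_z^nh^-(z)\bigr)Y(v,\underline z)+Y(v,\underline z)\tfrac1{n!}\bigl(\partial_z^nh^+(z)\bigr)\qquad(h\in H_l,\ n\ge 0),$$ where $h^-(z)=\sum_{k\ge0}h(-k-1)z^k$ and $h^+(z)=\sum_{k\ge0}h(k)z^{-k-1}$, and by the same formula with $\bar z$ in place of $z$ for $h\in H_r$. The vacuum is $\mathbf 1=1\otimes e_0$. The subspace $F_{h,\bar h}$ is spanned by the vectors $h_l^1(-n_1-1)\cdots h_l^k(-n_k-1)h_r^1(-m_1-1)\cdots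 h_r^j(-m_j-1)e_\alpha$ with $h_l^i\in H_l$, $h_r^i\in H_r$, $h=\frac12(p\alpha,p\alpha)_p+\sum_i(n_i+1)$ and $\bar h=\frac12(\bar p\alpha,\bar p\alpha)_p+\sum_i(m_i+1)$. Finally, let $\omega=\frac12\sum_ih_l^i(-1)h_l^i(-1)\mathbf 1$ and $\bar\omega=\frac12\sum_jh_r^j(-1)h_r^j(-1)\mathbf 1$, for any bases $(h_l^i)$ of $H_l\otimes\mathbb C$ and $(h_r^j)$ of $H_r\otimes\mathbb C$ that are orthonormal for $(-,-)_p$. **Proposition.** Let $L$ be a non-degenerate even lattice. 1. For every $p\in P(H_L)$, $(F_{L,H_L,p},Y,\mathbf 1)$ is a full vertex algebra. 2. For every $p\in P_>(H_L)$, $(F_{L,H_L,p},Y,\mathbf 1,\omega,\bar\omega)$ is a full vertex operator algebra, and it is self-dual and QP-generated. 3. The family in (2) is parametrized by a Grassmannian. Let $(n,m)$ be the signature of $H_L$, fix a basis of $H_L$ in which the form has matrix $\mathrm{diag}(1_n,-1_m)$, and let $p_0\in P_>(H_L)$ be the projection onto the span of the first $n$ basis vectors along the span of the last $m$. Identify $O(n,m;\mathbb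 R)$ with the isometry group of $H_L$ by means of the basis. Then $g\mapsto g\,p_0\,g^{-1}$ induces a homeomorphism $$O(n,m;\mathbb R)/\bigl(O(n;\mathbb R)\times O(m;\mathbb R)\bigr)\ \xrightarrow{\ \sim\ }\ P_>(H_L).$$ -/

import Mathlib

open scoped TensorProduct
noncomputable section
namespace FullVertex

section Fock
variable {E : Type*} [AddCommGroup E] [Module ℂ E]

/-- The symmetric algebra of `⨁ n, E t^(-n-1)`. -/
def Fock (E : Type*) [AddCommGroup E] [Module ℂ E] : Type _ := SymmetricAlgebra ℂ (ℕ →₀ E)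

instance : CommRing (Fock E) := inferInstanceAs (CommRing (SymmetricAlgebra ℂ (ℕ →₀ E)))

instance : Algebra ℂ (Fock E) := inferInstanceAs (Algebra ℂ (SymmetricAlgebra ℂ (ℕ →₀ E)))

namespace Fock

def ι : (ℕ →₀ E) →ₗ[ℂ] Fock E := SymmetricAlgebra.ι ℂ (ℕ →₀ E)

theorem induction {motive : Fock E → Prop}
    (algebraMap : ∀ r, motive (algebraMap ℂ (Fock E) r)) (ι : ∀ v, motive (ι v))
    (mul : ∀ a b, motive a → motive b → motive (a * b))
    (add : ∀ a b, motive a → motive b → motive (a + b)) (a : Fock E) : motive a :=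
  SymmetricAlgebra.induction ℂ (ℕ →₀ E) (motive := motive) algebraMap ι mul add a

def lift {A : Type*} [CommSemiring A] [Algebra ℂ A] (f : (ℕ →₀ E) →ₗ[ℂ] A) : Fock E →ₐ[ℂ] A :=
  SymmetricAlgebra.lift f

theorem lift_ι {A : Type*} [CommSemiring A] [Algebra ℂ A] (f : (ℕ →₀ E) →ₗ[ℂ] A) (v : ℕ →₀ E) :
    lift f (ι v) = f v :=
  SymmetricAlgebra.lift_ι_apply f v

end Fock

/-- The generator `h(-n-1)`. -/
def gen (n : ℕ) : E →ₗ[ℂ] Fock E :=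
  Fock.ι ∘ₗ Finsupp.lsingle n

def contractHom (c : (ℕ →₀ E) →ₗ[ℂ] ℂ) : Fock E →ₐ[ℂ] TrivSqZeroExt (Fock E) (Fock E) :=
  Fock.lift
    { toFun := fun v => TrivSqZeroExt.inl (Fock.ι v)
        + TrivSqZeroExt.inr (algebraMap ℂ (Fock E) (c v))
      map_add' := fun v w => by
        simp only [map_add, TrivSqZeroExt.inl_add, TrivSqZeroExt.inr_add]
        abel
      map_smul' := fun t v => by
        simp only [map_smul, TrivSqZeroExt.inl_smul, smul_add, RingHom.id_apply, smul_eq_mul,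
          map_mul, ← TrivSqZeroExt.inr_smul, Algebra.smul_def t (algebraMap ℂ (Fock E) (c v))] }

theorem contractHom_fst (c : (ℕ →₀ E) →ₗ[ℂ] ℂ) (s : Fock E) : (contractHom c s).fst = s := by
  induction s using Fock.induction with
  | algebraMap r => simp [TrivSqZeroExt.algebraMap_eq_inl']
  | ι v => simp [contractHom, Fock.lift_ι]
  | mul a b ha hb => simp [ha, hb]
  | add a b ha hb => simp [ha, hb]

/-- The derivation of the symmetric algebra extending a linear functional on the generators. -/
def contract (c : (ℕ →₀ E) →ₗ[ℂ] ℂ) : Module.End ℂ (Fock E) where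
  toFun s := (contractHom c s).snd
  map_add' s t := by simp
  map_smul' r s := by simp

theorem contract_ι (c : (ℕ →₀ E) →ₗ[ℂ] ℂ) (v : ℕ →₀ E) :
    contract c (Fock.ι v) = algebraMap ℂ (Fock E) (c v) := by
  simp [contract, contractHom, Fock.lift_ι, Algebra.algebraMap_eq_smul_one]

theorem contract_algebraMap (c : (ℕ →₀ E) →ₗ[ℂ] ℂ) (r : ℂ) :
    contract c (algebraMap ℂ (Fock E) r) = 0 := by
  simp [contract, TrivSqZeroExt.algebraMap_eq_inl']

theorem contract_mul (c : (ℕ →₀ E) →ₗ[ℂ] ℂ) (s t : Fock E) :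
    contract c (s * t) = s * contract c t + t * contract c s := by
  simp [contract, contractHom_fst, mul_comm]

theorem contract_comm (c d : (ℕ →₀ E) →ₗ[ℂ] ℂ) (s : Fock E) :
    contract c (contract d s) = contract d (contract c s) := by
  induction s using Fock.induction with
  | algebraMap r => simp [contract_algebraMap]
  | ι v => simp [contract_ι, contract_algebraMap]
  | mul a b ha hb => simp only [contract_mul, map_add, ha, hb]; ring
  | add a b ha hb => simp only [map_add, ha, hb]

/-- The operator `h(n)` on the Fock space of charge `w`. -/
def modeAt (g : LinearMap.BilinForm ℂ E) (w h : E) : ℤ → Module.End ℂ (Fock E)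
  | .ofNat 0 => g h w • LinearMap.id
  | .ofNat (n + 1) => contract (((n : ℂ) + 1) • (g h ∘ₗ Finsupp.lapply n))
  | .negSucc n => LinearMap.mulLeft ℂ (gen n h)

def level (K : ℤ) : Submodule ℂ (Fock E) :=
  Submodule.span ℂ {s | ∃ l : List (ℕ × E), s = (l.map fun x => gen x.1 x.2).prod ∧
    (l.map fun x => (x.1 : ℤ) + 1).sum ≤ K}

theorem level_neg {K : ℤ} (hK : K < 0) : level (E := E) K = ⊥ := by
  rw [level, Submodule.span_eq_bot]
  rintro s ⟨l, -, hl⟩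
  exfalso
  have : 0 ≤ (l.map fun x => (x.1 : ℤ) + 1).sum := by
    apply List.sum_nonneg
    intro y hy
    obtain ⟨x, -, rfl⟩ := List.mem_map.1 hy
    positivity
  omega

theorem level_mono {K K' : ℤ} (h : K ≤ K') : level (E := E) K ≤ level K' := by
  apply Submodule.span_mono
  rintro s ⟨l, hs, hl⟩
  exact ⟨l, hs, hl.trans h⟩

theorem level_mul {K K' : ℤ} {s t : Fock E} (hs : s ∈ level K) (ht : t ∈ level K') :
    s * t ∈ level (K + K') := by
  have := Submodule.mul_mem_mul hs ht
  rw [level, level, Submodule.span_mul_span] at this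
  refine Submodule.span_mono ?_ this
  rintro _ ⟨_, ⟨l, rfl, hl⟩, _, ⟨l', rfl, hl'⟩, rfl⟩
  refine ⟨l ++ l', by simp, by rw [List.map_append, List.sum_append]; omega⟩

theorem exists_level (s : Fock E) : ∃ K : ℕ, s ∈ level (K : ℤ) := by
  induction s using Fock.induction with
  | algebraMap r =>
    refine ⟨0, ?_⟩
    rw [Algebra.algebraMap_eq_smul_one]
    exact Submodule.smul_mem _ _ (Submodule.subset_span ⟨[], by simp, by simp⟩)
  | ι v =>
    induction v using Finsupp.induction_linear with
    | zero => exact ⟨0, by simp⟩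
    | add f g hf hg =>
      obtain ⟨K, hK⟩ := hf
      obtain ⟨K', hK'⟩ := hg
      refine ⟨max K K', ?_⟩
      rw [map_add]
      exact Submodule.add_mem _ (level_mono (by simp) hK) (level_mono (by simp) hK')
    | single n h =>
      exact ⟨n + 1, Submodule.subset_span ⟨[(n, h)], by simp [gen], by simp⟩⟩
  | mul a b ha hb =>
    obtain ⟨K, hK⟩ := ha
    obtain ⟨K', hK'⟩ := hb
    exact ⟨K + K', by push_cast; exact level_mul hK hK'⟩
  | add a b ha hb =>
    obtain ⟨K, hK⟩ := ha
    obtain ⟨K', hK'⟩ := hb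
    exact ⟨max K K', Submodule.add_mem _ (level_mono (by simp) hK) (level_mono (by simp) hK')⟩

theorem modeAt_level (g : LinearMap.BilinForm ℂ E) (w h : E) (n : ℕ) {K : ℤ} {s : Fock E}
    (hs : s ∈ level K) : modeAt g w h (n : ℤ) s ∈ level (K - n) := by
  cases n with
  | zero => simpa [modeAt] using Submodule.smul_mem _ _ hs
  | succ n =>
    have key : ∀ l : List (ℕ × E), ∀ K : ℤ, (l.map fun x => (x.1 : ℤ) + 1).sum ≤ K →
        contract (((n : ℂ) + 1) • (g h ∘ₗ Finsupp.lapply n)) (l.map fun x => gen x.1 x.2).prod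
          ∈ level (K - (n + 1)) := by
      intro l
      induction l with
      | nil =>
        intro K _
        have := contract_algebraMap (((n : ℂ) + 1) • (g h ∘ₗ Finsupp.lapply n)) 1
        rw [map_one] at this
        simp [this]
      | cons x l ih =>
        intro K hK
        simp only [List.map_cons, List.sum_cons, List.prod_cons] at hK ⊢
        rw [contract_mul]
        refine Submodule.add_mem _ ?_ ?_
        · have h1 : gen x.1 x.2 ∈ level (E := E) (x.1 + 1) :=
            Submodule.subset_span ⟨[x], by simp, by simp⟩
          have := level_mul h1 (ih (K - (x.1 + 1)) (by omega))
          convert this using 2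
          ring
        · rw [gen, LinearMap.comp_apply, contract_ι, mul_comm, ← Algebra.smul_def]
          by_cases hx : x.1 = n
          · refine Submodule.smul_mem _ _ (Submodule.subset_span ⟨l, rfl, by omega⟩)
          · simp [hx]
    change contract _ s ∈ _
    push_cast
    refine Submodule.span_induction (p := fun s _ => contract _ s ∈ level (K - (n + 1))) ?_ ?_ ?_ ?_ hs
    · rintro _ ⟨l, rfl, hl⟩
      exact key l K hl
    · simp
    · intro a b _ _ ha hb
      rw [map_add]; exact Submodule.add_mem _ ha hb
    · intro r a _ ha
      rw [map_smul]; exact Submodule.smul_mem _ _ ha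

theorem modeAt_comm_nonneg (g : LinearMap.BilinForm ℂ E) (w h h' : E) (n n' : ℕ) :
    modeAt g w h n * modeAt g w h' n' = modeAt g w h' n' * modeAt g w h n := by
  rcases n with _ | n <;> rcases n' with _ | n'
  · simp only [modeAt]; ext; simp [smul_smul, mul_comm]
  all_goals ext s
  · change g h w • contract _ s = contract _ (g h w • s)
    rw [map_smul]
  · change contract _ (g h' w • s) = g h' w • contract _ s
    rw [map_smul]
  · exact contract_comm _ _ s

theorem modeAt_comm_neg (g : LinearMap.BilinForm ℂ E) (w h h' : E) (n n' : ℕ) :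
    modeAt g w h (.negSucc n) * modeAt g w h' (.negSucc n') =
      modeAt g w h' (.negSucc n') * modeAt g w h (.negSucc n) := by
  ext s
  change gen n h * (gen n' h' * s) = gen n' h' * (gen n h * s)
  ring

theorem modeAt_heis (g : LinearMap.BilinForm ℂ E) (hg : g.IsSymm) (w h h' : E) (m n : ℤ) :
    modeAt g w h m * modeAt g w h' n - modeAt g w h' n * modeAt g w h m =
      (if m + n = 0 then (m : ℂ) * g h h' else 0) • 1 := by
  rcases m with m | m <;> rcases n with n | n
  · rw [Int.ofNat_eq_natCast, Int.ofNat_eq_natCast, modeAt_comm_nonneg, sub_self]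
    split_ifs with h0
    · have : m = 0 := by omega
      simp [this]
    · simp
  · rcases m with _ | m
    · ext s; simp [modeAt]
    · apply LinearMap.ext; intro s
      change contract _ (gen n h' * s) - gen n h' * contract _ s = _
      rw [contract_mul, gen, LinearMap.comp_apply, contract_ι, add_sub_cancel_left, mul_comm, ← Algebra.smul_def]
      by_cases hmn : n = m
      · subst hmn; simp [Int.negSucc_eq]
      · have : ¬ ((m + 1 : ℤ) + Int.negSucc n = 0) := by omega
        simp [hmn, this]
  · rcases n with _ | n
    · have : ¬ (Int.negSucc m + Int.ofNat 0 = 0) := by simp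
      rw [if_neg this]
      ext s; simp [modeAt]
    · apply LinearMap.ext; intro s
      change gen m h * contract _ s - contract _ (gen m h * s) = _
      rw [contract_mul, gen, LinearMap.comp_apply, contract_ι, sub_add_cancel_left, mul_comm, ← Algebra.smul_def]
      by_cases hmn : n = m
      · subst hmn
        have : Int.negSucc n + Int.ofNat (n + 1) = 0 := by
          rw [Int.negSucc_eq]; simp
        rw [if_pos this]
        simp [Int.negSucc_eq, hg.eq h' h]
        rw [← neg_smul]; congr 1; ring
      · have : ¬ (Int.negSucc m + Int.ofNat (n + 1) = 0) := by
          rw [Int.negSucc_eq]; simp; omega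
        rw [if_neg this]; simp [Ne.symm hmn]
  · rw [modeAt_comm_neg, sub_self]
    have : ¬ (Int.negSucc m + Int.negSucc n = 0) := by omega
    simp [this]
end Fock

section Fields
variable {F : Type*} [AddCommGroup F] [Module ℂ F]

/-- The pointwise finite sum of a family of operators (zero if it is not pointwise finite). -/
def lfSum {ι : Type*} (T : ι → Module.End ℂ F) : Module.End ℂ F :=
  open Classical in
  if h : ∀ w, (Function.support fun i => T i w).Finite then
    { toFun := fun w => ∑ᶠ i, T i w
      map_add' := fun v w => by
        simp only [map_add]
        exact finsum_add_distrib (h v) (h w)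
      map_smul' := fun t v => by
        simp only [map_smul, RingHom.id_apply]
        exact (smul_finsum' t (h v)).symm }
  else 0

theorem lfSum_apply {ι : Type*} {T : ι → Module.End ℂ F}
    (h : ∀ w, (Function.support fun i => T i w).Finite) (w : F) :
    lfSum T w = ∑ᶠ i, T i w := by
  simp [lfSum, h]

theorem lfSum_eq {T : ℕ → Module.End ℂ F} (h : ∀ w, ∃ K : ℕ, ∀ j, K ≤ j → T j w = 0)
    (w : F) (K : ℕ) (hK : ∀ j, K ≤ j → T j w = 0) :
    lfSum T w = ∑ j ∈ Finset.range K, T j w := by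
  have aux : ∀ w K, (∀ j, K ≤ j → T j w = 0) →
      (Function.support fun i => T i w) ⊆ (Finset.range K : Set ℕ) := by
    intro w K hK j hj
    by_contra hc
    simp at hc
    exact hj (hK j hc)
  rw [lfSum_apply]
  · exact finsum_eq_sum_of_support_subset _ (aux w K hK)
  · intro w
    obtain ⟨K, hK⟩ := h w
    exact (Finset.finite_toSet _).subset (aux w K hK)

variable (F) in
/-- The fields on `F`: series `∑ A r s z^r z̄^s` of operators such that, on every vector, the
exponents that occur are bounded below. -/
def fieldSpace : Submodule ℂ (ℝ → ℝ → Module.End ℂ F) where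
  carrier := {A | ∀ w, ∃ N : ℝ, ∀ r s, (r < N ∨ s < N) → A r s w = 0}
  zero_mem' := fun w => ⟨0, fun r s _ => rfl⟩
  add_mem' := by
    intro A B hA hB w
    obtain ⟨N, hN⟩ := hA w
    obtain ⟨M, hM⟩ := hB w
    refine ⟨min N M, fun r s h => ?_⟩
    have h1 : r < N ∨ s < N := h.imp (fun h => h.trans_le (min_le_left _ _))
      (fun h => h.trans_le (min_le_left _ _))
    have h2 : r < M ∨ s < M := h.imp (fun h => h.trans_le (min_le_right _ _))
      (fun h => h.trans_le (min_le_right _ _))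
    simp [hN r s h1, hM r s h2]
  smul_mem' := by
    intro t A hA w
    obtain ⟨N, hN⟩ := hA w
    exact ⟨N, fun r s h => by simp [hN r s h]⟩

/-- A direction: `(1, 0)` for the variable `z`, `(0, 1)` for the variable `z̄`. -/
structure Direction where
  fst : ℝ
  snd : ℝ
  nonneg_fst : 0 ≤ fst
  nonneg_snd : 0 ≤ snd
  sum_eq : fst + snd = 1

def Direction.z : Direction := ⟨1, 0, by norm_num, by norm_num, by norm_num⟩
def Direction.zbar : Direction := ⟨0, 1, by norm_num, by norm_num, by norm_num⟩

theorem left_finite (d : Direction) {N r s : ℝ} {j : ℕ} (hj : ⌈r + s - 2 * N⌉₊ + 1 ≤ j) :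
    r - j * d.fst < N ∨ s - j * d.snd < N := by
  by_contra hc
  push Not at hc
  have h1 : (r + s - 2 * N : ℝ) ≤ ⌈r + s - 2 * N⌉₊ := Nat.le_ceil _
  have h2 : ((⌈r + s - 2 * N⌉₊ + 1 : ℕ) : ℝ) ≤ j := by exact_mod_cast hj
  push_cast at h2
  have h3 : (j : ℝ) * d.fst + j * d.snd = j := by rw [← mul_add, d.sum_eq, mul_one]
  linarith [hc.1, hc.2]

theorem left_bound (A : fieldSpace F) (d : Direction) (r s : ℝ) (w : F) :
    ∃ K : ℕ, ∀ j : ℕ, K ≤ j → A.1 (r - j * d.fst) (s - j * d.snd) w = 0 := by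
  obtain ⟨N, hN⟩ := A.2 w
  exact ⟨_, fun j hj => hN _ _ (left_finite d hj)⟩

/-- Left multiplication of a field by `∑ T j x ^ j`, where `x` is the variable of `d`. -/
def leftMul (T : ℕ → Module.End ℂ F) (d : Direction) : Module.End ℂ (fieldSpace F) where
  toFun A := ⟨fun r s => lfSum fun j => T j * A.1 (r - j * d.fst) (s - j * d.snd), by
    intro w
    obtain ⟨N, hN⟩ := A.2 w
    refine ⟨N, fun r s h => ?_⟩
    rw [lfSum_eq (K := 0)]
    · simp
    · intro w
      obtain ⟨K, hK⟩ := left_bound A d r s w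
      exact ⟨K, fun j hj => by simp [hK j hj]⟩
    · intro j _
      have h1 : (0 : ℝ) ≤ j * d.fst := mul_nonneg j.cast_nonneg d.nonneg_fst
      have h2 : (0 : ℝ) ≤ j * d.snd := mul_nonneg j.cast_nonneg d.nonneg_snd
      simp [hN (r - j * d.fst) (s - j * d.snd) (h.imp (by intro h; linarith) (by intro h; linarith))]⟩
  map_add' A B := by
    ext r s w
    obtain ⟨K, hK⟩ := left_bound A d r s w
    obtain ⟨M, hM⟩ := left_bound B d r s w
    change lfSum (fun j => T j * (A.1 + B.1) _ _) w = lfSum (fun j => T j * A.1 _ _) w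
      + lfSum (fun j => T j * B.1 _ _) w
    rw [lfSum_eq (K := max K M), lfSum_eq (K := max K M), lfSum_eq (K := max K M),
      ← Finset.sum_add_distrib]
    · simp
    · intro w
      obtain ⟨M, hM⟩ := left_bound B d r s w
      exact ⟨M, fun j hj => by simp [hM j hj]⟩
    · intro j hj
      simp [hM j ((le_max_right _ _).trans hj)]
    · intro w
      obtain ⟨K, hK⟩ := left_bound A d r s w
      exact ⟨K, fun j hj => by simp [hK j hj]⟩
    · intro j hj
      simp [hK j ((le_max_left _ _).trans hj)]
    · intro w
      obtain ⟨K, hK⟩ := left_bound (A + B) d r s w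
      exact ⟨K, fun j hj => by
        have := hK j hj
        simp only [Submodule.coe_add] at this
        simp only [Module.End.mul_apply, this, map_zero]⟩
    · intro j hj
      simp [hK j ((le_max_left _ _).trans hj), hM j ((le_max_right _ _).trans hj)]
  map_smul' t A := by
    ext r s w
    obtain ⟨K, hK⟩ := left_bound A d r s w
    change lfSum (fun j => T j * (t • A.1) _ _) w = t • lfSum (fun j => T j * A.1 _ _) w
    rw [lfSum_eq (K := K), lfSum_eq (K := K), Finset.smul_sum]
    · simp
    · intro w
      obtain ⟨K, hK⟩ := left_bound A d r s w
      exact ⟨K, fun j hj => by simp [hK j hj]⟩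
    · intro j hj
      simp [hK j hj]
    · intro w
      obtain ⟨K, hK⟩ := left_bound A d r s w
      exact ⟨K, fun j hj => by simp [hK j hj]⟩
    · intro j hj
      simp [hK j hj]

theorem leftMul_eq (T : ℕ → Module.End ℂ F) (d : Direction) (A : fieldSpace F) (r s : ℝ) (w : F)
    (K : ℕ) (hK : ∀ j : ℕ, K ≤ j → A.1 (r - j * d.fst) (s - j * d.snd) w = 0) :
    (leftMul T d A).1 r s w =
      ∑ j ∈ Finset.range K, T j (A.1 (r - j * d.fst) (s - j * d.snd) w) := by
  change lfSum (fun j => T j * A.1 _ _) w = _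
  rw [lfSum_eq (K := K)]
  · rfl
  · intro w
    obtain ⟨K, hK⟩ := left_bound A d r s w
    exact ⟨K, fun j hj => by simp [hK j hj]⟩
  · intro j hj
    simp [hK j hj]

variable (F) in
/-- Sequences of operators that are eventually zero on every vector. -/
def finiteSeq : Submodule ℂ (ℕ → Module.End ℂ F) where
  carrier := {T | ∀ w, ∃ K : ℕ, ∀ j, K ≤ j → T j w = 0}
  zero_mem' := fun w => ⟨0, fun j _ => rfl⟩
  add_mem' := by
    intro A B hA hB w
    obtain ⟨N, hN⟩ := hA w
    obtain ⟨M, hM⟩ := hB w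
    exact ⟨max N M, fun j h => by
      simp [hN j ((le_max_left _ _).trans h), hM j ((le_max_right _ _).trans h)]⟩
  smul_mem' := by
    intro t A hA w
    obtain ⟨N, hN⟩ := hA w
    exact ⟨N, fun j h => by simp [hN j h]⟩

/-- Right multiplication of a field by `∑ T j x ^ (-j - 1)`, where `x` is the variable of `d`. -/
def rightMul (T : finiteSeq F) (d : Direction) : Module.End ℂ (fieldSpace F) where
  toFun A := ⟨fun r s => lfSum fun j : ℕ => A.1 (r + (j + 1) * d.fst) (s + (j + 1) * d.snd) * T.1 j, by
    intro w
    obtain ⟨K, hK⟩ := T.2 w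
    choose N hN using fun j : ℕ => A.2 (T.1 j w)
    obtain ⟨M, hM⟩ : ∃ M : ℝ, ∀ j < K, M ≤ N j - (j + 1) := by
      obtain ⟨M, hM⟩ := ((Finset.range K).image fun j => N j - (j + 1)).bddBelow
      exact ⟨M, fun j hj => hM (by
        simp only [Finset.coe_image, Set.mem_image, Finset.coe_range, Set.mem_Iio]
        exact ⟨j, hj, rfl⟩)⟩
    refine ⟨M, fun r s h => ?_⟩
    rw [lfSum_eq (K := K)]
    · refine Finset.sum_eq_zero fun j hj => ?_
      have hj' := hM j (Finset.mem_range.1 hj)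
      have hf : d.fst ≤ 1 := by linarith [d.sum_eq, d.nonneg_snd]
      have hs : d.snd ≤ 1 := by linarith [d.sum_eq, d.nonneg_fst]
      have h0 : (0 : ℝ) ≤ (j : ℝ) + 1 := by positivity
      have h1 := mul_le_mul_of_nonneg_left hf h0
      have h2 := mul_le_mul_of_nonneg_left hs h0
      exact hN j _ _ (h.imp (by intro h; linarith) (by intro h; linarith))
    · intro w
      obtain ⟨K, hK⟩ := T.2 w
      exact ⟨K, fun j hj => by simp [hK j hj]⟩
    · intro j hj
      simp [hK j hj]⟩
  map_add' A B := by
    ext r s w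
    obtain ⟨K, hK⟩ := T.2 w
    have hT : ∀ (C : ℝ → ℝ → Module.End ℂ F) (w : F), ∃ K : ℕ, ∀ j, K ≤ j →
        (C (r + (j + 1) * d.fst) (s + (j + 1) * d.snd) * T.1 j) w = 0 := fun C w => by
      obtain ⟨K, hK⟩ := T.2 w
      exact ⟨K, fun j hj => by simp [hK j hj]⟩
    change lfSum (fun j : ℕ => (A.1 + B.1) _ _ * T.1 j) w = lfSum (fun j : ℕ => A.1 _ _ * T.1 j) w
      + lfSum (fun j : ℕ => B.1 _ _ * T.1 j) w
    rw [lfSum_eq (hT _) w K (fun j hj => by simp [hK j hj]),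
      lfSum_eq (hT _) w K (fun j hj => by simp [hK j hj]),
      lfSum_eq (hT _) w K (fun j hj => by simp [hK j hj]), ← Finset.sum_add_distrib]
    simp
  map_smul' t A := by
    ext r s w
    obtain ⟨K, hK⟩ := T.2 w
    have hT : ∀ (C : ℝ → ℝ → Module.End ℂ F) (w : F), ∃ K : ℕ, ∀ j, K ≤ j →
        (C (r + (j + 1) * d.fst) (s + (j + 1) * d.snd) * T.1 j) w = 0 := fun C w => by
      obtain ⟨K, hK⟩ := T.2 w
      exact ⟨K, fun j hj => by simp [hK j hj]⟩
    change lfSum (fun j : ℕ => (t • A.1) _ _ * T.1 j) w = t • lfSum (fun j : ℕ => A.1 _ _ * T.1 j) w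
    rw [lfSum_eq (hT _) w K (fun j hj => by simp [hK j hj]),
      lfSum_eq (hT _) w K (fun j hj => by simp [hK j hj]), Finset.smul_sum]
    simp

theorem rightMul_eq (T : finiteSeq F) (d : Direction) (A : fieldSpace F) (r s : ℝ) (w : F)
    (K : ℕ) (hK : ∀ j : ℕ, K ≤ j → T.1 j w = 0) :
    (rightMul T d A).1 r s w =
      ∑ j ∈ Finset.range K, A.1 (r + (j + 1) * d.fst) (s + (j + 1) * d.snd) (T.1 j w) := by
  change lfSum (fun j : ℕ => A.1 (r + (j + 1) * d.fst) (s + (j + 1) * d.snd) * T.1 j) w = _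
  rw [lfSum_eq (K := K)]
  · rfl
  · intro w
    obtain ⟨K, hK⟩ := T.2 w
    exact ⟨K, fun j hj => by simp [hK j hj]⟩
  · intro j hj
    simp [hK j hj]

theorem leftMul_comm (T T' : ℕ → Module.End ℂ F) (d d' : Direction)
    (h : ∀ i j, T i * T' j = T' j * T i) : Commute (leftMul T d) (leftMul T' d') := by
  have key : ∀ (T T' : ℕ → Module.End ℂ F) (d d' : Direction) (A : fieldSpace F) (r s : ℝ) (w : F)
      (N : ℝ), (∀ r s, (r < N ∨ s < N) → A.1 r s w = 0) →
      (leftMul T d (leftMul T' d' A)).1 r s w =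
        ∑ i ∈ Finset.range (⌈r + s - 2 * N⌉₊ + 1), ∑ j ∈ Finset.range (⌈r + s - 2 * N⌉₊ + 1),
          T i (T' j (A.1 (r - i * d.fst - j * d'.fst) (s - i * d.snd - j * d'.snd) w)) := by
    intro T T' d d' A r s w N hN
    have h0 : ∀ i j : ℕ, (⌈r + s - 2 * N⌉₊ + 1 ≤ j ∨ ⌈r + s - 2 * N⌉₊ + 1 ≤ i) →
        A.1 (r - i * d.fst - j * d'.fst) (s - i * d.snd - j * d'.snd) w = 0 := by
      intro i j hij
      apply hN
      have e1 : (0 : ℝ) ≤ i * d.fst := mul_nonneg i.cast_nonneg d.nonneg_fst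
      have e2 : (0 : ℝ) ≤ i * d.snd := mul_nonneg i.cast_nonneg d.nonneg_snd
      have e3 : (0 : ℝ) ≤ j * d'.fst := mul_nonneg j.cast_nonneg d'.nonneg_fst
      have e4 : (0 : ℝ) ≤ j * d'.snd := mul_nonneg j.cast_nonneg d'.nonneg_snd
      rcases hij with hij | hij
      · exact (left_finite d' hij).imp (by intro h; linarith) (by intro h; linarith)
      · exact (left_finite d hij).imp (by intro h; linarith) (by intro h; linarith)
    rw [leftMul_eq (K := ⌈r + s - 2 * N⌉₊ + 1)]
    · refine Finset.sum_congr rfl fun i _ => ?_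
      rw [leftMul_eq (K := ⌈r + s - 2 * N⌉₊ + 1) (hK := fun j hj => h0 i j (Or.inl hj)), map_sum]
    · intro i hi
      rw [leftMul_eq (K := 0)]
      · simp
      · intro j _
        exact h0 i j (Or.inr hi)
  apply LinearMap.ext
  intro A
  ext r s w
  obtain ⟨N, hN⟩ := A.2 w
  change (leftMul T d (leftMul T' d' A)).1 r s w = (leftMul T' d' (leftMul T d A)).1 r s w
  rw [key T T' d d' A r s w N hN, key T' T d' d A r s w N hN, Finset.sum_comm]
  refine Finset.sum_congr rfl fun j _ => Finset.sum_congr rfl fun i _ => ?_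
  have := LinearMap.congr_fun (h i j)
  simp only [Module.End.mul_apply] at this
  rw [this, sub_right_comm r, sub_right_comm s]

theorem rightMul_comm (T T' : finiteSeq F) (d d' : Direction)
    (h : ∀ i j, T.1 i * T'.1 j = T'.1 j * T.1 i) : Commute (rightMul T d) (rightMul T' d') := by
  have key : ∀ (T T' : finiteSeq F) (d d' : Direction) (A : fieldSpace F) (r s : ℝ) (w : F) (K : ℕ),
      (∀ i j, T.1 i * T'.1 j = T'.1 j * T.1 i) → (∀ j, K ≤ j → T.1 j w = 0) →
      (∀ j, K ≤ j → T'.1 j w = 0) →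
      (rightMul T d (rightMul T' d' A)).1 r s w =
        ∑ i ∈ Finset.range K, ∑ j ∈ Finset.range K,
          A.1 (r + (i + 1) * d.fst + (j + 1) * d'.fst) (s + (i + 1) * d.snd + (j + 1) * d'.snd)
            (T'.1 j (T.1 i w)) := by
    intro T T' d d' A r s w K h hT hT'
    rw [rightMul_eq (hK := hT)]
    refine Finset.sum_congr rfl fun i _ => ?_
    rw [rightMul_eq]
    intro j hj
    have := LinearMap.congr_fun (h i j) w
    simp only [Module.End.mul_apply] at this
    rw [← this, hT' j hj, map_zero]
  apply LinearMap.ext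
  intro A
  ext r s w
  obtain ⟨K, hK⟩ := T.2 w
  obtain ⟨K', hK'⟩ := T'.2 w
  have h1 : ∀ j, max K K' ≤ j → T.1 j w = 0 := fun j hj => hK j ((le_max_left _ _).trans hj)
  have h2 : ∀ j, max K K' ≤ j → T'.1 j w = 0 := fun j hj => hK' j ((le_max_right _ _).trans hj)
  change (rightMul T d (rightMul T' d' A)).1 r s w = (rightMul T' d' (rightMul T d A)).1 r s w
  rw [key T T' d d' A r s w _ h h1 h2, key T' T d' d A r s w _ (fun i j => (h j i).symm) h2 h1,
    Finset.sum_comm]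
  refine Finset.sum_congr rfl fun j _ => Finset.sum_congr rfl fun i _ => ?_
  have := LinearMap.congr_fun (h i j) w
  simp only [Module.End.mul_apply] at this
  rw [this, add_right_comm r, add_right_comm s]

theorem leftMul_rightMul_comm (T : ℕ → Module.End ℂ F) (T' : finiteSeq F) (d d' : Direction) :
    Commute (leftMul T d) (rightMul T' d') := by
  apply LinearMap.ext
  intro A
  ext r s w
  obtain ⟨K', hK'⟩ := T'.2 w
  choose M hM using fun j : ℕ => left_bound A d (r + (j + 1) * d'.fst) (s + (j + 1) * d'.snd) (T'.1 j w)
  obtain ⟨K, hK⟩ : ∃ K : ℕ, ∀ j < K', M j ≤ K :=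
    ⟨(Finset.range K').sup M, fun j hj => Finset.le_sup (Finset.mem_range.2 hj)⟩
  change (leftMul T d (rightMul T' d' A)).1 r s w = (rightMul T' d' (leftMul T d A)).1 r s w
  rw [rightMul_eq (hK := hK'), leftMul_eq (K := K)]
  · simp_rw [rightMul_eq T' d' A _ _ w K' hK', map_sum]
    rw [Finset.sum_comm]
    refine Finset.sum_congr rfl fun j hj => ?_
    rw [leftMul_eq (K := K)]
    · refine Finset.sum_congr rfl fun i _ => ?_
      rw [sub_add_eq_add_sub, sub_add_eq_add_sub]
    · intro i hi
      exact hM j i ((hK j (Finset.mem_range.1 hj)).trans hi)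
  · intro i hi
    rw [rightMul_eq (hK := hK')]
    refine Finset.sum_eq_zero fun j hj => ?_
    rw [sub_add_eq_add_sub, sub_add_eq_add_sub]
    exact hM j i ((hK j (Finset.mem_range.1 hj)).trans hi)

end Fields

section LatticeFock
variable {L : Type*} {E : Type*} [AddCommGroup E] [Module ℂ E]

theorem contract_add (c d : (ℕ →₀ E) →ₗ[ℂ] ℂ) (s : Fock E) :
    contract (c + d) s = contract c s + contract d s := by
  induction s using Fock.induction with
  | algebraMap r => simp [contract_algebraMap]
  | ι v => simp [contract_ι]
  | mul a b ha hb => simp only [contract_mul, ha, hb]; ring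
  | add a b ha hb => simp only [map_add, ha, hb]; abel

theorem contract_smul (t : ℂ) (c : (ℕ →₀ E) →ₗ[ℂ] ℂ) (s : Fock E) :
    contract (t • c) s = t • contract c s := by
  induction s using Fock.induction with
  | algebraMap r => simp [contract_algebraMap]
  | ι v => simp [contract_ι, Algebra.smul_def]
  | mul a b ha hb => simp only [contract_mul, ha, hb, mul_smul_comm, smul_add]
  | add a b ha hb => simp only [map_add, ha, hb, smul_add]

theorem modeAt_add (g : LinearMap.BilinForm ℂ E) (w h h' : E) (n : ℤ) :
    modeAt g w (h + h') n = modeAt g w h n + modeAt g w h' n := by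
  rcases n with (_ | n) | n
  · simp [modeAt, add_smul]
  · apply LinearMap.ext; intro s
    simp only [modeAt, map_add, LinearMap.add_comp, smul_add, contract_add, LinearMap.add_apply]
  · apply LinearMap.ext; intro s
    simp [modeAt, add_mul]

theorem modeAt_smul (g : LinearMap.BilinForm ℂ E) (w : E) (t : ℂ) (h : E) (n : ℤ) :
    modeAt g w (t • h) n = t • modeAt g w h n := by
  rcases n with (_ | n) | n
  · simp [modeAt, mul_smul]
  · apply LinearMap.ext; intro s
    simp only [modeAt, map_smul, LinearMap.smul_comp, smul_comm _ t, contract_smul,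
      LinearMap.smul_apply]
  · apply LinearMap.ext; intro s
    simp [modeAt]

/-- The operator `h(n)` on `⨁ α, Fock E ⊗ e_α`. -/
def mode (g : LinearMap.BilinForm ℂ E) (wt : L → E) (n : ℤ) :
    E →ₗ[ℂ] Module.End ℂ (L →₀ Fock E) where
  toFun h := Finsupp.lsum ℂ fun α => Finsupp.lsingle α ∘ₗ modeAt g (wt α) h n
  map_add' h h' := by
    ext α s : 2
    simp [modeAt_add]
  map_smul' t h := by
    ext α s : 2
    simp [modeAt_smul]

theorem mode_single (g : LinearMap.BilinForm ℂ E) (wt : L → E) (n : ℤ) (h : E) (α : L)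
    (s : Fock E) : mode g wt n h (Finsupp.single α s) = Finsupp.single α (modeAt g (wt α) h n s) := by
  simp [mode]

theorem mode_commutator (g : LinearMap.BilinForm ℂ E) (hg : g.IsSymm) (wt : L → E) (h h' : E)
    (m n : ℤ) :
    mode g wt m h * mode g wt n h' - mode g wt n h' * mode g wt m h =
      (if m + n = 0 then (m : ℂ) * g h h' else 0) • 1 := by
  refine Finsupp.lhom_ext fun α s => ?_
  have := LinearMap.congr_fun (modeAt_heis g hg (wt α) h h' m n) s
  simp only [LinearMap.sub_apply, Module.End.mul_apply, LinearMap.smul_apply,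
    Module.End.one_apply] at this
  simp only [LinearMap.sub_apply, Module.End.mul_apply, LinearMap.smul_apply,
    Module.End.one_apply, mode_single, ← Finsupp.single_sub, this, Finsupp.smul_single]

theorem mode_comm_nonneg (g : LinearMap.BilinForm ℂ E) (wt : L → E) (h h' : E) (m n : ℕ) :
    mode g wt m h * mode g wt n h' = mode g wt n h' * mode g wt m h := by
  refine Finsupp.lhom_ext fun α s => ?_
  have := LinearMap.congr_fun (modeAt_comm_nonneg g (wt α) h h' m n) s
  simp only [Module.End.mul_apply] at this
  simp only [Module.End.mul_apply, mode_single, this]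

theorem mode_comm_neg (g : LinearMap.BilinForm ℂ E) (wt : L → E) (h h' : E) (m n : ℕ) :
    mode g wt (.negSucc m) h * mode g wt (.negSucc n) h' =
      mode g wt (.negSucc n) h' * mode g wt (.negSucc m) h := by
  refine Finsupp.lhom_ext fun α s => ?_
  have := LinearMap.congr_fun (modeAt_comm_neg g (wt α) h h' m n) s
  simp only [Module.End.mul_apply] at this
  simp only [Module.End.mul_apply, mode_single, this]

theorem mode_eventually (g : LinearMap.BilinForm ℂ E) (wt : L → E) (h : E) (v : L →₀ Fock E) :
    ∃ K : ℕ, ∀ n : ℕ, K ≤ n → mode g wt n h v = 0 := by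
  induction v using Finsupp.induction_linear with
  | zero => exact ⟨0, fun n _ => map_zero _⟩
  | add v w hv hw =>
    obtain ⟨K, hK⟩ := hv
    obtain ⟨M, hM⟩ := hw
    exact ⟨max K M, fun n hn => by
      rw [map_add, hK n ((le_max_left _ _).trans hn), hM n ((le_max_right _ _).trans hn), add_zero]⟩
  | single α s =>
    obtain ⟨K, hK⟩ := exists_level s
    refine ⟨K + 1, fun n hn => ?_⟩
    have h1 := modeAt_level g (wt α) h n hK
    rw [level_neg (by omega), Submodule.mem_bot] at h1
    rw [mode_single, h1, Finsupp.single_zero]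

/-- The coefficients of `(1/k!) (d/dx)^k h⁻(x) = ∑ j, (j+k choose k) h(-j-k-1) x^j`. -/
def creationSeq (g : LinearMap.BilinForm ℂ E) (wt : L → E) (k : ℕ) :
    E →ₗ[ℂ] (ℕ → Module.End ℂ (L →₀ Fock E)) :=
  LinearMap.pi fun j => (Nat.choose (j + k) k : ℂ) • mode g wt (.negSucc (j + k))

/-- The coefficients of `(1/k!) (d/dx)^k h⁺(x) = ∑ j, (-1)^k (j choose k) h(j-k) x^(-j-1)`. -/
def annihilationSeq (g : LinearMap.BilinForm ℂ E) (wt : L → E) (k : ℕ) :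
    E →ₗ[ℂ] finiteSeq (L →₀ Fock E) :=
  LinearMap.codRestrict _
    (LinearMap.pi fun j => ((-1) ^ k * (Nat.choose j k : ℂ)) • mode g wt ((j - k : ℕ) : ℤ)) (by
    intro h w
    obtain ⟨K, hK⟩ := mode_eventually g wt h w
    exact ⟨K + k, fun j hj => by simp [hK (j - k) (by omega)]⟩)

theorem leftMul_add {F : Type*} [AddCommGroup F] [Module ℂ F] (T T' : ℕ → Module.End ℂ F)
    (d : Direction) : leftMul (T + T') d = leftMul T d + leftMul T' d := by
  apply LinearMap.ext; intro A
  ext r s w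
  obtain ⟨K, hK⟩ := left_bound A d r s w
  change _ = (leftMul T d A).1 r s w + (leftMul T' d A).1 r s w
  simp [leftMul_eq (hK := hK), Finset.sum_add_distrib]

theorem leftMul_smul {F : Type*} [AddCommGroup F] [Module ℂ F] (t : ℂ) (T : ℕ → Module.End ℂ F)
    (d : Direction) : leftMul (t • T) d = t • leftMul T d := by
  apply LinearMap.ext; intro A
  ext r s w
  obtain ⟨K, hK⟩ := left_bound A d r s w
  change _ = t • (leftMul T d A).1 r s w
  simp [leftMul_eq (hK := hK), Finset.smul_sum]

theorem rightMul_add {F : Type*} [AddCommGroup F] [Module ℂ F] (T T' : finiteSeq F)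
    (d : Direction) : rightMul (T + T') d = rightMul T d + rightMul T' d := by
  apply LinearMap.ext; intro A
  ext r s w
  obtain ⟨K, hK⟩ := T.2 w
  obtain ⟨K', hK'⟩ := T'.2 w
  have h1 : ∀ j, max K K' ≤ j → T.1 j w = 0 := fun j hj => hK j ((le_max_left _ _).trans hj)
  have h2 : ∀ j, max K K' ≤ j → T'.1 j w = 0 := fun j hj => hK' j ((le_max_right _ _).trans hj)
  change _ = (rightMul T d A).1 r s w + (rightMul T' d A).1 r s w
  rw [rightMul_eq (hK := h1), rightMul_eq (hK := h2), rightMul_eq (K := max K K')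
    (hK := fun j hj => by simp [h1 j hj, h2 j hj]), ← Finset.sum_add_distrib]
  simp

theorem rightMul_smul {F : Type*} [AddCommGroup F] [Module ℂ F] (t : ℂ) (T : finiteSeq F)
    (d : Direction) : rightMul (t • T) d = t • rightMul T d := by
  apply LinearMap.ext; intro A
  ext r s w
  obtain ⟨K, hK⟩ := T.2 w
  change _ = t • (rightMul T d A).1 r s w
  rw [rightMul_eq (hK := hK), rightMul_eq (K := K) (hK := fun j hj => by simp [hK j hj]),
    Finset.smul_sum]
  simp

/-- The map `A ↦ (1/k!) (∂^k h⁻) A + A (1/k!) (∂^k h⁺)` on fields, where `h(z, z̄)` is the current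
in which `P h` goes with `z` and `h - P h` goes with `z̄`. -/
def normalOrder (g : LinearMap.BilinForm ℂ E) (P : Module.End ℂ E) (wt : L → E) (k : ℕ) :
    E →ₗ[ℂ] Module.End ℂ (fieldSpace (L →₀ Fock E)) where
  toFun h :=
    leftMul (creationSeq g wt k (P h)) .z + rightMul (annihilationSeq g wt k (P h)) .z
    + (leftMul (creationSeq g wt k (h - P h)) .zbar
        + rightMul (annihilationSeq g wt k (h - P h)) .zbar)
  map_add' h h' := by
    have : h + h' - P (h + h') = (h - P h) + (h' - P h') := by rw [map_add]; abel
    rw [this]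
    simp only [map_add, leftMul_add, rightMul_add]
    abel
  map_smul' t h := by
    have : t • h - P (t • h) = t • (h - P h) := by rw [map_smul, smul_sub]
    rw [this]
    simp only [map_smul, leftMul_smul, rightMul_smul, RingHom.id_apply, smul_add]

theorem normalOrder_commute (g : LinearMap.BilinForm ℂ E) (P : Module.End ℂ E) (wt : L → E)
    (k k' : ℕ) (h h' : E) : Commute (normalOrder g P wt k h) (normalOrder g P wt k' h') := by
  have LL : ∀ (a b : E) (d d' : Direction), Commute (leftMul (creationSeq g wt k a) d)
      (leftMul (creationSeq g wt k' b) d') := fun a b d d' => by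
    apply leftMul_comm
    intro i j
    simp only [creationSeq, LinearMap.pi_apply, LinearMap.smul_apply, smul_mul_smul_comm,
      mode_comm_neg g wt b a, mul_comm]
  have RR : ∀ (a b : E) (d d' : Direction), Commute (rightMul (annihilationSeq g wt k a) d)
      (rightMul (annihilationSeq g wt k' b) d') := fun a b d d' => by
    apply rightMul_comm
    intro i j
    change (((-1) ^ k * (Nat.choose i k : ℂ)) • mode g wt ((i - k : ℕ) : ℤ) a)
        * (((-1) ^ k' * (Nat.choose j k' : ℂ)) • mode g wt ((j - k' : ℕ) : ℤ) b)
      = (((-1) ^ k' * (Nat.choose j k' : ℂ)) • mode g wt ((j - k' : ℕ) : ℤ) b)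
        * (((-1) ^ k * (Nat.choose i k : ℂ)) • mode g wt ((i - k : ℕ) : ℤ) a)
    rw [smul_mul_smul_comm, smul_mul_smul_comm, mode_comm_nonneg g wt b a, mul_comm (_ * _ : ℂ)]
  have LR : ∀ (a b : E) (d d' : Direction), Commute (leftMul (creationSeq g wt k a) d)
      (rightMul (annihilationSeq g wt k' b) d') := fun a b d d' => leftMul_rightMul_comm _ _ _ _
  have RL : ∀ (a b : E) (d d' : Direction), Commute (rightMul (annihilationSeq g wt k a) d)
      (leftMul (creationSeq g wt k' b) d') := fun a b d d' => (leftMul_rightMul_comm _ _ _ _).symm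
  exact (((LL _ _ _ _).add_right (LR _ _ _ _)).add_right
      ((LL _ _ _ _).add_right (LR _ _ _ _))).add_left
      (((RL _ _ _ _).add_right (RR _ _ _ _)).add_right
        ((RL _ _ _ _).add_right (RR _ _ _ _))) |>.add_left
    ((((LL _ _ _ _).add_right (LR _ _ _ _)).add_right
      ((LL _ _ _ _).add_right (LR _ _ _ _))).add_left
      (((RL _ _ _ _).add_right (RR _ _ _ _)).add_right
        ((RL _ _ _ _).add_right (RR _ _ _ _))))

def normalOrderLin (g : LinearMap.BilinForm ℂ E) (P : Module.End ℂ E) (wt : L → E) :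
    (ℕ →₀ E) →ₗ[ℂ] Module.End ℂ (fieldSpace (L →₀ Fock E)) :=
  Finsupp.lsum ℂ fun k => normalOrder g P wt k

theorem normalOrderLin_commute (g : LinearMap.BilinForm ℂ E) (P : Module.End ℂ E) (wt : L → E)
    (v v' : ℕ →₀ E) : Commute (normalOrderLin g P wt v) (normalOrderLin g P wt v') := by
  simp only [normalOrderLin, Finsupp.lsum_apply, Finsupp.sum]
  exact Commute.sum_left _ _ _ fun k _ => Commute.sum_right _ _ _ fun k' _ =>
    normalOrder_commute g P wt k k' _ _

/-- The (commutative) algebra generated by the operators `normalOrder`. -/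
abbrev normalOrderAlg (g : LinearMap.BilinForm ℂ E) (P : Module.End ℂ E) (wt : L → E) :
    Subalgebra ℂ (Module.End ℂ (fieldSpace (L →₀ Fock E))) :=
  Algebra.adjoin ℂ (Set.range (normalOrderLin g P wt))

instance (g : LinearMap.BilinForm ℂ E) (P : Module.End ℂ E) (wt : L → E) :
    IsMulCommutative (normalOrderAlg g P wt) :=
  Algebra.isMulCommutative_adjoin ℂ (by
    rintro _ ⟨v, rfl⟩ _ ⟨v', rfl⟩
    exact normalOrderLin_commute g P wt v v')

open scoped IsMulCommutative in
/-- The algebra map `h¹(-k₁-1)⋯hʲ(-kⱼ-1) ↦ normalOrder k₁ h¹ ∘ ⋯ ∘ normalOrder kⱼ hʲ`. -/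
def normalOrderHom (g : LinearMap.BilinForm ℂ E) (P : Module.End ℂ E) (wt : L → E) :
    Fock E →ₐ[ℂ] Module.End ℂ (fieldSpace (L →₀ Fock E)) :=
  (normalOrderAlg g P wt).val.comp
    (Fock.lift (A := normalOrderAlg g P wt)
      { toFun := fun v => ⟨normalOrderLin g P wt v, Algebra.subset_adjoin ⟨v, rfl⟩⟩
        map_add' := fun v w => Subtype.ext (map_add _ v w)
        map_smul' := fun t v => Subtype.ext (map_smul _ t v) })

open scoped IsMulCommutative in
theorem normalOrderHom_gen (g : LinearMap.BilinForm ℂ E) (P : Module.End ℂ E) (wt : L → E)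
    (k : ℕ) (h : E) : normalOrderHom g P wt (gen k h) = normalOrder g P wt k h := by
  simp only [normalOrderHom, gen, LinearMap.comp_apply, AlgHom.comp_apply,
    Fock.lift_ι]
  simp [normalOrderLin]


/-- The exponential of a series without constant term. -/
def expSeries {R : Type*} [Ring R] [Algebra ℂ R] (X : PowerSeries R) : PowerSeries R :=
  PowerSeries.mk fun n => ∑ k ∈ Finset.range (n + 1),
    ((Nat.factorial k : ℂ)⁻¹) • PowerSeries.coeff n (X ^ k)

/-- `exp (-∑_{n ≤ -1} (h(n)/n) x^(-n))` as a series in `x`. -/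
def expMinus (g : LinearMap.BilinForm ℂ E) (h : E) : PowerSeries (Module.End ℂ (Fock E)) :=
  expSeries (PowerSeries.mk fun n => if n = 0 then 0 else ((n : ℂ)⁻¹) • modeAt g 0 h (-(n : ℤ)))

/-- `exp (-∑_{n ≥ 1} (h(n)/n) x^(-n))` as a series in `x⁻¹`. -/
def expPlus (g : LinearMap.BilinForm ℂ E) (h : E) : PowerSeries (Module.End ℂ (Fock E)) :=
  expSeries (PowerSeries.mk fun n => if n = 0 then 0 else (-(n : ℂ)⁻¹) • modeAt g 0 h (n : ℤ))

theorem expPlus_level (g : LinearMap.BilinForm ℂ E) (h : E) (n : ℕ) {K : ℤ} {s : Fock E}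
    (hs : s ∈ level K) : PowerSeries.coeff n (expPlus g h) s ∈ level (K - n) := by
  have hX : ∀ (n : ℕ) (K : ℤ) (s : Fock E), s ∈ level K → PowerSeries.coeff n
      (PowerSeries.mk fun n => if n = 0 then 0 else (-(n : ℂ)⁻¹) • modeAt g 0 h (n : ℤ)) s
        ∈ level (K - n) := by
    intro n K s hs
    rw [PowerSeries.coeff_mk]
    split_ifs
    · simp
    · exact Submodule.smul_mem _ _ (modeAt_level g 0 h n hs)
  have hpow : ∀ (X : PowerSeries (Module.End ℂ (Fock E))), (∀ (n : ℕ) (K : ℤ) (s : Fock E),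
      s ∈ level K → PowerSeries.coeff n X s ∈ level (K - n)) → ∀ (k n : ℕ) (K : ℤ) (s : Fock E),
      s ∈ level K → PowerSeries.coeff n (X ^ k) s ∈ level (K - n) := by
    intro X hX k
    induction k with
    | zero =>
      intro n K s hs
      rw [pow_zero, PowerSeries.coeff_one]
      split_ifs with h0
      · simpa [h0] using hs
      · simp
    | succ k ih =>
      intro n K s hs
      rw [pow_succ, PowerSeries.coeff_mul, LinearMap.sum_apply]
      refine Submodule.sum_mem _ fun p hp => ?_
      have hp' := Finset.HasAntidiagonal.mem_antidiagonal.1 hp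
      have := ih p.1 _ _ (hX p.2 K s hs)
      rw [show K - (n : ℤ) = K - p.2 - p.1 by omega]
      exact this
  rw [expPlus, expSeries, PowerSeries.coeff_mk, LinearMap.sum_apply]
  exact Submodule.sum_mem _ fun k _ => Submodule.smul_mem _ _ (hpow _ hX k n K s hs)

/-- The coefficient of `x ^ a` in a power series, for a real exponent `a`. -/
def coeffReal {R : Type*} [Ring R] (X : PowerSeries R) (a : ℝ) : R :=
  open Classical in if (⌊a⌋₊ : ℝ) = a then PowerSeries.coeff ⌊a⌋₊ X else 0

/-- The coefficient of `z^a z̄^b` in `E⁻(h, z) E⁺(h, z)`, where `P h` goes with `z` and `h - P h`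
with `z̄`. The sum is pointwise finite. -/
def expCoeff (g : LinearMap.BilinForm ℂ E) (P : Module.End ℂ E) (h : E) (a b : ℝ) :
    Module.End ℂ (Fock E) :=
  lfSum fun x : ℕ × ℕ =>
    (coeffReal (expMinus g (P h)) (a + x.1) * coeffReal (expMinus g (h - P h)) (b + x.2)) *
      (PowerSeries.coeff x.1 (expPlus g (P h)) * PowerSeries.coeff x.2 (expPlus g (h - P h)))

theorem expPlus_zero_of_lt (g : LinearMap.BilinForm ℂ E) (P : Module.End ℂ E) (h : E) {K : ℕ}
    {s : Fock E} (hs : s ∈ level (K : ℤ)) (x : ℕ × ℕ) (hx : K < x.1 + x.2) :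
    PowerSeries.coeff x.1 (expPlus g (P h)) (PowerSeries.coeff x.2 (expPlus g (h - P h)) s) = 0 := by
  have := expPlus_level g (P h) x.1 (expPlus_level g (h - P h) x.2 hs)
  rwa [level_neg (by omega), Submodule.mem_bot] at this

theorem expCoeff_apply (g : LinearMap.BilinForm ℂ E) (P : Module.End ℂ E) (h : E) (a b : ℝ)
    (s : Fock E) : expCoeff g P h a b s = ∑ᶠ x : ℕ × ℕ,
      coeffReal (expMinus g (P h)) (a + x.1) (coeffReal (expMinus g (h - P h)) (b + x.2)
        (PowerSeries.coeff x.1 (expPlus g (P h))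
          (PowerSeries.coeff x.2 (expPlus g (h - P h)) s))) := by
  rw [expCoeff, lfSum_apply]
  · rfl
  · intro s
    obtain ⟨K, hK⟩ := exists_level s
    refine (Set.finite_Iic ((K, K) : ℕ × ℕ)).subset fun x hx => ?_
    by_contra hc
    apply hx
    have : K < x.1 + x.2 := by
      simp only [Set.mem_Iic, Prod.le_def, not_and_or, not_le] at hc
      omega
    simp [expPlus_zero_of_lt g P h hK x this]

theorem expCoeff_eq_zero (g : LinearMap.BilinForm ℂ E) (P : Module.End ℂ E) (h : E) {K : ℕ}
    {s : Fock E} (hs : s ∈ level (K : ℤ)) {a b : ℝ} (hab : a < -K ∨ b < -K) :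
    expCoeff g P h a b s = 0 := by
  have hneg : ∀ (X : PowerSeries (Module.End ℂ (Fock E))) {c : ℝ}, c < 0 → coeffReal X c = 0 := by
    intro X c hc
    rw [coeffReal, if_neg]
    rw [Nat.floor_of_nonpos hc.le]
    simpa using hc.ne'
  rw [expCoeff_apply]
  rw [finsum_eq_zero_of_forall_eq_zero]
  intro x
  by_cases hx : K < x.1 + x.2
  · rw [expPlus_zero_of_lt g P h hs x hx]
    simp
  · have h1 : (x.1 : ℝ) ≤ K := by exact_mod_cast (by omega : x.1 ≤ K)
    have h2 : (x.2 : ℝ) ≤ K := by exact_mod_cast (by omega : x.2 ≤ K)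
    rcases hab with h | h
    · rw [hneg _ (c := a + x.1) (by linarith)]; simp
    · rw [hneg _ (c := b + x.2) (by linarith)]; simp

section
variable [AddCommGroup L]

/-- The field `E⁻(α, z) E⁺(α, z) l_{e_α} z^{pα} z̄^{(1-p)α}`, where
`l_{e_α} z^{pα} z̄^{(1-p)α} e_β = ε(α, β) z^{a(α, β)} z̄^{b(α, β)} e_{α+β}`. -/
def chargedField (g : LinearMap.BilinForm ℂ E) (P : Module.End ℂ E) (wt : L → E)
    (ε : L → L → ℂ) (a b : L → L → ℝ) (α : L) : fieldSpace (L →₀ Fock E) :=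
  ⟨fun r s => Finsupp.lsum ℂ fun β => Finsupp.lsingle (α + β) ∘ₗ
      (ε α β • expCoeff g P (wt α) (r - a α β) (s - b α β)), by
    intro w
    induction w using Finsupp.induction_linear with
    | zero => exact ⟨0, fun r s _ => map_zero _⟩
    | add v w hv hw =>
      obtain ⟨N, hN⟩ := hv
      obtain ⟨M, hM⟩ := hw
      refine ⟨min N M, fun r s h => ?_⟩
      rw [map_add, hN r s (h.imp (fun h => h.trans_le (min_le_left _ _))
        (fun h => h.trans_le (min_le_left _ _))), hM r s (h.imp
        (fun h => h.trans_le (min_le_right _ _)) (fun h => h.trans_le (min_le_right _ _))),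
        add_zero]
    | single β v =>
      obtain ⟨K, hK⟩ := exists_level v
      refine ⟨min (a α β) (b α β) - K, fun r s h => ?_⟩
      have h1 := min_le_left (a α β) (b α β)
      have h2 := min_le_right (a α β) (b α β)
      have := expCoeff_eq_zero g P (wt α) hK (a := r - a α β) (b := s - b α β)
        (h.imp (by intro h; linarith) (by intro h; linarith))
      simp [this]⟩

/-- The fields `Y(v, z)`, determined by `Y(e_α, z) = e_α(z)` and
`Y(h(-k-1)v, z) = (1/k!) (∂^k h⁻) Y(v, z) + Y(v, z) (1/k!) (∂^k h⁺)`; these two properties are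
`vertexField_single_one` and `vertexField_mode` below. -/
def vertexField (g : LinearMap.BilinForm ℂ E) (P : Module.End ℂ E) (wt : L → E)
    (ε : L → L → ℂ) (a b : L → L → ℝ) : (L →₀ Fock E) →ₗ[ℂ] fieldSpace (L →₀ Fock E) :=
  Finsupp.lsum ℂ fun α => LinearMap.applyₗ (chargedField g P wt ε a b α) ∘ₗ
    (normalOrderHom g P wt).toLinearMap

theorem vertexField_single (g : LinearMap.BilinForm ℂ E) (P : Module.End ℂ E) (wt : L → E)
    (ε : L → L → ℂ) (a b : L → L → ℝ) (α : L) (s : Fock E) :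
    vertexField g P wt ε a b (Finsupp.single α s) =
      normalOrderHom g P wt s (chargedField g P wt ε a b α) := by
  simp [vertexField]

theorem vertexField_single_one (g : LinearMap.BilinForm ℂ E) (P : Module.End ℂ E) (wt : L → E)
    (ε : L → L → ℂ) (a b : L → L → ℝ) (α : L) :
    vertexField g P wt ε a b (Finsupp.single α 1) = chargedField g P wt ε a b α := by
  simp [vertexField_single]

theorem vertexField_mode (g : LinearMap.BilinForm ℂ E) (P : Module.End ℂ E) (wt : L → E)
    (ε : L → L → ℂ) (a b : L → L → ℝ) (k : ℕ) (h : E) (v : L →₀ Fock E) :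
    vertexField g P wt ε a b (mode g wt (.negSucc k) h v) =
      normalOrder g P wt k h (vertexField g P wt ε a b v) := by
  induction v using Finsupp.induction_linear with
  | zero => simp
  | add v w hv hw => simp only [map_add, hv, hw]
  | single α s =>
    rw [mode_single]
    have h1 : modeAt g (wt α) h (.negSucc k) s = gen k h * s := rfl
    have h2 : normalOrderHom g P wt (gen k h * s) = normalOrder g P wt k h * normalOrderHom g P wt s :=
      ((normalOrderHom g P wt).map_mul _ _).trans
        (congrArg (· * normalOrderHom g P wt s) (normalOrderHom_gen g P wt k h))
    rw [h1, vertexField_single, vertexField_single, h2, Module.End.mul_apply]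

/-- The part of `S(⨁ E t^(-n-1))` spanned by the monomials
`h_l¹(-n₁-1)⋯h_lᵏ(-nₖ-1) h_r¹(-m₁-1)⋯h_rʲ(-mⱼ-1)` with `h_lⁱ ∈ El`, `h_rⁱ ∈ Er`,
`∑ (nᵢ+1) = n` and `∑ (mᵢ+1) = m`. -/
def fockLevel (El Er : Submodule ℂ E) (n m : ℕ) : Submodule ℂ (Fock E) :=
  Submodule.span ℂ {s | ∃ l l' : List (ℕ × E),
    (∀ x ∈ l, x.2 ∈ El) ∧ (∀ x ∈ l', x.2 ∈ Er) ∧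
    (l.map fun x => x.1 + 1).sum = n ∧ (l'.map fun x => x.1 + 1).sum = m ∧
    s = (l.map fun x => gen x.1 x.2).prod * (l'.map fun x => gen x.1 x.2).prod}

/-- The span of the `s ⊗ e_α`, `s` in the part `(n, m)` of the Fock space, with
`h = a(α, α) / 2 + n` and `h̄ = b(α, α) / 2 + m`. -/
def weightSpace (El Er : Submodule ℂ E) (a b : L → L → ℝ) (h hbar : ℝ) :
    Submodule ℂ (L →₀ Fock E) :=
  ⨆ (α : L) (n : ℕ) (m : ℕ) (_ : h = a α α / 2 + n ∧ hbar = b α α / 2 + m),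
    (fockLevel El Er n m).map (Finsupp.lsingle α)

end

end LatticeFock

section Correlation

/-- `z^r z̄^s = |z|^(2s) z^(r-s)`, for `r - s` an integer. -/
def zpow₂ (z : ℂ) (r s : ℝ) : ℂ := ((‖z‖ ^ (2 * s) : ℝ) : ℂ) * z ^ ⌊r - s⌋

/-- `f p = ∑ a r s p^r p̄^s` for small `p ≠ 0`, with a series in `ℂ((p, p̄, |p|^ℝ))`: the exponents
satisfy `r - s ∈ ℤ`, are countably many and bounded below, and the sum converges absolutely. -/
structure HasConformalExpansion (f : ℂ → ℂ) (a : ℝ → ℝ → ℂ) : Prop where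
  integral : ∀ r s, a r s ≠ 0 → ∃ k : ℤ, r - s = k
  countable : {x : ℝ × ℝ | a x.1 x.2 ≠ 0}.Countable
  bounded : ∃ N : ℤ, ∀ r s, a r s ≠ 0 → (N : ℝ) ≤ r ∧ (N : ℝ) ≤ s
  hasSum : ∃ R > 0, ∀ p : ℂ, 0 < ‖p‖ → ‖p‖ < R →
    HasSum (fun x : ℝ × ℝ => a x.1 x.2 * zpow₂ p x.1 x.2) (f p)

/-- The real analytic functions on `ℂP¹ \ {0, 1, ∞}` with conformal singularities at `0, 1, ∞`: in
every chart at one of these points the function has a conformal expansion. The charts are given by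
their inverses `χ`, holomorphic near `0` with `χ' 0 ≠ 0` (at `∞`, the inverse of the chart is
`1 / χ`). The values of the function at `0` and `1` are irrelevant. -/
structure IsConformalFunction (f : ℂ → ℂ) : Prop where
  analytic : AnalyticOnNhd ℝ f {0, 1}ᶜ
  zero_one : ∀ c ∈ ({0, 1} : Set ℂ), ∀ χ : ℂ → ℂ, AnalyticAt ℂ χ 0 → χ 0 = c → deriv χ 0 ≠ 0 →
    ∃ a, HasConformalExpansion (fun p => f (χ p)) a
  infty : ∀ χ : ℂ → ℂ, AnalyticAt ℂ χ 0 → χ 0 = 0 → deriv χ 0 ≠ 0 →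
    ∃ a, HasConformalExpansion (fun p => f (χ p)⁻¹) a

/-- The space `Y₂ = {(z₁, z₂) | z₁ ≠ z₂, z₁ ≠ 0, z₂ ≠ 0}`. -/
def Y₂ : Set (ℂ × ℂ) := {z | z.1 ≠ z.2 ∧ z.1 ≠ 0 ∧ z.2 ≠ 0}

/-- Exponents `α₁, β₁, α₂, β₂, α₁₂, β₁₂` with integral differences. -/
structure Exponents where
  (α₁ β₁ α₂ β₂ α₁₂ β₁₂ : ℝ)
  integral₁ : ∃ k : ℤ, α₁ - β₁ = k
  integral₂ : ∃ k : ℤ, α₂ - β₂ = k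
  integral₁₂ : ∃ k : ℤ, α₁₂ - β₁₂ = k

/-- `z₁^α₁ z₂^α₂ (z₁-z₂)^α₁₂ z̄₁^β₁ z̄₂^β₂ (z̄₁-z̄₂)^β₁₂ f(z₂/z₁)` on `Y₂`. -/
def corrFun (e : Exponents) (f : ℂ → ℂ) : Y₂ → ℂ := fun z =>
  zpow₂ z.1.1 e.α₁ e.β₁ * zpow₂ z.1.2 e.α₂ e.β₂ * zpow₂ (z.1.1 - z.1.2) e.α₁₂ e.β₁₂ *
    f (z.1.2 / z.1.1)

/-- The space `GCor₂` of generalized two point correlation functions. -/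
def GCor₂ : Submodule ℂ (Y₂ → ℂ) :=
  Submodule.span ℂ {μ | ∃ e f, IsConformalFunction f ∧ μ = corrFun e f}

/-- Formal series in two pairs of variables; the value at `r₁ s₁ r₂ s₂` is the coefficient of
`x^r₁ x̄^s₁ y^r₂ ȳ^s₂`. -/
abbrev FormalSeries₂ : Type := ℝ → ℝ → ℝ → ℝ → ℂ

/-- The coefficient of `w^r w̄^s` in `(1 + σ w)^γ (1 + σ w̄)^δ ∑ a r s w^r w̄^s`. For series `a` with
exponents bounded below, the sum is finite. -/
def binomMul (σ : ℂ) (γ δ : ℝ) (a : ℝ → ℝ → ℂ) (r s : ℝ) : ℂ :=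
  ∑ᶠ x : ℕ × ℕ, ((Ring.choose γ x.1 : ℝ) : ℂ) * ((Ring.choose δ x.2 : ℝ) : ℂ) * σ ^ (x.1 + x.2) *
    a (r - x.1) (s - x.2)

open Classical in
/-- `z₁^(α₁+α₁₂) z̄₁^(β₁+β₁₂) z₂^α₂ z̄₂^β₂ (1-w)^α₁₂ (1-w̄)^β₁₂ ∑ a r s w^r w̄^s` for `w = z₂/z₁`,
as a series in `z₁, z₂`. -/
def series₁₂ (e : Exponents) (a : ℝ → ℝ → ℂ) : FormalSeries₂ := fun r₁ s₁ r₂ s₂ =>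
  if r₁ + r₂ = e.α₁ + e.α₂ + e.α₁₂ ∧ s₁ + s₂ = e.β₁ + e.β₂ + e.β₁₂ then
    binomMul (-1) e.α₁₂ e.β₁₂ a (r₂ - e.α₂) (s₂ - e.β₂) else 0

open Classical in
/-- `(-1)^(α₁₂-β₁₂) z₁^α₁ z̄₁^β₁ z₂^(α₂+α₁₂) z̄₂^(β₂+β₁₂) (1-w)^α₁₂ (1-w̄)^β₁₂ ∑ a r s w^r w̄^s` for
`w = z₁/z₂`, as a series in `z₁, z₂`. -/
def series₂₁ (e : Exponents) (a : ℝ → ℝ → ℂ) : FormalSeries₂ := fun r₁ s₁ r₂ s₂ =>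
  if r₁ + r₂ = e.α₁ + e.α₂ + e.α₁₂ ∧ s₁ + s₂ = e.β₁ + e.β₂ + e.β₁₂ then
    (-1 : ℂ) ^ ⌊e.α₁₂ - e.β₁₂⌋ * binomMul (-1) e.α₁₂ e.β₁₂ a (r₁ - e.α₁) (s₁ - e.β₁) else 0

open Classical in
/-- `z₂^(α₁+α₂) z̄₂^(β₁+β₂) z₀^α₁₂ z̄₀^β₁₂ (1+w)^α₁ (1+w̄)^β₁ ∑ a r s (-w)^r (-w̄)^s` for `w = z₀/z₂`,
as a series in `z₀, z₂`. -/
def series₀₂ (e : Exponents) (a : ℝ → ℝ → ℂ) : FormalSeries₂ := fun r₀ s₀ r₂ s₂ =>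
  if r₀ + r₂ = e.α₁ + e.α₂ + e.α₁₂ ∧ s₀ + s₂ = e.β₁ + e.β₂ + e.β₁₂ then
    binomMul 1 e.α₁ e.β₁ (fun r s => (-1 : ℂ) ^ ⌊r - s⌋ * a r s) (r₀ - e.α₁₂) (s₀ - e.β₁₂) else 0

/-- The graph of the linear map sending `corrFun e f` to `S e a`, where `a` is the expansion of `f`
in the chart with inverse `χ`. -/
def expansionGraph (S : Exponents → (ℝ → ℝ → ℂ) → FormalSeries₂) (χ : ℂ → ℂ) :
    Submodule ℂ ((Y₂ → ℂ) × FormalSeries₂) :=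
  Submodule.span ℂ {x | ∃ e f a, IsConformalFunction f ∧
    HasConformalExpansion (fun p => f (χ p)) a ∧ x = (corrFun e f, S e a)}

/-- `S = μ|_{|z₁|>|z₂|}`; the chart at `0` is `p`. -/
def IsExpansion₁₂ (μ : Y₂ → ℂ) (S : FormalSeries₂) : Prop :=
  (μ, S) ∈ expansionGraph series₁₂ fun p => p

/-- `S = μ|_{|z₂|>|z₁|}`; the chart at `∞` is `p⁻¹`. -/
def IsExpansion₂₁ (μ : Y₂ → ℂ) (S : FormalSeries₂) : Prop :=
  (μ, S) ∈ expansionGraph series₂₁ fun p => p⁻¹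

/-- `S = μ|_{|z₂|>|z₁-z₂|}`, a series in `z₀ = z₁ - z₂` and `z₂`; the chart at `1` is `1 - p⁻¹`. -/
def IsExpansion₀₂ (μ : Y₂ → ℂ) (S : FormalSeries₂) : Prop :=
  (μ, S) ∈ expansionGraph series₀₂ fun p => (1 - p)⁻¹

end Correlation

section FullVertexAlgebra
variable {F : Type*} [AddCommGroup F] [Module ℂ F]

/-- The data of a full vertex algebra: the subspaces `F_{h,h̄}`, the products
`Y a r s = a(r, s)`, that is `Y(a, z) = ∑ a(r, s) z^(-r-1) z̄^(-s-1)`, and the vacuum vector. -/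
structure VertexData (F : Type*) [AddCommGroup F] [Module ℂ F] where
  grade : ℝ → ℝ → Submodule ℂ F
  Y : F →ₗ[ℂ] (ℝ → ℝ → Module.End ℂ F)
  one : F

namespace VertexData
variable (V : VertexData F)

/-- `F^∨ = ⨁ F_{h,h̄}^*`: the functionals that vanish on all but finitely many `F_{h,h̄}`. -/
def dual : Submodule ℂ (Module.Dual ℂ F) where
  carrier := {u | {x : ℝ × ℝ | ∃ v ∈ V.grade x.1 x.2, u v ≠ 0}.Finite}
  zero_mem' := by simp
  add_mem' := by
    intro u u' hu hu'
    refine (Set.Finite.union hu hu').subset ?_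
    rintro x ⟨v, hv, h⟩
    by_cases h0 : u v = 0
    · exact Or.inr ⟨v, hv, by simpa [h0] using h⟩
    · exact Or.inl ⟨v, hv, h0⟩
  smul_mem' := by
    intro t u hu
    refine hu.subset ?_
    rintro x ⟨v, hv, h⟩
    exact ⟨v, hv, fun h0 => h (by simp [h0])⟩

/-- `D a = a(-2, -1) 1`. -/
def D : Module.End ℂ F where
  toFun a := V.Y a (-2) (-1) V.one
  map_add' a b := by simp
  map_smul' t a := by simp

/-- `D̄ a = a(-1, -2) 1`. -/
def Dbar : Module.End ℂ F where
  toFun a := V.Y a (-1) (-2) V.one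
  map_add' a b := by simp
  map_smul' t a := by simp

/-- Full vertex algebras. -/
structure IsFullVertexAlgebra : Prop where
  isInternal : DirectSum.IsInternal fun x : ℝ × ℝ => V.grade x.1 x.2
  one_mem : V.one ∈ V.grade 0 0
  integral : ∀ a r s, V.Y a r s ≠ 0 → ∃ k : ℤ, r - s = k
  countable : ∀ a, {x : ℝ × ℝ | V.Y a x.1 x.2 ≠ 0}.Countable
  truncation : ∀ a b, ∃ N : ℝ, ∀ r s, (N ≤ r ∨ N ≤ s) → V.Y a r s b = 0
  spin : ∀ h hbar, (¬ ∃ k : ℤ, h - hbar = k) → V.grade h hbar = ⊥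
  creation : ∀ a r s, V.Y a r s V.one ≠ 0 → ∃ m n : ℕ, -r - 1 = m ∧ -s - 1 = n
  creation_one : ∀ a, V.Y a (-1) (-1) V.one = a
  vacuum : ∀ r s, V.Y V.one r s = open Classical in if r = -1 ∧ s = -1 then 1 else 0
  correlation : ∀ a b c, ∀ u ∈ V.dual, ∃ μ ∈ GCor₂,
    IsExpansion₁₂ μ (fun r₁ s₁ r₂ s₂ =>
      u (V.Y a (-r₁ - 1) (-s₁ - 1) (V.Y b (-r₂ - 1) (-s₂ - 1) c))) ∧
    IsExpansion₀₂ μ (fun r₀ s₀ r₂ s₂ =>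
      u (V.Y (V.Y a (-r₀ - 1) (-s₀ - 1) b) (-r₂ - 1) (-s₂ - 1) c)) ∧
    IsExpansion₂₁ μ (fun r₁ s₁ r₂ s₂ =>
      u (V.Y b (-r₂ - 1) (-s₂ - 1) (V.Y a (-r₁ - 1) (-s₁ - 1) c)))
  grading : ∀ h hbar h' hbar' r s, ∀ a ∈ V.grade h hbar, ∀ b ∈ V.grade h' hbar',
    V.Y a r s b ∈ V.grade (h + h' - r - 1) (hbar + hbar' - s - 1)

variable (ω ωbar : F)

/-- `L(n) = ω(n+1, -1)`. -/
def vir (n : ℤ) : Module.End ℂ F := V.Y ω (n + 1) (-1)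

/-- `L̄(n) = ω̄(-1, n+1)`. -/
def virBar (n : ℤ) : Module.End ℂ F := V.Y ωbar (-1) (n + 1)

/-- Full vertex operator algebras with energy-momentum tensor `(ω, ω̄)`. -/
structure IsFullVOA : Prop extends V.IsFullVertexAlgebra where
  holomorphic : V.Dbar ω = 0
  antiholomorphic : V.D ωbar = 0
  virasoro : ∃ c : ℂ, ∀ m n : ℤ, ⁅V.vir ω m, V.vir ω n⁆ = ((m : ℂ) - n) • V.vir ω (m + n) +
    (if m + n = 0 then ((m : ℂ) ^ 3 - m) / 12 * c else 0) • 1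
  virasoroBar : ∃ c : ℂ, ∀ m n : ℤ, ⁅V.virBar ωbar m, V.virBar ωbar n⁆ =
    ((m : ℂ) - n) • V.virBar ωbar (m + n) +
    (if m + n = 0 then ((m : ℂ) ^ 3 - m) / 12 * c else 0) • 1
  D_eq : V.D = V.vir ω (-1)
  Dbar_eq : V.Dbar = V.virBar ωbar (-1)
  vir_zero : ∀ h hbar, ∀ v ∈ V.grade h hbar, V.vir ω 0 v = (h : ℂ) • v
  virBar_zero : ∀ h hbar, ∀ v ∈ V.grade h hbar, V.virBar ωbar 0 v = (hbar : ℂ) • v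
  finite : ∀ h hbar, Module.Finite ℂ (V.grade h hbar)
  boundedBelow : ∃ N : ℝ, ∀ h hbar, (h ≤ N ∨ hbar ≤ N) → V.grade h hbar = ⊥

/-- For `a ∈ F_{h,h̄}`, the value `⟨a(r, s) u, v⟩` of the dual module structure, the coefficient of
`z^(-r-1) z̄^(-s-1)` in `⟨u, Y(exp(z L(1) + z̄ L̄(1)) (-1)^(h-h̄) z^(-2h) z̄^(-2h̄) a, z⁻¹) v⟩`. -/
def dualAction (h hbar : ℝ) (a : F) (r s : ℝ) (u : Module.Dual ℂ F) (v : F) : ℂ :=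
  ∑ᶠ x : ℕ × ℕ, ((-1 : ℂ) ^ ⌊h - hbar⌋ / (Nat.factorial x.1 * Nat.factorial x.2)) *
    u (V.Y ((V.vir ω 1 ^ x.1) ((V.virBar ωbar 1 ^ x.2) a))
      (2 * h - x.1 - r - 2) (2 * hbar - x.2 - s - 2) v)

/-- `F` is isomorphic to its dual `F^∨` as a module over `F`. -/
def IsSelfDual : Prop :=
  ∃ Φ : F ≃ₗ[ℂ] V.dual, ∀ h hbar, ∀ a ∈ V.grade h hbar, ∀ b c r s,
    (Φ (V.Y a r s b) : Module.Dual ℂ F) c =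
      V.dualAction ω ωbar h hbar a r s (Φ b : Module.Dual ℂ F) c

/-- The space `QF_{h,h̄}` of quasi-primary vectors. -/
def quasiPrimary (h hbar : ℝ) : Submodule ℂ F :=
  V.grade h hbar ⊓ LinearMap.ker (V.vir ω 1) ⊓ LinearMap.ker (V.virBar ωbar 1)

/-- `F` is generated by the quasi-primary vectors as a module over `sl₂ ⊕ sl₂`, spanned by the
`L(i)`, `L̄(i)` with `i = -1, 0, 1`. -/
def IsQPGenerated : Prop :=
  ∀ W : Submodule ℂ F, (∀ h hbar, V.quasiPrimary ω ωbar h hbar ≤ W) →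
    (∀ i ∈ ({-1, 0, 1} : Set ℤ), ∀ w ∈ W, V.vir ω i w ∈ W ∧ V.virBar ωbar i w ∈ W) → W = ⊤

end VertexData
end FullVertexAlgebra

section Lattice
variable {L : Type*} [AddCommGroup L]

/-- The real vector space `L ⊗ ℝ`. -/
abbrev RealSpace (L : Type*) [AddCommGroup L] : Type _ := ℝ ⊗[ℤ] L

/-- The complexification of `L ⊗ ℝ`. -/
abbrev ComplexSpace (L : Type*) [AddCommGroup L] : Type _ := ℂ ⊗[ℝ] RealSpace L

def toReal (α : L) : RealSpace L := 1 ⊗ₜ α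

def toComplex (α : L) : ComplexSpace L := 1 ⊗ₜ toReal α

/-- The real extension of the form of the lattice. -/
def realForm (B : LinearMap.BilinForm ℤ L) : LinearMap.BilinForm ℝ (RealSpace L) :=
  B.baseChange ℝ

/-- The form `(h, h')_p = (p h, p h') - ((1 - p) h, (1 - p) h')`. -/
def twistedForm {H : Type*} [AddCommGroup H] [Module ℝ H] (B : LinearMap.BilinForm ℝ H)
    (p : Module.End ℝ H) : LinearMap.BilinForm ℝ H :=
  B.compl₁₂ p p - B.compl₁₂ (1 - p) (1 - p)

/-- The projections `p` with `ker p` orthogonal to `ker (1 - p)`. -/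
def orthogonalProjections {H : Type*} [AddCommGroup H] [Module ℝ H] (B : LinearMap.BilinForm ℝ H) :
    Set (Module.End ℝ H) :=
  {p | p * p = p ∧ ∀ x ∈ LinearMap.ker p, ∀ y ∈ LinearMap.ker (1 - p), B x y = 0}

/-- Those for which moreover `ker (1 - p)` is positive and `ker p` negative definite. -/
def positiveProjections {H : Type*} [AddCommGroup H] [Module ℝ H] (B : LinearMap.BilinForm ℝ H) :
    Set (Module.End ℝ H) :=
  {p | p ∈ orthogonalProjections B ∧ (∀ x ∈ LinearMap.ker (1 - p), x ≠ 0 → 0 < B x x) ∧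
    ∀ x ∈ LinearMap.ker p, x ≠ 0 → B x x < 0}

/-- The structure constants `e_α e_β = ε(α, β) e_{α+β}` of a twisted group algebra
`⨁ α, ℂ e_α` of the lattice: an associative algebra with unit `e_0`, such that `e_α e_β ≠ 0` and
`e_α e_β = (-1)^(α, β) e_β e_α`. -/
structure TwistedGroupAlgebra (B : LinearMap.BilinForm ℤ L) where
  ε : L → L → ℂ
  ne_zero : ∀ α β, ε α β ≠ 0
  zero_left : ∀ α, ε 0 α = 1
  zero_right : ∀ α, ε α 0 = 1
  assoc : ∀ α β γ, ε α β * ε (α + β) γ = ε β γ * ε α (β + γ)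
  comm : ∀ α β, ε α β = (-1 : ℂ) ^ (B α β) * ε β α

/-- The space `F = S(⨁_{n ≥ 0} (H ⊗ ℂ) t^(-n-1)) ⊗ ℂ[L]`: the finitely supported function with
value `s` at `α` is `s ⊗ e_α`. -/
abbrev LatticeSpace (L : Type*) [AddCommGroup L] : Type _ := L →₀ Fock (ComplexSpace L)

variable (B : LinearMap.BilinForm ℤ L) (p : Module.End ℝ (RealSpace L))

/-- The complex extension of `(-, -)_p`. -/
def latticeForm : LinearMap.BilinForm ℂ (ComplexSpace L) :=
  (twistedForm (realForm B) p).baseChange ℂ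

def complexProj : Module.End ℂ (ComplexSpace L) := LinearMap.baseChange ℂ p

/-- `(p α, p β)_p` for lattice vectors. -/
def leftPairing (α β : L) : ℝ := twistedForm (realForm B) p (p (toReal α)) (p (toReal β))

/-- `((1 - p) α, (1 - p) β)_p` for lattice vectors. -/
def rightPairing (α β : L) : ℝ :=
  twistedForm (realForm B) p ((1 - p) (toReal α)) ((1 - p) (toReal β))

/-- The operator `h(n)` on `F`. -/
def heis (h : ComplexSpace L) (n : ℤ) : Module.End ℂ (LatticeSpace L) :=
  mode (latticeForm B p) toComplex n h

/-- `H_l ⊗ ℂ`, where `H_l = ker (1 - p)`. -/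
def leftSpace : Submodule ℂ (ComplexSpace L) := (LinearMap.ker (1 - p)).baseChange ℂ

/-- `H_r ⊗ ℂ`, where `H_r = ker p`. -/
def rightSpace : Submodule ℂ (ComplexSpace L) := (LinearMap.ker p).baseChange ℂ

variable {B} in
/-- The full vertex algebra `F_{L,H_L,p}`. -/
def latticeVertex (A : TwistedGroupAlgebra B) : VertexData (LatticeSpace L) where
  grade := weightSpace (leftSpace p) (rightSpace p) (leftPairing B p) (rightPairing B p)
  Y :=
    { toFun := fun v r s => (vertexField (latticeForm B p) (complexProj p) toComplex A.ε
        (leftPairing B p) (rightPairing B p) v).1 (-r - 1) (-s - 1)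
      map_add' := fun v w => by
        rw [map_add]; rfl
      map_smul' := fun t v => by
        rw [map_smul]; rfl }
  one := Finsupp.single 0 1

/-- The vector `(1/2) ∑ hᵢ(-1) hᵢ`, where `hᵢ = hᵢ(-1) 1`. -/
def conformalVector {k : ℕ} (h : Fin k → ComplexSpace L) : LatticeSpace L :=
  (2⁻¹ : ℂ) • ∑ i, heis B p (h i) (-1) (heis B p (h i) (-1) (Finsupp.single 0 1))

/-- Orthonormality for `(-, -)_p`. -/
def IsOrthonormal {k : ℕ} (h : Fin k → ComplexSpace L) : Prop :=
  ∀ i j, latticeForm B p (h i) (h j) = if i = j then 1 else 0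

end Lattice

section TwistedGroupAlgebra
variable {L : Type*} [AddCommGroup L]

theorem neg_one_zpow_add (m n : ℤ) : (-1 : ℂ) ^ (m + n) = (-1) ^ m * (-1) ^ n :=
  zpow_add₀ (by norm_num) m n

/-- Twisted group algebras exist. -/
theorem nonempty_twistedGroupAlgebra [Module.Free ℤ L] [Module.Finite ℤ L]
    (B : LinearMap.BilinForm ℤ L) (hB : B.IsSymm) (heven : ∀ α, Even (B α α)) :
    Nonempty (TwistedGroupAlgebra B) := by
  classical
  let b := Module.finBasis ℤ L
  let η : L → L → ℤ := fun α β => ∑ i, ∑ j, if j < i then b.repr α i * b.repr β j * B (b i) (b j) else 0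
  have addl : ∀ α β γ, η (α + β) γ = η α γ + η β γ := by
    intro α β γ
    simp only [η, ← Finset.sum_add_distrib]
    refine Finset.sum_congr rfl fun i _ => Finset.sum_congr rfl fun j _ => ?_
    split_ifs <;> simp <;> ring
  have addr : ∀ α β γ, η α (β + γ) = η α β + η α γ := by
    intro α β γ
    simp only [η, ← Finset.sum_add_distrib]
    refine Finset.sum_congr rfl fun i _ => Finset.sum_congr rfl fun j _ => ?_
    split_ifs <;> simp <;> ring
  have swap : ∀ α β, ∃ k : ℤ, B α β = η α β + η β α + 2 * k := by
    intro α β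
    have h1 : B α β = ∑ i, ∑ j, b.repr α i * b.repr β j * B (b i) (b j) := by
      conv_lhs => rw [← b.sum_repr α, ← b.sum_repr β]
      simp only [map_sum, LinearMap.sum_apply, map_smul, LinearMap.smul_apply, smul_eq_mul]
      rw [Finset.sum_comm]
      refine Finset.sum_congr rfl fun i _ => ?_
      rw [Finset.mul_sum]
      exact Finset.sum_congr rfl fun j _ => by ring
    have h2 : η β α = ∑ i, ∑ j, if i < j then b.repr α i * b.repr β j * B (b i) (b j) else 0 := by
      simp only [η]
      rw [Finset.sum_comm]
      refine Finset.sum_congr rfl fun i _ => Finset.sum_congr rfl fun j _ => ?_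
      rw [hB.eq (b j) (b i)]
      split_ifs <;> ring
    choose c hc using fun i => heven (b i)
    refine ⟨∑ i, b.repr α i * b.repr β i * c i, ?_⟩
    rw [h1, h2]
    simp only [η]
    rw [Finset.mul_sum, ← Finset.sum_add_distrib, ← Finset.sum_add_distrib]
    refine Finset.sum_congr rfl fun i _ => ?_
    have e1 : ∀ j, b.repr α i * b.repr β j * B (b i) (b j) =
        ((if j < i then b.repr α i * b.repr β j * B (b i) (b j) else 0) +
        (if i < j then b.repr α i * b.repr β j * B (b i) (b j) else 0)) +
        (if i = j then b.repr α i * b.repr β j * B (b i) (b j) else 0) := by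
      intro j
      rcases lt_trichotomy j i with h | h | h
      · simp [h, h.not_gt, h.ne']
      · simp [h]
      · simp [h, h.not_gt, h.ne]
    rw [Finset.sum_congr rfl fun j _ => e1 j, Finset.sum_add_distrib, Finset.sum_add_distrib,
      Finset.sum_ite_eq, if_pos (Finset.mem_univ i), hc i]
    ring
  refine ⟨⟨fun α β => (-1) ^ (η α β), fun α β => zpow_ne_zero _ (by norm_num), ?_, ?_, ?_, ?_⟩⟩
  · intro α; simp [η]
  · intro α; simp [η]
  · intro α β γ
    rw [← neg_one_zpow_add, ← neg_one_zpow_add, addl, addr]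
    congr 1
    ring
  · intro α β
    obtain ⟨k, hk⟩ := swap α β
    have h2 : (-1 : ℂ) ^ (2 * k) = 1 := by rw [zpow_mul]; norm_num
    have h3 : (-1 : ℂ) ^ (η β α) * (-1 : ℂ) ^ (η β α) = 1 := by
      rw [← neg_one_zpow_add, ← two_mul, zpow_mul]; norm_num
    rw [hk, neg_one_zpow_add, neg_one_zpow_add, h2, mul_one, mul_assoc, h3, mul_one]

end TwistedGroupAlgebra

section Grassmannian

/-- The diagonal matrix with `n` entries `1` and `m` entries `-1`. -/
def signMatrix (n m : ℕ) : Matrix (Fin n ⊕ Fin m) (Fin n ⊕ Fin m) ℝ :=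
  Matrix.fromBlocks 1 0 0 (-1)

/-- The group `O(n, m; ℝ)`. -/
def pseudoOrthogonal (n m : ℕ) : Subgroup (GL (Fin n ⊕ Fin m) ℝ) where
  carrier := {g | g.val.transpose * signMatrix n m * g.val
    = signMatrix n m}
  one_mem' := by simp
  mul_mem' := by
    intro g k hg hk
    simp only [Set.mem_ofPred_eq, Matrix.GeneralLinearGroup.coe_mul, Matrix.transpose_mul] at *
    calc _ = k.val.transpose * (g.val.transpose * signMatrix n m *
          g.val) * k.val := by simp only [Matrix.mul_assoc]
      _ = _ := by rw [hg, hk]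
  inv_mem' := by
    intro g hg
    simp only [Set.mem_ofPred_eq] at *
    have h1 : g.val * g⁻¹.val = 1 := by
      rw [← Matrix.GeneralLinearGroup.coe_mul, mul_inv_cancel]; rfl
    have h2 : g⁻¹.val.transpose * g.val.transpose = 1 := by
      rw [← Matrix.transpose_mul, h1, Matrix.transpose_one]
    calc _ = g⁻¹.val.transpose * (g.val.transpose *
          signMatrix n m * g.val) * g⁻¹.val := by rw [hg]
      _ = (g⁻¹.val.transpose * g.val.transpose) *
          signMatrix n m * (g.val * g⁻¹.val) := by
        simp only [Matrix.mul_assoc]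
      _ = _ := by rw [h1, h2, Matrix.one_mul, Matrix.mul_one]

/-- The subgroup `O(n; ℝ) × O(m; ℝ)` of block diagonal matrices in `O(n, m; ℝ)`. -/
def blockOrthogonal (n m : ℕ) : Subgroup (pseudoOrthogonal n m) where
  carrier := {g | ∃ a ∈ Matrix.orthogonalGroup (Fin n) ℝ, ∃ d ∈ Matrix.orthogonalGroup (Fin m) ℝ,
    g.1.val = Matrix.fromBlocks a 0 0 d}
  one_mem' := ⟨1, one_mem _, 1, one_mem _, by simp⟩
  mul_mem' := by
    rintro g k ⟨a, ha, d, hd, hg⟩ ⟨a', ha', d', hd', hk⟩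
    exact ⟨a * a', mul_mem ha ha', d * d', mul_mem hd hd', by
      simp [hg, hk, Matrix.fromBlocks_multiply]⟩
  inv_mem' := by
    rintro g ⟨a, ha, d, hd, hg⟩
    refine ⟨star a, Unitary.star_mem ha, star d, Unitary.star_mem hd, ?_⟩
    have h1 : g.1.val *
        Matrix.fromBlocks (star a) 0 0 (star d) = 1 := by
      rw [hg, Matrix.fromBlocks_multiply]
      rw [Unitary.mul_star_self_of_mem ha, Unitary.mul_star_self_of_mem hd]
      simp
    have h2 : g⁻¹.1.val *
        g.1.val = 1 := by
      rw [← Matrix.GeneralLinearGroup.coe_mul, ← Subgroup.coe_mul, inv_mul_cancel]; rfl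
    calc _ = g⁻¹.1.val *
          (g.1.val *
            Matrix.fromBlocks (star a) 0 0 (star d)) := by rw [h1, Matrix.mul_one]
      _ = _ := by rw [← Matrix.mul_assoc, h2, Matrix.one_mul]

/-- The matrix of the projection onto the first `n` coordinates. -/
def blockProj (n m : ℕ) : Matrix (Fin n ⊕ Fin m) (Fin n ⊕ Fin m) ℝ :=
  Matrix.fromBlocks 1 0 0 0

/-- The set of positive projections as a topological space, with the topology induced by that of
the finite-dimensional space of endomorphisms. -/
def PositiveProjection {H : Type*} [AddCommGroup H] [Module ℝ H] (B : LinearMap.BilinForm ℝ H) :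
    Type _ := {p : Module.End ℝ H // p ∈ positiveProjections B}

instance {H : Type*} [AddCommGroup H] [Module ℝ H] (B : LinearMap.BilinForm ℝ H) :
    TopologicalSpace (PositiveProjection B) :=
  TopologicalSpace.induced Subtype.val (moduleTopology ℝ (Module.End ℝ H))

end Grassmannian
end FullVertex
end

open FullVertex

/-! The construction only sees a complex space `E` with a symmetric form, an orthogonal projection
`P` splitting it into a left part (variable z) and a right part (variable z̄), the lattice vectors
inside `E`, the cocycle, and the real exponents `a`, `b` whose difference is the integral form.
These data are collected in `LatticeDatum`, and the arguments about the algebra are carried out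
there. A Boolean selects the part, so that the holomorphic and the antiholomorphic half are treated
by one computation.

Locality and associativity. The field of `x(-k-1)v` is a normally ordered product of a derivative of
the current of `x` with the field of `v`. By induction this gives the commutator formula
`commutator`, [x(n), Y(b,z)] = ∑ C(n,j) z^(n-j) Y(x(j)b, z). It follows that the three matrix
coefficients of (FV5), kept together as the triple `corr`, satisfy the same Ward identities:
`corr_comp_h` moves a mode from the functional onto the three vectors, and `IsVacuum.corr_h`,
`IsVacuum.corr_e_h` strip creation operators. Each step multiplies by integral powers of z₁, z₂ or
z₁ - z₂, expanded in the appropriate region. The span `monomialSpan` of the triples of expansions of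
z₁^x₁ z₂^x₂ (z₁-z₂)^x₁₂ is stable under these multiplications. What remains is a vacuum functional
on three exponentials (`IsVacuum.corr_e_e_e`), where `corr` is one monomial; the relation e_α e_β =
(-1)^(α,β) e_β e_α supplies exactly the sign from expanding (z₁-z₂)^x₁₂ at |z₂| > |z₁|. So the
correlation functions are combinations of monomials, and the conformal function f = 1 suffices. A
homogeneous functional is reduced to a vacuum one by the Euler operator ∑ f(-k-1) f'(k+1), which
acts as the level.

Conformal structure. The Sugawara vector of an orthonormal frame gives [x(m), L(n)] = m x(m+n). The
defect in the Virasoro relation therefore commutes with all modes and is determined by its values on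
the e_α (`Frame.bracket_e`), where weights leave only m + n = 0 to compute. When the projection is
positive, weights are nonnegative and weight spaces are finite-dimensional. Then L(1)L(-1) is
invertible on positive weight, so a vector can be corrected by some L(-1)u to one killed by L(1);
this fails only when L(1)v has weight zero, but there L(1)v = 0 anyway. This gives generation by
quasi-primary vectors (`Frame.mem_of_ker`).

Self-duality. There is a symmetric form with x(n)* = -x(-n) pairing charge δ with -δ. Every
homogeneous functional lies in its range, again by the Euler operator, so it is nondegenerate.
Invariance under Y holds for e_α thanks to the normalization `κ` (`ε_κ`, `form_Y_e`) and passes to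
x(-k-1)a by a Vandermonde identity (`isContravariant_h`).

The Grassmannian. For J = diag(1,-1), the conjugate p of the standard projection by g satisfies
(2p-1)J = g gᵀ. Conversely positivity of p says that J(2p-1), the matrix of the twisted form, is
positive definite, and its square root stays in the pseudo-orthogonal group; this yields
transitivity. The stabilizer consists of the block diagonal matrices. Since g ↦ g gᵀ is proper, the
orbit map is closed and descends to a homeomorphism. -/

noncomputable section
namespace FullVertex
open Filter

/-! ### Exponentials of power series with noncommuting coefficients -/

section Exponential
variable {R : Type*} [Ring R] [Algebra ℂ R]

/-- The Euler derivation `x d/dx` of power series. -/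
def eulerSeries (A : PowerSeries R) : PowerSeries R :=
  PowerSeries.mk fun n => (n : ℂ) • PowerSeries.coeff n A

theorem eulerSeries_mul (A B : PowerSeries R) :
    eulerSeries (A * B) = eulerSeries A * B + A * eulerSeries B := by
  ext n
  simp only [eulerSeries, PowerSeries.coeff_mk, map_add, PowerSeries.coeff_mul, Finset.smul_sum,
    ← Finset.sum_add_distrib]
  refine Finset.sum_congr rfl fun p hp => ?_
  rw [smul_mul_assoc, mul_smul_comm, ← add_smul, ← Finset.HasAntidiagonal.mem_antidiagonal.1 hp]
  push_cast
  rfl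

/-- The coefficients are operators, so the power rule needs a series that commutes with its own
Euler derivative. -/
theorem eulerSeries_pow (A : PowerSeries R) (h : Commute (eulerSeries A) A) (k : ℕ) :
    eulerSeries (A ^ (k + 1)) = (k + 1) • (eulerSeries A * A ^ k) := by
  induction k with
  | zero => simp
  | succ k ih =>
    rw [pow_succ, eulerSeries_mul, ih, smul_mul_assoc, mul_assoc, ← pow_succ,
      ← (h.pow_right (k + 1)).eq, ← succ_nsmul]

theorem coeff_pow_eq_zero (A : PowerSeries R) (h0 : PowerSeries.coeff 0 A = 0) {n k : ℕ}
    (hnk : n < k) : PowerSeries.coeff n (A ^ k) = 0 := by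
  induction k generalizing n with
  | zero => omega
  | succ k ih =>
    rw [pow_succ, PowerSeries.coeff_mul]
    refine Finset.sum_eq_zero fun p hp => ?_
    have hp' := Finset.HasAntidiagonal.mem_antidiagonal.1 hp
    by_cases h : p.2 = 0
    · rw [h, h0, mul_zero]
    · rw [ih (by omega), zero_mul]

/-- A series without constant term contributes to degree n only through its powers up to n, so the
cutoff may be enlarged at will; this allows all coefficients up to a given degree to be written with
one common cutoff. -/
theorem coeff_expSeries (A : PowerSeries R) (h0 : PowerSeries.coeff 0 A = 0) {n K : ℕ}
    (hK : n < K) : PowerSeries.coeff n (expSeries A) =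
      ∑ k ∈ Finset.range K, ((Nat.factorial k : ℂ)⁻¹) • PowerSeries.coeff n (A ^ k) := by
  rw [expSeries, PowerSeries.coeff_mk]
  refine Finset.sum_subset (Finset.range_subset_range.2 hK) fun k _ hk => ?_
  rw [coeff_pow_eq_zero A h0 (by simpa using hk), smul_zero]

/-- This is x d/dx exp A = (x d/dx A) exp A, read off coefficientwise. -/
theorem expSeries_recursion (A : PowerSeries R) (h0 : PowerSeries.coeff 0 A = 0)
    (h : Commute (eulerSeries A) A) (n : ℕ) :
    (n : ℂ) • PowerSeries.coeff n (expSeries A) =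
      ∑ p ∈ Finset.HasAntidiagonal.antidiagonal n,
        (p.1 : ℂ) • PowerSeries.coeff p.1 A * PowerSeries.coeff p.2 (expSeries A) := by
  have h1 : ∀ k : ℕ, (n : ℂ) • PowerSeries.coeff n (A ^ (k + 1)) =
      ((k : ℂ) + 1) • PowerSeries.coeff n (eulerSeries A * A ^ k) := by
    intro k
    have := congrArg (PowerSeries.coeff n) (eulerSeries_pow A h k)
    rw [map_nsmul, eulerSeries, PowerSeries.coeff_mk] at this
    rw [this, ← Nat.cast_smul_eq_nsmul ℂ]
    push_cast
    rfl
  -- The cutoff n + 2 leaves n + 1 terms once the zeroth power is split off, as many as in the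
  -- expansion of the right-hand side.
  rw [coeff_expSeries A h0 (n.lt_succ_self.trans (n + 1).lt_succ_self), Finset.sum_range_succ']
  have h2 : (n : ℂ) • PowerSeries.coeff n (1 : PowerSeries R) = 0 := by
    rw [PowerSeries.coeff_one]
    split_ifs with hn <;> simp [hn]
  rw [smul_add, pow_zero, smul_comm (n : ℂ) _ (PowerSeries.coeff n (1 : PowerSeries R)), h2,
    smul_zero, add_zero, Finset.smul_sum]
  have h3 : ∀ p ∈ Finset.HasAntidiagonal.antidiagonal n,
      (p.1 : ℂ) • PowerSeries.coeff p.1 A * PowerSeries.coeff p.2 (expSeries A) =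
      ∑ k ∈ Finset.range (n + 1), ((Nat.factorial k : ℂ)⁻¹) •
        (PowerSeries.coeff p.1 (eulerSeries A) * PowerSeries.coeff p.2 (A ^ k)) := by
    intro p hp
    rw [coeff_expSeries A h0 (K := n + 1)
      (by have := Finset.HasAntidiagonal.mem_antidiagonal.1 hp; omega), Finset.mul_sum]
    refine Finset.sum_congr rfl fun k _ => ?_
    rw [mul_smul_comm, eulerSeries, PowerSeries.coeff_mk]
  rw [Finset.sum_congr rfl h3, Finset.sum_comm]
  refine Finset.sum_congr rfl fun k _ => ?_
  rw [smul_comm, h1, smul_smul, PowerSeries.coeff_mul, ← Finset.smul_sum]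
  have : (((k + 1).factorial : ℂ)⁻¹) * ((k : ℂ) + 1) = (k.factorial : ℂ)⁻¹ := by
    rw [Nat.factorial_succ]
    push_cast
    have : (k : ℂ) + 1 ≠ 0 := Nat.cast_add_one_ne_zero k
    field_simp
  rw [this]

/-- The recursion satisfied by the coefficients `Y` of `exp (∑ X k x^(k+1) / (k+1))`. -/
structure IsExpSeq (X Y : ℕ → R) : Prop where
  zero : Y 0 = 1
  recursion : ∀ n : ℕ, (n : ℂ) • Y n = ∑ k ∈ Finset.range n, X k * Y (n - (k + 1))

/-- The recursion determines the coefficients, and it is the only property of E⁺ and E⁻ used in the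
commutation relations below. -/
theorem isExpSeq_expSeries (X : ℕ → R) (hX : ∀ i j, X i * X j = X j * X i) :
    IsExpSeq X fun n => PowerSeries.coeff n (expSeries (PowerSeries.mk fun n =>
      if n = 0 then 0 else ((n : ℂ)⁻¹) • X (n - 1))) := by
  set A : PowerSeries R := PowerSeries.mk fun n => if n = 0 then 0 else ((n : ℂ)⁻¹) • X (n - 1)
  have h0 : PowerSeries.coeff 0 A = 0 := by simp [A]
  have hA : ∀ n : ℕ, (n : ℂ) • PowerSeries.coeff n A = if n = 0 then 0 else X (n - 1) := by
    intro n
    simp only [A, PowerSeries.coeff_mk]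
    split_ifs with h
    · simp
    · rw [smul_smul, mul_inv_cancel₀ (by exact_mod_cast h), one_smul]
  have hc : Commute (eulerSeries A) A := by
    ext n
    rw [PowerSeries.coeff_mul, PowerSeries.coeff_mul, ← Finset.Nat.sum_antidiagonal_swap]
    refine Finset.sum_congr rfl fun p _ => ?_
    simp only [eulerSeries, PowerSeries.coeff_mk, hA, Prod.fst_swap, Prod.snd_swap]
    simp only [A, PowerSeries.coeff_mk]
    split_ifs <;> simp [hX (p.2 - 1)]
  refine ⟨?_, fun n => ?_⟩
  · change PowerSeries.coeff 0 (expSeries A) = 1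
    rw [expSeries, PowerSeries.coeff_mk]
    simp
  · rw [expSeries_recursion A h0 hc, Finset.Nat.sum_antidiagonal_eq_sum_range_succ_mk,
      Finset.sum_range_succ']
    simp only [hA]
    simp

namespace IsExpSeq
variable {X Y : ℕ → R}

/-- An operator whose commutator with the exponent is the scalar series c x^m acts on the
exponential as a derivation, hence [T, exp] = c x^m exp. The induction runs over the degree through
the recursion. -/
theorem commutator (h : IsExpSeq X Y) (T : R) (m : ℕ) (hm : 0 < m) (c : ℂ)
    (hT : ∀ k, T * X k = X k * T + if k + 1 = m then ((m : ℂ) * c) • 1 else 0) (n : ℕ) :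
    T * Y n = Y n * T + if m ≤ n then c • Y (n - m) else 0 := by
  induction n using Nat.strong_induction_on with
  | _ n ih =>
    rcases Nat.eq_zero_or_pos n with rfl | hn
    · simp [h.zero, hm.ne']
    · have h1 : (n : ℂ) ≠ 0 := by exact_mod_cast hn.ne'
      -- The recursion gives n • Y n, so both sides are multiplied by n ≠ 0.
      apply smul_right_injective R h1
      change (n : ℂ) • _ = (n : ℂ) • _
      have e1 : ∀ k ∈ Finset.range n, T * (X k * Y (n - (k + 1))) = X k * Y (n - (k + 1)) * T +
          (X k * (if m ≤ n - (k + 1) then c • Y (n - (k + 1) - m) else 0) +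
            if k + 1 = m then ((m : ℂ) * c) • Y (n - m) else 0) := by
        intro k hk
        rw [← mul_assoc, hT, add_mul, mul_assoc, ih _ (by have := Finset.mem_range.1 hk; omega),
          mul_add, mul_assoc, add_assoc]
        congr 2
        split_ifs with hk'
        · rw [smul_one_mul, hk']
        · rw [zero_mul]
      rw [← mul_smul_comm, h.recursion, Finset.mul_sum, Finset.sum_congr rfl e1, Finset.sum_add_distrib,
        ← Finset.sum_mul, ← h.recursion, smul_add, smul_mul_assoc, Finset.sum_add_distrib]
      congr 1
      split_ifs with hmn
      · have e2 : (∑ k ∈ Finset.range n, if k + 1 = m then ((m : ℂ) * c) • Y (n - m) else 0)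
            = ((m : ℂ) * c) • Y (n - m) := by
          rw [Finset.sum_eq_single (m - 1)]
          · rw [if_pos (by omega)]
          · intro k _ hk
            rw [if_neg (by omega)]
          · intro hk
            simp at hk
            omega
        -- The recursion for Y (n - m) produces the factor n - m; with the m from the contraction of
        -- T with the exponent this makes up n.
        have e3 : (∑ k ∈ Finset.range n,
            X k * (if m ≤ n - (k + 1) then c • Y (n - (k + 1) - m) else 0)) =
            c • ((n - m : ℕ) : ℂ) • Y (n - m) := by
          rw [h.recursion, Finset.smul_sum]
          symm
          refine Finset.sum_subset_zero_on_sdiff (Finset.range_subset_range.2 (by omega)) ?_ ?_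
          · intro k hk
            simp only [Finset.mem_sdiff, Finset.mem_range] at hk
            rw [if_neg (by omega), mul_zero]
          · intro k hk
            simp only [Finset.mem_range] at hk
            rw [if_pos (by omega), mul_smul_comm, show n - m - (k + 1) = n - (k + 1) - m by omega]
        rw [e2, e3, smul_smul, ← add_smul, smul_smul]
        congr 1
        push_cast [Nat.cast_sub hmn]
        ring
      · rw [smul_zero]
        rw [Finset.sum_eq_zero, Finset.sum_eq_zero, add_zero]
        · intro k hk
          have := Finset.mem_range.1 hk
          rw [if_neg (by omega)]
        · intro k _
          rw [if_neg (by omega), mul_zero]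

theorem commute (h : IsExpSeq X Y) (T : R) (hT : ∀ k, T * X k = X k * T) (n : ℕ) : T * Y n = Y n * T := by
  have := h.commutator T (n + 1) n.succ_pos 0 (fun k => by simp [hT]) n
  simpa using this

end IsExpSeq

theorem coeffReal_natCast (X : PowerSeries R) (n : ℕ) : coeffReal X n = PowerSeries.coeff n X := by
  simp [coeffReal]

theorem coeffReal_eq_zero (X : PowerSeries R) (a : ℝ) (ha : ∀ n : ℕ, (n : ℝ) ≠ a) :
    coeffReal X a = 0 := by
  rw [coeffReal, if_neg (ha _)]

end Exponential

/-! ### Commutation of the Heisenberg modes with E⁻ and E⁺ -/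

section FockExponential
variable {E : Type*} [AddCommGroup E] [Module ℂ E]

theorem isExpSeq_expMinus (g : LinearMap.BilinForm ℂ E) (h : E) :
    IsExpSeq (fun k => modeAt g 0 h (.negSucc k)) fun n => PowerSeries.coeff n (expMinus g h) := by
  have := isExpSeq_expSeries (fun k => modeAt g 0 h (.negSucc k))
    fun i j => modeAt_comm_neg g 0 h h i j
  convert this using 5 with n
  rw [expMinus]
  congr 2
  funext n
  rcases n with _ | n
  · simp
  · rfl

/-- The sign in the exponent of E⁺ is absorbed into the vector `(-1) • h`. -/
theorem isExpSeq_expPlus (g : LinearMap.BilinForm ℂ E) (h : E) :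
    IsExpSeq (fun k => modeAt g 0 ((-1 : ℂ) • h) ((k + 1 : ℕ) : ℤ))
      fun n => PowerSeries.coeff n (expPlus g h) := by
  have := isExpSeq_expSeries (fun k => modeAt g 0 ((-1 : ℂ) • h) ((k + 1 : ℕ) : ℤ))
    fun i j => modeAt_comm_nonneg g 0 _ _ _ _
  convert this using 5 with n
  rw [expPlus]
  congr 2
  funext n
  rcases n with _ | n
  · simp
  · simp only [Nat.add_sub_cancel, modeAt_smul, smul_smul, mul_neg, mul_one]

/-- Only h(0) sees the charge, so the exponentials, which involve nonzero modes only, can be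
computed in charge 0. -/
theorem modeAt_of_ne_zero (g : LinearMap.BilinForm ℂ E) (w w' h : E) {n : ℤ} (hn : n ≠ 0) :
    modeAt g w h n = modeAt g w' h n := by
  rcases n with (_ | n) | n
  · simp at hn
  · rfl
  · rfl

theorem modeAt_commutator (g : LinearMap.BilinForm ℂ E) (hg : g.IsSymm) (w h h' : E) (m n : ℤ) :
    modeAt g w h m * modeAt g w h' n = modeAt g w h' n * modeAt g w h m +
      (if m + n = 0 then (m : ℂ) * g h h' else 0) • 1 := by
  rw [← modeAt_heis g hg w h h' m n]; abel

/-- Because `coeffReal` vanishes away from the natural numbers, the shifted term needs no side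
condition m ≤ a: when a - m is negative it is zero by itself. -/
theorem modeAt_expMinus_pos (g : LinearMap.BilinForm ℂ E) (hg : g.IsSymm) (h h' : E) (m : ℕ)
    (hm : 0 < m) (a : ℝ) :
    modeAt g 0 h m * coeffReal (expMinus g h') a = coeffReal (expMinus g h') a * modeAt g 0 h m +
      g h h' • coeffReal (expMinus g h') (a - m) := by
  by_cases ha : ∃ n : ℕ, (n : ℝ) = a
  · obtain ⟨n, rfl⟩ := ha
    have := (isExpSeq_expMinus g h').commutator (modeAt g 0 h m) m hm (g h h') (fun k => by
      rw [modeAt_commutator g hg]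
      congr 1
      by_cases hk : k + 1 = m
      · rw [if_pos hk, if_pos (by rw [← hk]; simp [Int.negSucc_eq])]
        simp
      · rw [if_neg hk, if_neg (by rw [Int.negSucc_eq]; omega), zero_smul]) n
    rw [coeffReal_natCast, this]
    congr 1
    split_ifs with hmn
    · rw [← Nat.cast_sub hmn, coeffReal_natCast]
    · rw [coeffReal_eq_zero, smul_zero]
      intro k hk
      have : ((k + m : ℕ) : ℝ) = n := by push_cast; linarith
      have := Nat.cast_injective this
      omega
  · push Not at ha
    rw [coeffReal_eq_zero _ a ha, coeffReal_eq_zero]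
    · simp
    · intro n hn
      exact ha (n + m) (by push_cast; linarith)

theorem modeAt_expMinus_neg (g : LinearMap.BilinForm ℂ E) (h h' : E) (m : ℕ) (a : ℝ) :
    modeAt g 0 h (.negSucc m) * coeffReal (expMinus g h') a =
      coeffReal (expMinus g h') a * modeAt g 0 h (.negSucc m) := by
  rw [coeffReal]
  split_ifs
  · exact (isExpSeq_expMinus g h').commute _ (fun k => modeAt_comm_neg g 0 _ _ _ _) _
  · simp

theorem modeAt_expPlus_pos (g : LinearMap.BilinForm ℂ E) (h h' : E) (m n : ℕ) :
    modeAt g 0 h m * PowerSeries.coeff n (expPlus g h') =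
      PowerSeries.coeff n (expPlus g h') * modeAt g 0 h m :=
  (isExpSeq_expPlus g h').commute _ (fun k => modeAt_comm_nonneg g 0 _ _ _ _) _

theorem modeAt_expPlus_neg (g : LinearMap.BilinForm ℂ E) (hg : g.IsSymm) (h h' : E) (m n : ℕ) :
    modeAt g 0 h (.negSucc m) * PowerSeries.coeff n (expPlus g h') =
      PowerSeries.coeff n (expPlus g h') * modeAt g 0 h (.negSucc m) +
      if m + 1 ≤ n then g h h' • PowerSeries.coeff (n - (m + 1)) (expPlus g h') else 0 := by
  refine (isExpSeq_expPlus g h').commutator _ (m + 1) m.succ_pos (g h h') (fun k => ?_) n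
  rw [modeAt_commutator g hg]
  congr 1
  by_cases hk : k + 1 = m + 1
  · rw [if_pos hk, if_pos (by rw [Int.negSucc_eq, hk]; simp), Int.cast_negSucc, map_smul]
    congr 1
    rw [smul_eq_mul]
    ring
  · rw [if_neg hk, if_neg (by rw [Int.negSucc_eq]; omega), zero_smul]

/-- A product of annihilation operators of total degree above K kills level K, so the locally finite
sum is a sum over a square of any size M > K. Having M free permits a common cutoff for several
vectors. -/
theorem expCoeff_eq_sum (g : LinearMap.BilinForm ℂ E) (P : Module.End ℂ E) (h : E) (a b : ℝ)
    {K : ℕ} {s : Fock E} (hs : s ∈ level (K : ℤ)) {M : ℕ} (hM : K < M) :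
    expCoeff g P h a b s = ∑ i ∈ Finset.range M, ∑ j ∈ Finset.range M,
      coeffReal (expMinus g (P h)) (a + i) (coeffReal (expMinus g (h - P h)) (b + j)
        (PowerSeries.coeff i (expPlus g (P h))
          (PowerSeries.coeff j (expPlus g (h - P h)) s))) := by
  rw [expCoeff_apply, finsum_eq_sum_of_support_subset (s := Finset.range M ×ˢ Finset.range M),
    Finset.sum_product]
  intro x hx
  by_contra hc
  apply hx
  have : K < x.1 + x.2 := by
    simp only [Finset.coe_product, Finset.coe_range, Set.mem_prod, Set.mem_Iio, not_and_or,
      not_lt] at hc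
    omega
  simp [expPlus_zero_of_lt g P h hs x this]

/-- A positive mode commutes with E⁺, so it contracts only with the two factors of E⁻, each
contraction lowering the exponent of that factor by m. -/
theorem modeAt_expCoeff_pos (g : LinearMap.BilinForm ℂ E) (hg : g.IsSymm) (P : Module.End ℂ E)
    (h h' : E) (m : ℕ) (hm : 0 < m) (a b : ℝ) (s : Fock E) :
    modeAt g 0 h m (expCoeff g P h' a b s) = expCoeff g P h' a b (modeAt g 0 h m s) +
      (g h (P h') • expCoeff g P h' (a - m) b s + g h (h' - P h') • expCoeff g P h' a (b - m) s) := by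
  obtain ⟨K, hK⟩ := exists_level s
  have hK' : modeAt g 0 h m s ∈ level (K : ℤ) := level_mono (by omega) (modeAt_level g 0 h m hK)
  rw [expCoeff_eq_sum g P h' a b hK K.lt_succ_self, expCoeff_eq_sum g P h' a b hK' K.lt_succ_self,
    expCoeff_eq_sum g P h' _ b hK K.lt_succ_self, expCoeff_eq_sum g P h' a _ hK K.lt_succ_self]
  simp only [map_sum, Finset.smul_sum, ← Finset.sum_add_distrib]
  refine Finset.sum_congr rfl fun i _ => Finset.sum_congr rfl fun j _ => ?_
  have e1 := fun x t => LinearMap.congr_fun (modeAt_expMinus_pos g hg h (P h') m hm t) x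
  have e2 := fun x t => LinearMap.congr_fun (modeAt_expMinus_pos g hg h (h' - P h') m hm t) x
  have e3 := fun x n => LinearMap.congr_fun (modeAt_expPlus_pos g h (P h') m n) x
  have e4 := fun x n => LinearMap.congr_fun (modeAt_expPlus_pos g h (h' - P h') m n) x
  simp only [Module.End.mul_apply, LinearMap.add_apply, LinearMap.smul_apply] at e1 e2 e3 e4
  rw [e1, e2, e3, e4, map_add, map_smul, show a + i - m = a - m + i by ring,
    show b + j - m = b - m + j by ring]
  abel

theorem sum_range_shift {M : Type*} [AddCommMonoid M] (f : ℕ → M) (m K : ℕ) (h : ∀ i < m, f i = 0)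
    (h' : ∀ i, K ≤ i → f i = 0) : ∑ i ∈ Finset.range K, f i = ∑ i ∈ Finset.range K, f (i + m) := by
  have h1 : ∑ i ∈ Finset.range K, f i = ∑ i ∈ Finset.range (K + m), f i :=
    Finset.sum_subset (Finset.range_subset_range.2 (by omega)) fun i _ hi => h' i (by simpa using hi)
  rw [h1, add_comm K m, Finset.sum_range_add,
    Finset.sum_eq_zero fun i hi => h i (Finset.mem_range.1 hi), zero_add]
  simp only [add_comm m]

/-- A negative mode commutes with E⁻ and contracts only with E⁺. The lowered index of the E⁺
coefficient is compensated by shifting the summation, which raises the exponent of z or z̄ by m + 1.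
-/
theorem modeAt_expCoeff_neg (g : LinearMap.BilinForm ℂ E) (hg : g.IsSymm) (P : Module.End ℂ E)
    (h h' : E) (m : ℕ) (a b : ℝ) (s : Fock E) :
    modeAt g 0 h (.negSucc m) (expCoeff g P h' a b s) =
      expCoeff g P h' a b (modeAt g 0 h (.negSucc m) s) +
      (g h (P h') • expCoeff g P h' (a + (m + 1)) b s +
        g h (h' - P h') • expCoeff g P h' a (b + (m + 1)) s) := by
  obtain ⟨K, hK⟩ := exists_level s
  have hK' : modeAt g 0 h (.negSucc m) s ∈ level ((K + m + 1 : ℕ) : ℤ) := by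
    have : gen m h ∈ level (E := E) (m + 1) := Submodule.subset_span ⟨[(m, h)], by simp, by simp⟩
    have := level_mul this hK
    refine level_mono ?_ this
    push_cast
    omega
  -- The creation operator raises the level by m + 1; a square of side K + m + 2 serves both vectors
  -- and also leaves room for the shift.
  have hM : K + m + 1 < K + m + 2 := Nat.lt_succ_self _
  have hM' : K < K + m + 2 := by omega
  rw [expCoeff_eq_sum g P h' a b hK hM', expCoeff_eq_sum g P h' a b hK' hM,
    expCoeff_eq_sum g P h' _ b hK hM', expCoeff_eq_sum g P h' a _ hK hM']
  have hz : ∀ i j : ℕ, K < i + j → PowerSeries.coeff i (expPlus g (P h'))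
      (PowerSeries.coeff j (expPlus g (h' - P h')) s) = 0 :=
    fun i j hij => expPlus_zero_of_lt g P h' hK (i, j) hij
  have s1 : ∀ j : ℕ, ∑ i ∈ Finset.range (K + m + 2), coeffReal (expMinus g (P h')) (a + (m + 1) + i)
      (coeffReal (expMinus g (h' - P h')) (b + j) (PowerSeries.coeff i (expPlus g (P h'))
          (PowerSeries.coeff j (expPlus g (h' - P h')) s))) =
      ∑ i ∈ Finset.range (K + m + 2), coeffReal (expMinus g (P h')) (a + i)
      (coeffReal (expMinus g (h' - P h')) (b + j) (if m + 1 ≤ i then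
        PowerSeries.coeff (i - (m + 1)) (expPlus g (P h'))
          (PowerSeries.coeff j (expPlus g (h' - P h')) s) else 0)) := by
    intro j
    symm
    rw [sum_range_shift _ (m + 1)]
    · refine Finset.sum_congr rfl fun i _ => ?_
      rw [if_pos (by omega), Nat.add_sub_cancel]
      push_cast
      rw [show a + ((i : ℝ) + (m + 1)) = a + (m + 1) + i by ring]
    · intro i hi
      rw [if_neg (by omega), map_zero, map_zero]
    · intro i hi
      rw [if_pos (by omega), hz _ _ (by omega), map_zero, map_zero]
  have s2 : ∀ i : ℕ, ∑ j ∈ Finset.range (K + m + 2), coeffReal (expMinus g (P h')) (a + i)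
      (coeffReal (expMinus g (h' - P h')) (b + (m + 1) + j) (PowerSeries.coeff i (expPlus g (P h'))
          (PowerSeries.coeff j (expPlus g (h' - P h')) s))) =
      ∑ j ∈ Finset.range (K + m + 2), coeffReal (expMinus g (P h')) (a + i)
      (coeffReal (expMinus g (h' - P h')) (b + j) (PowerSeries.coeff i (expPlus g (P h'))
          (if m + 1 ≤ j then PowerSeries.coeff (j - (m + 1)) (expPlus g (h' - P h')) s else 0))) := by
    intro i
    symm
    rw [sum_range_shift _ (m + 1)]
    · refine Finset.sum_congr rfl fun j _ => ?_
      rw [if_pos (by omega), Nat.add_sub_cancel]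
      push_cast
      rw [show b + ((j : ℝ) + (m + 1)) = b + (m + 1) + j by ring]
    · intro i hi
      rw [if_neg (by omega), map_zero, map_zero, map_zero]
    · intro j hj
      rw [if_pos (by omega), hz _ _ (by omega), map_zero, map_zero]
  rw [Finset.sum_comm (f := fun i j : ℕ => coeffReal (expMinus g (P h')) (a + (m + 1) + i)
      (coeffReal (expMinus g (h' - P h')) (b + j) (PowerSeries.coeff i (expPlus g (P h'))
          (PowerSeries.coeff j (expPlus g (h' - P h')) s))))]
  rw [Finset.sum_congr rfl fun j _ => s1 j, Finset.sum_congr rfl fun i _ => s2 i,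
    Finset.sum_comm (s := Finset.range (K + m + 2)) (t := Finset.range (K + m + 2)) (f := fun j i : ℕ =>
      coeffReal (expMinus g (P h')) (a + i)
      (coeffReal (expMinus g (h' - P h')) (b + j) (if m + 1 ≤ i then
        PowerSeries.coeff (i - (m + 1)) (expPlus g (P h'))
          (PowerSeries.coeff j (expPlus g (h' - P h')) s) else 0)))]
  simp only [map_sum, Finset.smul_sum, ← Finset.sum_add_distrib]
  refine Finset.sum_congr rfl fun i _ => Finset.sum_congr rfl fun j _ => ?_
  have e1 := fun x t => LinearMap.congr_fun (modeAt_expMinus_neg g h (P h') m t) x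
  have e2 := fun x t => LinearMap.congr_fun (modeAt_expMinus_neg g h (h' - P h') m t) x
  have e3 := fun x n => LinearMap.congr_fun (modeAt_expPlus_neg g hg h (P h') m n) x
  have e4 := fun x n => LinearMap.congr_fun (modeAt_expPlus_neg g hg h (h' - P h') m n) x
  simp only [Module.End.mul_apply, LinearMap.add_apply] at e1 e2 e3 e4
  rw [e1, e2, e3, e4]
  simp only [map_add]
  split_ifs
  · simp only [LinearMap.smul_apply, map_smul]
    abel
  · simp only [LinearMap.smul_apply, map_smul, LinearMap.zero_apply, map_zero, smul_zero]
    abel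
  · simp only [LinearMap.smul_apply, map_smul, LinearMap.zero_apply, map_zero, smul_zero]
    abel
  · simp

end FockExponential

/-! ### Binomial coefficients with real upper entry -/

section Binomial

/-- The binomial coefficient of a real number, as a complex number. -/
def ch (r : ℝ) (j : ℕ) : ℂ := ((Ring.choose r j : ℝ) : ℂ)

theorem ch_zero (r : ℝ) : ch r 0 = 1 := by simp [ch]

theorem ch_one (r : ℝ) : ch r 1 = r := by simp [ch]

theorem ch_natCast (n j : ℕ) : ch n j = Nat.choose n j := by
  simp [ch, Ring.choose_natCast]

theorem ch_zero_left (j : ℕ) : ch 0 j = if j = 0 then 1 else 0 := by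
  rw [ch, Ring.choose_zero_ite]
  split_ifs <;> simp

theorem ch_neg (n j : ℕ) : ch (-((n : ℝ) + 1)) j = (-1) ^ j * Nat.choose (n + j) j := by
  rw [ch, Ring.choose_neg, show ((n : ℝ) + 1 + j - 1) = ((n + j : ℕ) : ℝ) by push_cast; ring,
    Ring.choose_natCast, Int.negOnePow_def, Units.smul_def]
  simp

/-- Both sides count a subset of size i + j together with a distinguished part of size i. It turns
iterated commutators into the expansion of a single power of z₂ + z₀. -/
theorem ch_mul_ch (r : ℝ) (i j : ℕ) :
    ch r (i + j) * Nat.choose (i + j) i = ch r i * ch (r - i) j := by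
  have := Ring.choose_smul_choose r (Nat.le_add_right i j)
  rw [Nat.add_sub_cancel_left, nsmul_eq_mul] at this
  rw [ch, ch, ch, ← Complex.ofReal_mul, ← this]
  push_cast
  ring

theorem succ_mul_ch (r : ℝ) (j : ℕ) : ((j : ℂ) + 1) * ch r (j + 1) = r * ch (r - 1) j := by
  have := ch_mul_ch r 1 j
  rw [ch_one, Nat.choose_one_right, add_comm 1 j] at this
  push_cast at this
  rw [← this, mul_comm]

theorem ch_add (r s : ℝ) (k : ℕ) : ch (r + s) k =
    ∑ p ∈ Finset.HasAntidiagonal.antidiagonal k, ch r p.1 * ch s p.2 := by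
  rw [ch, Ring.add_choose_eq k (Commute.all r s), Complex.ofReal_sum]
  exact Finset.sum_congr rfl fun p _ => Complex.ofReal_mul _ _

theorem ch_add_range (r s : ℝ) (k : ℕ) : ch (r + s) k =
    ∑ j ∈ Finset.range (k + 1), ch r j * ch s (k - j) := by
  rw [ch_add, Finset.Nat.sum_antidiagonal_eq_sum_range_succ_mk]

/-- Both sides are the trinomial coefficient (i+j+k)! / (i! j! k!). -/
theorem natCast_choose_mul_choose (i j k : ℕ) :
    (Nat.choose (i + j + k) k : ℂ) * Nat.choose (i + j) j =
      Nat.choose (j + k) k * Nat.choose (j + k + i) i := by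
  have h1 := Nat.add_choose_mul_factorial_mul_factorial (i + j) k
  have h2 := Nat.add_choose_mul_factorial_mul_factorial i j
  have h3 := Nat.add_choose_mul_factorial_mul_factorial j k
  have h4 := Nat.add_choose_mul_factorial_mul_factorial (j + k) i
  rw [show j + k + i = i + j + k by ring] at h4 ⊢
  have hpos : 0 < i.factorial * j.factorial * k.factorial * (i + j).factorial * (j + k).factorial := by
    positivity
  have : Nat.choose (i + j + k) k * Nat.choose (i + j) j =
      Nat.choose (j + k) k * Nat.choose (i + j + k) i := by
    apply Nat.eq_of_mul_eq_mul_right hpos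
    calc _ = (Nat.choose (i + j + k) k * (i + j).factorial * k.factorial) *
          (Nat.choose (i + j) j * i.factorial * j.factorial) * (j + k).factorial := by ring
      _ = (Nat.choose (i + j + k) i * (j + k).factorial * i.factorial) *
          (Nat.choose (j + k) k * j.factorial * k.factorial) * (i + j).factorial := by
        rw [h1, h2, h3, h4]; ring
      _ = _ := by ring
  exact_mod_cast this

end Binomial

/-! ### Abstract lattice data and their fields -/

/-- The data entering the construction of a lattice full vertex algebra. -/
structure LatticeDatum (L E : Type*) [AddCommGroup L] [AddCommGroup E] [Module ℂ E] where
  g : LinearMap.BilinForm ℂ E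
  symm : g.IsSymm
  P : Module.End ℂ E
  P_idem : ∀ x, P (P x) = P x
  P_adj : ∀ x y, g (P x) y = g x (P y)
  wt : L →+ E
  B : LinearMap.BilinForm ℤ L
  even : ∀ α, Even (B α α)
  A : TwistedGroupAlgebra B
  a : L → L → ℝ
  b : L → L → ℝ
  a_eq : ∀ α β, (a α β : ℂ) = g (P (wt α)) (wt β)
  b_eq : ∀ α β, (b α β : ℂ) = g (wt α - P (wt α)) (wt β)
  sub_eq : ∀ α β, a α β - b α β = B α β
  exists_dual : ∃ (n : ℕ) (e e' : Fin n → E), ∀ x, ∑ i, g (e' i) x • e i = x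

/-- The exponent of `z` or of `z̄`. -/
def dv (c : Bool) : ℝ × ℝ := cond c (1, 0) (0, 1)

def dir (c : Bool) : Direction := cond c .z .zbar

theorem dv_fst (c : Bool) : (dv c).1 = (dir c).fst := by cases c <;> rfl
theorem dv_snd (c : Bool) : (dv c).2 = (dir c).snd := by cases c <;> rfl

namespace LatticeDatum
variable {L E : Type*} [AddCommGroup L] [AddCommGroup E] [Module ℂ E] (D : LatticeDatum L E)

/-- The projection onto the left or the right part. -/
def pr (c : Bool) : Module.End ℂ E := cond c D.P (LinearMap.id - D.P)

theorem pr_true (x : E) : D.pr true x = D.P x := rfl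
theorem pr_false (x : E) : D.pr false x = x - D.P x := rfl

theorem pr_pr (c : Bool) (x : E) : D.pr c (D.pr c x) = D.pr c x := by
  cases c
  · simp [pr_false, D.P_idem]
  · exact D.P_idem x

theorem pr_pr_of_ne {c c' : Bool} (h : c ≠ c') (x : E) : D.pr c (D.pr c' x) = 0 := by
  cases c <;> cases c' <;> first | exact absurd rfl h | simp [pr_false, pr_true, D.P_idem]

theorem pr_add (x : E) : D.pr true x + D.pr false x = x := by simp [pr_true, pr_false]

theorem pr_adj (c : Bool) (x y : E) : D.g (D.pr c x) y = D.g x (D.pr c y) := by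
  cases c
  · simp [pr_false, D.P_adj]
  · exact D.P_adj x y

theorem g_comm (x y : E) : D.g x y = D.g y x := D.symm.eq x y

theorem g_eq_zero {c c' : Bool} (h : c ≠ c') {x y : E} (hx : D.pr c x = x) (hy : D.pr c' y = y) :
    D.g x y = 0 := by
  rw [← hx, ← hy, pr_adj, D.pr_pr_of_ne h, map_zero]

/-- The exponents of `z^a z̄^b` in `e_α(z) e_β`. -/
def pe (α β : L) : ℝ × ℝ := (D.a α β, D.b α β)

/-- The operator `h(n)`. -/
def h (n : ℤ) : E →ₗ[ℂ] Module.End ℂ (L →₀ Fock E) := mode D.g D.wt n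

/-- The coefficient of `z^x z̄^y` of the field of a vector. -/
def Y (x : ℝ × ℝ) : (L →₀ Fock E) →ₗ[ℂ] Module.End ℂ (L →₀ Fock E) where
  toFun v := (vertexField D.g D.P D.wt D.A.ε D.a D.b v).1 x.1 x.2
  map_add' v w := by rw [map_add]; rfl
  map_smul' t v := by rw [map_smul]; rfl

/-- The vector `e_α`. -/
def e (α : L) : L →₀ Fock E := Finsupp.single α 1

theorem h_single (n : ℤ) (x : E) (α : L) (s : Fock E) :
    D.h n x (Finsupp.single α s) = Finsupp.single α (modeAt D.g (D.wt α) x n s) :=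
  mode_single _ _ _ _ _ _

theorem h_e_pos (n : ℤ) (hn : 0 < n) (x : E) (α : L) : D.h n x (e α) = 0 := by
  obtain ⟨n, rfl⟩ : ∃ k : ℕ, n = ((k + 1 : ℕ) : ℤ) := ⟨(n - 1).toNat, by omega⟩
  rw [e, h_single]
  have := contract_algebraMap (((n : ℂ) + 1) • (D.g x ∘ₗ Finsupp.lapply n)) 1
  rw [map_one] at this
  change Finsupp.single α (contract _ 1) = 0
  rw [this, Finsupp.single_zero]

theorem h_zero_single (x : E) (α : L) (s : Fock E) :
    D.h 0 x (Finsupp.single α s) = D.g x (D.wt α) • Finsupp.single α s := by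
  rw [h_single, Finsupp.smul_single]
  rfl

theorem h_neg_single (k : ℕ) (x : E) (α : L) (s : Fock E) :
    D.h (-((k : ℤ) + 1)) x (Finsupp.single α s) = Finsupp.single α (gen k x * s) := by
  rw [← Int.negSucc_eq, h_single]
  rfl

theorem h_commutator (m n : ℤ) (x y : E) (w : L →₀ Fock E) :
    D.h m x (D.h n y w) = D.h n y (D.h m x w) + (if m + n = 0 then (m : ℂ) * D.g x y else 0) • w := by
  have := LinearMap.congr_fun (mode_commutator D.g D.symm D.wt x y m n) w
  simp only [LinearMap.sub_apply, Module.End.mul_apply, LinearMap.smul_apply,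
    Module.End.one_apply] at this
  rw [← this]
  simp [h]

theorem h_eventually (x : E) (w : L →₀ Fock E) : ∀ᶠ K : ℕ in atTop, ∀ n : ℤ, (K : ℤ) ≤ n →
    D.h n x w = 0 := by
  obtain ⟨K, hK⟩ := mode_eventually D.g D.wt x w
  filter_upwards [eventually_ge_atTop K] with M hM n hn
  obtain ⟨m, rfl⟩ : ∃ m : ℕ, n = m := ⟨n.toNat, by omega⟩
  exact hK m (by omega)

/-- The space is generated by the creation operators from the `e_α`. -/
theorem induction {motive : (L →₀ Fock E) → Prop} (e : ∀ α, motive (e α))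
    (add : ∀ v w, motive v → motive w → motive (v + w))
    (smul : ∀ (t : ℂ) v, motive v → motive (t • v))
    (h : ∀ c (k : ℕ) x v, D.pr c x = x → motive v → motive (D.h (-((k : ℤ) + 1)) x v))
    (v : L →₀ Fock E) : motive v := by
  have key : ∀ α (s t : Fock E), motive (Finsupp.single α t) → motive (Finsupp.single α (s * t)) := by
    intro α s
    induction s using Fock.induction with
    | algebraMap r =>
      intro t ht
      rw [← Algebra.smul_def, ← Finsupp.smul_single]
      exact smul _ _ ht
    | mul a b ha hb =>
      intro t ht
      rw [mul_assoc]
      exact ha _ (hb _ ht)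
    | add a b ha hb =>
      intro t ht
      rw [add_mul, Finsupp.single_add]
      exact add _ _ (ha _ ht) (hb _ ht)
    | ι v =>
      intro t ht
      induction v using Finsupp.induction_linear with
      | zero =>
        rw [map_zero, zero_mul, ← zero_mul t, ← map_zero (algebraMap ℂ (Fock E)), ← Algebra.smul_def,
          ← Finsupp.smul_single]
        exact smul _ _ ht
      | add a b ha hb =>
        rw [map_add, add_mul, Finsupp.single_add]
        exact add _ _ ha hb
      | single n x =>
        have e1 : ∀ y, Finsupp.single α (Fock.ι (Finsupp.single n y) * t) =
            D.h (-((n : ℤ) + 1)) y (Finsupp.single α t) := fun y => (D.h_neg_single n y α t).symm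
        rw [e1, ← D.pr_add x, map_add, LinearMap.add_apply]
        exact add _ _ (h _ _ _ _ (D.pr_pr _ _) ht) (h _ _ _ _ (D.pr_pr _ _) ht)
  induction v using Finsupp.induction_linear with
  | zero =>
    rw [← zero_smul ℂ (LatticeDatum.e 0)]
    exact smul _ _ (e 0)
  | add v w hv hw => exact add _ _ hv hw
  | single α s => simpa using key α s 1 (e α)

theorem Y_bounded (v w : L →₀ Fock E) : ∃ N : ℝ, ∀ x : ℝ × ℝ, (x.1 < N ∨ x.2 < N) →
    D.Y x v w = 0 := by
  obtain ⟨N, hN⟩ := (vertexField D.g D.P D.wt D.A.ε D.a D.b v).2 w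
  exact ⟨N, fun x => hN x.1 x.2⟩

theorem sub_smul_dv_lt (N : ℝ) (x : ℝ × ℝ) (c : Bool) : ∀ᶠ K : ℕ in atTop, ∀ j : ℕ, K ≤ j →
    (x - (j : ℝ) • dv c).1 < N ∨ (x - (j : ℝ) • dv c).2 < N := by
  filter_upwards [eventually_ge_atTop (⌈x.1 + x.2 - 2 * N⌉₊ + 1)] with K hK j hj
  have := left_finite (dir c) (N := N) (r := x.1) (s := x.2) (hK.trans hj)
  rwa [← dv_fst, ← dv_snd] at this

/-- Sums that are finite on every vector are expressed as finite sums valid for all sufficiently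
large cutoffs. Filters then supply one cutoff that serves several identities at once. -/
theorem Y_eventually (v w : L →₀ Fock E) (x : ℝ × ℝ) (c : Bool) : ∀ᶠ K : ℕ in atTop,
    ∀ j : ℕ, K ≤ j → D.Y (x - (j : ℝ) • dv c) v w = 0 := by
  obtain ⟨N, hN⟩ := D.Y_bounded v w
  filter_upwards [sub_smul_dv_lt N x c] with K hK j hj
  exact hN _ (hK j hj)

theorem leftMul_zero (d : Direction) :
    leftMul (0 : ℕ → Module.End ℂ (L →₀ Fock E)) d = 0 := by
  rw [← zero_smul ℂ (0 : ℕ → Module.End ℂ (L →₀ Fock E)), leftMul_smul, zero_smul]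

theorem rightMul_zero (d : Direction) :
    rightMul (0 : finiteSeq (L →₀ Fock E)) d = 0 := by
  rw [← zero_smul ℂ (0 : finiteSeq (L →₀ Fock E)), rightMul_smul, zero_smul]

/-- A vector in one part has zero component in the other, so two of the four terms of `normalOrder`
drop out and only one variable remains. -/
theorem normalOrder_eq (c : Bool) (k : ℕ) (x : E) (hx : D.pr c x = x) :
    normalOrder D.g D.P D.wt k x = leftMul (creationSeq D.g D.wt k x) (dir c) +
      rightMul (annihilationSeq D.g D.wt k x) (dir c) := by
  cases c
  · have h1 : D.P x = 0 := by rw [← hx, pr_false, map_sub, D.P_idem, sub_self]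
    change leftMul (creationSeq D.g D.wt k (D.P x)) _ + rightMul (annihilationSeq D.g D.wt k (D.P x)) _
      + (leftMul (creationSeq D.g D.wt k (x - D.P x)) _ +
        rightMul (annihilationSeq D.g D.wt k (x - D.P x)) _) = _
    rw [h1, map_zero, map_zero, leftMul_zero, rightMul_zero, add_zero, zero_add, sub_zero]
    rfl
  · have h1 : D.P x = x := hx
    change leftMul (creationSeq D.g D.wt k (D.P x)) _ + rightMul (annihilationSeq D.g D.wt k (D.P x)) _
      + (leftMul (creationSeq D.g D.wt k (x - D.P x)) _ +
        rightMul (annihilationSeq D.g D.wt k (x - D.P x)) _) = _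
    rw [h1, sub_self, map_zero, map_zero, leftMul_zero, rightMul_zero, add_zero, add_zero]
    rfl

/-- The normal ordering formula for `Y(x(-k-1)v, z)`. -/
theorem Y_h (c : Bool) (k : ℕ) (x : E) (hx : D.pr c x = x) (v w : L →₀ Fock E) (y : ℝ × ℝ) :
    ∀ᶠ K : ℕ in atTop, D.Y y (D.h (-((k : ℤ) + 1)) x v) w =
      ∑ j ∈ Finset.range K, (Nat.choose (j + k) k : ℂ) •
        D.h (-(((j + k : ℕ) : ℤ) + 1)) x (D.Y (y - (j : ℝ) • dv c) v w) +
      ∑ i ∈ Finset.range K, ((-1) ^ k * Nat.choose (i + k) k : ℂ) •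
        D.Y (y + ((i + k + 1 : ℕ) : ℝ) • dv c) v (D.h i x w) := by
  filter_upwards [D.Y_eventually v w y c, D.h_eventually x w] with K hK1 hK2
  have e1 : D.Y y (D.h (-((k : ℤ) + 1)) x v) =
      (normalOrder D.g D.P D.wt k x (vertexField D.g D.P D.wt D.A.ε D.a D.b v)).1 y.1 y.2 := by
    rw [← vertexField_mode, ← Int.negSucc_eq]
    rfl
  rw [e1, D.normalOrder_eq c k x hx]
  change (leftMul _ _ _).1 _ _ w + (rightMul _ _ _).1 _ _ w = _
  -- The first k coefficients of the differentiated h⁺ vanish, since C(j,k) = 0 for j < k; cutting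
  -- at K + k leaves a sum of K terms after reindexing.
  rw [leftMul_eq (K := K), rightMul_eq (K := K + k)]
  · congr 1
    · refine Finset.sum_congr rfl fun j _ => ?_
      rw [← Int.negSucc_eq, ← dv_fst, ← dv_snd]
      rfl
    · rw [add_comm K k, Finset.sum_range_add, Finset.sum_eq_zero, zero_add]
      · refine Finset.sum_congr rfl fun j _ => ?_
        change ((vertexField D.g D.P D.wt D.A.ε D.a D.b) v).1 _ _
          (((-1) ^ k * (Nat.choose (k + j) k : ℂ)) • D.h ((k + j - k : ℕ) : ℤ) x w) = _
        rw [map_smul, Nat.add_sub_cancel_left, add_comm k j]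
        congr 2
        change _ = ((vertexField D.g D.P D.wt D.A.ε D.a D.b) v).1
          (y.1 + ((j + k + 1 : ℕ) : ℝ) * (dv c).1) (y.2 + ((j + k + 1 : ℕ) : ℝ) * (dv c).2)
        rw [dv_fst, dv_snd]
        push_cast
        rfl
      · intro j hj
        have : Nat.choose j k = 0 := Nat.choose_eq_zero_of_lt (Finset.mem_range.1 hj)
        change ((vertexField D.g D.P D.wt D.A.ε D.a D.b) v).1 _ _
          (((-1) ^ k * (Nat.choose j k : ℂ)) • D.h ((j - k : ℕ) : ℤ) x w) = _
        rw [this]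
        simp
  · intro j hj
    change ((-1) ^ k * (Nat.choose j k : ℂ)) • D.h ((j - k : ℕ) : ℤ) x w = 0
    rw [hK2 _ (by omega), smul_zero]
  · intro j hj
    have := hK1 j hj
    rw [← dv_fst, ← dv_snd]
    exact this

theorem Y_e_single (α β : L) (y : ℝ × ℝ) (s : Fock E) : D.Y y (e α) (Finsupp.single β s) =
    D.A.ε α β • Finsupp.single (α + β)
      (expCoeff D.g D.P (D.wt α) (y.1 - D.a α β) (y.2 - D.b α β) s) := by
  change (vertexField D.g D.P D.wt D.A.ε D.a D.b (Finsupp.single α 1)).1 y.1 y.2 _ = _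
  rw [vertexField_single_one]
  change Finsupp.lsum ℂ _ _ = _
  simp

/-- The bracket of x(n) with e_α(z) is (x,α) z^n e_α(z). Negative n contract with E⁺, positive n
with E⁻, and n = 0 measures the change of charge from β to α + β. The projection of α decides which
variable is shifted, and it is fixed by the part in which x lies. -/
theorem e_commutator (c : Bool) (x : E) (hx : D.pr c x = x) (n : ℤ) (α : L) (y : ℝ × ℝ)
    (w : L →₀ Fock E) : D.h n x (D.Y y (e α) w) = D.Y y (e α) (D.h n x w) +
      D.g x (D.wt α) • D.Y (y - (n : ℝ) • dv c) (e α) w := by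
  induction w using Finsupp.induction_linear with
  | zero => simp
  | add v w hv hw => simp only [map_add, hv, hw, smul_add]; abel
  | single β s =>
    have hP : D.g x (D.P (D.wt α)) • expCoeff D.g D.P (D.wt α) (y.1 - D.a α β - n) (y.2 - D.b α β) s +
        D.g x (D.wt α - D.P (D.wt α)) •
          expCoeff D.g D.P (D.wt α) (y.1 - D.a α β) (y.2 - D.b α β - n) s =
        D.g x (D.wt α) • expCoeff D.g D.P (D.wt α) ((y - (n : ℝ) • dv c).1 - D.a α β)
          ((y - (n : ℝ) • dv c).2 - D.b α β) s := by
      cases c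
      · have h1 : D.g x (D.P (D.wt α)) = 0 := by
          rw [← D.P_adj, ← hx, pr_false, map_sub, D.P_idem, sub_self]; simp
        rw [map_sub, h1, sub_zero, zero_smul, zero_add]
        simp [dv, sub_right_comm]
      · have h1 : D.g x (D.P (D.wt α)) = D.g x (D.wt α) := by rw [← D.P_adj]; exact congrFun (congrArg _ (congrArg _ hx)) _
        rw [map_sub, h1, sub_self, zero_smul, add_zero]
        simp [dv, sub_right_comm]
    rcases lt_trichotomy n 0 with hn | rfl | hn
    · obtain ⟨m, rfl⟩ : ∃ m : ℕ, n = .negSucc m := ⟨(-n - 1).toNat, by rw [Int.negSucc_eq]; omega⟩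
      rw [Y_e_single, h_single, Y_e_single, Y_e_single, map_smul, h_single,
        modeAt_of_ne_zero D.g (D.wt (α + β)) 0 x hn.ne, modeAt_of_ne_zero D.g (D.wt β) 0 x hn.ne,
        modeAt_expCoeff_neg D.g D.symm, smul_comm (D.g x (D.wt α)), Finsupp.smul_single (D.g x (D.wt α)),
        ← hP, ← smul_add, ← Finsupp.single_add, Int.cast_negSucc]
      push_cast
      rw [sub_neg_eq_add, sub_neg_eq_add]
    · rw [h_zero_single, Y_e_single, map_smul, map_smul, Y_e_single, Y_e_single]
      rw [h_zero_single]
      simp only [Int.cast_zero, zero_smul, sub_zero, map_add]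
      module
    · obtain ⟨m, rfl⟩ : ∃ m : ℕ, n = m := ⟨n.toNat, by omega⟩
      rw [Y_e_single, h_single, Y_e_single, Y_e_single, map_smul, h_single,
        modeAt_of_ne_zero D.g (D.wt (α + β)) 0 x hn.ne',
        modeAt_of_ne_zero D.g (D.wt β) 0 x hn.ne',
        modeAt_expCoeff_pos D.g D.symm D.P x _ m (by omega), smul_comm (D.g x (D.wt α)),
        Finsupp.smul_single (D.g x (D.wt α)), ← hP, ← smul_add, ← Finsupp.single_add,
        Int.cast_natCast]

end LatticeDatum

/-! ### The commutator formula and products of exponentials -/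

namespace LatticeDatum
variable {L E : Type*} [AddCommGroup L] [AddCommGroup E] [Module ℂ E] (D : LatticeDatum L E)

/-- A mode x(n) contracts with the creation half of a normally ordered current when n > 0 and with
the annihilation half when n ≤ 0. In both cases the coefficient is n C(n-1,k) = (k+1) C(n,k+1),
which is the l = k + 1 term of the commutator formula, where x(k+1) meets x'(-k-1). -/
theorem choose_contraction (n : ℤ) (k K : ℕ) (hK : n.natAbs < K) (f : ℤ → (L →₀ Fock E)) :
    ∑ j ∈ Finset.range K, (Nat.choose (j + k) k : ℂ) •
      ((if n + -(((j + k : ℕ) : ℤ) + 1) = 0 then (n : ℂ) else 0) • f (-j)) +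
    ∑ i ∈ Finset.range K, ((-1) ^ k * Nat.choose (i + k) k : ℂ) •
      ((if n + (i : ℤ) = 0 then (n : ℂ) else 0) • f (i + k + 1)) =
    (((k : ℂ) + 1) * ch n (k + 1)) • f (-n + k + 1) := by
  have h1 : ((k : ℂ) + 1) * ch n (k + 1) = n * ch (n - 1) k := by
    rw [succ_mul_ch]; norm_cast
  rw [h1]
  by_cases hn : 0 < n
  · rw [Finset.sum_eq_zero (s := Finset.range K) (f := fun i : ℕ => ((-1) ^ k * Nat.choose (i + k) k : ℂ) •
      ((if n + (i : ℤ) = 0 then (n : ℂ) else 0) • f (i + k + 1))), add_zero]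
    · obtain ⟨m, rfl⟩ : ∃ m : ℕ, n = m + 1 := ⟨(n - 1).toNat, by omega⟩
      have h2 : ch (((m : ℤ) + 1 : ℤ) - 1) k = Nat.choose m k := by
        rw [← ch_natCast]; congr 1; push_cast; ring
      rw [h2]
      by_cases hm : k ≤ m
      · obtain ⟨j, rfl⟩ := Nat.exists_eq_add_of_le' hm
        rw [Finset.sum_eq_single j]
        · rw [if_pos (by push_cast; ring), smul_smul, mul_comm]
          congr 2
          push_cast; ring
        · intro i _ hi
          rw [if_neg (by omega), zero_smul, smul_zero]
        · intro hj
          simp at hj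
          omega
      · rw [Nat.choose_eq_zero_of_lt (by omega), Finset.sum_eq_zero]
        · simp
        · intro i _
          rw [if_neg (by omega), zero_smul, smul_zero]
    · intro i _
      rw [if_neg (by omega), zero_smul, smul_zero]
  · obtain ⟨m, rfl⟩ : ∃ m : ℕ, n = -m := ⟨(-n).toNat, by omega⟩
    rw [Finset.sum_eq_zero, zero_add, Finset.sum_eq_single m]
    · have h2 : ch ((-(m : ℤ) : ℤ) - 1) k = (-1) ^ k * Nat.choose (m + k) k := by
        rw [← ch_neg]; congr 1; push_cast; ring
      rw [if_pos (by ring), h2, smul_smul, mul_comm, neg_neg]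
    · intro i _ hi
      rw [if_neg (by omega), zero_smul, smul_zero]
    · intro hj
      simp at hj
      omega
    · intro i _
      rw [if_neg (by omega), zero_smul, smul_zero]

/-- The commutator formula `[x(n), Y(b, z)] = ∑ j, (n choose j) z^(n-j) Y(x(j)b, z)`. -/
theorem commutator (c : Bool) (x : E) (hx : D.pr c x = x) (b : L →₀ Fock E) :
    ∀ᶠ M : ℕ in atTop, ∀ (n : ℤ) (y : ℝ × ℝ) (w : L →₀ Fock E),
      D.h n x (D.Y y b w) = D.Y y b (D.h n x w) +
        ∑ l ∈ Finset.range M, ch n l • D.Y (y - ((n : ℝ) - l) • dv c) (D.h l x b) w := by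
  induction b using D.induction with
  | e α =>
    filter_upwards [eventually_ge_atTop 1] with M hM n y w
    rw [Finset.sum_eq_single 0, ch_zero, D.e_commutator c x hx]
    · have : D.h ((0 : ℕ) : ℤ) x (LatticeDatum.e α) = D.g x (D.wt α) • LatticeDatum.e α :=
        D.h_zero_single x α 1
      rw [this]
      simp
    · intro l _ hl
      rw [D.h_e_pos _ (by omega)]
      simp
    · intro h
      simp at h
      omega
  | add v w hv hw =>
    filter_upwards [hv, hw] with M h1 h2 n y u
    simp only [map_add, LinearMap.add_apply, h1, h2, smul_add, Finset.sum_add_distrib]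
    abel
  | smul t v hv =>
    filter_upwards [hv] with M h1 n y u
    simp only [map_smul, LinearMap.smul_apply, h1, smul_add, Finset.smul_sum]
    congr 1
    exact Finset.sum_congr rfl fun l _ => smul_comm _ _ _
  | h c' k x' b hx' ih =>
    -- The cutoff must exceed k + 1 so that the contraction term l = k + 1 is among the summands.
    filter_upwards [ih, eventually_gt_atTop (k + 1)] with M hM hMk n y w
    obtain ⟨K, ⟨H1, H2⟩, H3, H4⟩ := (((D.Y_h c' k x' hx' b w y).and
      (D.Y_h c' k x' hx' b (D.h n x w) y)).and
      (((Filter.eventually_all_finset (Finset.range M)).2 fun l _ =>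
        D.Y_h c' k x' hx' (D.h l x b) w (y - ((n : ℝ) - l) • dv c)).and
      (eventually_gt_atTop n.natAbs))).exists
    rw [H1, H2]
    have R : ∀ l ∈ Finset.range M, ch n l • D.Y (y - ((n : ℝ) - l) • dv c)
        (D.h l x (D.h (-((k : ℤ) + 1)) x' b)) w =
        (∑ j ∈ Finset.range K, (Nat.choose (j + k) k : ℂ) • D.h (-(((j + k : ℕ) : ℤ) + 1)) x'
          (ch n l • D.Y (y - (j : ℝ) • dv c' - ((n : ℝ) - l) • dv c) (D.h l x b) w) +
        ∑ i ∈ Finset.range K, ((-1) ^ k * Nat.choose (i + k) k : ℂ) •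
          (ch n l • D.Y (y + ((i + k + 1 : ℕ) : ℝ) • dv c' - ((n : ℝ) - l) • dv c) (D.h l x b)
            (D.h i x' w))) +
        ch n l • (if l = k + 1 then ((k : ℂ) + 1) * D.g x x' else 0) •
          D.Y (y - ((n : ℝ) - l) • dv c) b w := by
      intro l hl
      rw [D.h_commutator, map_add, LinearMap.add_apply, H3 l hl, map_smul, LinearMap.smul_apply,
        smul_add, smul_add, Finset.smul_sum, Finset.smul_sum]
      refine congrArg₂ (· + ·) (congrArg₂ (· + ·) ?_ ?_) ?_
      · refine Finset.sum_congr rfl fun j _ => ?_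
        rw [map_smul, smul_comm, sub_right_comm y]
      · refine Finset.sum_congr rfl fun j _ => ?_
        rw [smul_comm, sub_add_eq_add_sub y]
      · refine congrArg (ch n l • ·) (congrArg (· • D.Y (y - ((n : ℝ) - l) • dv c) b w) ?_)
        by_cases hlk : l = k + 1
        · rw [if_pos hlk, if_pos (by omega), hlk]
          push_cast
          rfl
        · rw [if_neg hlk, if_neg (by omega)]
    -- Vectors in different parts are orthogonal, so in every contraction term the direction of x'
    -- may be replaced by that of x.
    have hc : ∀ m : ℤ, D.g x x' • D.Y (y + (m : ℝ) • dv c') b w =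
        D.g x x' • D.Y (y + (m : ℝ) • dv c) b w := by
      intro m
      by_cases hcc : c = c'
      · rw [hcc]
      · rw [D.g_eq_zero hcc hx hx', zero_smul, zero_smul]
    have T1 : ∀ j ∈ Finset.range K, D.h n x ((Nat.choose (j + k) k : ℂ) •
        D.h (-(((j + k : ℕ) : ℤ) + 1)) x' (D.Y (y - (j : ℝ) • dv c') b w)) =
        (Nat.choose (j + k) k : ℂ) • D.h (-(((j + k : ℕ) : ℤ) + 1)) x'
          (D.Y (y - (j : ℝ) • dv c') b (D.h n x w)) +
        ∑ l ∈ Finset.range M, (Nat.choose (j + k) k : ℂ) • D.h (-(((j + k : ℕ) : ℤ) + 1)) x'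
          (ch n l • D.Y (y - (j : ℝ) • dv c' - ((n : ℝ) - l) • dv c) (D.h l x b) w) +
        (Nat.choose (j + k) k : ℂ) • ((if n + -(((j + k : ℕ) : ℤ) + 1) = 0 then (n : ℂ) else 0) •
          (D.g x x' • D.Y (y + ((-j : ℤ) : ℝ) • dv c) b w)) := by
      intro j _
      rw [map_smul, D.h_commutator, hM, map_add, map_sum, smul_add, smul_add, Finset.smul_sum]
      refine congrArg₂ (· + ·) rfl (congrArg _ ?_)
      rw [← hc, smul_smul]
      push_cast
      rw [neg_smul, ← sub_eq_add_neg]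
      refine congrArg (· • D.Y (y - (j : ℝ) • dv c') b w) ?_
      split_ifs <;> simp
    have T2 : ∀ i ∈ Finset.range K, D.h n x (((-1) ^ k * Nat.choose (i + k) k : ℂ) •
          D.Y (y + ((i + k + 1 : ℕ) : ℝ) • dv c') b (D.h i x' w)) =
        ((-1) ^ k * Nat.choose (i + k) k : ℂ) •
          D.Y (y + ((i + k + 1 : ℕ) : ℝ) • dv c') b (D.h i x' (D.h n x w)) +
        ∑ l ∈ Finset.range M, ((-1) ^ k * Nat.choose (i + k) k : ℂ) •
          (ch n l • D.Y (y + ((i + k + 1 : ℕ) : ℝ) • dv c' - ((n : ℝ) - l) • dv c) (D.h l x b)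
            (D.h i x' w)) +
        ((-1) ^ k * Nat.choose (i + k) k : ℂ) • ((if n + (i : ℤ) = 0 then (n : ℂ) else 0) •
          (D.g x x' • D.Y (y + ((i + k + 1 : ℤ) : ℝ) • dv c) b w)) := by
      intro i _
      rw [map_smul, hM, D.h_commutator, map_add, map_smul, smul_add, smul_add, Finset.smul_sum, ← hc,
        smul_smul (ite _ _ _)]
      push_cast
      rw [add_right_comm]
      refine congrArg₂ (· + ·) rfl (congrArg _ ?_)
      refine congrArg (· • D.Y (y + ((i : ℝ) + k + 1) • dv c') b w) ?_
      split_ifs <;> simp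
    have T3 := choose_contraction n k K H4 fun m => D.g x x' • D.Y (y + (m : ℝ) • dv c) b w
    have T4 : ∑ l ∈ Finset.range M, ch n l • (if l = k + 1 then ((k : ℂ) + 1) * D.g x x' else 0) •
          D.Y (y - ((n : ℝ) - l) • dv c) b w = (((k : ℂ) + 1) * ch n (k + 1)) •
          (D.g x x' • D.Y (y + ((-n + k + 1 : ℤ) : ℝ) • dv c) b w) := by
      rw [Finset.sum_eq_single (k + 1)]
      · rw [if_pos rfl, smul_smul, smul_smul, show y - ((n : ℝ) - (k + 1 : ℕ)) • dv c =
          y + ((-n + k + 1 : ℤ) : ℝ) • dv c by push_cast; module]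
        congr 1
        ring
      · intro l _ hl
        rw [if_neg hl, zero_smul, smul_zero]
      · intro h
        simp at h
        omega
    rw [map_add, map_sum, map_sum, Finset.sum_congr rfl T1, Finset.sum_congr rfl T2,
      Finset.sum_congr rfl R]
    simp only [Finset.sum_add_distrib]
    rw [T4, ← T3, Finset.sum_comm (s := Finset.range M) (t := Finset.range K),
      Finset.sum_comm (s := Finset.range M) (t := Finset.range K)]
    abel

/-- The coefficients of E⁻ are polynomials in creation operators, which commute with multiplication
by s; they are therefore multiplication by their value on 1. -/
theorem coeff_expMinus_apply (x : E) (n : ℕ) (s : Fock E) :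
    PowerSeries.coeff n (expMinus D.g x) s = PowerSeries.coeff n (expMinus D.g x) 1 * s := by
  have := (isExpSeq_expMinus D.g x).commute (LinearMap.mulRight ℂ s) (fun k => by
    ext t
    exact mul_assoc (gen k x) t s) n
  have := LinearMap.congr_fun this 1
  simpa using this.symm

/-- The coefficients of `exp (∑ x(-n) z^n / n) 1`. -/
def em (x : E) (n : ℕ) : Fock E := PowerSeries.coeff n (expMinus D.g x) 1

theorem em_zero (x : E) : D.em x 0 = 1 := by
  rw [em, (isExpSeq_expMinus D.g x).zero]; rfl

theorem em_rec (x : E) (n : ℕ) :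
    (n : ℂ) • D.em x n = ∑ k ∈ Finset.range n, gen k x * D.em x (n - (k + 1)) := by
  have := LinearMap.congr_fun ((isExpSeq_expMinus D.g x).recursion n) 1
  rw [LinearMap.sum_apply] at this
  exact this

theorem expCoeff_one (P : Module.End ℂ E) (x : E) (a b : ℝ) : expCoeff D.g P x a b 1 =
    coeffReal (expMinus D.g (P x)) a (coeffReal (expMinus D.g (x - P x)) b 1) := by
  have h1 : (1 : Fock E) ∈ level ((0 : ℕ) : ℤ) := Submodule.subset_span ⟨[], by simp, by simp⟩
  rw [expCoeff_eq_sum D.g P x a b h1 Nat.zero_lt_one]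
  simp only [Finset.range_one, Finset.sum_singleton]
  rw [(isExpSeq_expPlus D.g _).zero, (isExpSeq_expPlus D.g _).zero]
  simp

theorem Y_e_e (α β : L) (n m : ℕ) : D.Y (D.pe α β + ((n : ℝ), (m : ℝ))) (e α) (e β) =
    D.A.ε α β • Finsupp.single (α + β) (D.em (D.pr true (D.wt α)) n * D.em (D.pr false (D.wt α)) m) := by
  rw [e, e, ← e, Y_e_single, expCoeff_one]
  simp only [pe, Prod.fst_add, Prod.snd_add, add_sub_cancel_left]
  rw [coeffReal_natCast, coeffReal_natCast, coeff_expMinus_apply]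
  rfl

theorem Y_e_e_eq_zero (α β : L) (y : ℝ × ℝ)
    (hy : ∀ n m : ℕ, y ≠ D.pe α β + ((n : ℝ), (m : ℝ))) : D.Y y (e α) (e β) = 0 := by
  rw [e, e, ← e, Y_e_single, expCoeff_one]
  by_cases h1 : ∃ n : ℕ, (n : ℝ) = y.1 - D.a α β
  · by_cases h2 : ∃ n : ℕ, (n : ℝ) = y.2 - D.b α β
    · obtain ⟨n, hn⟩ := h1
      obtain ⟨m, hm⟩ := h2
      refine absurd ?_ (hy n m)
      rw [hn, hm]
      ext <;> simp [pe]
    · push Not at h2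
      rw [coeffReal_eq_zero _ _ h2]
      simp
  · push Not at h1
    rw [coeffReal_eq_zero _ _ h1]
    simp

end LatticeDatum

/-! ### Expansions of monomials in the three regions -/

section Series

/-- Formal series in a small and a large pair of variables, the exponents of the small pair being
the first argument. -/
abbrev Ser : Type := ℝ × ℝ → ℝ × ℝ → ℂ

/-- The exponents of the small variables are bounded below. -/
def Ser.Bounded (S : Ser) : Prop :=
  ∃ N : ℝ, ∀ s l, (s.1 < N ∨ s.2 < N) → S s l = 0

/-- Multiplication by the power `n` of the small variable. -/
def shiftSmall (c : Bool) (n : ℤ) : Ser →ₗ[ℂ] Ser where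
  toFun S s l := S (s - (n : ℝ) • dv c) l
  map_add' _ _ := rfl
  map_smul' _ _ := rfl

/-- Multiplication by the power `n` of the large variable. -/
def shiftLarge (c : Bool) (n : ℤ) : Ser →ₗ[ℂ] Ser where
  toFun S s l := S s (l - (n : ℝ) • dv c)
  map_add' _ _ := rfl
  map_smul' _ _ := rfl

/-- Multiplication by the power `n` of the sum of the large variable and `σ` times the small one. -/
def binomShift (σ : ℂ) (c : Bool) (n : ℤ) (S : Ser) : Ser := fun s l =>
  ∑ᶠ j : ℕ, ch n j * σ ^ j * S (s - (j : ℝ) • dv c) (l - ((n : ℝ) - j) • dv c)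

theorem binomShift_apply (σ : ℂ) (c : Bool) (n : ℤ) (S : Ser) (s l : ℝ × ℝ) (K : ℕ)
    (hK : ∀ j : ℕ, K ≤ j → ∀ l, S (s - (j : ℝ) • dv c) l = 0) : binomShift σ c n S s l =
      ∑ j ∈ Finset.range K, ch n j * σ ^ j * S (s - (j : ℝ) • dv c) (l - ((n : ℝ) - j) • dv c) := by
  rw [binomShift, finsum_eq_sum_of_support_subset]
  intro j hj
  by_contra hc
  simp only [Finset.coe_range, Set.mem_Iio, not_lt] at hc
  exact hj (mul_eq_zero_of_right _ (hK j hc _))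

namespace Ser

theorem Bounded.eventually {S : Ser} (hS : S.Bounded) (s : ℝ × ℝ) (c : Bool) :
    ∀ᶠ K : ℕ in atTop, ∀ j : ℕ, K ≤ j → ∀ l, S (s - (j : ℝ) • dv c) l = 0 := by
  obtain ⟨N, hN⟩ := hS
  filter_upwards [LatticeDatum.sub_smul_dv_lt N s c] with K hK j hj l
  exact hN _ _ (hK j hj)

theorem Bounded.add {S T : Ser} (hS : S.Bounded) (hT : T.Bounded) : (S + T).Bounded := by
  obtain ⟨N, hN⟩ := hS
  obtain ⟨M, hM⟩ := hT
  refine ⟨min N M, fun s l h => ?_⟩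
  rw [Pi.add_apply, Pi.add_apply, hN, hM, add_zero]
  · exact h.imp (fun h => h.trans_le (min_le_right _ _)) (fun h => h.trans_le (min_le_right _ _))
  · exact h.imp (fun h => h.trans_le (min_le_left _ _)) (fun h => h.trans_le (min_le_left _ _))

theorem Bounded.smul {S : Ser} (hS : S.Bounded) (t : ℂ) : (t • S).Bounded := by
  obtain ⟨N, hN⟩ := hS
  exact ⟨N, fun s l h => by rw [Pi.smul_apply, Pi.smul_apply, hN s l h, smul_zero]⟩

end Ser

/-- Boundedness is essential for additivity: a `finsum` with infinite support has the default value
zero. -/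
theorem binomShift_add (σ : ℂ) (c : Bool) (n : ℤ) {S T : Ser} (hS : S.Bounded) (hT : T.Bounded) :
    binomShift σ c n (S + T) = binomShift σ c n S + binomShift σ c n T := by
  funext s l
  obtain ⟨K, h1, h2⟩ := ((hS.eventually s c).and (hT.eventually s c)).exists
  rw [Pi.add_apply, Pi.add_apply, binomShift_apply (K := K) (hK := h1),
    binomShift_apply (K := K) (hK := h2), binomShift_apply (K := K), ← Finset.sum_add_distrib]
  · exact Finset.sum_congr rfl fun j _ => mul_add _ _ _
  · intro j hj l
    rw [Pi.add_apply, Pi.add_apply, h1 j hj, h2 j hj, add_zero]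

theorem binomShift_smul (σ : ℂ) (c : Bool) (n : ℤ) {S : Ser} (hS : S.Bounded) (t : ℂ) :
    binomShift σ c n (t • S) = t • binomShift σ c n S := by
  funext s l
  obtain ⟨K, h1⟩ := (hS.eventually s c).exists
  rw [Pi.smul_apply, Pi.smul_apply, binomShift_apply (K := K) (hK := h1),
    binomShift_apply (K := K), Finset.smul_sum]
  · refine Finset.sum_congr rfl fun j _ => ?_
    rw [Pi.smul_apply, Pi.smul_apply, smul_eq_mul, smul_eq_mul]
    ring
  · intro j hj l
    rw [Pi.smul_apply, Pi.smul_apply, h1 j hj, smul_zero]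

/-- The coefficient of `w ^ x` in `(1 + σ w) ^ t`. -/
def binomCoeff (σ : ℂ) (t x : ℝ) : ℂ :=
  open Classical in if (⌊x⌋₊ : ℝ) = x then ch t ⌊x⌋₊ * σ ^ ⌊x⌋₊ else 0

theorem binomCoeff_natCast (σ : ℂ) (t : ℝ) (n : ℕ) : binomCoeff σ t n = ch t n * σ ^ n := by
  simp [binomCoeff]

theorem binomCoeff_eq_zero (σ : ℂ) (t x : ℝ) (hx : ∀ n : ℕ, (n : ℝ) ≠ x) : binomCoeff σ t x = 0 := by
  rw [binomCoeff, if_neg (hx _)]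

theorem binomCoeff_of_neg (σ : ℂ) (t x : ℝ) (hx : x < 0) : binomCoeff σ t x = 0 :=
  binomCoeff_eq_zero _ _ _ fun n hn => by
    have : (0 : ℝ) ≤ n := n.cast_nonneg
    linarith

/-- Vandermonde's identity for (1+σw)^r (1+σw)^t. A cutoff K > x loses nothing, because coefficients
at negative exponents vanish. -/
theorem sum_ch_mul_binomCoeff (σ : ℂ) (r t x : ℝ) (K : ℕ) (hK : x < K) :
    ∑ j ∈ Finset.range K, ch r j * σ ^ j * binomCoeff σ t (x - j) = binomCoeff σ (t + r) x := by
  by_cases hx : ∃ n : ℕ, (n : ℝ) = x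
  · obtain ⟨n, rfl⟩ := hx
    have hn : n < K := by exact_mod_cast hK
    rw [binomCoeff_natCast, add_comm t r, ch_add_range, Finset.sum_mul]
    symm
    refine Finset.sum_subset_zero_on_sdiff (Finset.range_subset_range.2 hn) ?_ ?_
    · intro j hj
      simp only [Finset.mem_sdiff, Finset.mem_range] at hj
      rw [binomCoeff_of_neg, mul_zero]
      have : n < j := by omega
      have : (n : ℝ) < j := by exact_mod_cast this
      linarith
    · intro j hj
      have hj' : j ≤ n := by have := Finset.mem_range.1 hj; omega
      rw [← Nat.cast_sub hj', binomCoeff_natCast]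
      conv_lhs => rw [← Nat.add_sub_cancel' hj', pow_add]
      rw [Nat.add_sub_cancel' hj']
      ring
  · push Not at hx
    rw [binomCoeff_eq_zero _ _ _ hx, Finset.sum_eq_zero]
    intro j _
    rw [binomCoeff_eq_zero, mul_zero]
    intro n hn
    exact hx (n + j) (by push_cast; linarith)

open Classical in
/-- The series `w^base (1 + σ w)^t` of total exponent `tot`, `w` being the quotient of the small and
the large variable. -/
def basicSeries (σ : ℂ) (t base tot : ℝ × ℝ) : Ser := fun s l =>
  if s + l = tot then binomCoeff σ t.1 (s.1 - base.1) * binomCoeff σ t.2 (s.2 - base.2) else 0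

theorem basicSeries_bounded (σ : ℂ) (t base tot : ℝ × ℝ) : (basicSeries σ t base tot).Bounded := by
  refine ⟨min base.1 base.2, fun s l h => ?_⟩
  rw [basicSeries]
  split_ifs
  · rcases h with h | h
    · rw [binomCoeff_of_neg, zero_mul]
      linarith [min_le_left base.1 base.2]
    · rw [binomCoeff_of_neg _ _ (s.2 - base.2), mul_zero]
      linarith [min_le_right base.1 base.2]
  · rfl

theorem shiftSmall_basicSeries (σ : ℂ) (c : Bool) (n : ℤ) (t base tot : ℝ × ℝ) :
    shiftSmall c n (basicSeries σ t base tot) =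
      basicSeries σ t (base + (n : ℝ) • dv c) (tot + (n : ℝ) • dv c) := by
  funext s l
  change basicSeries _ _ _ _ (s - (n : ℝ) • dv c) l = _
  have h1 : s - (n : ℝ) • dv c + l = tot ↔ s + l = tot + (n : ℝ) • dv c := by
    rw [sub_add_eq_add_sub, sub_eq_iff_eq_add]
  simp only [basicSeries, h1, Prod.fst_sub, Prod.snd_sub, Prod.fst_add, Prod.snd_add]
  rw [sub_right_comm, sub_sub, sub_right_comm s.2, sub_sub s.2]

theorem shiftLarge_basicSeries (σ : ℂ) (c : Bool) (n : ℤ) (t base tot : ℝ × ℝ) :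
    shiftLarge c n (basicSeries σ t base tot) = basicSeries σ t base (tot + (n : ℝ) • dv c) := by
  funext s l
  change basicSeries _ _ _ _ s (l - (n : ℝ) • dv c) = _
  have h1 : s + (l - (n : ℝ) • dv c) = tot ↔ s + l = tot + (n : ℝ) • dv c := by
    rw [← add_sub_assoc, sub_eq_iff_eq_add]
  simp only [basicSeries, h1]

theorem binomShift_basicSeries (σ : ℂ) (c : Bool) (n : ℤ) (t base tot : ℝ × ℝ) :
    binomShift σ c n (basicSeries σ t base tot) =
      basicSeries σ (t + (n : ℝ) • dv c) base (tot + (n : ℝ) • dv c) := by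
  funext s l
  obtain ⟨K, hK, hK'⟩ := (((basicSeries_bounded σ t base tot).eventually s c).and
    (eventually_gt_atTop ⌈max (s.1 - base.1) (s.2 - base.2)⌉₊)).exists
  have hK2 : max (s.1 - base.1) (s.2 - base.2) < K :=
    (Nat.le_ceil _).trans_lt (by exact_mod_cast hK')
  have k1 := (le_max_left _ _).trans_lt hK2
  have k2 := (le_max_right _ _).trans_lt hK2
  rw [binomShift_apply (K := K) (hK := hK)]
  have h1 : ∀ j : ℕ, s - (j : ℝ) • dv c + (l - ((n : ℝ) - j) • dv c) = tot ↔
      s + l = tot + (n : ℝ) • dv c := by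
    intro j
    rw [show s - (j : ℝ) • dv c + (l - ((n : ℝ) - j) • dv c) = s + l - (n : ℝ) • dv c by module,
      sub_eq_iff_eq_add]
  simp only [basicSeries, h1]
  split_ifs with h
  · cases c
    · have := sum_ch_mul_binomCoeff σ n t.2 _ K k2
      simp only [dv, cond_false, Prod.smul_mk, smul_eq_mul, mul_zero, mul_one, Prod.fst_sub,
        Prod.snd_sub, sub_zero, Prod.fst_add, Prod.snd_add, add_zero]
      rw [← this, Finset.mul_sum]
      refine Finset.sum_congr rfl fun j _ => ?_
      rw [sub_right_comm]
      ring
    · have := sum_ch_mul_binomCoeff σ n t.1 _ K k1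
      simp only [dv, cond_true, Prod.smul_mk, smul_eq_mul, mul_zero, mul_one, Prod.fst_sub,
        Prod.snd_sub, sub_zero, Prod.fst_add, Prod.snd_add, add_zero]
      rw [← this, Finset.sum_mul]
      refine Finset.sum_congr rfl fun j _ => ?_
      rw [sub_right_comm]
      ring
  · simp

/-- Triples of expansions in the regions `|z₁| > |z₂|`, `|z₂| > |z₁ - z₂|`, `|z₂| > |z₁|`. -/
abbrev SerTriple : Type := Ser × Ser × Ser

def SerTriple.Bounded (T : SerTriple) : Prop := T.1.Bounded ∧ T.2.1.Bounded ∧ T.2.2.Bounded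

/-- Multiplication by `z₁ ^ n`. -/
def mulZ₁ (c : Bool) (n : ℤ) (T : SerTriple) : SerTriple :=
  (shiftLarge c n T.1, binomShift 1 c n T.2.1, shiftSmall c n T.2.2)

/-- Multiplication by `z₂ ^ n`. -/
def mulZ₂ (c : Bool) (n : ℤ) (T : SerTriple) : SerTriple :=
  (shiftSmall c n T.1, shiftLarge c n T.2.1, shiftLarge c n T.2.2)

/-- Multiplication by `(z₁ - z₂) ^ n`. -/
def mulZ₁₂ (c : Bool) (n : ℤ) (T : SerTriple) : SerTriple :=
  (binomShift (-1) c n T.1, shiftSmall c n T.2.1, (-1 : ℂ) ^ n • binomShift (-1) c n T.2.2)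

/-- The expansions of `z₁^x₁ z₂^x₂ (z₁ - z₂)^x₁₂`. -/
def monomialTriple (x₁ x₂ x₁₂ : ℝ × ℝ) : SerTriple :=
  (basicSeries (-1) x₁₂ x₂ (x₁ + x₂ + x₁₂), basicSeries 1 x₁ x₁₂ (x₁ + x₂ + x₁₂),
    (-1 : ℂ) ^ ⌊x₁₂.1 - x₁₂.2⌋ • basicSeries (-1) x₁₂ x₁ (x₁ + x₂ + x₁₂))

def IsIntegral₂ (x : ℝ × ℝ) : Prop := ∃ k : ℤ, x.1 - x.2 = k

theorem IsIntegral₂.add_dv {x : ℝ × ℝ} (hx : IsIntegral₂ x) (n : ℤ) (c : Bool) :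
    IsIntegral₂ (x + (n : ℝ) • dv c) := by
  obtain ⟨k, hk⟩ := hx
  cases c
  · exact ⟨k - n, by simp [dv, ← hk]; ring⟩
  · exact ⟨k + n, by simp [dv, ← hk]; ring⟩

/-- The span of the expansions of monomials. -/
def monomialSpan : Submodule ℂ SerTriple :=
  Submodule.span ℂ {T | ∃ x₁ x₂ x₁₂, IsIntegral₂ x₁ ∧ IsIntegral₂ x₂ ∧ IsIntegral₂ x₁₂ ∧
    T = monomialTriple x₁ x₂ x₁₂}

theorem SerTriple.bounded_of_mem {T : SerTriple} (hT : T ∈ monomialSpan) : T.Bounded := by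
  induction hT using Submodule.span_induction with
  | mem T h =>
    obtain ⟨x₁, x₂, x₁₂, -, -, -, rfl⟩ := h
    exact ⟨basicSeries_bounded _ _ _ _, basicSeries_bounded _ _ _ _,
      (basicSeries_bounded _ _ _ _).smul _⟩
  | zero => exact ⟨⟨0, fun _ _ _ => rfl⟩, ⟨0, fun _ _ _ => rfl⟩, ⟨0, fun _ _ _ => rfl⟩⟩
  | add T T' _ _ h h' => exact ⟨h.1.add h'.1, h.2.1.add h'.2.1, h.2.2.add h'.2.2⟩
  | smul t T _ h => exact ⟨h.1.smul t, h.2.1.smul t, h.2.2.smul t⟩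

/-- The multiplications are linear on bounded triples only, so they are not linear maps of the whole
space; elements of the span are bounded, which makes induction over the span possible. -/
theorem mem_monomialSpan_of_linear (Z : SerTriple → SerTriple)
    (add : ∀ T T' : SerTriple, T.Bounded → T'.Bounded → Z (T + T') = Z T + Z T')
    (smul : ∀ (t : ℂ) (T : SerTriple), T.Bounded → Z (t • T) = t • Z T)
    (mono : ∀ x₁ x₂ x₁₂, IsIntegral₂ x₁ → IsIntegral₂ x₂ → IsIntegral₂ x₁₂ →
      Z (monomialTriple x₁ x₂ x₁₂) ∈ monomialSpan) {T : SerTriple} (hT : T ∈ monomialSpan) :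
    Z T ∈ monomialSpan := by
  induction hT using Submodule.span_induction with
  | mem T h =>
    obtain ⟨x₁, x₂, x₁₂, h1, h2, h3, rfl⟩ := h
    exact mono _ _ _ h1 h2 h3
  | zero =>
    rw [← zero_smul ℂ (0 : SerTriple), smul _ _ (SerTriple.bounded_of_mem (zero_mem _)), zero_smul]
    exact zero_mem _
  | add T T' h1 h2 h h' =>
    rw [add _ _ (SerTriple.bounded_of_mem h1) (SerTriple.bounded_of_mem h2)]
    exact add_mem h h'
  | smul t T h1 h =>
    rw [smul _ _ (SerTriple.bounded_of_mem h1)]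
    exact Submodule.smul_mem _ _ h

theorem mulZ₁_mem (c : Bool) (n : ℤ) {T : SerTriple} (hT : T ∈ monomialSpan) :
    mulZ₁ c n T ∈ monomialSpan := by
  refine mem_monomialSpan_of_linear (mulZ₁ c n) ?_ ?_ ?_ hT
  · intro T T' h h'
    simp only [mulZ₁, Prod.fst_add, Prod.snd_add, map_add, binomShift_add _ _ _ h.2.1 h'.2.1]
    rfl
  · intro t T h
    simp only [mulZ₁, Prod.smul_fst, Prod.smul_snd, map_smul, binomShift_smul _ _ _ h.2.1]
    rfl
  · intro x₁ x₂ x₁₂ h1 h2 h3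
    refine Submodule.subset_span ⟨x₁ + (n : ℝ) • dv c, x₂, x₁₂, h1.add_dv n c, h2, h3, ?_⟩
    simp only [mulZ₁, monomialTriple, map_smul, shiftLarge_basicSeries, shiftSmall_basicSeries,
      binomShift_basicSeries, add_right_comm x₁ ((n : ℝ) • dv c) x₂,
      add_right_comm (x₁ + x₂) ((n : ℝ) • dv c) x₁₂]

theorem mulZ₂_mem (c : Bool) (n : ℤ) {T : SerTriple} (hT : T ∈ monomialSpan) :
    mulZ₂ c n T ∈ monomialSpan := by
  refine mem_monomialSpan_of_linear (mulZ₂ c n) ?_ ?_ ?_ hT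
  · intro T T' h h'
    simp only [mulZ₂, Prod.fst_add, Prod.snd_add, map_add]
    rfl
  · intro t T h
    simp only [mulZ₂, Prod.smul_fst, Prod.smul_snd, map_smul]
    rfl
  · intro x₁ x₂ x₁₂ h1 h2 h3
    refine Submodule.subset_span ⟨x₁, x₂ + (n : ℝ) • dv c, x₁₂, h1, h2.add_dv n c, h3, ?_⟩
    simp only [mulZ₂, monomialTriple, map_smul, shiftLarge_basicSeries, shiftSmall_basicSeries,
      ← add_assoc x₁ x₂ ((n : ℝ) • dv c), add_right_comm (x₁ + x₂) ((n : ℝ) • dv c) x₁₂]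

/-- The integer x.1 - x.2 changes by n in one direction and by -n in the other, and the two have the
same parity. Hence the sign in `mulZ₁₂` has one form for both directions. -/
theorem neg_one_zpow_floor_add_dv {x : ℝ × ℝ} (hx : IsIntegral₂ x) (n : ℤ) (c : Bool) :
    (-1 : ℂ) ^ ⌊(x + (n : ℝ) • dv c).1 - (x + (n : ℝ) • dv c).2⌋ =
      (-1) ^ n * (-1) ^ ⌊x.1 - x.2⌋ := by
  obtain ⟨k, hk⟩ := hx
  cases c
  · have : (x + (n : ℝ) • dv false).1 - (x + (n : ℝ) • dv false).2 = ((k - n : ℤ) : ℝ) := by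
      simp [dv, ← hk]; ring
    rw [this, hk, Int.floor_intCast, Int.floor_intCast, zpow_sub₀ (by norm_num), mul_comm,
      div_eq_mul_inv, ← zpow_neg, zpow_neg, ← inv_zpow, inv_neg, inv_one]
  · have : (x + (n : ℝ) • dv true).1 - (x + (n : ℝ) • dv true).2 = ((k + n : ℤ) : ℝ) := by
      simp [dv, ← hk]; ring
    rw [this, hk, Int.floor_intCast, Int.floor_intCast, zpow_add₀ (by norm_num), mul_comm]

theorem mulZ₁₂_mem (c : Bool) (n : ℤ) {T : SerTriple} (hT : T ∈ monomialSpan) :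
    mulZ₁₂ c n T ∈ monomialSpan := by
  refine mem_monomialSpan_of_linear (mulZ₁₂ c n) ?_ ?_ ?_ hT
  · intro T T' h h'
    simp only [mulZ₁₂, Prod.fst_add, Prod.snd_add, map_add, binomShift_add _ _ _ h.1 h'.1,
      binomShift_add _ _ _ h.2.2 h'.2.2, smul_add]
    rfl
  · intro t T h
    simp only [mulZ₁₂, Prod.smul_fst, Prod.smul_snd, map_smul, binomShift_smul _ _ _ h.1,
      binomShift_smul _ _ _ h.2.2, smul_comm _ t]
    rfl
  · intro x₁ x₂ x₁₂ h1 h2 h3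
    refine Submodule.subset_span ⟨x₁, x₂, x₁₂ + (n : ℝ) • dv c, h1, h2, h3.add_dv n c, ?_⟩
    simp only [mulZ₁₂, monomialTriple, shiftSmall_basicSeries, binomShift_basicSeries,
      binomShift_smul _ _ _ (basicSeries_bounded _ _ _ _), smul_smul,
      ← add_assoc (x₁ + x₂) x₁₂ ((n : ℝ) • dv c), neg_one_zpow_floor_add_dv h3]

end Series

/-! ### Ward identities for the correlation triples -/

theorem sum_range_eq_of_le {M : Type*} [AddCommMonoid M] (f : ℕ → M) {m K : ℕ} (hmK : m ≤ K)
    (h : ∀ i, m ≤ i → f i = 0) : ∑ i ∈ Finset.range K, f i = ∑ i ∈ Finset.range m, f i :=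
  (Finset.sum_subset (Finset.range_subset_range.2 hmK) fun i _ hi => h i (by simpa using hi)).symm

namespace LatticeDatum
variable {L E : Type*} [AddCommGroup L] [AddCommGroup E] [Module ℂ E] (D : LatticeDatum L E)

/-- The three expansions of the correlation function of `a`, `b`, `v` and `u`. -/
def corr (u : Module.Dual ℂ (L →₀ Fock E)) (a b v : L →₀ Fock E) : SerTriple :=
  (fun s l => u (D.Y l a (D.Y s b v)), fun s l => u (D.Y l (D.Y s a b) v),
    fun s l => u (D.Y l b (D.Y s a v)))

theorem corr_ext {T T' : SerTriple} (h1 : ∀ s l, T.1 s l = T'.1 s l)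
    (h2 : ∀ s l, T.2.1 s l = T'.2.1 s l) (h3 : ∀ s l, T.2.2 s l = T'.2.2 s l) : T = T' :=
  Prod.ext (funext fun s => funext fun l => h1 s l) (Prod.ext (funext fun s => funext fun l => h2 s l)
    (funext fun s => funext fun l => h3 s l))

theorem binomShift_one_corr (c : Bool) (n : ℤ) (u a b v) (s l : ℝ × ℝ) (K : ℕ)
    (hK : ∀ j : ℕ, K ≤ j → D.Y (s - (j : ℝ) • dv c) a b = 0) :
    binomShift 1 c n (D.corr u a b v).2.1 s l = ∑ j ∈ Finset.range K,
      ch n j * u (D.Y (l - ((n : ℝ) - j) • dv c) (D.Y (s - (j : ℝ) • dv c) a b) v) := by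
  rw [binomShift_apply (K := K)]
  · simp [corr]
  · intro j hj l
    simp [corr, hK j hj]

theorem binomShift_corr_fst (c : Bool) (n : ℤ) (u a b v) (s l : ℝ × ℝ) (K : ℕ)
    (hK : ∀ j : ℕ, K ≤ j → D.Y (s - (j : ℝ) • dv c) b v = 0) :
    binomShift (-1) c n (D.corr u a b v).1 s l = ∑ j ∈ Finset.range K,
      ch n j * (-1) ^ j * u (D.Y (l - ((n : ℝ) - j) • dv c) a (D.Y (s - (j : ℝ) • dv c) b v)) := by
  rw [binomShift_apply (K := K)]
  · simp [corr]
  · intro j hj l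
    simp [corr, hK j hj]

theorem binomShift_corr_snd (c : Bool) (n : ℤ) (u a b v) (s l : ℝ × ℝ) (K : ℕ)
    (hK : ∀ j : ℕ, K ≤ j → D.Y (s - (j : ℝ) • dv c) a v = 0) :
    binomShift (-1) c n (D.corr u a b v).2.2 s l = ∑ j ∈ Finset.range K,
      ch n j * (-1) ^ j * u (D.Y (l - ((n : ℝ) - j) • dv c) b (D.Y (s - (j : ℝ) • dv c) a v)) := by
  rw [binomShift_apply (K := K)]
  · simp [corr]
  · intro j hj l
    simp [corr, hK j hj]

/-- Commuting x(n) to the right through two fields gives powers z₁^(n-j) and z₂^(n-j). For |z₁| >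
|z₂| and |z₂| > |z₁| this is the commutator formula applied twice. For the iterated product x(j)
must be commuted a second time, into Y(a,z₀)b, and the double sum has to reassemble into powers of
z₁ = z₂ + z₀. -/
theorem corr_comp_h (c : Bool) (x : E) (hx : D.pr c x = x) (n : ℤ)
    (u : Module.Dual ℂ (L →₀ Fock E)) (a b v : L →₀ Fock E) :
    ∀ᶠ M : ℕ in atTop, D.corr (u ∘ₗ D.h n x) a b v =
      ∑ j ∈ Finset.range M, ch n j • mulZ₁ c (n - j) (D.corr u (D.h j x a) b v) +
      ∑ j ∈ Finset.range M, ch n j • mulZ₂ c (n - j) (D.corr u a (D.h j x b) v) +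
      D.corr u a b (D.h n x v) := by
  filter_upwards [D.commutator c x hx a, D.commutator c x hx b, D.h_eventually x b,
    D.h_eventually x a] with M ha hb hb0 ha0
  refine corr_ext (fun s l => ?_) (fun s l => ?_) (fun s l => ?_)
  · simp only [Prod.fst_add, Prod.fst_sum, Prod.smul_fst, Pi.add_apply, Finset.sum_apply,
      Pi.smul_apply]
    change u (D.h n x (D.Y l a (D.Y s b v))) = ∑ j ∈ Finset.range M, ch n j •
      u (D.Y (l - ((n - j : ℤ) : ℝ) • dv c) (D.h j x a) (D.Y s b v)) +
      ∑ j ∈ Finset.range M, ch n j • u (D.Y l a (D.Y (s - ((n - j : ℤ) : ℝ) • dv c) (D.h j x b) v)) +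
      u (D.Y l a (D.Y s b (D.h n x v)))
    rw [ha, hb]
    simp only [map_add, map_sum, map_smul]
    push_cast
    abel
  · obtain ⟨K, ⟨hab, hK1⟩, hK2, hK3⟩ := (((D.commutator c x hx (D.Y s a b)).and
      (eventually_ge_atTop M)).and
      (((Filter.eventually_all_finset (Finset.range M)).2 fun i _ =>
        D.Y_eventually (D.h i x a) b s c).and
      ((Filter.eventually_all_finset (Finset.range M)).2 fun i _ =>
        D.Y_eventually (D.h i x a) b (s + (i : ℝ) • dv c) c))).exists
    simp only [Prod.snd_add, Prod.snd_sum, Prod.smul_snd, Prod.fst_add, Prod.fst_sum, Prod.smul_fst,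
      Pi.add_apply, Finset.sum_apply, Pi.smul_apply]
    have e1 : ∀ i ∈ Finset.range M, ch n i • (mulZ₁ c (n - i) (D.corr u (D.h i x a) b v)).2.1 s l =
        ∑ j ∈ Finset.range K, ch n j * ch j i *
          u (D.Y (l - ((n : ℝ) - j) • dv c) (D.Y (s - ((j : ℝ) - i) • dv c) (D.h i x a) b) v) := by
      intro i hi
      change ch n i • binomShift 1 c (n - i) (D.corr u (D.h i x a) b v).2.1 s l = _
      rw [D.binomShift_one_corr c _ _ _ _ _ s l K (hK2 i hi)]
      symm
      -- With j = i + m, `ch_mul_ch` turns C(n,j) C(j,i) into C(n,i) C(n-i,m), and the sum over m is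
      -- the expansion of (z₂ + z₀)^(n-i).
      rw [sum_range_shift _ i, Finset.smul_sum]
      · refine Finset.sum_congr rfl fun m _ => ?_
        have h1 := ch_mul_ch n i m
        rw [smul_eq_mul, ← mul_assoc, ch_natCast, add_comm m i]
        push_cast
        rw [h1]
        rw [show l - ((n : ℝ) - (i + m)) • dv c = l - ((n : ℝ) - i - m) • dv c by module,
          show s - ((i : ℝ) + m - i) • dv c = s - (m : ℝ) • dv c by module]
      · intro j hj
        rw [ch_natCast, Nat.choose_eq_zero_of_lt hj]
        simp
      · intro j hj
        have := hK3 i hi j hj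
        rw [show s + (i : ℝ) • dv c - (j : ℝ) • dv c = s - ((j : ℝ) - i) • dv c by module] at this
        rw [this]
        simp
    rw [Finset.sum_congr rfl e1]
    change u (D.h n x (D.Y l (D.Y s a b) v)) = _ + ∑ j ∈ Finset.range M, ch n j •
      u (D.Y (l - ((n - j : ℤ) : ℝ) • dv c) (D.Y s a (D.h j x b)) v) +
      u (D.Y l (D.Y s a b) (D.h n x v))
    rw [hab, Finset.sum_congr rfl fun (j : ℕ) _ => by rw [ha (j : ℤ) s b]]
    simp only [map_add, map_sum, map_smul, LinearMap.add_apply, LinearMap.sum_apply, smul_add,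
      LinearMap.smul_apply, Finset.sum_add_distrib, Finset.smul_sum]
    rw [sum_range_eq_of_le _ hK1 fun i hi => by rw [hb0 i (by omega)]; simp,
      Finset.sum_comm (s := Finset.range M)]
    push_cast
    simp only [smul_eq_mul, mul_assoc]
    abel
  · simp only [Prod.snd_add, Prod.snd_sum, Prod.smul_snd, Pi.add_apply, Finset.sum_apply,
      Pi.smul_apply]
    change u (D.h n x (D.Y l b (D.Y s a v))) = ∑ j ∈ Finset.range M, ch n j •
      u (D.Y l b (D.Y (s - ((n - j : ℤ) : ℝ) • dv c) (D.h j x a) v)) +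
      ∑ j ∈ Finset.range M, ch n j • u (D.Y (l - ((n - j : ℤ) : ℝ) • dv c) (D.h j x b) (D.Y s a v)) +
      u (D.Y l b (D.Y s a (D.h n x v)))
    rw [hb, ha]
    simp only [map_add, map_sum, map_smul]
    push_cast
    abel

/-- Functionals that vanish on the images of the creation operators. -/
def IsVacuum (u : Module.Dual ℂ (L →₀ Fock E)) : Prop :=
  ∀ (k : ℕ) (x : E) (v : L →₀ Fock E), u (D.h (-((k : ℤ) + 1)) x v) = 0

variable {D} in
theorem IsVacuum.apply_Y_h {u : Module.Dual ℂ (L →₀ Fock E)} (hu : D.IsVacuum u) (c : Bool)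
    (k : ℕ) (x : E) (hx : D.pr c x = x) (v w : L →₀ Fock E) (y : ℝ × ℝ) (M : ℕ)
    (hM : ∀ i : ℕ, M ≤ i → D.h i x w = 0) : u (D.Y y (D.h (-((k : ℤ) + 1)) x v) w) =
      ∑ i ∈ Finset.range M, ((-1) ^ k * Nat.choose (i + k) k : ℂ) *
        u (D.Y (y + ((i + k + 1 : ℕ) : ℝ) • dv c) v (D.h i x w)) := by
  obtain ⟨K, hK, hKM⟩ := ((D.Y_h c k x hx v w y).and (eventually_ge_atTop M)).exists
  rw [hK, map_add, map_sum, Finset.sum_eq_zero, zero_add, map_sum, sum_range_eq_of_le _ hKM]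
  · exact Finset.sum_congr rfl fun i _ => by rw [map_smul, smul_eq_mul]
  · intro i hi
    rw [hM i hi, map_zero, smul_zero, map_zero]
  · intro j _
    rw [map_smul, hu, smul_zero]

-- Since u vanishes on the image of x(-k-1), the commutator formula expresses the value with x(-k-1)
-- on the far right through the terms with x(j) on b.
variable {D} in
theorem IsVacuum.apply_Y_comp_h {u : Module.Dual ℂ (L →₀ Fock E)} (hu : D.IsVacuum u) (c : Bool)
    (x : E) (hx : D.pr c x = x) (b : L →₀ Fock E) : ∀ᶠ M : ℕ in atTop,
      ∀ (k : ℕ) (y : ℝ × ℝ) (w : L →₀ Fock E), u (D.Y y b (D.h (-((k : ℤ) + 1)) x w)) =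
        -∑ j ∈ Finset.range M, (-1) ^ j * Nat.choose (k + j) j *
          u (D.Y (y + ((k + 1 + j : ℕ) : ℝ) • dv c) (D.h j x b) w) := by
  filter_upwards [D.commutator c x hx b] with M hM k y w
  have h1 := congrArg u (hM (-((k : ℤ) + 1)) y w)
  rw [hu, map_add] at h1
  rw [eq_neg_of_add_eq_zero_left h1.symm, map_sum]
  congr 1
  refine Finset.sum_congr rfl fun j _ => ?_
  rw [map_smul, smul_eq_mul]
  push_cast
  rw [ch_neg]
  congr 6
  module

end LatticeDatum

theorem ch_neg_natCast (n j : ℕ) :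
    ch ((-((n + 1 : ℕ) : ℤ) : ℤ) : ℝ) j = (-1) ^ j * Nat.choose (n + j) j := by
  rw [← ch_neg]; push_cast; rfl

theorem sub_neg_natCast_smul (l : ℝ × ℝ) (n : ℕ) (c : Bool) :
    l - ((-(n : ℤ) : ℤ) : ℝ) • dv c = l + (n : ℝ) • dv c := by push_cast; module

theorem neg_one_zpow_neg (n : ℕ) : (-1 : ℂ) ^ (-(n : ℤ)) = (-1) ^ n := by
  rw [zpow_neg, zpow_natCast, ← inv_pow, inv_neg, inv_one]

theorem neg_one_pow_mul_self (n : ℕ) : (-1 : ℂ) ^ n * (-1) ^ n = 1 := by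
  rw [← mul_pow]; norm_num

namespace LatticeDatum
variable {L E : Type*} [AddCommGroup L] [AddCommGroup E] [Module ℂ E] {D : LatticeDatum L E}

/-- As a function of its position, the current of x between a vacuum functional and the other
vectors has no contribution from infinity. Its part at z₁ can therefore be traded for its poles at
z₂ and at 0: the modes x(j) act on b with weight (z₁-z₂)^(-j-k-1) and the modes x(i) act on v with
weight z₁^(-i-k-1). Formally this is checked in each of the three regions, where a different one of
these powers has to be expanded. -/
theorem IsVacuum.corr_h {u : Module.Dual ℂ (L →₀ Fock E)} (hu : D.IsVacuum u) (c : Bool)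
    (k : ℕ) (x : E) (hx : D.pr c x = x) (a b v : L →₀ Fock E) : ∀ᶠ M : ℕ in atTop,
    D.corr u (D.h (-((k : ℤ) + 1)) x a) b v =
      ∑ i ∈ Finset.range M, ((-1) ^ k * Nat.choose (i + k) k : ℂ) •
        mulZ₁ c (-((i + k + 1 : ℕ) : ℤ)) (D.corr u a b (D.h i x v)) +
      ∑ j ∈ Finset.range M, ((-1) ^ k * Nat.choose (j + k) k : ℂ) •
        mulZ₁₂ c (-((j + k + 1 : ℕ) : ℤ)) (D.corr u a (D.h j x b) v) := by
  filter_upwards [D.commutator c x hx b, D.h_eventually x b, D.h_eventually x v,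
    hu.apply_Y_comp_h c x hx b] with M hb hb0 hv0 hub
  refine corr_ext (fun s l => ?_) (fun s l => ?_) (fun s l => ?_)
  · obtain ⟨K, ⟨hK0, hKM⟩, hK2, hK3⟩ := (((D.h_eventually x (D.Y s b v)).and
      (eventually_ge_atTop M)).and
      (((Filter.eventually_all_finset (Finset.range M)).2 fun j _ =>
        D.Y_eventually (D.h j x b) v s c).and
      ((Filter.eventually_all_finset (Finset.range M)).2 fun j _ =>
        D.Y_eventually (D.h j x b) v (s + (j : ℝ) • dv c) c))).exists
    simp only [Prod.fst_add, Prod.fst_sum, Prod.smul_fst, Pi.add_apply, Finset.sum_apply,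
      Pi.smul_apply]
    -- For |z₁| > |z₂| the annihilation modes x(i) are commuted past Y(b,z₂), which gives powers
    -- z₂^(i-j); summing over i yields (z₁-z₂)^(-j-k-1) expanded in z₂/z₁.
    have e1 : ∀ j ∈ Finset.range M, ((-1) ^ k * Nat.choose (j + k) k : ℂ) •
        (mulZ₁₂ c (-((j + k + 1 : ℕ) : ℤ)) (D.corr u a (D.h j x b) v)).1 s l =
        ∑ i ∈ Finset.range K, ((-1) ^ k * Nat.choose (i + k) k * Nat.choose i j : ℂ) *
          u (D.Y (l + ((i + k + 1 : ℕ) : ℝ) • dv c) a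
            (D.Y (s - ((i : ℝ) - j) • dv c) (D.h j x b) v)) := by
      intro j hj
      change _ • binomShift (-1) c _ (D.corr u a (D.h j x b) v).1 s l = _
      rw [D.binomShift_corr_fst c _ _ _ _ _ s l K (hK2 j hj)]
      symm
      rw [sum_range_shift _ j, Finset.smul_sum]
      · refine Finset.sum_congr rfl fun m _ => ?_
        rw [ch_neg_natCast, smul_eq_mul, ← mul_assoc]
        have h1 := natCast_choose_mul_choose m j k
        rw [show l - (((-((j + k + 1 : ℕ) : ℤ) : ℤ) : ℝ) - m) • dv c =
          l + ((m + j + k + 1 : ℕ) : ℝ) • dv c by push_cast; module,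
          show s - (((m + j : ℕ) : ℝ) - j) • dv c = s - (m : ℝ) • dv c by push_cast; module]
        congr 1
        linear_combination (-1) ^ k * h1 - (-1) ^ k * Nat.choose (j + k) k *
          Nat.choose (j + k + m) m * neg_one_pow_mul_self m
      · intro i hi
        rw [Nat.choose_eq_zero_of_lt hi]
        simp
      · intro i hi
        have := hK3 j hj i hi
        rw [show s + (j : ℝ) • dv c - (i : ℝ) • dv c = s - ((i : ℝ) - j) • dv c by module] at this
        rw [this]
        simp
    rw [Finset.sum_congr rfl e1]
    change u (D.Y l (D.h (-((k : ℤ) + 1)) x a) (D.Y s b v)) = ∑ i ∈ Finset.range M,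
      ((-1) ^ k * Nat.choose (i + k) k : ℂ) •
        u (D.Y (l - ((-((i + k + 1 : ℕ) : ℤ) : ℤ) : ℝ) • dv c) a (D.Y s b (D.h i x v))) + _
    rw [hu.apply_Y_h c k x hx _ _ l K fun i hi => hK0 i (by omega),
      Finset.sum_congr rfl fun (j : ℕ) _ => by rw [hb (j : ℤ) s v]]
    simp only [map_add, map_sum, map_smul, mul_add, Finset.sum_add_distrib, Finset.mul_sum]
    rw [sum_range_eq_of_le _ hKM fun i hi => by rw [hv0 i (by omega)]; simp,
      Finset.sum_comm (s := Finset.range K)]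
    simp only [sub_neg_natCast_smul, smul_eq_mul, ← mul_assoc, Int.cast_natCast, ch_natCast]
  · obtain ⟨K, ⟨hK0, hKM⟩, hK2⟩ := (((D.Y_h c k x hx a b s).and
      (eventually_ge_atTop M)).and (D.Y_eventually a b s c)).exists
    simp only [Prod.snd_add, Prod.snd_sum, Prod.smul_snd, Prod.fst_add, Prod.fst_sum, Prod.smul_fst,
      Pi.add_apply, Finset.sum_apply, Pi.smul_apply]
    -- For the iterated product the creation terms x(-m-k-1) act on Y(a,z₀)b; a second normal
    -- ordering turns them into x(i) on v, and the sum over m is (z₂+z₀)^(-i-k-1).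
    have e1 : ∀ i ∈ Finset.range M, ((-1) ^ k * Nat.choose (i + k) k : ℂ) •
        (mulZ₁ c (-((i + k + 1 : ℕ) : ℤ)) (D.corr u a b (D.h i x v))).2.1 s l =
        ∑ m ∈ Finset.range K, (Nat.choose (m + k) k : ℂ) *
          (((-1) ^ (m + k) * Nat.choose (i + (m + k)) (m + k)) *
          u (D.Y (l + ((i + (m + k) + 1 : ℕ) : ℝ) • dv c)
            (D.Y (s - (m : ℝ) • dv c) a b) (D.h i x v))) := by
      intro i hi
      change _ • binomShift 1 c _ (D.corr u a b (D.h i x v)).2.1 s l = _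
      rw [D.binomShift_one_corr c _ _ _ _ _ s l K hK2, Finset.smul_sum]
      refine Finset.sum_congr rfl fun m _ => ?_
      rw [ch_neg_natCast, smul_eq_mul, ← mul_assoc, ← mul_assoc]
      have h1 := natCast_choose_mul_choose m k i
      rw [show l - (((-((i + k + 1 : ℕ) : ℤ) : ℤ) : ℝ) - m) • dv c =
          l + ((i + (m + k) + 1 : ℕ) : ℝ) • dv c by push_cast; module, ← mul_assoc]
      congr 1
      have h2 : (Nat.choose (i + (m + k)) (m + k) : ℂ) = Nat.choose (m + k + i) i := by
        rw [add_comm i, Nat.choose_symm_add]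
      have h3 : (Nat.choose (i + k) k : ℂ) = Nat.choose (k + i) i := by
        rw [add_comm i, Nat.choose_symm_add]
      rw [pow_add, h2, h3, add_comm i k]
      linear_combination (-1 : ℂ) ^ k * (-1) ^ m * -h1
    rw [Finset.sum_congr rfl e1]
    change u (D.Y l (D.Y s (D.h (-((k : ℤ) + 1)) x a) b) v) = _ + ∑ j ∈ Finset.range M,
      ((-1) ^ k * Nat.choose (j + k) k : ℂ) •
        u (D.Y l (D.Y (s - ((-((j + k + 1 : ℕ) : ℤ) : ℤ) : ℝ) • dv c) a (D.h j x b)) v)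
    rw [hK0]
    simp only [map_add, map_sum, map_smul, LinearMap.add_apply, LinearMap.sum_apply,
      LinearMap.smul_apply, sub_neg_natCast_smul]
    rw [sum_range_eq_of_le (fun i : ℕ => ((-1) ^ k * Nat.choose (i + k) k : ℂ) • u (D.Y l
      (D.Y (s + ((i + k + 1 : ℕ) : ℝ) • dv c) a (D.h i x b)) v)) hKM
      fun i hi => by rw [hb0 i (by omega)]; simp]
    rw [Finset.sum_congr rfl fun m (_ : m ∈ Finset.range K) => by
      rw [hu.apply_Y_h c (m + k) x hx _ _ l M fun i hi => hv0 i (by omega)]]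
    rw [Finset.sum_comm (s := Finset.range M)]
    simp only [smul_eq_mul, Finset.mul_sum]
  · obtain ⟨K, ⟨hK0, hKM⟩, hK2⟩ := (((D.Y_h c k x hx a v s).and
      (eventually_ge_atTop M)).and (D.Y_eventually a v s c)).exists
    simp only [Prod.snd_add, Prod.snd_sum, Prod.smul_snd, Pi.add_apply, Finset.sum_apply,
      Pi.smul_apply]
    -- For |z₂| > |z₁| the creation terms are commuted to the left past Y(b,z₂), where u kills them;
    -- the sum over m is (z₁-z₂)^(-j-k-1) expanded in z₁/z₂, with the sign carried by `mulZ₁₂`.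
    have e1 : ∀ j ∈ Finset.range M, ((-1) ^ k * Nat.choose (j + k) k : ℂ) •
        (mulZ₁₂ c (-((j + k + 1 : ℕ) : ℤ)) (D.corr u a (D.h j x b) v)).2.2 s l =
        ∑ m ∈ Finset.range K, (Nat.choose (m + k) k : ℂ) *
          -((-1) ^ j * Nat.choose (m + k + j) j *
          u (D.Y (l + ((m + k + 1 + j : ℕ) : ℝ) • dv c) (D.h j x b)
            (D.Y (s - (m : ℝ) • dv c) a v))) := by
      intro j hj
      change _ • ((-1 : ℂ) ^ (-((j + k + 1 : ℕ) : ℤ)) • binomShift (-1) c (-((j + k + 1 : ℕ) : ℤ))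
        (D.corr u a (D.h j x b) v).2.2 s l) = _
      rw [D.binomShift_corr_snd c _ _ _ _ _ s l K hK2, Finset.smul_sum, Finset.smul_sum]
      refine Finset.sum_congr rfl fun m _ => ?_
      rw [ch_neg_natCast, neg_one_zpow_neg, smul_eq_mul, smul_eq_mul]
      have h1 := natCast_choose_mul_choose m k j
      rw [show l - (((-((j + k + 1 : ℕ) : ℤ) : ℤ) : ℝ) - m) • dv c =
          l + ((m + k + 1 + j : ℕ) : ℝ) • dv c by push_cast; module]
      generalize u _ = t
      rw [add_comm k j] at h1
      have h2 : (Nat.choose (j + k) k : ℂ) = Nat.choose (j + k) j := by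
        rw [Nat.choose_symm_add]
      rw [h2]
      have h3 : (-1 : ℂ) ^ (j + k + 1) * (-1) ^ k = -(-1) ^ j := by
        rw [pow_succ, pow_add, mul_assoc, mul_assoc, mul_comm (-1 : ℂ), ← mul_assoc ((-1 : ℂ) ^ k),
          neg_one_pow_mul_self]
        ring
      linear_combination t * ((Nat.choose (j + k) j : ℂ) * Nat.choose (j + k + m) m * (-1) ^ m *
        (-1) ^ m * h3 - (-1) ^ j * Nat.choose (j + k) j * Nat.choose (j + k + m) m *
        neg_one_pow_mul_self m + (-1) ^ j * h1)
    rw [Finset.sum_congr rfl e1]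
    change u (D.Y l b (D.Y s (D.h (-((k : ℤ) + 1)) x a) v)) = ∑ i ∈ Finset.range M,
      ((-1) ^ k * Nat.choose (i + k) k : ℂ) •
        u (D.Y l b (D.Y (s - ((-((i + k + 1 : ℕ) : ℤ) : ℤ) : ℝ) • dv c) a (D.h i x v))) + _
    rw [hK0]
    simp only [map_add, map_sum, map_smul, sub_neg_natCast_smul]
    rw [sum_range_eq_of_le (fun i : ℕ => ((-1) ^ k * Nat.choose (i + k) k : ℂ) • u (D.Y l b
      (D.Y (s + ((i + k + 1 : ℕ) : ℝ) • dv c) a (D.h i x v)))) hKM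
      fun i hi => by rw [hv0 i (by omega)]; simp]
    rw [Finset.sum_congr rfl fun m (_ : m ∈ Finset.range K) => by rw [hub (m + k) l]]
    rw [add_comm, Finset.sum_comm (s := Finset.range M)]
    simp only [smul_eq_mul, Finset.mul_sum, mul_neg, Finset.sum_neg_distrib]

/-- With an exponential in first position the bracket with x(n) has only the term (x,α). Removing
x(-k-1) from b therefore leaves the poles at 0 and a single pole (z₁-z₂)^(-k-1). -/
theorem IsVacuum.corr_e_h {u : Module.Dual ℂ (L →₀ Fock E)} (hu : D.IsVacuum u) (c : Bool)
    (k : ℕ) (x : E) (hx : D.pr c x = x) (α : L) (b v : L →₀ Fock E) : ∀ᶠ M : ℕ in atTop,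
    D.corr u (e α) (D.h (-((k : ℤ) + 1)) x b) v =
      ∑ i ∈ Finset.range M, ((-1) ^ k * Nat.choose (i + k) k : ℂ) •
        mulZ₂ c (-((i + k + 1 : ℕ) : ℤ)) (D.corr u (e α) b (D.h i x v)) -
      D.g x (D.wt α) • mulZ₁₂ c (-((k + 1 : ℕ) : ℤ)) (D.corr u (e α) b v) := by
  have he : ∀ (N : ℕ) (y : ℝ × ℝ) (w : L →₀ Fock E),
      u (D.Y y (e α) (D.h (-((N : ℤ) + 1)) x w)) =
        -(D.g x (D.wt α) * u (D.Y (y + ((N + 1 : ℕ) : ℝ) • dv c) (e α) w)) := by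
    intro N y w
    have := congrArg u (D.e_commutator c x hx (-((N : ℤ) + 1)) α y w)
    rw [hu, map_add, map_smul] at this
    rw [eq_neg_of_add_eq_zero_left this.symm, smul_eq_mul, show y - ((-((N : ℤ) + 1) : ℤ) : ℝ) • dv c =
      y + ((N + 1 : ℕ) : ℝ) • dv c by push_cast; module]
  filter_upwards [D.h_eventually x v] with M hv0
  refine corr_ext (fun s l => ?_) (fun s l => ?_) (fun s l => ?_)
  · obtain ⟨K, ⟨hK0, hKM⟩, hK2⟩ := (((D.Y_h c k x hx b v s).and
      (eventually_ge_atTop M)).and (D.Y_eventually b v s c)).exists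
    simp only [Prod.fst_sub, Prod.fst_sum, Prod.smul_fst, Pi.sub_apply, Finset.sum_apply,
      Pi.smul_apply]
    change u (D.Y l (e α) (D.Y s (D.h (-((k : ℤ) + 1)) x b) v)) = ∑ i ∈ Finset.range M,
      ((-1) ^ k * Nat.choose (i + k) k : ℂ) •
        u (D.Y l (e α) (D.Y (s - ((-((i + k + 1 : ℕ) : ℤ) : ℤ) : ℝ) • dv c) b (D.h i x v))) -
      D.g x (D.wt α) • binomShift (-1) c _ (D.corr u (e α) b v).1 s l
    rw [hK0, D.binomShift_corr_fst c _ _ _ _ _ s l K hK2]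
    simp only [map_add, map_sum, map_smul, sub_neg_natCast_smul]
    rw [sum_range_eq_of_le (fun i : ℕ => ((-1) ^ k * Nat.choose (i + k) k : ℂ) • u (D.Y l (e α)
      (D.Y (s + ((i + k + 1 : ℕ) : ℝ) • dv c) b (D.h i x v)))) hKM
      fun i hi => by rw [hv0 i (by omega)]; simp]
    rw [Finset.sum_congr rfl fun m (_ : m ∈ Finset.range K) => by rw [he (m + k) l]]
    rw [add_comm, sub_eq_add_neg, Finset.smul_sum, ← Finset.sum_neg_distrib]
    congr 1
    refine Finset.sum_congr rfl fun m _ => ?_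
    rw [ch_neg_natCast, show l - (((-((k + 1 : ℕ) : ℤ) : ℤ) : ℝ) - m) • dv c =
          l + ((m + k + 1 : ℕ) : ℝ) • dv c by push_cast; module, smul_eq_mul, smul_eq_mul,
          add_comm k m, ← Nat.choose_symm_add]
    linear_combination (D.g x (D.wt α) * Nat.choose (m + k) m *
      u (D.Y (l + ((m + k + 1 : ℕ) : ℝ) • dv c) (e α) (D.Y (s - (m : ℝ) • dv c) b v))) *
      neg_one_pow_mul_self m
  · simp only [Prod.snd_sub, Prod.snd_sum, Prod.smul_snd, Prod.fst_sub, Prod.fst_sum, Prod.smul_fst,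
      Pi.sub_apply, Finset.sum_apply, Pi.smul_apply]
    change u (D.Y l (D.Y s (e α) (D.h (-((k : ℤ) + 1)) x b)) v) = ∑ i ∈ Finset.range M,
      ((-1) ^ k * Nat.choose (i + k) k : ℂ) •
        u (D.Y (l - ((-((i + k + 1 : ℕ) : ℤ) : ℤ) : ℝ) • dv c) (D.Y s (e α) b) (D.h i x v)) -
      D.g x (D.wt α) • u (D.Y l (D.Y (s - ((-((k + 1 : ℕ) : ℤ) : ℤ) : ℝ) • dv c) (e α) b) v)
    have h1 := D.e_commutator c x hx (-((k : ℤ) + 1)) α s b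
    rw [← sub_eq_iff_eq_add] at h1
    rw [← h1, map_sub, LinearMap.sub_apply, map_sub, map_smul, LinearMap.smul_apply, map_smul,
      hu.apply_Y_h c k x hx _ _ l M fun i hi => hv0 i (by omega)]
    rw [show s - ((-((k : ℤ) + 1) : ℤ) : ℝ) • dv c = s + ((k + 1 : ℕ) : ℝ) • dv c by push_cast; module]
    simp only [sub_neg_natCast_smul, smul_eq_mul]
  · obtain ⟨K, ⟨hK0, hKM⟩, hK2⟩ := (((D.h_eventually x (D.Y s (e α) v)).and
      (eventually_ge_atTop M)).and (D.Y_eventually (e α) v s c)).exists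
    simp only [Prod.snd_sub, Prod.snd_sum, Prod.smul_snd, Pi.sub_apply, Finset.sum_apply,
      Pi.smul_apply]
    change u (D.Y l (D.h (-((k : ℤ) + 1)) x b) (D.Y s (e α) v)) = ∑ i ∈ Finset.range M,
      ((-1) ^ k * Nat.choose (i + k) k : ℂ) •
        u (D.Y (l - ((-((i + k + 1 : ℕ) : ℤ) : ℤ) : ℝ) • dv c) b (D.Y s (e α) (D.h i x v))) -
      D.g x (D.wt α) • ((-1 : ℂ) ^ (-((k + 1 : ℕ) : ℤ)) •
        binomShift (-1) c _ (D.corr u (e α) b v).2.2 s l)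
    rw [hu.apply_Y_h c k x hx _ _ l K fun i hi => hK0 i (by omega),
      D.binomShift_corr_snd c _ _ _ _ _ s l K hK2,
      Finset.sum_congr rfl fun (j : ℕ) _ => by rw [D.e_commutator c x hx (j : ℤ) α s v]]
    simp only [map_add, map_smul, mul_add, Finset.sum_add_distrib, sub_neg_natCast_smul]
    rw [sum_range_eq_of_le (fun i : ℕ => ((-1) ^ k * Nat.choose (i + k) k : ℂ) * u (D.Y
      (l + ((i + k + 1 : ℕ) : ℝ) • dv c) b (D.Y s (e α) (D.h i x v)))) hKM
      fun i hi => by rw [hv0 i (by omega)]; simp, sub_eq_add_neg, Finset.smul_sum, Finset.smul_sum,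
      ← Finset.sum_neg_distrib]
    congr 1
    refine Finset.sum_congr rfl fun m _ => ?_
    rw [ch_neg_natCast, neg_one_zpow_neg, show l - (((-((k + 1 : ℕ) : ℤ) : ℤ) : ℝ) - m) • dv c =
          l + ((m + k + 1 : ℕ) : ℝ) • dv c by push_cast; module, smul_eq_mul, smul_eq_mul, smul_eq_mul,
          add_comm k m, ← Nat.choose_symm_add, Int.cast_natCast, pow_succ]
    linear_combination -((-1) ^ k * D.g x (D.wt α) * Nat.choose (m + k) m *
      u (D.Y (l + ((m + k + 1 : ℕ) : ℝ) • dv c) b (D.Y (s - (m : ℝ) • dv c) (e α) v))) *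
      neg_one_pow_mul_self m

end LatticeDatum

/-! ### Correlation functions of exponentials and of vacuum functionals -/

theorem succ_mul_ch_eq (r : ℝ) (n : ℕ) : ((n : ℂ) + 1) * ch r (n + 1) = (r - n) * ch r n := by
  have h1 := ch_mul_ch r n 1
  rw [ch_one, Nat.choose_symm_add, Nat.choose_one_right] at h1
  push_cast at h1
  linear_combination h1

/-- The alternating partial sums of binomial coefficients telescope to (-1)^(n-1) C(r-1,n-1), and r
C(r-1,n-1) = n C(r,n). -/
theorem sum_neg_one_pow_mul_ch (r : ℝ) (n : ℕ) :
    ∑ j ∈ Finset.range n, (-1) ^ j * ch r j * r = -((n : ℂ) * ch r n * (-1) ^ n) := by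
  induction n with
  | zero => simp
  | succ n ih =>
    have := succ_mul_ch_eq r n
    rw [Finset.sum_range_succ, ih, pow_succ]
    push_cast
    linear_combination -(-1) ^ n * this

theorem eq_smul_basicSeries {S : Ser} (σ C : ℂ) (t base tot : ℝ × ℝ)
    (h0 : ∀ s l, (∀ n m : ℕ, s ≠ base + ((n : ℝ), (m : ℝ))) → S s l = 0)
    (h1 : ∀ (n m : ℕ) l, S (base + ((n : ℝ), (m : ℝ))) l = open Classical in
      if base + ((n : ℝ), (m : ℝ)) + l = tot then C * (ch t.1 n * σ ^ n * (ch t.2 m * σ ^ m)) else 0) :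
    S = C • basicSeries σ t base tot := by
  funext s l
  simp only [Pi.smul_apply, smul_eq_mul, basicSeries]
  by_cases hs : ∃ n m : ℕ, s = base + ((n : ℝ), (m : ℝ))
  · obtain ⟨n, m, rfl⟩ := hs
    rw [h1]
    split_ifs
    · simp [binomCoeff_natCast]
    · simp
  · push Not at hs
    rw [h0 s l hs]
    split_ifs
    · by_cases h2 : ∃ n : ℕ, (n : ℝ) = s.1 - base.1
      · obtain ⟨n, hn⟩ := h2
        rw [binomCoeff_eq_zero _ _ (s.2 - base.2), mul_zero, mul_zero]
        intro m hm
        exact hs n m (Prod.ext (by simp [hn]) (by simp [hm]))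
      · rw [binomCoeff_eq_zero, zero_mul, mul_zero]
        simpa using h2
    · simp

namespace LatticeDatum
variable {L E : Type*} [AddCommGroup L] [AddCommGroup E] [Module ℂ E] {D : LatticeDatum L E}

theorem g_pr_wt (c : Bool) (α β : L) : D.g (D.pr c (D.wt α)) (D.wt β) =
    ((cond c (D.a α β) (D.b α β) : ℝ) : ℂ) := by
  cases c
  · exact (D.b_eq α β).symm
  · exact (D.a_eq α β).symm

theorem pe_comm (α β : L) : D.pe α β = D.pe β α := by
  have h : ∀ c, (cond c (D.a α β) (D.b α β) : ℝ) = cond c (D.a β α) (D.b β α) := fun c => by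
    have h1 := D.g_pr_wt c α β
    rw [pr_adj, g_comm, g_pr_wt] at h1
    exact_mod_cast h1.symm
  exact Prod.ext (h true) (h false)

theorem pe_add_left (α β γ : L) : D.pe (α + β) γ = D.pe α γ + D.pe β γ := by
  have h : ∀ c, (cond c (D.a (α + β) γ) (D.b (α + β) γ) : ℝ) =
      cond c (D.a α γ) (D.b α γ) + cond c (D.a β γ) (D.b β γ) := fun c => by
    have h1 := D.g_pr_wt c (α + β) γ
    rw [map_add, map_add, map_add, LinearMap.add_apply, g_pr_wt, g_pr_wt] at h1
    exact_mod_cast h1.symm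
  exact Prod.ext (h true) (h false)

theorem pe_add_right (α β γ : L) : D.pe α (β + γ) = D.pe α β + D.pe α γ := by
  rw [pe_comm, pe_add_left, pe_comm β, pe_comm γ]

theorem isIntegral_pe (α β : L) : IsIntegral₂ (D.pe α β) := ⟨D.B α β, D.sub_eq α β⟩

/-- Functionals that transform like vertex operators turn `E⁻` into a binomial series. -/
theorem apply_em_mul (c : Bool) (x : E) (τ : ℂ) (r : ℝ) (φ : ℝ × ℝ → Fock E →ₗ[ℂ] ℂ)
    (hφ : ∀ (k : ℕ) (y : ℝ × ℝ) (t : Fock E),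
      φ y (gen k x * t) = -(τ ^ (k + 1) * r * φ (y + ((k + 1 : ℕ) : ℝ) • dv c) t))
    (n : ℕ) (y : ℝ × ℝ) (t : Fock E) :
    φ y (D.em x n * t) = ch r n * (-τ) ^ n * φ (y + (n : ℝ) • dv c) t := by
  induction n using Nat.strong_induction_on generalizing y with
  | _ n ih =>
    rcases Nat.eq_zero_or_pos n with rfl | hn
    · simp [em_zero, ch_zero]
    · have hn0 : (n : ℂ) ≠ 0 := by exact_mod_cast hn.ne'
      apply mul_left_cancel₀ hn0
      have h1 : (n : ℂ) • φ y (D.em x n * t) = φ y (((n : ℂ) • D.em x n) * t) := by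
        rw [smul_mul_assoc, map_smul]
      -- Reversing the summation makes j the degree of the remaining factor of E⁻, to which the
      -- induction hypothesis applies.
      rw [← smul_eq_mul, h1, em_rec, Finset.sum_mul, map_sum, ← Finset.sum_range_reflect]
      have h2 : ∀ j ∈ Finset.range n, φ y (gen (n - 1 - j) x * D.em x (n - (n - 1 - j + 1)) * t) =
          -((-1) ^ j * ch r j * r) * (τ ^ n * φ (y + (n : ℝ) • dv c) t) := by
        intro j hj
        have hj := Finset.mem_range.1 hj
        rw [mul_assoc, hφ, show n - (n - 1 - j + 1) = j by omega, ih j hj,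
          show y + ((n - 1 - j + 1 : ℕ) : ℝ) • dv c + (j : ℝ) • dv c =
            y + ((n - 1 - j + 1 + j : ℕ) : ℝ) • dv c by push_cast; module,
          show n - 1 - j + 1 + j = n by omega]
        conv_rhs => rw [show n = n - 1 - j + 1 + j by omega, pow_add]
        rw [neg_pow τ j, show n - 1 - j + 1 + j = n by omega]
        ring
      rw [Finset.sum_congr rfl h2, ← Finset.sum_mul, Finset.sum_neg_distrib, sum_neg_one_pow_mul_ch,
        neg_pow τ n]
      ring

/-- By the recursion every positive-degree coefficient of E⁻ is a combination of images of creation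
operators. -/
theorem IsVacuum.apply_em {u : Module.Dual ℂ (L →₀ Fock E)} (hu : D.IsVacuum u) (x x' : E) (δ : L)
    (n m : ℕ) (h : n ≠ 0 ∨ m ≠ 0) : u (Finsupp.single δ (D.em x n * D.em x' m)) = 0 := by
  have key : ∀ (x : E) (n : ℕ) (t : Fock E), n ≠ 0 → u (Finsupp.single δ (D.em x n * t)) = 0 := by
    intro x n t hn
    have hn0 : (n : ℂ) ≠ 0 := by exact_mod_cast hn
    apply (smul_eq_zero.1 _).resolve_left hn0
    rw [← map_smul, Finsupp.smul_single, ← smul_mul_assoc, em_rec, Finset.sum_mul]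
    rw [← Finsupp.lsingle_apply (R := ℂ), map_sum, map_sum]
    refine Finset.sum_eq_zero fun k _ => ?_
    rw [Finsupp.lsingle_apply, mul_assoc, ← h_neg_single (D := D), hu]
  rcases h with h | h
  · exact key _ _ _ h
  · rw [mul_comm]
    exact key _ _ _ h

open Classical in
theorem IsVacuum.apply_Y_e_e {u : Module.Dual ℂ (L →₀ Fock E)} (hu : D.IsVacuum u) (α β : L)
    (y : ℝ × ℝ) : u (D.Y y (e α) (e β)) =
      if y = D.pe α β then D.A.ε α β * u (e (α + β)) else 0 := by
  by_cases h : ∃ n m : ℕ, y = D.pe α β + ((n : ℝ), (m : ℝ))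
  · obtain ⟨n, m, rfl⟩ := h
    rw [Y_e_e, map_smul]
    by_cases h0 : n = 0 ∧ m = 0
    · obtain ⟨rfl, rfl⟩ := h0
      simp [em_zero, e]
    · rw [hu.apply_em _ _ _ _ _ (by tauto), smul_zero, if_neg]
      intro h1
      apply h0
      simpa [Prod.ext_iff] using h1
  · push Not at h
    rw [Y_e_e_eq_zero _ _ _ _ h, map_zero, if_neg]
    rintro rfl
    exact h 0 0 (by simp)

/-- Moving e_α to the right past E⁻ of β produces the factor (1-w)^(α,β) in each of the two
variables. -/
theorem IsVacuum.apply_Y_e_single {u : Module.Dual ℂ (L →₀ Fock E)} (hu : D.IsVacuum u) (α β γ : L)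
    (n m : ℕ) (y : ℝ × ℝ) : u (D.Y y (e α) (Finsupp.single γ
      (D.em (D.pr true (D.wt β)) n * D.em (D.pr false (D.wt β)) m))) =
      ch (D.a α β) n * (-1) ^ n * (ch (D.b α β) m * (-1) ^ m) *
        u (D.Y (y + ((n : ℝ), (m : ℝ))) (e α) (e γ)) := by
  have key : ∀ (c : Bool) (n : ℕ) (y : ℝ × ℝ) (t : Fock E),
      u (D.Y y (e α) (Finsupp.single γ (D.em (D.pr c (D.wt β)) n * t))) =
        ch (cond c (D.a β α) (D.b β α)) n * (-1) ^ n *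
          u (D.Y (y + (n : ℝ) • dv c) (e α) (Finsupp.single γ t)) := by
    intro c n y t
    refine apply_em_mul (D := D) c _ 1 _
      (fun y => u ∘ₗ D.Y y (e α) ∘ₗ Finsupp.lsingle γ) (fun k y t => ?_) n y t
    have := congrArg u (D.e_commutator c _ (D.pr_pr c (D.wt β)) (-((k : ℤ) + 1)) α y
      (Finsupp.single γ t))
    rw [hu, map_add, map_smul, h_neg_single] at this
    simp only [LinearMap.comp_apply, Finsupp.lsingle_apply]
    rw [eq_neg_of_add_eq_zero_left this.symm, smul_eq_mul, g_pr_wt, one_pow, one_mul,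
      show y - ((-((k : ℤ) + 1) : ℤ) : ℝ) • dv c = y + ((k + 1 : ℕ) : ℝ) • dv c by
        push_cast; module]
  have h1 := pe_comm (D := D) β α
  rw [key, ← mul_one (D.em (D.pr false (D.wt β)) m), key,
    show y + (n : ℝ) • dv true + (m : ℝ) • dv false = y + ((n : ℝ), (m : ℝ)) by simp [dv, add_assoc]]
  simp only [cond_true, cond_false, show D.a β α = D.a α β from congrArg Prod.fst h1,
    show D.b β α = D.b α β from congrArg Prod.snd h1]
  rw [e, e]
  ring

/-- Inside an iterated product the factor E⁻ of α is converted by normal ordering into zero modes on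
e_β; here this gives (1+w)^(α,β) in each of the two variables. -/
theorem IsVacuum.apply_Y_single_e {u : Module.Dual ℂ (L →₀ Fock E)} (hu : D.IsVacuum u) (α β γ : L)
    (n m : ℕ) (y : ℝ × ℝ) : u (D.Y y (Finsupp.single γ
      (D.em (D.pr true (D.wt α)) n * D.em (D.pr false (D.wt α)) m)) (e β)) =
      ch (D.a α β) n * ch (D.b α β) m * u (D.Y (y + ((n : ℝ), (m : ℝ))) (e γ) (e β)) := by
  have key : ∀ (c : Bool) (n : ℕ) (y : ℝ × ℝ) (t : Fock E),
      u (D.Y y (Finsupp.single γ (D.em (D.pr c (D.wt α)) n * t)) (e β)) =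
        ch (cond c (D.a α β) (D.b α β)) n *
          u (D.Y (y + (n : ℝ) • dv c) (Finsupp.single γ t) (e β)) := by
    intro c n y t
    have := apply_em_mul (D := D) c (D.pr c (D.wt α)) (-1) (cond c (D.a α β) (D.b α β))
      (fun y => u ∘ₗ (LinearMap.applyₗ (e β)) ∘ₗ D.Y y ∘ₗ Finsupp.lsingle γ) (fun k y t => ?_) n y t
    · rw [neg_neg, one_pow, mul_one] at this
      exact this
    · simp only [LinearMap.comp_apply, Finsupp.lsingle_apply, LinearMap.applyₗ_apply_apply]
      rw [← h_neg_single (D := D), hu.apply_Y_h c k _ (D.pr_pr c _) _ _ y 1 fun i hi =>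
        D.h_e_pos _ (by omega) _ _, Finset.sum_range_one, Nat.cast_zero, e, h_zero_single, map_smul,
        map_smul, g_pr_wt, zero_add, Nat.choose_self, pow_succ, smul_eq_mul]
      push_cast
      ring
  rw [key, ← mul_one (D.em (D.pr false (D.wt α)) m), key,
    show y + (n : ℝ) • dv true + (m : ℝ) • dv false = y + ((n : ℝ), (m : ℝ)) by simp [dv, add_assoc]]
  rw [e, e]
  simp only [cond_true, cond_false]
  ring

theorem IsVacuum.apply_Y_e_Y_e_e {u : Module.Dual ℂ (L →₀ Fock E)} (hu : D.IsVacuum u) (α β γ : L) :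
    (fun s l => u (D.Y l (e α) (D.Y s (e β) (e γ))) : Ser) =
      (D.A.ε β γ * D.A.ε α (β + γ) * u (e (α + (β + γ)))) •
        basicSeries (-1) (D.pe α β) (D.pe β γ) (D.pe α γ + D.pe β γ + D.pe α β) := by
  refine eq_smul_basicSeries _ _ _ _ _ (fun s l hs => ?_) fun n m l => ?_
  · rw [Y_e_e_eq_zero _ _ _ _ hs, map_zero, map_zero]
  · rw [Y_e_e, map_smul, map_smul, hu.apply_Y_e_single, hu.apply_Y_e_e, pe_add_right]
    have h1 : l + ((n : ℝ), (m : ℝ)) = D.pe α β + D.pe α γ ↔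
        D.pe β γ + ((n : ℝ), (m : ℝ)) + l = D.pe α γ + D.pe β γ + D.pe α β := by
      constructor <;> intro h
      · linear_combination h
      · linear_combination h
    simp only [h1]
    split_ifs
    · rw [smul_eq_mul]
      change _ = _ * (ch (D.a α β) n * _ * (ch (D.b α β) m * _))
      ring
    · simp

theorem IsVacuum.apply_Y_Y_e_e_e {u : Module.Dual ℂ (L →₀ Fock E)} (hu : D.IsVacuum u) (α β γ : L) :
    (fun s l => u (D.Y l (D.Y s (e α) (e β)) (e γ)) : Ser) =
      (D.A.ε α β * D.A.ε (α + β) γ * u (e (α + β + γ))) •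
        basicSeries 1 (D.pe α γ) (D.pe α β) (D.pe α γ + D.pe β γ + D.pe α β) := by
  refine eq_smul_basicSeries _ _ _ _ _ (fun s l hs => ?_) fun n m l => ?_
  · rw [Y_e_e_eq_zero _ _ _ _ hs, map_zero, LinearMap.zero_apply, map_zero]
  · rw [Y_e_e, map_smul, LinearMap.smul_apply, map_smul, hu.apply_Y_single_e, hu.apply_Y_e_e,
      pe_add_left]
    have h1 : l + ((n : ℝ), (m : ℝ)) = D.pe α γ + D.pe β γ ↔
        D.pe α β + ((n : ℝ), (m : ℝ)) + l = D.pe α γ + D.pe β γ + D.pe α β := by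
      constructor <;> intro h
      · linear_combination h
      · linear_combination h
    simp only [h1]
    split_ifs
    · rw [smul_eq_mul, one_pow, one_pow]
      change _ = _ * (ch (D.a α γ) n * _ * (ch (D.b α γ) m * _))
      ring
    · simp

/-- Associativity of the twisted group algebra gives the first two components the same scalar. The
third is the first with α and β exchanged; the resulting factor (-1)^(α,β) equals the sign of
(z₁-z₂)^x₁₂ expanded at |z₂| > |z₁|, because x₁₂ has spin (α,β). -/
theorem IsVacuum.corr_e_e_e {u : Module.Dual ℂ (L →₀ Fock E)} (hu : D.IsVacuum u) (α β γ : L) :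
    D.corr u (e α) (e β) (e γ) = (D.A.ε α β * D.A.ε (α + β) γ * u (e (α + β + γ))) •
      monomialTriple (D.pe α γ) (D.pe β γ) (D.pe α β) := by
  have h1 := hu.apply_Y_e_Y_e_e α β γ
  have h2 := hu.apply_Y_Y_e_e_e α β γ
  have h3 := hu.apply_Y_e_Y_e_e β α γ
  rw [← D.A.assoc, ← add_assoc] at h1 h3
  rw [D.A.comm β α, pe_comm β α, add_comm β α, add_comm (D.pe β γ)] at h3
  have h4 : ⌊(D.pe α β).1 - (D.pe α β).2⌋ = D.B α β := by
    rw [show (D.pe α β).1 - (D.pe α β).2 = D.B α β from D.sub_eq α β, Int.floor_intCast]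
  refine Prod.ext h1 (Prod.ext h2 (h3.trans ?_))
  change _ = _ • (_ • _ : Ser)
  rw [h4, smul_smul]
  congr 1
  have h5 : D.B α β = D.B β α := by
    have h6 := D.sub_eq α β
    rw [show D.a α β = D.a β α from congrArg Prod.fst (pe_comm α β),
      show D.b α β = D.b β α from congrArg Prod.snd (pe_comm α β), D.sub_eq β α] at h6
    exact_mod_cast h6.symm
  rw [h5]
  ring

section Linearity
variable (D) (u u' : Module.Dual ℂ (L →₀ Fock E)) (a a' b b' v v' : L →₀ Fock E) (t : ℂ)

theorem corr_add_left : D.corr u (a + a') b v = D.corr u a b v + D.corr u a' b v :=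
  corr_ext (fun s l => by simp [corr]) (fun s l => by simp [corr]) fun s l => by simp [corr]

theorem corr_smul_left : D.corr u (t • a) b v = t • D.corr u a b v :=
  corr_ext (fun s l => by simp [corr]) (fun s l => by simp [corr]) fun s l => by simp [corr]

theorem corr_add_mid : D.corr u a (b + b') v = D.corr u a b v + D.corr u a b' v :=
  corr_ext (fun s l => by simp [corr]) (fun s l => by simp [corr]) fun s l => by simp [corr]

theorem corr_smul_mid : D.corr u a (t • b) v = t • D.corr u a b v :=
  corr_ext (fun s l => by simp [corr]) (fun s l => by simp [corr]) fun s l => by simp [corr]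

theorem corr_add_right : D.corr u a b (v + v') = D.corr u a b v + D.corr u a b v' :=
  corr_ext (fun s l => by simp [corr]) (fun s l => by simp [corr]) fun s l => by simp [corr]

theorem corr_smul_right : D.corr u a b (t • v) = t • D.corr u a b v :=
  corr_ext (fun s l => by simp [corr]) (fun s l => by simp [corr]) fun s l => by simp [corr]

theorem corr_add_dual : D.corr (u + u') a b v = D.corr u a b v + D.corr u' a b v :=
  corr_ext (fun s l => by simp [corr]) (fun s l => by simp [corr]) fun s l => by simp [corr]

theorem corr_smul_dual : D.corr (t • u) a b v = t • D.corr u a b v :=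
  corr_ext (fun s l => by simp [corr]) (fun s l => by simp [corr]) fun s l => by simp [corr]

end Linearity

theorem h_natCast_e (j : ℕ) (x : E) (α : L) :
    D.h j x (e α) = (if j = 0 then D.g x (D.wt α) else 0) • e α := by
  rcases Nat.eq_zero_or_pos j with rfl | hj
  · exact D.h_zero_single x α 1
  · rw [D.h_e_pos _ (by omega), if_neg hj.ne', zero_smul]

/-- Creation operators are stripped first from a, then from b, then from v. Each step expresses the
triple through shorter ones multiplied by powers of z₁, z₂ and z₁ - z₂, under which the span is
stable. -/
theorem IsVacuum.corr_mem {u : Module.Dual ℂ (L →₀ Fock E)} (hu : D.IsVacuum u)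
    (a b v : L →₀ Fock E) : D.corr u a b v ∈ monomialSpan := by
  induction a using D.induction generalizing b v with
  | add a a' ha ha' =>
    rw [corr_add_left]
    exact add_mem (ha b v) (ha' b v)
  | smul t a ha =>
    rw [corr_smul_left]
    exact Submodule.smul_mem _ _ (ha b v)
  | h c k x a hx ha =>
    obtain ⟨M, hM⟩ := (hu.corr_h c k x hx a b v).exists
    rw [hM]
    exact add_mem (Submodule.sum_mem _ fun i _ => Submodule.smul_mem _ _ (mulZ₁_mem _ _ (ha _ _)))
      (Submodule.sum_mem _ fun i _ => Submodule.smul_mem _ _ (mulZ₁₂_mem _ _ (ha _ _)))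
  | e α =>
    induction b using D.induction generalizing v with
    | add b b' hb hb' =>
      rw [corr_add_mid]
      exact add_mem (hb v) (hb' v)
    | smul t b hb =>
      rw [corr_smul_mid]
      exact Submodule.smul_mem _ _ (hb v)
    | h c k x b hx hb =>
      obtain ⟨M, hM⟩ := (hu.corr_e_h c k x hx α b v).exists
      rw [hM]
      exact sub_mem (Submodule.sum_mem _ fun i _ => Submodule.smul_mem _ _ (mulZ₂_mem _ _ (hb _)))
        (Submodule.smul_mem _ _ (mulZ₁₂_mem _ _ (hb _)))
    | e β =>
      induction v using D.induction with
      | add v v' hv hv' =>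
        rw [corr_add_right]
        exact add_mem hv hv'
      | smul t v hv =>
        rw [corr_smul_right]
        exact Submodule.smul_mem _ _ hv
      | h c k x v hx hv =>
        -- The functional composed with x(-k-1) is zero, so the Ward identity can be solved for the
        -- term with x(-k-1) on v; on e_α and e_β the modes x(j) act as scalars.
        obtain ⟨M, hM⟩ := (D.corr_comp_h c x hx (-((k : ℤ) + 1)) u (e α) (e β) v).exists
        have h0 : D.corr (u ∘ₗ D.h (-((k : ℤ) + 1)) x) (e α) (e β) v = 0 :=
          corr_ext (fun s l => hu k x _) (fun s l => hu k x _) fun s l => hu k x _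
        rw [h0] at hM
        rw [eq_neg_of_add_eq_zero_right hM.symm]
        refine neg_mem (add_mem (Submodule.sum_mem _ fun i _ => Submodule.smul_mem _ _
          (mulZ₁_mem _ _ ?_)) (Submodule.sum_mem _ fun i _ => Submodule.smul_mem _ _
          (mulZ₂_mem _ _ ?_)))
        · rw [h_natCast_e, corr_smul_left]
          exact Submodule.smul_mem _ _ hv
        · rw [h_natCast_e, corr_smul_mid]
          exact Submodule.smul_mem _ _ hv
      | e γ =>
        rw [hu.corr_e_e_e]
        exact Submodule.smul_mem _ _ (Submodule.subset_span ⟨_, _, _, isIntegral_pe _ _,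
          isIntegral_pe _ _, isIntegral_pe _ _, rfl⟩)

end LatticeDatum

/-! ### Grading of the Fock space by charge and weight -/

theorem level_dv (c : Bool) (k : ℕ) : ((k + 1 : ℕ) : ℝ) • dv c =
    (((cond c (k + 1) 0 : ℕ) : ℝ), ((cond c 0 (k + 1) : ℕ) : ℝ)) := by
  cases c <;> simp [dv]

namespace LatticeDatum
variable {L E : Type*} [AddCommGroup L] [AddCommGroup E] [Module ℂ E] (D : LatticeDatum L E)

/-- The left or the right part of `E`. -/
def part (c : Bool) : Submodule ℂ E := LinearMap.eqLocus (D.pr c) LinearMap.id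

theorem mem_part {c : Bool} {x : E} : x ∈ D.part c ↔ D.pr c x = x := Iff.rfl

theorem pr_mem_part (c : Bool) (x : E) : D.pr c x ∈ D.part c := D.pr_pr c x

/-- The part of the Fock space of the given left and right levels. -/
def fockPart (i : ℕ × ℕ) : Submodule ℂ (Fock E) := fockLevel (D.part true) (D.part false) i.1 i.2

instance : SetLike.GradedMonoid D.fockPart where
  one_mem := Submodule.subset_span ⟨[], [], by simp⟩
  mul_mem := by
    intro i j s t hs ht
    have := Submodule.mul_mem_mul hs ht
    rw [fockPart, fockPart, fockLevel, fockLevel, Submodule.span_mul_span] at this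
    refine Submodule.span_mono ?_ this
    rintro _ ⟨_, ⟨l, l', h1, h2, h3, h4, rfl⟩, _, ⟨r, r', k1, k2, k3, k4, rfl⟩, rfl⟩
    refine ⟨l ++ r, l' ++ r', ?_, ?_, ?_, ?_, ?_⟩
    · simp only [List.mem_append]
      rintro x (hx | hx)
      exacts [h1 x hx, k1 x hx]
    · simp only [List.mem_append]
      rintro x (hx | hx)
      exacts [h2 x hx, k2 x hx]
    · rw [List.map_append, List.sum_append, h3, k3]; rfl
    · rw [List.map_append, List.sum_append, h4, k4]; rfl
    · simp only [List.map_append, List.prod_append]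
      ring

/-- The level of `x(-k-1)` for `x` in the given part. -/
def lev (c : Bool) (k : ℕ) : ℕ × ℕ := (cond c (k + 1) 0, cond c 0 (k + 1))

theorem gen_mem_fockPart (c : Bool) (k : ℕ) {x : E} (hx : x ∈ D.part c) :
    gen k x ∈ D.fockPart (lev c k) := by
  cases c
  · exact Submodule.subset_span ⟨[], [(k, x)], by simpa [lev] using hx⟩
  · exact Submodule.subset_span ⟨[(k, x)], [], by simpa [lev] using hx⟩

/-- The decomposition of the Fock space into the parts of given levels. -/
def fockDecompose : Fock E →ₐ[ℂ] DirectSum (ℕ × ℕ) fun i => D.fockPart i :=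
  Fock.lift (Finsupp.lsum ℂ fun k => ∑ c : Bool,
    DirectSum.lof ℂ (ℕ × ℕ) (fun i => D.fockPart i) (lev c k) ∘ₗ
      (gen k ∘ₗ D.pr c).codRestrict (D.fockPart (lev c k)) fun x =>
        D.gen_mem_fockPart c k (D.pr_mem_part c x))

theorem fockDecompose_gen (c : Bool) (k : ℕ) {x : E} (hx : x ∈ D.part c) :
    D.fockDecompose (gen k x) =
      DirectSum.of (fun i => D.fockPart i) (lev c k) ⟨gen k x, D.gen_mem_fockPart c k hx⟩ := by
  refine (Fock.lift_ι _ (Finsupp.single k x)).trans ?_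
  simp only [Finsupp.lsum_apply, Finsupp.lsingle_apply, map_zero, Finsupp.sum_single_index]
  rw [LinearMap.sum_apply, Fintype.sum_eq_single c]
  · rw [LinearMap.comp_apply, DirectSum.lof_eq_of]
    congr 1
    exact Subtype.ext (congrArg (gen k) hx)
  · intro c' hc
    rw [LinearMap.comp_apply]
    refine (congrArg _ (Subtype.ext ?_)).trans (map_zero _)
    have h0 : D.pr c' x = 0 := by rw [← (D.mem_part.1 hx), D.pr_pr_of_ne hc]
    change gen k (D.pr c' x) = 0
    rw [h0, map_zero]

/-- The decomposition map is an algebra homomorphism, so it suffices that it returns each generator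
correctly and that a monomial of given left and right levels is sent to that single summand. -/
instance fockGraded : GradedAlgebra D.fockPart :=
  GradedAlgebra.ofAlgHom D.fockPart D.fockDecompose (by
    refine AlgHom.ext fun s => ?_
    rw [AlgHom.comp_apply, AlgHom.id_apply]
    induction s using Fock.induction with
    | algebraMap r => rw [AlgHom.commutes, AlgHom.commutes]
    | mul a b ha hb => rw [map_mul, map_mul, ha, hb]
    | add a b ha hb => rw [map_add, map_add, ha, hb]
    | ι v =>
      induction v using Finsupp.induction_linear with
      | zero => simp
      | add a b ha hb => simp only [map_add, ha, hb]
      | single k x =>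
        change DirectSum.coeAlgHom _ (D.fockDecompose (gen k x)) = gen k x
        conv_lhs => rw [← D.pr_add x, map_add, map_add,
          D.fockDecompose_gen true k (D.pr_mem_part _ _),
          D.fockDecompose_gen false k (D.pr_mem_part _ _), map_add, DirectSum.coeAlgHom_of,
          DirectSum.coeAlgHom_of]
        rw [← map_add, D.pr_add])
  (by
    have one : D.fockDecompose 1 = DirectSum.of (fun i => D.fockPart i) 0
      ⟨1, SetLike.GradedOne.one_mem⟩ := map_one _
    have mul : ∀ i j s t, (∃ hs : s ∈ D.fockPart i, D.fockDecompose s =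
        DirectSum.of (fun i => D.fockPart i) i ⟨s, hs⟩) → (∃ ht : t ∈ D.fockPart j,
        D.fockDecompose t = DirectSum.of (fun i => D.fockPart i) j ⟨t, ht⟩) →
        ∃ hst : s * t ∈ D.fockPart (i + j), D.fockDecompose (s * t) =
          DirectSum.of (fun i => D.fockPart i) (i + j) ⟨s * t, hst⟩ := by
      rintro i j s t ⟨hs, h1⟩ ⟨ht, h2⟩
      refine ⟨SetLike.GradedMul.mul_mem hs ht, ?_⟩
      rw [map_mul, h1, h2, DirectSum.of_mul_of]
      rfl
    have list : ∀ (c : Bool) (l : List (ℕ × E)), (∀ x ∈ l, x.2 ∈ D.part c) → ∀ i : ℕ × ℕ,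
        i = (cond c (l.map fun x => x.1 + 1).sum 0, cond c 0 (l.map fun x => x.1 + 1).sum) →
        ∃ h : (l.map fun x => gen x.1 x.2).prod ∈ D.fockPart i,
          D.fockDecompose (l.map fun x => gen x.1 x.2).prod =
            DirectSum.of (fun i => D.fockPart i) i ⟨_, h⟩ := by
      intro c l
      induction l with
      | nil =>
        rintro - i rfl
        cases c <;> exact ⟨SetLike.GradedOne.one_mem, one⟩
      | cons x l ih =>
        rintro hl i rfl
        have h1 := ih (fun y hy => hl y (List.mem_cons_of_mem _ hy)) _ rfl
        have h2 := hl x List.mem_cons_self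
        have := mul (lev c x.1) _ _ _ ⟨D.gen_mem_fockPart c x.1 h2, D.fockDecompose_gen c x.1 h2⟩ h1
        have e1 : (cond c ((x :: l).map fun x => x.1 + 1).sum 0,
            cond c 0 ((x :: l).map fun x => x.1 + 1).sum) = lev c x.1 +
            (cond c (l.map fun x => x.1 + 1).sum 0, cond c 0 (l.map fun x => x.1 + 1).sum) := by
          cases c <;> rfl
        rw [e1]
        exact this
    rintro i ⟨s, hs⟩
    have key : ∃ h : s ∈ D.fockPart i, D.fockDecompose s =
        DirectSum.of (fun i => D.fockPart i) i ⟨s, h⟩ := by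
      refine Submodule.span_induction (p := fun s _ => ∃ h : s ∈ D.fockPart i, D.fockDecompose s =
        DirectSum.of (fun i => D.fockPart i) i ⟨s, h⟩) ?_ ?_ ?_ ?_ hs
      · rintro _ ⟨l, l', h1, h2, h3, h4, rfl⟩
        have hi : i = ((l.map fun x => x.1 + 1).sum, 0) + (0, (l'.map fun x => x.1 + 1).sum) :=
          Prod.ext (by simp [h3]) (by simp [h4])
        rw [hi]
        exact mul _ _ _ _ (list true l h1 _ rfl) (list false l' h2 _ rfl)
      · exact ⟨zero_mem _, (map_zero _).trans (map_zero _).symm⟩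
      · rintro s t _ _ ⟨h1, hs⟩ ⟨h2, ht⟩
        refine ⟨add_mem h1 h2, ?_⟩
        rw [map_add, hs, ht, ← map_add]
        rfl
      · rintro r s _ ⟨h1, hs⟩
        refine ⟨Submodule.smul_mem _ _ h1, ?_⟩
        rw [map_smul, hs, ← DirectSum.lof_eq_of ℂ, ← map_smul]
        rfl
    exact key.2)

/-- The weight of `e_α`. -/
def wtE (α : L) : ℝ × ℝ := (D.a α α / 2, D.b α α / 2)

/-- The part of charge `δ` and weight `y`. -/
def U (δ : L) (y : ℝ × ℝ) : Submodule ℂ (L →₀ Fock E) :=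
  ⨆ (n : ℕ) (m : ℕ) (_ : y.1 = D.a δ δ / 2 + n ∧ y.2 = D.b δ δ / 2 + m),
    (fockLevel (D.part true) (D.part false) n m).map (Finsupp.lsingle δ)

theorem U_eq (δ : L) (i : ℕ × ℕ) : D.U δ (D.wtE δ + ((i.1 : ℝ), (i.2 : ℝ))) =
    (D.fockPart i).map (Finsupp.lsingle δ) := by
  refine le_antisymm ?_ ?_
  · refine iSup_le fun n => iSup_le fun m => iSup_le fun h => ?_
    have h1 : n = i.1 := by
      have : (i.1 : ℝ) = n := add_left_cancel h.1
      exact_mod_cast this.symm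
    have h2 : m = i.2 := by
      have : (i.2 : ℝ) = m := add_left_cancel h.2
      exact_mod_cast this.symm
    rw [h1, h2]
    rfl
  · exact le_iSup_of_le i.1 (le_iSup_of_le i.2 (le_iSup_of_le ⟨rfl, rfl⟩ le_rfl))

theorem U_eq_bot {δ : L} {y : ℝ × ℝ} (h : ∀ n m : ℕ, y ≠ D.wtE δ + ((n : ℝ), (m : ℝ))) :
    D.U δ y = ⊥ := by
  refine le_bot_iff.1 (iSup_le fun n => iSup_le fun m => iSup_le fun h1 => ?_)
  exact absurd (Prod.ext h1.1 h1.2) (h n m)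

theorem single_mem_U {δ : L} {i : ℕ × ℕ} {s : Fock E} (hs : s ∈ D.fockPart i) :
    Finsupp.single δ s ∈ D.U δ (D.wtE δ + ((i.1 : ℝ), (i.2 : ℝ))) := by
  rw [U_eq]
  exact ⟨s, hs, rfl⟩

theorem e_mem_U (α : L) : e α ∈ D.U α (D.wtE α) := by
  have := D.single_mem_U (δ := α) (i := 0) (s := 1) SetLike.GradedOne.one_mem
  simpa [e, ← Prod.zero_eq_mk] using this

theorem h_neg_mem_U (c : Bool) (k : ℕ) {x : E} (hx : D.pr c x = x) {δ : L} {y : ℝ × ℝ}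
    {v : L →₀ Fock E} (hv : v ∈ D.U δ y) :
    D.h (-((k : ℤ) + 1)) x v ∈ D.U δ (y + ((k + 1 : ℕ) : ℝ) • dv c) := by
  by_cases h : ∃ n m : ℕ, y = D.wtE δ + ((n : ℝ), (m : ℝ))
  · obtain ⟨n, m, rfl⟩ := h
    rw [D.U_eq δ (n, m)] at hv
    obtain ⟨s, hs, rfl⟩ := hv
    rw [Finsupp.lsingle_apply, h_neg_single]
    have := D.single_mem_U (δ := δ) (SetLike.GradedMul.mul_mem (D.gen_mem_fockPart c k hx) hs)
    convert this using 2
    rw [level_dv, add_assoc]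
    congr 1
    refine Prod.ext ?_ ?_ <;> simp only [lev, Prod.fst_add, Prod.snd_add] <;> push_cast <;>
      exact add_comm _ _
  · push Not at h
    rw [U_eq_bot _ h, Submodule.mem_bot] at hv
    rw [hv, map_zero]
    exact zero_mem _

/-- A homogeneous monomial is built from e_δ by creation operators lying in one of the two parts, so
weights can be tracked along the induction. The case of zero is required at every weight because U δ
y is trivial away from the weights above that of e_δ. -/
theorem U_induction {motive : L → ℝ × ℝ → (L →₀ Fock E) → Prop} (zero : ∀ δ y, motive δ y 0)
    (e : ∀ α, motive α (D.wtE α) (e α))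
    (add : ∀ δ y v w, motive δ y v → motive δ y w → motive δ y (v + w))
    (smul : ∀ δ y (t : ℂ) v, motive δ y v → motive δ y (t • v))
    (h : ∀ c (k : ℕ) x δ y v, D.pr c x = x → v ∈ D.U δ y →
      (∃ n m : ℕ, y = D.wtE δ + ((n : ℝ), (m : ℝ))) → motive δ y v →
      motive δ (y + ((k + 1 : ℕ) : ℝ) • dv c) (D.h (-((k : ℤ) + 1)) x v))
    {δ : L} {y : ℝ × ℝ} {v : L →₀ Fock E} (hv : v ∈ D.U δ y) : motive δ y v := by
  by_cases hy : ∃ n m : ℕ, y = D.wtE δ + ((n : ℝ), (m : ℝ))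
  · obtain ⟨n, m, rfl⟩ := hy
    rw [D.U_eq δ (n, m)] at hv
    obtain ⟨s, hs, rfl⟩ := hv
    have step : ∀ (c : Bool) (k : ℕ) (x : E) (i : ℕ × ℕ) (t : Fock E), x ∈ D.part c →
        t ∈ D.fockPart i → motive δ (D.wtE δ + ((i.1 : ℝ), (i.2 : ℝ))) (Finsupp.single δ t) →
        motive δ (D.wtE δ + (((lev c k + i).1 : ℝ), ((lev c k + i).2 : ℝ)))
          (Finsupp.single δ (gen k x * t)) := by
      intro c k x i t hx ht hm
      have := h c k x _ _ _ hx (D.single_mem_U ht) ⟨i.1, i.2, rfl⟩ hm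
      rw [h_neg_single, level_dv, add_assoc] at this
      convert this using 2
      refine Prod.ext ?_ ?_ <;> simp only [lev, Prod.fst_add, Prod.snd_add] <;> push_cast <;>
        exact add_comm _ _
    -- A whole list of factors from one part is applied at once; it is used first for the right
    -- factors acting on e_δ and then for the left ones.
    have list : ∀ (c : Bool) (l : List (ℕ × E)) (i j : ℕ × ℕ) (t : Fock E), t ∈ D.fockPart i →
        (∀ x ∈ l, x.2 ∈ D.part c) → motive δ (D.wtE δ + ((i.1 : ℝ), (i.2 : ℝ))) (Finsupp.single δ t) →
        j = (cond c (l.map fun x => x.1 + 1).sum 0, cond c 0 (l.map fun x => x.1 + 1).sum) + i →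
        (l.map fun x => gen x.1 x.2).prod * t ∈ D.fockPart j ∧
        motive δ (D.wtE δ + ((j.1 : ℝ), (j.2 : ℝ)))
          (Finsupp.single δ ((l.map fun x => gen x.1 x.2).prod * t)) := by
      intro c l i j t ht hl hm hj
      induction l generalizing j with
      | nil =>
        have : j = i := by rw [hj]; cases c <;> exact zero_add i
        rw [this]
        simpa using ⟨ht, hm⟩
      | cons x l ih =>
        obtain ⟨h1, h2⟩ := ih _ (fun y hy => hl y (List.mem_cons_of_mem _ hy)) rfl
        have hx := hl x List.mem_cons_self
        have e1 : j = lev c x.1 + ((cond c (l.map fun x => x.1 + 1).sum 0,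
            cond c 0 (l.map fun x => x.1 + 1).sum) + i) := by
          rw [hj, ← add_assoc]
          cases c <;> rfl
        rw [List.map_cons, List.prod_cons, mul_assoc, e1]
        exact ⟨SetLike.GradedMul.mul_mem (D.gen_mem_fockPart c x.1 hx) h1,
          step c x.1 x.2 _ _ hx h1 h2⟩
    have hs' : s ∈ Submodule.span ℂ {s | _} := hs
    clear hs
    rw [Finsupp.lsingle_apply]
    induction hs' using Submodule.span_induction with
    | mem s h =>
      obtain ⟨l, l', h1, h2, h3, h4, rfl⟩ := h
      obtain ⟨k1, k2⟩ := list false l' 0 _ 1 SetLike.GradedOne.one_mem h2 (by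
        simpa [LatticeDatum.e, ← Prod.zero_eq_mk] using e δ) rfl
      rw [mul_one] at k1 k2
      refine (list true l _ (n, m) _ k1 h1 k2 (Prod.ext ?_ ?_)).2
      · simp only [cond_true, cond_false, Prod.fst_add, Prod.fst_zero, add_zero]
        exact h3.symm
      · simp only [cond_true, cond_false, Prod.snd_add, Prod.snd_zero, add_zero, zero_add]
        exact h4.symm
    | zero => simpa using zero _ _
    | add s t _ _ hs ht =>
      rw [Finsupp.single_add]
      exact add _ _ _ _ hs ht
    | smul r s _ hs =>
      rw [← Finsupp.smul_single]
      exact smul _ _ _ _ hs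
  · push Not at hy
    rw [U_eq_bot _ hy, Submodule.mem_bot] at hv
    rw [hv]
    exact zero _ _

end LatticeDatum

/-! ### Weights of products, the Euler operator and homogeneous functionals -/

namespace LatticeDatum
variable {L E : Type*} [AddCommGroup L] [AddCommGroup E] [Module ℂ E] (D : LatticeDatum L E)

theorem eq_of_mem_U {δ : L} {y : ℝ × ℝ} {v : L →₀ Fock E} (hv : v ∈ D.U δ y) (h0 : v ≠ 0) :
    ∃ n m : ℕ, y = D.wtE δ + ((n : ℝ), (m : ℝ)) := by
  by_contra hc
  push Not at hc
  rw [U_eq_bot _ hc, Submodule.mem_bot] at hv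
  exact h0 hv

theorem h_mem_U (c : Bool) (n : ℤ) {x : E} (hx : D.pr c x = x) {δ : L} {y : ℝ × ℝ}
    {v : L →₀ Fock E} (hv : v ∈ D.U δ y) : D.h n x v ∈ D.U δ (y - (n : ℝ) • dv c) := by
  obtain hn | hn := lt_or_ge n 0
  · obtain ⟨k, rfl⟩ : ∃ k : ℕ, n = -((k : ℤ) + 1) := ⟨(-n - 1).toNat, by omega⟩
    have := D.h_neg_mem_U c k hx hv
    rwa [show y - ((-((k : ℤ) + 1) : ℤ) : ℝ) • dv c = y + ((k + 1 : ℕ) : ℝ) • dv c by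
      push_cast; module]
  · refine D.U_induction (motive := fun δ y v => D.h n x v ∈ D.U δ (y - (n : ℝ) • dv c)) ?_ ?_ ?_ ?_ ?_ hv
    · intro δ y
      rw [map_zero]
      exact zero_mem _
    · intro α
      rcases hn.eq_or_lt with rfl | hn
      · rw [e, h_zero_single, Int.cast_zero, zero_smul, sub_zero]
        exact Submodule.smul_mem _ _ (D.e_mem_U α)
      · rw [D.h_e_pos _ hn]
        exact zero_mem _
    · intro δ y v w h1 h2
      rw [map_add]
      exact add_mem h1 h2
    · intro δ y t v h1
      rw [map_smul]
      exact Submodule.smul_mem _ _ h1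
    · intro c' k x' δ y v hx' hv _ ih
      rw [h_commutator]
      refine add_mem ?_ ?_
      · have := D.h_neg_mem_U c' k hx' ih
        rwa [sub_add_eq_add_sub] at this
      · split_ifs with h0
        · by_cases hc : c = c'
          · subst hc
            have : y + ((k + 1 : ℕ) : ℝ) • dv c - (n : ℝ) • dv c = y := by
              rw [show n = (k : ℤ) + 1 by omega]
              push_cast
              module
            rw [this]
            exact Submodule.smul_mem _ _ hv
          · rw [D.g_eq_zero hc hx hx', mul_zero, zero_smul]
            exact zero_mem _
        · rw [zero_smul]
          exact zero_mem _

theorem em_mul_mem_U (c : Bool) {x : E} (hx : D.pr c x = x) (n : ℕ) {δ : L} {y : ℝ × ℝ} {t : Fock E}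
    (ht : Finsupp.single δ t ∈ D.U δ y) :
    Finsupp.single δ (D.em x n * t) ∈ D.U δ (y + (n : ℝ) • dv c) := by
  induction n using Nat.strong_induction_on with
  | _ n ih =>
    rcases Nat.eq_zero_or_pos n with rfl | hn
    · simpa [em_zero] using ht
    · have hn0 : (n : ℂ) ≠ 0 := by exact_mod_cast hn.ne'
      rw [← Submodule.smul_mem_iff _ hn0, Finsupp.smul_single, ← smul_mul_assoc, em_rec,
        Finset.sum_mul, ← Finsupp.lsingle_apply (R := ℂ), map_sum]
      refine Submodule.sum_mem _ fun k hk => ?_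
      have hk := Finset.mem_range.1 hk
      have := D.h_neg_mem_U c k hx (ih (n - (k + 1)) (by omega))
      rw [h_neg_single, ← mul_assoc] at this
      rw [show y + (n : ℝ) • dv c = y + ((n - (k + 1) : ℕ) : ℝ) • dv c + ((k + 1 : ℕ) : ℝ) • dv c by
        rw [Nat.cast_sub (by omega)]; module]
      exact this

/-- Polarization: half of (α+β, α+β) exceeds the two halves by (α,β), which is the leading exponent
of e_α(z)e_β. -/
theorem wtE_add (α β : L) : D.wtE (α + β) = D.wtE α + D.wtE β + D.pe α β := by
  have h : D.pe (α + β) (α + β) = D.pe α α + D.pe β β + D.pe α β + D.pe α β := by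
    rw [pe_add_left, pe_add_right, pe_add_right, pe_comm β α]
    abel
  have h1 := congrArg Prod.fst h
  have h2 := congrArg Prod.snd h
  simp only [pe, Prod.fst_add, Prod.snd_add] at h1 h2
  refine Prod.ext ?_ ?_
  · simp only [wtE, pe, Prod.fst_add]
    linarith
  · simp only [wtE, pe, Prod.snd_add]
    linarith

theorem Y_e_e_mem_U (α β : L) (x : ℝ × ℝ) :
    D.Y x (e α) (e β) ∈ D.U (α + β) (D.wtE α + D.wtE β + x) := by
  by_cases h : ∃ n m : ℕ, x = D.pe α β + ((n : ℝ), (m : ℝ))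
  · obtain ⟨n, m, rfl⟩ := h
    rw [Y_e_e]
    refine Submodule.smul_mem _ _ ?_
    have h1 := D.em_mul_mem_U true (D.pr_pr true (D.wt α)) n
      (D.em_mul_mem_U false (D.pr_pr false (D.wt α)) m (D.e_mem_U (α + β)))
    rw [mul_one, wtE_add] at h1
    convert h1 using 2
    simp [dv, Prod.ext_iff]
    constructor <;> ring
  · push Not at h
    rw [Y_e_e_eq_zero _ _ _ _ h]
    exact zero_mem _

theorem Y_e_mem_U (α : L) (x : ℝ × ℝ) {β : L} {y : ℝ × ℝ} {w : L →₀ Fock E} (hw : w ∈ D.U β y) :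
    D.Y x (e α) w ∈ D.U (α + β) (D.wtE α + y + x) := by
  refine D.U_induction (motive := fun β y w => ∀ x, D.Y x (e α) w ∈ D.U (α + β) (D.wtE α + y + x))
    ?_ ?_ ?_ ?_ ?_ hw x
  · intro β y x
    rw [map_zero]
    exact zero_mem _
  · intro β x
    exact D.Y_e_e_mem_U α β x
  · intro β y v w hv hw x
    rw [map_add]
    exact add_mem (hv x) (hw x)
  · intro β y t v hv x
    rw [map_smul]
    exact Submodule.smul_mem _ _ (hv x)
  · intro c k z β y w hz _ _ ih x
    have h1 := D.e_commutator c z hz (-((k : ℤ) + 1)) α x w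
    rw [← sub_eq_iff_eq_add] at h1
    rw [← h1]
    refine sub_mem ?_ (Submodule.smul_mem _ _ ?_)
    · have := D.h_neg_mem_U c k hz (ih x)
      convert this using 2
      module
    · have := ih (x - ((-((k : ℤ) + 1) : ℤ) : ℝ) • dv c)
      convert this using 2
      push_cast
      module

theorem Y_mem_U (x : ℝ × ℝ) {α β : L} {y z : ℝ × ℝ} {v w : L →₀ Fock E} (hv : v ∈ D.U α y)
    (hw : w ∈ D.U β z) : D.Y x v w ∈ D.U (α + β) (y + z + x) := by
  refine D.U_induction (motive := fun α y v => ∀ x z w, w ∈ D.U β z →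
    D.Y x v w ∈ D.U (α + β) (y + z + x)) ?_ ?_ ?_ ?_ ?_ hv x z w hw
  · intro α y x z w hw
    rw [map_zero]
    exact zero_mem _
  · intro α x z w hw
    exact D.Y_e_mem_U α x hw
  · intro β y v v' hv hv' x z w hw
    rw [map_add]
    exact add_mem (hv x z w hw) (hv' x z w hw)
  · intro β y t v hv x z w hw
    rw [map_smul]
    exact Submodule.smul_mem _ _ (hv x z w hw)
  · intro c k a α y v ha _ _ ih x z w hw
    obtain ⟨K, hK⟩ := (D.Y_h c k a ha v w x).exists
    rw [hK]
    refine add_mem (Submodule.sum_mem _ fun j _ => Submodule.smul_mem _ _ ?_)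
      (Submodule.sum_mem _ fun j _ => Submodule.smul_mem _ _ ?_)
    · have := D.h_neg_mem_U c (j + k) ha (ih (x - (j : ℝ) • dv c) z w hw)
      convert this using 2
      push_cast
      module
    · have := ih (x + ((j + k + 1 : ℕ) : ℝ) • dv c) _ _ (D.h_mem_U c j ha hw)
      convert this using 2
      push_cast
      module

/-- The `U δ y` span. -/
theorem U_span_induction {motive : (L →₀ Fock E) → Prop} (mem : ∀ δ y v, v ∈ D.U δ y → motive v)
    (add : ∀ v w, motive v → motive w → motive (v + w)) (v : L →₀ Fock E) : motive v := by
  classical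
  induction v using Finsupp.induction_linear with
  | zero => exact mem 0 0 0 (zero_mem _)
  | add v w hv hw => exact add v w hv hw
  | single δ s =>
    induction s using DirectSum.Decomposition.inductionOn D.fockPart with
    | zero => exact mem 0 0 _ (by simp)
    | homogeneous s => exact mem _ _ _ (D.single_mem_U s.2)
    | add s t hs ht =>
      rw [Finsupp.single_add]
      exact add _ _ hs ht

open Classical in
/-- The projection onto the part of charge `δ` and weight `y`. -/
def comp (δ : L) (y : ℝ × ℝ) : Module.End ℂ (L →₀ Fock E) :=
  if h : ∃ i : ℕ × ℕ, y = D.wtE δ + ((i.1 : ℝ), (i.2 : ℝ)) then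
    Finsupp.lsingle δ ∘ₗ GradedAlgebra.proj D.fockPart h.choose ∘ₗ Finsupp.lapply δ
  else 0

theorem comp_apply (δ : L) (i : ℕ × ℕ) (v : L →₀ Fock E) :
    D.comp δ (D.wtE δ + ((i.1 : ℝ), (i.2 : ℝ))) v =
      Finsupp.single δ (GradedAlgebra.proj D.fockPart i (v δ)) := by
  have h : ∃ j : ℕ × ℕ, D.wtE δ + ((i.1 : ℝ), (i.2 : ℝ)) = D.wtE δ + ((j.1 : ℝ), (j.2 : ℝ)) := ⟨i, rfl⟩
  have h1 : h.choose = i := by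
    have := h.choose_spec
    rw [add_right_inj, Prod.mk.injEq, Nat.cast_inj, Nat.cast_inj] at this
    exact (Prod.ext this.1 this.2).symm
  rw [comp, dif_pos h, h1]
  rfl

theorem comp_of_mem {δ : L} {y : ℝ × ℝ} {v : L →₀ Fock E} (hv : v ∈ D.U δ y) :
    D.comp δ y v = v := by
  by_cases h0 : v = 0
  · rw [h0, map_zero]
  obtain ⟨n, m, rfl⟩ := D.eq_of_mem_U hv h0
  rw [D.U_eq δ (n, m)] at hv
  obtain ⟨s, hs, rfl⟩ := hv
  rw [D.comp_apply δ (n, m), Finsupp.lsingle_apply, Finsupp.single_eq_same, GradedAlgebra.proj_apply,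
    DirectSum.decompose_of_mem_same _ hs]

theorem comp_of_ne {δ δ' : L} {y y' : ℝ × ℝ} {v : L →₀ Fock E} (hv : v ∈ D.U δ' y')
    (hne : (δ', y') ≠ (δ, y)) : D.comp δ y v = 0 := by
  by_cases h0 : v = 0
  · rw [h0, map_zero]
  obtain ⟨n, m, rfl⟩ := D.eq_of_mem_U hv h0
  rw [D.U_eq δ' (n, m)] at hv
  obtain ⟨s, hs, rfl⟩ := hv
  by_cases hy : ∃ i : ℕ × ℕ, y = D.wtE δ + ((i.1 : ℝ), (i.2 : ℝ))
  · obtain ⟨i, rfl⟩ := hy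
    rw [D.comp_apply, Finsupp.lsingle_apply]
    by_cases hδ : δ' = δ
    · subst hδ
      have hi : (n, m) ≠ i := by
        rintro rfl
        exact hne rfl
      rw [Finsupp.single_eq_same, GradedAlgebra.proj_apply, DirectSum.decompose_of_mem_ne _ hs hi,
        Finsupp.single_zero]
    · rw [Finsupp.single_eq_of_ne (Ne.symm hδ), map_zero, Finsupp.single_zero]
  · rw [comp, dif_neg hy, LinearMap.zero_apply]

theorem eq_zero_of_comp {v : L →₀ Fock E} (hv : ∀ δ y, D.comp δ y v = 0) : v = 0 := by
  ext δ
  have h1 : ∀ i, DirectSum.decompose D.fockPart (v δ) i = 0 := fun i => by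
    have := hv δ (D.wtE δ + ((i.1 : ℝ), (i.2 : ℝ)))
    rw [comp_apply, Finsupp.single_eq_zero] at this
    exact Subtype.ext this
  have h2 : DirectSum.decompose D.fockPart (v δ) = 0 := DFinsupp.ext h1
  exact (DirectSum.decompose D.fockPart).injective (h2.trans (DirectSum.decompose_zero _).symm)

/-- The part of weight `y`. -/
def W (y : ℝ × ℝ) : Submodule ℂ (L →₀ Fock E) := ⨆ δ, D.U δ y

theorem U_le_W (δ : L) (y : ℝ × ℝ) : D.U δ y ≤ D.W y := le_iSup (fun δ => D.U δ y) δ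

/-- The projections `comp` jointly detect a vector and each annihilates all other charges and
weights, which gives independence even when infinitely many charges share a weight. -/
theorem isInternal_W : DirectSum.IsInternal D.W := by
  rw [DirectSum.isInternal_submodule_iff_iSupIndep_and_iSup_eq_top]
  constructor
  · rw [iSupIndep_def]
    intro x
    rw [Submodule.disjoint_def]
    intro v hv hv'
    apply D.eq_zero_of_comp
    intro δ y
    by_cases hy : y = x
    · subst hy
      have : (⨆ (j) (_ : j ≠ y), D.W j) ≤ LinearMap.ker (D.comp δ y) := by
        refine iSup_le fun j => iSup_le fun hj => iSup_le fun δ' w hw => D.comp_of_ne hw ?_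
        intro h
        exact hj (congrArg Prod.snd h)
      exact this hv'
    · have : D.W x ≤ LinearMap.ker (D.comp δ y) := by
        refine iSup_le fun δ' w hw => D.comp_of_ne hw ?_
        intro h
        exact hy (congrArg Prod.snd h).symm
      exact this hv
  · rw [eq_top_iff]
    intro v _
    induction v using D.U_span_induction with
    | mem δ y v hv => exact le_iSup D.W y (D.U_le_W δ y hv)
    | add v w hv hw => exact add_mem (hv trivial) (hw trivial)

theorem Y_mem_W (x : ℝ × ℝ) {y z : ℝ × ℝ} {v w : L →₀ Fock E} (hv : v ∈ D.W y)
    (hw : w ∈ D.W z) : D.Y x v w ∈ D.W (y + z + x) := by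
  induction hv using Submodule.iSup_induction' with
  | zero => rw [map_zero]; exact zero_mem _
  | add v v' _ _ h h' => rw [map_add]; exact add_mem h h'
  | mem α v hv =>
    induction hw using Submodule.iSup_induction' with
    | zero => rw [map_zero]; exact zero_mem _
    | add v v' _ _ h h' => rw [map_add]; exact add_mem h h'
    | mem β w hw => exact D.U_le_W _ _ (D.Y_mem_U x hv hw)

/-- The Euler operator counts the left or the right level. -/
theorem euler {n : ℕ} {f f' : Fin n → E} (hf : ∀ x, ∑ i, D.g (f' i) x • f i = x) (c : Bool)
    {δ : L} {y : ℝ × ℝ} {v : L →₀ Fock E} (hv : v ∈ D.U δ y) (K : ℕ)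
    (hK : (y - D.wtE δ).1 + (y - D.wtE δ).2 ≤ K) :
    ∑ k ∈ Finset.range K, ∑ i, D.h (-((k : ℤ) + 1)) (D.pr c (f i))
      (D.h ((k : ℤ) + 1) (D.pr c (f' i)) v) =
      ((cond c (y - D.wtE δ).1 (y - D.wtE δ).2 : ℝ) : ℂ) • v := by
  refine D.U_induction (motive := fun δ y v => (y - D.wtE δ).1 + (y - D.wtE δ).2 ≤ K →
    ∑ k ∈ Finset.range K, ∑ i, D.h (-((k : ℤ) + 1)) (D.pr c (f i))
      (D.h ((k : ℤ) + 1) (D.pr c (f' i)) v) =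
      ((cond c (y - D.wtE δ).1 (y - D.wtE δ).2 : ℝ) : ℂ) • v) ?_ ?_ ?_ ?_ ?_ hv hK
  · intro δ y _
    simp
  · intro α _
    rw [sub_self]
    have : ((cond c (0 : ℝ × ℝ).1 (0 : ℝ × ℝ).2 : ℝ) : ℂ) = 0 := by cases c <;> simp
    rw [this, zero_smul]
    refine Finset.sum_eq_zero fun k _ => Finset.sum_eq_zero fun i _ => ?_
    rw [D.h_e_pos _ (by omega), map_zero]
  · intro δ y v w hv hw h
    simp only [map_add, Finset.sum_add_distrib, smul_add]
    rw [hv h, hw h]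
  · intro δ y t v hv h
    simp only [map_smul, ← Finset.smul_sum]
    rw [hv h, smul_comm]
  · rintro c' j x δ y v hx hv ⟨n, m, rfl⟩ ih h
    have hjn : D.wtE δ + ((n : ℝ), (m : ℝ)) + ((j + 1 : ℕ) : ℝ) • dv c' - D.wtE δ =
        ((n : ℝ), (m : ℝ)) + ((j + 1 : ℕ) : ℝ) • dv c' := by module
    rw [hjn] at h ⊢
    rw [add_sub_cancel_left] at ih
    have hsum : (((n : ℝ), (m : ℝ)) + ((j + 1 : ℕ) : ℝ) • dv c').1 +
        (((n : ℝ), (m : ℝ)) + ((j + 1 : ℕ) : ℝ) • dv c').2 = ((n + m + (j + 1) : ℕ) : ℝ) := by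
      cases c' <;> simp [dv] <;> ring
    rw [hsum] at h
    have hle : n + m + (j + 1) ≤ K := by exact_mod_cast h
    have ih := ih (by
      have : ((n + m : ℕ) : ℝ) ≤ K := by exact_mod_cast (by omega : n + m ≤ K)
      simpa using this)
    -- Commuting the operator past x(-j-1) leaves a contraction only for k = j, where the dual bases
    -- reproduce the component of x in the given part with coefficient j + 1. The bound on K ensures
    -- that k = j occurs in the sum.
    have e1 : ∀ k ∈ Finset.range K, ∑ i, D.h (-((k : ℤ) + 1)) (D.pr c (f i))
        (D.h ((k : ℤ) + 1) (D.pr c (f' i)) (D.h (-((j : ℤ) + 1)) x v)) =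
        D.h (-((j : ℤ) + 1)) x (∑ i, D.h (-((k : ℤ) + 1)) (D.pr c (f i))
          (D.h ((k : ℤ) + 1) (D.pr c (f' i)) v)) +
        if k = j then ((j : ℂ) + 1) • D.h (-((j : ℤ) + 1)) (D.pr c x) v else 0 := by
      intro k _
      have h2 : ∑ i, D.g (D.pr c (f' i)) x • D.pr c (f i) = D.pr c x := by
        conv_rhs => rw [← D.pr_pr, ← hf (D.pr c x), map_sum]
        exact Finset.sum_congr rfl fun i _ => by rw [map_smul, pr_adj]
      rw [map_sum]
      split_ifs with hkj
      · subst hkj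
        rw [← h2, map_sum, LinearMap.sum_apply, Finset.smul_sum, ← Finset.sum_add_distrib]
        refine Finset.sum_congr rfl fun i _ => ?_
        rw [D.h_commutator ((k : ℤ) + 1) (-((k : ℤ) + 1)), map_add, map_smul,
          D.h_commutator (-((k : ℤ) + 1)) (-((k : ℤ) + 1)), if_neg (by omega), zero_smul, add_zero,
          if_pos (by omega), map_smul, LinearMap.smul_apply, smul_smul]
        push_cast
        rfl
      · rw [add_zero]
        refine Finset.sum_congr rfl fun i _ => ?_
        rw [D.h_commutator ((k : ℤ) + 1) (-((j : ℤ) + 1)), map_add, map_smul,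
          D.h_commutator (-((k : ℤ) + 1)) (-((j : ℤ) + 1)), if_neg (by omega), zero_smul, add_zero,
          if_neg (by omega), zero_smul, add_zero]
    rw [Finset.sum_congr rfl e1, Finset.sum_add_distrib, ← map_sum, ih, map_smul,
      Finset.sum_ite_eq' _ j, if_pos (Finset.mem_range.2 (by omega))]
    by_cases hc : c = c'
    · subst hc
      rw [hx, ← add_smul]
      congr 1
      cases c <;> simp [dv]
    · have h3 : D.pr c x = 0 := by rw [← hx, D.pr_pr_of_ne hc]
      rw [h3, map_zero, LinearMap.zero_apply, smul_zero, add_zero]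
      congr 1
      cases c <;> cases c' <;> first | exact absurd rfl hc | simp [dv]

/-- Functionals supported in one charge and weight. -/
def IsHomogeneous (u : Module.Dual ℂ (L →₀ Fock E)) (δ : L) (y : ℝ × ℝ) : Prop :=
  ∀ δ' y' v, v ∈ D.U δ' y' → (δ', y') ≠ (δ, y) → u v = 0

variable {D}

theorem IsHomogeneous.eq_zero {u : Module.Dual ℂ (L →₀ Fock E)} {δ : L} {y : ℝ × ℝ}
    (hu : D.IsHomogeneous u δ y) (hy : ∀ n m : ℕ, y ≠ D.wtE δ + ((n : ℝ), (m : ℝ))) : u = 0 := by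
  refine LinearMap.ext fun v => ?_
  induction v using D.U_span_induction with
  | mem δ' y' v hv =>
    by_cases h : (δ', y') = (δ, y)
    · obtain ⟨rfl, rfl⟩ := Prod.mk.inj h
      rw [U_eq_bot _ hy, Submodule.mem_bot] at hv
      rw [hv, map_zero, map_zero]
    · exact hu _ _ _ hv h
  | add v w hv hw => rw [map_add, hv, hw, map_add]

theorem IsHomogeneous.comp_h {u : Module.Dual ℂ (L →₀ Fock E)} {δ : L} {y : ℝ × ℝ}
    (hu : D.IsHomogeneous u δ y) (c : Bool) (n : ℤ) {x : E} (hx : D.pr c x = x) :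
    D.IsHomogeneous (u ∘ₗ D.h n x) δ (y + (n : ℝ) • dv c) := by
  intro δ' y' v hv hne
  refine hu _ _ _ (D.h_mem_U c n hx hv) fun h => hne ?_
  obtain ⟨h1, h2⟩ := Prod.mk.inj h
  rw [h1, ← h2, sub_add_cancel]

/-- Composing with a creation operator would give a functional supported below the weight of e_δ,
where there are no vectors. -/
theorem IsHomogeneous.isVacuum {u : Module.Dual ℂ (L →₀ Fock E)} {δ : L}
    (hu : D.IsHomogeneous u δ (D.wtE δ)) : D.IsVacuum u := by
  intro k x v
  have key : ∀ c, u ∘ₗ D.h (-((k : ℤ) + 1)) (D.pr c x) = 0 := fun c =>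
    (hu.comp_h c _ (D.pr_pr c x)).eq_zero fun n m h => by
      rw [add_right_inj] at h
      cases c
      · have := congrArg Prod.snd h
        simp only [dv, cond_false, Prod.smul_mk, smul_eq_mul, mul_one] at this
        push_cast at this
        have h1 : (0 : ℝ) ≤ m := m.cast_nonneg
        have h2 : (0 : ℝ) ≤ k := k.cast_nonneg
        linarith
      · have := congrArg Prod.fst h
        simp only [dv, cond_true, Prod.smul_mk, smul_eq_mul, mul_one] at this
        push_cast at this
        have h1 : (0 : ℝ) ≤ n := n.cast_nonneg
        have h2 : (0 : ℝ) ≤ k := k.cast_nonneg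
        linarith
  rw [← D.pr_add x, map_add, LinearMap.add_apply, map_add]
  have h1 := LinearMap.congr_fun (key true) v
  have h2 := LinearMap.congr_fun (key false) v
  rw [LinearMap.comp_apply] at h1 h2
  rw [h1, h2]
  simp

/-- Homogeneous functionals are obtained from vacuum functionals by annihilation operators. -/
theorem IsHomogeneous.induction {motive : Module.Dual ℂ (L →₀ Fock E) → Prop} (zero : motive 0)
    (add : ∀ u u', motive u → motive u' → motive (u + u'))
    (smul : ∀ (t : ℂ) u, motive u → motive (t • u)) {δ : L}
    (vacuum : ∀ u, D.IsHomogeneous u δ (D.wtE δ) → D.IsVacuum u → motive u)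
    (h : ∀ u c (k : ℕ) x, D.pr c x = x → motive u → motive (u ∘ₗ D.h ((k : ℤ) + 1) x))
    {y : ℝ × ℝ} {u : Module.Dual ℂ (L →₀ Fock E)} (hu : D.IsHomogeneous u δ y) : motive u := by
  have key : ∀ (N n m : ℕ) (u : Module.Dual ℂ (L →₀ Fock E)), n + m = N →
      D.IsHomogeneous u δ (D.wtE δ + ((n : ℝ), (m : ℝ))) → motive u := by
    intro N
    induction N using Nat.strong_induction_on with
    | _ N ih =>
      intro n m u hN hu
      rcases Nat.eq_zero_or_pos N with rfl | hpos
      · obtain ⟨rfl, rfl⟩ : n = 0 ∧ m = 0 := by omega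
        have hu' : D.IsHomogeneous u δ (D.wtE δ) := by simpa [← Prod.zero_eq_mk] using hu
        exact vacuum u hu' hu'.isVacuum
      · obtain ⟨r, f, f', hf⟩ := D.exists_dual
        have hN0 : (N : ℂ) ≠ 0 := by exact_mod_cast hpos.ne'
        -- The Euler operators of the two parts together act on level (n, m) as n + m = N. Each u ∘
        -- x(-k-1) lives on a strictly lower level, so the induction hypothesis applies to it.
        have e1 : u = (N : ℂ)⁻¹ • ∑ c : Bool, ∑ k ∈ Finset.range N, ∑ i,
            (u ∘ₗ D.h (-((k : ℤ) + 1)) (D.pr c (f i))) ∘ₗ D.h ((k : ℤ) + 1) (D.pr c (f' i)) := by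
          refine LinearMap.ext fun w => ?_
          simp only [LinearMap.smul_apply, LinearMap.sum_apply, LinearMap.comp_apply]
          induction w using D.U_span_induction with
          | mem δ' y' w hw =>
            by_cases h : (δ', y') = (δ, D.wtE δ + ((n : ℝ), (m : ℝ)))
            · obtain ⟨rfl, rfl⟩ := Prod.mk.inj h
              simp only [← map_sum]
              rw [Fintype.sum_bool, D.euler hf true hw N, D.euler hf false hw N, ← add_smul, map_smul,
                smul_smul]
              · simp only [add_sub_cancel_left, cond_true, cond_false]
                rw [← hN] at hN0 ⊢
                push_cast at hN0 ⊢
                rw [inv_mul_cancel₀ hN0, one_smul]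
              all_goals
                simp only [add_sub_cancel_left]
                exact_mod_cast hN.le
            · rw [hu _ _ _ hw h, Finset.sum_eq_zero, smul_zero]
              intro c _
              refine Finset.sum_eq_zero fun k _ => Finset.sum_eq_zero fun i _ => ?_
              have := D.h_mem_U c (-((k : ℤ) + 1)) (D.pr_pr c (f i))
                (D.h_mem_U c ((k : ℤ) + 1) (D.pr_pr c (f' i)) hw)
              rw [show y' - (((k : ℤ) + 1 : ℤ) : ℝ) • dv c - ((-((k : ℤ) + 1) : ℤ) : ℝ) • dv c = y' by
                push_cast; module] at this
              exact hu _ _ _ this h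
          | add w w' h h' =>
            simp only [map_add, Finset.sum_add_distrib, smul_add]
            rw [h, h']
        rw [e1]
        refine smul _ _ (Finset.sum_induction _ _ add zero fun c _ => Finset.sum_induction _ _ add zero
          fun k _ => Finset.sum_induction _ _ add zero fun i _ => h _ c _ _ (D.pr_pr c _) ?_)
        have h1 := hu.comp_h c (-((k : ℤ) + 1)) (D.pr_pr c (f i))
        by_cases h2 : ∃ n' m' : ℕ, D.wtE δ + ((n : ℝ), (m : ℝ)) + ((-((k : ℤ) + 1) : ℤ) : ℝ) • dv c =
            D.wtE δ + ((n' : ℝ), (m' : ℝ))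
        · obtain ⟨n', m', h2⟩ := h2
          have h3 : n' + m' < N := by
            have h4 := congrArg Prod.fst h2
            have h5 := congrArg Prod.snd h2
            have h6 : (n : ℝ) + m = N := by exact_mod_cast hN
            have h7 : ((n' : ℝ) + m') < N := by
              have h8 : (0 : ℝ) ≤ k := k.cast_nonneg
              cases c
              · simp [dv] at h4 h5
                rw [h4] at h6
                linarith
              · simp [dv] at h4 h5
                rw [h5] at h6
                linarith
            exact_mod_cast h7
          rw [h2] at h1
          exact ih _ h3 n' m' _ rfl h1
        · push Not at h2
          rw [h1.eq_zero h2]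
          exact zero
  by_cases hy : ∃ n m : ℕ, y = D.wtE δ + ((n : ℝ), (m : ℝ))
  · obtain ⟨n, m, rfl⟩ := hy
    exact key _ n m u rfl hu
  · push Not at hy
    rw [hu.eq_zero hy]
    exact zero

theorem corr_zero_dual (a b v : L →₀ Fock E) : D.corr 0 a b v = 0 := by
  rw [← zero_smul ℂ (0 : Module.Dual ℂ (L →₀ Fock E)), corr_smul_dual, zero_smul]

theorem IsHomogeneous.corr_mem {u : Module.Dual ℂ (L →₀ Fock E)} {δ : L} {y : ℝ × ℝ}
    (hu : D.IsHomogeneous u δ y) (a b v : L →₀ Fock E) : D.corr u a b v ∈ monomialSpan := by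
  refine IsHomogeneous.induction (motive := fun u => ∀ a b v, D.corr u a b v ∈ monomialSpan)
    ?_ ?_ ?_ ?_ ?_ hu a b v
  · intro a b v
    rw [corr_zero_dual]
    exact zero_mem _
  · intro u u' h h' a b v
    rw [corr_add_dual]
    exact add_mem (h a b v) (h' a b v)
  · intro t u h a b v
    rw [corr_smul_dual]
    exact Submodule.smul_mem _ _ (h a b v)
  · exact fun u _ hu a b v => hu.corr_mem a b v
  · intro u c k x hx hu a b v
    obtain ⟨M, hM⟩ := (D.corr_comp_h c x hx ((k : ℤ) + 1) u a b v).exists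
    rw [hM]
    exact add_mem (add_mem (Submodule.sum_mem _ fun j _ => Submodule.smul_mem _ _
      (mulZ₁_mem _ _ (hu _ _ _))) (Submodule.sum_mem _ fun j _ => Submodule.smul_mem _ _
      (mulZ₂_mem _ _ (hu _ _ _)))) (hu _ _ _)

/-- One weight may contain infinitely many charges, so a functional in F^∨ need not be a finite sum
of homogeneous ones. For a, b, v of charges α, β, γ, however, only the charge α + β + γ is met, and
there the finitely many weights seen by u suffice. -/
theorem corr_mem {u : Module.Dual ℂ (L →₀ Fock E)}
    (hu : {x : ℝ × ℝ | ∃ v ∈ D.W x, u v ≠ 0}.Finite) (a b v : L →₀ Fock E) :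
    D.corr u a b v ∈ monomialSpan := by
  induction a using D.U_span_induction with
  | add a a' h h' =>
    rw [corr_add_left]
    exact add_mem h h'
  | mem α y₁ a ha =>
    induction b using D.U_span_induction with
    | add b b' h h' =>
      rw [corr_add_mid]
      exact add_mem h h'
    | mem β y₂ b hb =>
      induction v using D.U_span_induction with
      | add v v' h h' =>
        rw [corr_add_right]
        exact add_mem h h'
      | mem γ y₃ v hv =>
        have hhom : ∀ y, D.IsHomogeneous (u ∘ₗ D.comp (α + β + γ) y) (α + β + γ) y :=
          fun y δ' y' w hw h => by rw [LinearMap.comp_apply, D.comp_of_ne hw h, map_zero]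
        have hsum : ∀ y w, w ∈ D.U (α + β + γ) y → u w =
            (∑ y ∈ hu.toFinset, u ∘ₗ D.comp (α + β + γ) y) w := by
          intro y w hw
          rw [LinearMap.sum_apply]
          by_cases h0 : u w = 0
          · rw [h0, Finset.sum_eq_zero]
            intro y' _
            rw [LinearMap.comp_apply]
            by_cases hy : y = y'
            · rw [← hy, D.comp_of_mem hw, h0]
            · rw [D.comp_of_ne hw fun h => hy (Prod.mk.inj h).2, map_zero]
          · rw [Finset.sum_eq_single y, LinearMap.comp_apply, D.comp_of_mem hw]
            · intro y' _ hy
              rw [LinearMap.comp_apply, D.comp_of_ne hw fun h => hy (Prod.mk.inj h).2.symm, map_zero]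
            · intro h
              exact absurd (hu.mem_toFinset.2 ⟨w, D.U_le_W _ _ hw, h0⟩) h
        have e1 : D.corr u a b v = D.corr (∑ y ∈ hu.toFinset, u ∘ₗ D.comp (α + β + γ) y) a b v := by
          refine corr_ext (fun s l => ?_) (fun s l => ?_) (fun s l => ?_)
          · refine hsum (y₁ + (y₂ + y₃ + s) + l) _ ?_
            rw [add_assoc α]
            exact D.Y_mem_U l ha (D.Y_mem_U s hb hv)
          · exact hsum (y₁ + y₂ + s + y₃ + l) _ (D.Y_mem_U l (D.Y_mem_U s ha hb) hv)
          · refine hsum (y₂ + (y₁ + y₃ + s) + l) _ ?_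
            rw [add_comm α, add_assoc β]
            exact D.Y_mem_U l hb (D.Y_mem_U s ha hv)
        rw [e1]
        refine Finset.sum_induction _ (fun w => D.corr w a b v ∈ monomialSpan) ?_ ?_ ?_
        · intro w w' h h'
          rw [corr_add_dual]
          exact add_mem h h'
        · rw [corr_zero_dual]
          exact zero_mem _
        · intro y _
          exact (hhom y).corr_mem a b v

end LatticeDatum

/-! ### Monomials as generalized correlation functions -/

open Classical in
/-- The series of the constant function `1`. -/
def oneSeries (r s : ℝ) : ℂ := if r = 0 ∧ s = 0 then 1 else 0

theorem oneSeries_zero : oneSeries 0 0 = 1 := if_pos ⟨rfl, rfl⟩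

theorem oneSeries_of_ne {r s : ℝ} (h : ¬(r = 0 ∧ s = 0)) : oneSeries r s = 0 := if_neg h

theorem hasConformalExpansion_one : HasConformalExpansion (fun _ => 1) oneSeries where
  integral r s h := by
    have : r = 0 ∧ s = 0 := by
      by_contra hc
      exact h (oneSeries_of_ne hc)
    exact ⟨0, by simp [this.1, this.2]⟩
  countable := by
    refine (Set.countable_singleton ((0, 0) : ℝ × ℝ)).mono fun x hx => ?_
    by_contra hc
    exact hx (oneSeries_of_ne fun h => hc (Prod.ext h.1 h.2))
  bounded := by
    refine ⟨0, fun r s h => ?_⟩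
    have : r = 0 ∧ s = 0 := by
      by_contra hc
      exact h (oneSeries_of_ne hc)
    simp [this.1, this.2]
  hasSum := by
    refine ⟨1, one_pos, fun p _ _ => ?_⟩
    have := hasSum_single (f := fun x : ℝ × ℝ => oneSeries x.1 x.2 * zpow₂ p x.1 x.2) (0, 0)
      fun x hx => by
        rw [oneSeries_of_ne, zero_mul]
        exact fun h => hx (Prod.ext h.1 h.2)
    simpa [oneSeries_zero, zpow₂] using this

theorem isConformalFunction_one : IsConformalFunction fun _ => 1 where
  analytic := analyticOnNhd_const
  zero_one _ _ _ _ _ _ := ⟨_, hasConformalExpansion_one⟩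
  infty _ _ _ _ := ⟨_, hasConformalExpansion_one⟩

theorem binomMul_oneSeries (σ : ℂ) (γ δ r s : ℝ) :
    binomMul σ γ δ oneSeries r s = binomCoeff σ γ r * binomCoeff σ δ s := by
  rw [binomMul]
  by_cases hr : ∃ n : ℕ, (n : ℝ) = r
  · by_cases hs : ∃ m : ℕ, (m : ℝ) = s
    · obtain ⟨n, rfl⟩ := hr
      obtain ⟨m, rfl⟩ := hs
      rw [finsum_eq_single _ (n, m), binomCoeff_natCast, binomCoeff_natCast]
      · simp only [sub_self, oneSeries_zero, pow_add, ch]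
        ring
      · intro x hx
        rw [oneSeries_of_ne, mul_zero]
        rintro ⟨h1, h2⟩
        apply hx
        rw [sub_eq_zero, Nat.cast_inj] at h1 h2
        exact Prod.ext h1.symm h2.symm
    · push Not at hs
      rw [binomCoeff_eq_zero _ _ s hs, mul_zero, finsum_eq_zero_of_forall_eq_zero]
      intro x
      rw [oneSeries_of_ne, mul_zero]
      rintro ⟨_, h2⟩
      exact hs x.2 (sub_eq_zero.1 h2).symm
  · push Not at hr
    rw [binomCoeff_eq_zero _ _ r hr, zero_mul, finsum_eq_zero_of_forall_eq_zero]
    intro x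
    rw [oneSeries_of_ne, mul_zero]
    rintro ⟨h1, _⟩
    exact hr x.1 (sub_eq_zero.1 h1).symm

theorem neg_one_zpow_mul_oneSeries :
    (fun r s => (-1 : ℂ) ^ ⌊r - s⌋ * oneSeries r s) = oneSeries := by
  funext r s
  by_cases h : r = 0 ∧ s = 0
  · obtain ⟨rfl, rfl⟩ := h
    simp
  · rw [oneSeries_of_ne h, mul_zero]

/-- A series in the order small, large as a series in `z₁`, `z₂` for `|z₁| > |z₂|`. -/
def Ser.large : Ser →ₗ[ℂ] FormalSeries₂ where
  toFun S r₁ s₁ r₂ s₂ := S (r₂, s₂) (r₁, s₁)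
  map_add' _ _ := rfl
  map_smul' _ _ := rfl

/-- A series in the order small, large as a series with the small pair first. -/
def Ser.small : Ser →ₗ[ℂ] FormalSeries₂ where
  toFun S r₁ s₁ r₂ s₂ := S (r₁, s₁) (r₂, s₂)
  map_add' _ _ := rfl
  map_smul' _ _ := rfl

/-- A monomial is the correlation function of the constant function f = 1. A linear combination of
triples is matched by the same combination of functions in all three regions, so a single μ serves
them. -/
theorem exists_expansion {T : SerTriple} (hT : T ∈ monomialSpan) : ∃ μ ∈ GCor₂,
    IsExpansion₁₂ μ (Ser.large T.1) ∧ IsExpansion₀₂ μ (Ser.small T.2.1) ∧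
      IsExpansion₂₁ μ (Ser.small T.2.2) := by
  induction hT using Submodule.span_induction with
  | mem T h =>
    obtain ⟨x₁, x₂, x₁₂, h1, h2, h3, rfl⟩ := h
    let ex : Exponents := ⟨x₁.1, x₁.2, x₂.1, x₂.2, x₁₂.1, x₁₂.2, h1, h2, h3⟩
    refine ⟨corrFun ex fun _ => 1, Submodule.subset_span ⟨ex, _, isConformalFunction_one, rfl⟩,
      Submodule.subset_span ⟨ex, _, _, isConformalFunction_one, hasConformalExpansion_one, ?_⟩,
      Submodule.subset_span ⟨ex, _, _, isConformalFunction_one, hasConformalExpansion_one, ?_⟩,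
      Submodule.subset_span ⟨ex, _, _, isConformalFunction_one, hasConformalExpansion_one, ?_⟩⟩
    · refine Prod.ext rfl ?_
      funext r₁ s₁ r₂ s₂
      change basicSeries _ _ _ _ _ _ = series₁₂ _ _ _ _ _ _
      simp only [basicSeries, series₁₂, binomMul_oneSeries, Prod.ext_iff, Prod.fst_add, Prod.snd_add,
        ex, add_comm r₂ r₁, add_comm s₂ s₁]
    · refine Prod.ext rfl ?_
      funext r₁ s₁ r₂ s₂
      change basicSeries _ _ _ _ _ _ = series₀₂ _ _ _ _ _ _
      simp only [basicSeries, series₀₂, neg_one_zpow_mul_oneSeries, binomMul_oneSeries, Prod.ext_iff,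
        Prod.fst_add, Prod.snd_add, ex]
    · refine Prod.ext rfl ?_
      funext r₁ s₁ r₂ s₂
      change (-1 : ℂ) ^ ⌊x₁₂.1 - x₁₂.2⌋ • basicSeries _ _ _ _ _ _ = series₂₁ _ _ _ _ _ _
      simp only [basicSeries, series₂₁, binomMul_oneSeries, Prod.ext_iff,
        Prod.fst_add, Prod.snd_add, ex, smul_eq_mul, mul_ite, mul_zero]
  | zero => exact ⟨0, zero_mem _, zero_mem _, zero_mem _, zero_mem _⟩
  | add T T' _ _ h h' =>
    obtain ⟨μ, h0, h1, h2, h3⟩ := h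
    obtain ⟨μ', h0', h1', h2', h3'⟩ := h'
    exact ⟨μ + μ', add_mem h0 h0', add_mem h1 h1', add_mem h2 h2', add_mem h3 h3'⟩
  | smul t T _ h =>
    obtain ⟨μ, h0, h1, h2, h3⟩ := h
    exact ⟨t • μ, Submodule.smul_mem _ t h0, Submodule.smul_mem _ t h1, Submodule.smul_mem _ t h2,
      Submodule.smul_mem _ t h3⟩

/-! ### The axioms of a full vertex algebra -/

namespace LatticeDatum
variable {L E : Type*} [AddCommGroup L] [AddCommGroup E] [Module ℂ E] (D : LatticeDatum L E)

/-- Modes change exponents by integers, so every exponent that occurs differs by integers from one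
of the pairings of lattice vectors. This yields both the integrality and the countability of the
exponents. -/
theorem Y_eq_zero {x : ℝ × ℝ}
    (hx : ∀ (α β : L) (n m : ℤ), x ≠ D.pe α β + ((n : ℝ), (m : ℝ))) : D.Y x = 0 := by
  have shift : ∀ (x : ℝ × ℝ), (∀ (α β : L) (n m : ℤ), x ≠ D.pe α β + ((n : ℝ), (m : ℝ))) →
      ∀ (j : ℤ) (c : Bool) (α β : L) (n m : ℤ), x + (j : ℝ) • dv c ≠ D.pe α β + ((n : ℝ), (m : ℝ)) := by
    intro x hx j c α β n m h
    rw [← eq_sub_iff_add_eq] at h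
    cases c
    · refine hx α β n (m - j) (h.trans ?_)
      simp [dv, Prod.ext_iff, add_sub_assoc]
    · refine hx α β (n - j) m (h.trans ?_)
      simp [dv, Prod.ext_iff, add_sub_assoc]
  have he : ∀ (α : L) (w : L →₀ Fock E) (x : ℝ × ℝ),
      (∀ (α β : L) (n m : ℤ), x ≠ D.pe α β + ((n : ℝ), (m : ℝ))) → D.Y x (e α) w = 0 := by
    intro α w
    induction w using D.induction with
    | e β => exact fun x hx => D.Y_e_e_eq_zero _ _ _ fun n m => by exact_mod_cast hx α β n m
    | add v w hv hw => exact fun x hx => by rw [map_add, hv x hx, hw x hx, add_zero]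
    | smul t v hv => exact fun x hx => by rw [map_smul, hv x hx, smul_zero]
    | h c k z v hz hv =>
      intro x hx
      have h1 := D.e_commutator c z hz (-((k : ℤ) + 1)) α x v
      rw [hv x hx, hv _ (by
        have := shift x hx ((k : ℤ) + 1) c
        intro α β n m h
        refine this α β n m (Eq.trans ?_ h)
        push_cast
        module), map_zero, smul_zero, add_zero] at h1
      exact h1.symm
  refine LinearMap.ext fun v => LinearMap.ext fun w => ?_
  rw [LinearMap.zero_apply, LinearMap.zero_apply]
  induction v using D.induction generalizing w x with
  | e α => exact he α w x hx
  | add v v' hv hv' => rw [map_add, LinearMap.add_apply, hv hx, hv' hx, add_zero]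
  | smul t v hv => rw [map_smul, LinearMap.smul_apply, hv hx, smul_zero]
  | h c k z v hz hv =>
    obtain ⟨K, hK⟩ := (D.Y_h c k z hz v w x).exists
    rw [hK, Finset.sum_eq_zero, Finset.sum_eq_zero, add_zero]
    · intro i _
      rw [hv, smul_zero]
      exact_mod_cast shift x hx ((i : ℤ) + k + 1) c
    · intro j _
      rw [hv, map_zero, smul_zero]
      have := shift x hx (-(j : ℤ)) c
      intro α β n m h
      refine this α β n m (Eq.trans ?_ h)
      push_cast
      module

theorem pe_zero_left (α : L) : D.pe 0 α = 0 := by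
  have := D.pe_add_left 0 0 α
  rwa [add_zero, left_eq_add] at this

theorem pe_zero_right (α : L) : D.pe α 0 = 0 := by rw [pe_comm, pe_zero_left]

theorem Y_vacuum_eq_zero {x : ℝ × ℝ} (hx : ∀ n m : ℕ, x ≠ ((n : ℝ), (m : ℝ))) (v : L →₀ Fock E) :
    D.Y x v (e 0) = 0 := by
  induction v using D.induction generalizing x with
  | e α => exact D.Y_e_e_eq_zero _ _ _ fun n m => by rw [pe_zero_right, zero_add]; exact hx n m
  | add v w hv hw => rw [map_add, LinearMap.add_apply, hv hx, hw hx, add_zero]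
  | smul t v hv => rw [map_smul, LinearMap.smul_apply, hv hx, smul_zero]
  | h c k z v hz hv =>
    obtain ⟨K, hK⟩ := (D.Y_h c k z hz v (e 0) x).exists
    rw [hK, Finset.sum_eq_zero, Finset.sum_eq_zero, add_zero]
    · intro i _
      rw [h_natCast_e]
      simp
    · intro j _
      rw [hv, map_zero, smul_zero]
      intro n m h
      rw [sub_eq_iff_eq_add] at h
      cases c
      · exact hx n (m + j) (h.trans (by simp [dv]))
      · exact hx (n + j) m (h.trans (by simp [dv]))

/-- On the vacuum all annihilation terms vanish, and in the creation sum only j = 0 can survive,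
since negative powers do not occur in Y(v,z)1. -/
theorem Y_zero_vacuum (v : L →₀ Fock E) : D.Y 0 v (e 0) = v := by
  induction v using D.induction with
  | e α =>
    have := D.Y_e_e α 0 0 0
    simp only [pe_zero_right, Nat.cast_zero, ← Prod.zero_eq_mk, add_zero, em_zero, mul_one,
      D.A.zero_right, one_smul] at this
    exact this
  | add v w hv hw => rw [map_add, LinearMap.add_apply, hv, hw]
  | smul t v hv => rw [map_smul, LinearMap.smul_apply, hv]
  | h c k z v hz hv =>
    obtain ⟨K, hK, hK0⟩ := ((D.Y_h c k z hz v (e 0) 0).and (eventually_ge_atTop 1)).exists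
    rw [hK, Finset.sum_eq_zero (s := Finset.range K) (f := fun i : ℕ =>
      ((-1) ^ k * Nat.choose (i + k) k : ℂ) • D.Y (0 + ((i + k + 1 : ℕ) : ℝ) • dv c) v
        (D.h i z (e 0))), add_zero, Finset.sum_eq_single 0]
    · simp [hv]
    · intro j _ hj
      rw [Y_vacuum_eq_zero, map_zero, smul_zero]
      have h0 : (0 : ℝ) < j := by exact_mod_cast Nat.pos_of_ne_zero hj
      intro n m h
      have hn : (0 : ℝ) ≤ n := n.cast_nonneg
      have hm : (0 : ℝ) ≤ m := m.cast_nonneg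
      cases c
      · have := congrArg Prod.snd h
        simp [dv] at this
        exact hj this.1
      · have := congrArg Prod.fst h
        simp [dv] at this
        exact hj this.1
    · intro h
      simp at h
      omega
    · intro i _
      rw [h_natCast_e]
      simp

theorem em_of_eq_zero {x : E} (hx : x = 0) (n : ℕ) : D.em x n = if n = 0 then 1 else 0 := by
  split_ifs with hn
  · rw [hn, em_zero]
  · have h1 := D.em_rec x n
    simp only [hx, map_zero, zero_mul, Finset.sum_const_zero] at h1
    rw [hx]
    exact (smul_eq_zero.1 h1).resolve_left (by exact_mod_cast hn)

open Classical in
theorem Y_e_zero (x : ℝ × ℝ) (w : L →₀ Fock E) : D.Y x (e 0) w = if x = 0 then w else 0 := by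
  induction w using D.induction generalizing x with
  | e β =>
    by_cases h : ∃ n m : ℕ, x = ((n : ℝ), (m : ℝ))
    · obtain ⟨n, m, rfl⟩ := h
      have := D.Y_e_e 0 β n m
      rw [pe_zero_left, zero_add, zero_add, D.A.zero_left, one_smul, D.em_of_eq_zero (by simp),
        D.em_of_eq_zero (by simp)] at this
      rw [this]
      by_cases hn : n = 0
      · by_cases hm : m = 0
        · subst hn hm
          simp [e]
        · simp [hm, Prod.ext_iff]
      · simp [hn, Prod.ext_iff]
    · push Not at h
      rw [Y_e_e_eq_zero, if_neg]
      · rintro rfl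
        exact h 0 0 (by simp [Prod.zero_eq_mk])
      · rw [pe_zero_left]
        intro n m
        rw [zero_add]
        exact h n m
  | add v w hv hw =>
    rw [map_add, hv, hw]
    split_ifs
    · rfl
    · rw [add_zero]
  | smul t v hv => rw [map_smul, hv, smul_ite, smul_zero]
  | h c k z v hz hv =>
    have h1 := D.e_commutator c z hz (-((k : ℤ) + 1)) 0 x v
    rw [map_zero, map_zero, zero_smul, add_zero, hv] at h1
    rw [← h1]
    split_ifs
    · rfl
    · rw [map_zero]

/-- The full vertex algebra of a lattice datum. -/
def vertexData : VertexData (L →₀ Fock E) where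
  grade := weightSpace (D.part true) (D.part false) D.a D.b
  Y :=
    { toFun := fun v r s => (vertexField D.g D.P D.wt D.A.ε D.a D.b v).1 (-r - 1) (-s - 1)
      map_add' := fun v w => by
        rw [map_add]; rfl
      map_smul' := fun t v => by
        rw [map_smul]; rfl }
  one := Finsupp.single 0 1

theorem vertexData_Y (v : L →₀ Fock E) (r s : ℝ) : D.vertexData.Y v r s = D.Y (-r - 1, -s - 1) v :=
  rfl

theorem vertexData_Y_neg (v : L →₀ Fock E) (r s : ℝ) :
    D.vertexData.Y v (-r - 1) (-s - 1) = D.Y (r, s) v := by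
  rw [vertexData_Y, neg_sub, sub_neg_eq_add, add_sub_cancel_left, neg_sub, sub_neg_eq_add,
    add_sub_cancel_left]

theorem vertexData_one : D.vertexData.one = e 0 := rfl

theorem vertexData_grade (h hbar : ℝ) : D.vertexData.grade h hbar = D.W (h, hbar) := rfl

theorem wtE_zero : D.wtE 0 = 0 := by
  have h := D.pe_zero_left 0
  have h1 : D.a 0 0 = 0 := congrArg Prod.fst h
  have h2 : D.b 0 0 = 0 := congrArg Prod.snd h
  rw [wtE, h1, h2, zero_div, Prod.zero_eq_mk]

/-- The spin of e_δ is half of (δ,δ), an integer because the lattice is even, and the levels change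
it by integers. -/
theorem W_eq_bot {y : ℝ × ℝ} (hy : ¬ IsIntegral₂ y) : D.W y = ⊥ := by
  rw [W, iSup_eq_bot]
  intro δ
  refine D.U_eq_bot fun n m hx => hy ?_
  have h1 := congrArg Prod.fst hx
  have h2 := congrArg Prod.snd hx
  have h3 := D.sub_eq δ δ
  obtain ⟨r, hr⟩ := D.even δ
  simp only [wtE, Prod.fst_add, Prod.snd_add] at h1 h2
  refine ⟨r + n - m, ?_⟩
  rw [hr] at h3
  push_cast at h3 ⊢
  linarith

theorem exists_correlation (a b v : L →₀ Fock E) (u : Module.Dual ℂ (L →₀ Fock E))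
    (hu : u ∈ D.vertexData.dual) : ∃ μ ∈ GCor₂,
    IsExpansion₁₂ μ (fun r₁ s₁ r₂ s₂ =>
      u (D.vertexData.Y a (-r₁ - 1) (-s₁ - 1) (D.vertexData.Y b (-r₂ - 1) (-s₂ - 1) v))) ∧
    IsExpansion₀₂ μ (fun r₀ s₀ r₂ s₂ =>
      u (D.vertexData.Y (D.vertexData.Y a (-r₀ - 1) (-s₀ - 1) b) (-r₂ - 1) (-s₂ - 1) v)) ∧
    IsExpansion₂₁ μ (fun r₁ s₁ r₂ s₂ =>
      u (D.vertexData.Y b (-r₂ - 1) (-s₂ - 1) (D.vertexData.Y a (-r₁ - 1) (-s₁ - 1) v))) := by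
    obtain ⟨μ, h0, h1, h2, h3⟩ := exists_expansion (corr_mem (D := D) hu a b v)
    refine ⟨μ, h0, ?_, ?_, ?_⟩
    · simp only [vertexData_Y_neg]
      exact h1
    · simp only [vertexData_Y_neg]
      exact h2
    · simp only [vertexData_Y_neg]
      exact h3

theorem isFullVertexAlgebra [Countable L] : D.vertexData.IsFullVertexAlgebra := by
  refine ⟨?_, ?_, ?_, ?_, ?_, ?_, ?_, ?_, ?_, ?_, ?_⟩
  · have h : (fun x : ℝ × ℝ => D.vertexData.grade x.1 x.2) = D.W :=
      funext fun x => D.vertexData_grade x.1 x.2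
    rw [h]
    exact D.isInternal_W
  · rw [vertexData_one, vertexData_grade, Prod.mk_zero_zero, ← D.wtE_zero]
    exact D.U_le_W _ _ (D.e_mem_U 0)
  · intro a r s h
    by_contra hc
    apply h
    rw [vertexData_Y, Y_eq_zero, LinearMap.zero_apply]
    intro α β n m hx
    apply hc
    have h1 := congrArg Prod.fst hx
    have h2 := congrArg Prod.snd hx
    have h3 := D.sub_eq α β
    simp only [pe, Prod.fst_add, Prod.snd_add] at h1 h2
    refine ⟨-(D.B α β + n - m), ?_⟩
    push_cast
    linarith
  · intro a
    -- The possible exponents are indexed by two lattice vectors and two integers, hence countable.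
    have : (Set.range fun x : L × L × ℤ × ℤ =>
        ((-(D.pe x.1 x.2.1 + ((x.2.2.1 : ℝ), (x.2.2.2 : ℝ))).1 - 1,
          -(D.pe x.1 x.2.1 + ((x.2.2.1 : ℝ), (x.2.2.2 : ℝ))).2 - 1) : ℝ × ℝ)).Countable :=
      Set.countable_range _
    refine this.mono fun x hx => ?_
    by_contra hc
    apply hx
    rw [vertexData_Y, Y_eq_zero, LinearMap.zero_apply]
    intro α β n m h
    refine hc ⟨(α, β, n, m), ?_⟩
    have h1 := congrArg Prod.fst h
    have h2 := congrArg Prod.snd h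
    refine Prod.ext ?_ ?_
    · simp only [← h1]
      ring
    · simp only [← h2]
      ring
  · intro a b
    obtain ⟨N, hN⟩ := D.Y_bounded a b
    refine ⟨-N, fun r s h => ?_⟩
    rw [vertexData_Y]
    refine hN _ (h.imp (fun h => ?_) fun h => ?_)
    · change -r - 1 < N
      linarith
    · change -s - 1 < N
      linarith
  · intro h hbar hk
    rw [vertexData_grade]
    refine D.W_eq_bot fun ⟨k, hk'⟩ => hk ⟨k, ?_⟩
    have hk' : (h : ℝ) - hbar = k := hk'
    exact_mod_cast hk'
  · intro a r s h
    by_contra hc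
    push Not at hc
    apply h
    rw [vertexData_Y, vertexData_one]
    refine D.Y_vacuum_eq_zero (fun n m hx => ?_) a
    exact hc n m (congrArg Prod.fst hx) (congrArg Prod.snd hx)
  · intro a
    have := D.Y_zero_vacuum a
    rwa [vertexData_Y, vertexData_one, show ((-(-1) - 1, -(-1) - 1) : ℝ × ℝ) = 0 by norm_num]
  · intro r s
    rw [vertexData_Y, vertexData_one]
    refine LinearMap.ext fun w => (D.Y_e_zero _ w).trans ?_
    have : (-r - 1, -s - 1) = (0 : ℝ × ℝ) ↔ r = -1 ∧ s = -1 := by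
      rw [Prod.mk_eq_zero]
      constructor <;> rintro ⟨h1, h2⟩ <;> constructor <;> linarith
    simp only [this]
    split_ifs <;> rfl
  · exact D.exists_correlation
  · intro h hbar h' hbar' r s a ha b hb
    rw [vertexData_grade] at ha hb ⊢
    have := D.Y_mem_W (-r - 1, -s - 1) ha hb
    rw [vertexData_Y]
    rwa [show (h, hbar) + (h', hbar') + (-r - 1, -s - 1) =
      (h + h' - r - 1, hbar + hbar' - s - 1) from Prod.ext (by simp; ring) (by simp; ring)] at this

end LatticeDatum

/-! ### From a lattice with a projection to lattice data -/

section RealForm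
variable {H : Type*} [AddCommGroup H] [Module ℝ H] {Q : LinearMap.BilinForm ℝ H}
  {p : Module.End ℝ H}

theorem apply_apply_of_mem_orthogonalProjections (hp : p ∈ orthogonalProjections Q) (x : H) :
    p (p x) = p x := LinearMap.congr_fun hp.1 x

theorem orthogonal_apply (hQ : Q.IsSymm) (hp : p ∈ orthogonalProjections Q) (x y : H) :
    Q (p x) (y - p y) = 0 := by
  rw [← hQ.eq]
  refine hp.2 _ ?_ _ ?_
  · simp [apply_apply_of_mem_orthogonalProjections hp]
  · simp [apply_apply_of_mem_orthogonalProjections hp]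

theorem orthogonal_apply' (hQ : Q.IsSymm) (hp : p ∈ orthogonalProjections Q) (x y : H) :
    Q (x - p x) (p y) = 0 := by
  rw [← hQ.eq]
  exact orthogonal_apply hQ hp y x

theorem twistedForm_apply (x y : H) :
    twistedForm Q p x y = Q (p x) (p y) - Q (x - p x) (y - p y) := rfl

/-- Since the cross terms vanish, twisting by p amounts to inserting the involution 2p - 1 into one
argument. Being invertible, it preserves nondegeneracy; being the reflection attached to p, it
reappears in the study of the Grassmannian. -/
theorem twistedForm_eq (hQ : Q.IsSymm) (hp : p ∈ orthogonalProjections Q) (x y : H) :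
    twistedForm Q p x y = Q x ((2 : ℝ) • p y - y) := by
  have h1 := orthogonal_apply hQ hp x y
  have h2 := orthogonal_apply' hQ hp x y
  rw [twistedForm_apply]
  simp only [map_sub, map_smul, LinearMap.sub_apply, smul_eq_mul] at *
  linarith

theorem twistedForm_isSymm (hQ : Q.IsSymm) : (twistedForm Q p).IsSymm := by
  refine ⟨fun x y => ?_⟩
  simp only [twistedForm_apply]
  rw [hQ.eq (p y), hQ.eq (y - p y)]

theorem twistedForm_adj (hp : p ∈ orthogonalProjections Q) (x y : H) :
    twistedForm Q p (p x) y = twistedForm Q p x (p y) := by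
  simp [twistedForm_apply, apply_apply_of_mem_orthogonalProjections hp]

theorem twistedForm_nondegenerate (hQ : Q.IsSymm) (hn : Q.Nondegenerate)
    (hp : p ∈ orthogonalProjections Q) : (twistedForm Q p).Nondegenerate := by
  have key : ∀ x, (∀ y, twistedForm Q p x y = 0) → x = 0 := by
    intro x h
    refine hn.1 x fun y => ?_
    have := h ((2 : ℝ) • p y - y)
    rw [twistedForm_eq hQ hp] at this
    rw [← this]
    congr 1
    rw [map_sub, map_smul, apply_apply_of_mem_orthogonalProjections hp]
    module
  refine ⟨key, fun y h => key y fun x => ?_⟩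
  rw [(twistedForm_isSymm hQ).eq y x]
  exact h x

end RealForm

theorem realForm_isSymm {L : Type*} [AddCommGroup L] {B : LinearMap.BilinForm ℤ L}
    (hB : B.IsSymm) : (realForm B).IsSymm :=
  LinearMap.BilinForm.isSymm_iff.2
    (LinearMap.BilinForm.IsSymm.baseChange ℝ (LinearMap.BilinForm.isSymm_iff.1 hB))

/-- Dual bases of the real space remain dual after extension of scalars, and the identity ∑ (e'ᵢ, x)
eᵢ = x is all the Euler operator needs. -/
theorem baseChange_exists_dual {H : Type*} [AddCommGroup H] [Module ℝ H] [Module.Finite ℝ H]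
    {G : LinearMap.BilinForm ℝ H} (hG : G.Nondegenerate) :
    ∃ (n : ℕ) (e e' : Fin n → ℂ ⊗[ℝ] H), ∀ x, ∑ i, G.baseChange ℂ (e' i) x • e i = x := by
  classical
  let b := Module.finBasis ℝ H
  refine ⟨_, fun i => 1 ⊗ₜ b i, fun i => 1 ⊗ₜ G.dualBasis hG b i, fun x => ?_⟩
  induction x using TensorProduct.induction_on with
  | zero => simp
  | add x y hx hy =>
    conv_rhs => rw [← hx, ← hy]
    simp only [map_add, add_smul, Finset.sum_add_distrib]
  | tmul t h =>
    conv_rhs => rw [← b.sum_repr h]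
    rw [TensorProduct.tmul_sum]
    refine Finset.sum_congr rfl fun i _ => ?_
    rw [LinearMap.BilinForm.baseChange_tmul, TensorProduct.smul_tmul', TensorProduct.tmul_smul,
      ← TensorProduct.smul_tmul', TensorProduct.smul_tmul']
    congr 1
    have : G (G.dualBasis hG b i) h = b.repr h i := by
      conv_lhs => rw [← b.sum_repr h, map_sum]
      simp [-Module.Basis.sum_repr, -map_sum, LinearMap.BilinForm.apply_dualBasis_left]
    rw [this]
    simp

section Lattice
variable {L : Type*} [AddCommGroup L] [Module.Free ℤ L] [Module.Finite ℤ L]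
  (B : LinearMap.BilinForm ℤ L) (hB : B.IsSymm) (heven : ∀ α, Even (B α α))
  (hn : (realForm B).Nondegenerate) (A : TwistedGroupAlgebra B) (p : Module.End ℝ (RealSpace L))
  (hp : p ∈ orthogonalProjections (realForm B))

theorem latticeForm_tmul (s t : ℂ) (x y : RealSpace L) :
    latticeForm B p (s ⊗ₜ x) (t ⊗ₜ y) = twistedForm (realForm B) p x y • (s * t) := by
  rw [latticeForm, LinearMap.BilinForm.baseChange_tmul]

theorem complexProj_tmul (s : ℂ) (x : RealSpace L) : complexProj p (s ⊗ₜ x) = s ⊗ₜ p x := rfl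

/-- The datum of a lattice and an orthogonal projection. -/
def latticeDatum : LatticeDatum L (ComplexSpace L) where
  g := latticeForm B p
  symm := LinearMap.BilinForm.isSymm_iff.2 (LinearMap.BilinForm.IsSymm.baseChange ℂ
    (LinearMap.BilinForm.isSymm_iff.1 (twistedForm_isSymm (realForm_isSymm hB))))
  P := complexProj p
  P_idem x := by
    induction x using TensorProduct.induction_on with
    | zero => simp
    | add x y hx hy => simp only [map_add, hx, hy]
    | tmul s x => simp only [complexProj_tmul, apply_apply_of_mem_orthogonalProjections hp]
  P_adj x y := by
    induction x using TensorProduct.induction_on with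
    | zero => simp
    | add x y hx hy => simp only [map_add, LinearMap.add_apply, hx, hy]
    | tmul s x =>
      induction y using TensorProduct.induction_on with
      | zero => simp
      | add x y hx hy => simp only [map_add, hx, hy]
      | tmul t y => rw [complexProj_tmul, complexProj_tmul, latticeForm_tmul, latticeForm_tmul,
          twistedForm_adj hp]
  wt := ⟨⟨toComplex, by simp [toComplex, toReal]⟩,
    by intro x y; simp [toComplex, toReal, TensorProduct.tmul_add]⟩
  B := B
  even := heven
  A := A
  a := leftPairing B p
  b := rightPairing B p
  a_eq α β := by
    change _ = latticeForm B p (complexProj p (1 ⊗ₜ toReal α)) (1 ⊗ₜ toReal β)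
    rw [complexProj_tmul, latticeForm_tmul, leftPairing, ← twistedForm_adj hp,
      apply_apply_of_mem_orthogonalProjections hp]
    simp
  b_eq α β := by
    change _ = latticeForm B p (1 ⊗ₜ toReal α - complexProj p (1 ⊗ₜ toReal α)) (1 ⊗ₜ toReal β)
    rw [complexProj_tmul, ← TensorProduct.tmul_sub, latticeForm_tmul, rightPairing]
    have : twistedForm (realForm B) p ((1 - p) (toReal α)) ((1 - p) (toReal β)) =
        twistedForm (realForm B) p (toReal α - p (toReal α)) (toReal β) := by
      simp [twistedForm_apply, apply_apply_of_mem_orthogonalProjections hp]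
    rw [this]
    simp
  sub_eq α β := by
    have h1 := orthogonal_apply (realForm_isSymm hB) hp (toReal α) (toReal β)
    have h2 := orthogonal_apply' (realForm_isSymm hB) hp (toReal α) (toReal β)
    have h3 : realForm B (toReal α) (toReal β) = B α β := by
      rw [realForm, toReal, toReal, LinearMap.BilinForm.baseChange_tmul]; simp
    rw [leftPairing, rightPairing, ← h3]
    simp only [twistedForm_apply, apply_apply_of_mem_orthogonalProjections hp, LinearMap.sub_apply,
      Module.End.one_apply, map_sub, sub_self, map_zero, sub_zero] at *
    simp at *
    linarith
  exists_dual := baseChange_exists_dual (twistedForm_nondegenerate (realForm_isSymm hB) hn hp)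

/-- The kernel of 1 - q is the image of the idempotent q, and both being an image and being fixed
survive base change. -/
theorem mem_baseChange_of_sub_eq_zero {H : Type*} [AddCommGroup H] [Module ℝ H]
    {q : Module.End ℝ H} (hq : q * q = q) (x : ℂ ⊗[ℝ] H) :
    x ∈ (LinearMap.ker (1 - q)).baseChange ℂ ↔ LinearMap.baseChange ℂ q x = x := by
  constructor
  · intro hx
    rw [Submodule.baseChange_eq_span] at hx
    refine Submodule.span_induction (p := fun x _ => LinearMap.baseChange ℂ q x = x) ?_ ?_ ?_ ?_ hx
    · rintro _ ⟨y, hy, rfl⟩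
      have : y - q y = 0 := hy
      simp [← sub_eq_zero.1 this]
    · simp
    · intro a b _ _ ha hb
      rw [map_add, ha, hb]
    · intro t a _ ha
      rw [map_smul, ha]
  · intro hx
    rw [← hx]
    clear hx
    induction x using TensorProduct.induction_on with
    | zero => simp
    | add x y hx hy => rw [map_add]; exact Submodule.add_mem _ hx hy
    | tmul s y =>
      refine Submodule.tmul_mem_baseChange_of_mem s ?_
      have := LinearMap.congr_fun hq y
      simpa [sub_eq_zero] using this.symm

theorem latticeDatum_part_true : (latticeDatum B hB heven hn A p hp).part true = leftSpace p := by
  ext x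
  exact (mem_baseChange_of_sub_eq_zero hp.1 x).symm

theorem latticeDatum_part_false :
    (latticeDatum B hB heven hn A p hp).part false = rightSpace p := by
  ext x
  have h1 : (1 - p) * (1 - p) = 1 - p := by
    rw [mul_sub, sub_mul, sub_mul, hp.1]; simp
  have := mem_baseChange_of_sub_eq_zero h1 x
  rw [sub_sub_cancel, LinearMap.baseChange_sub] at this
  rw [rightSpace, this, LatticeDatum.mem_part]
  change x - complexProj p x = x ↔ LinearMap.baseChange ℂ (1 : Module.End ℝ _) x - complexProj p x = x
  rw [Module.End.one_eq_id, LinearMap.baseChange_id]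
  rfl

/-- The two constructions differ only in how the left and right subspaces of the grading are
presented: as complexified kernels or as fixed spaces of the complex projections. -/
theorem latticeVertex_eq :
    latticeVertex p A = (latticeDatum B hB heven hn A p hp).vertexData := by
  have h1 := latticeDatum_part_true B hB heven hn A p hp
  have h2 := latticeDatum_part_false B hB heven hn A p hp
  unfold latticeVertex
  rw [← h1, ← h2]
  rfl

include hB heven hn hp in
theorem latticeVertex_isFullVertexAlgebra : (latticeVertex p A).IsFullVertexAlgebra := by
  have : Countable L := (Module.Free.chooseBasis ℤ L).repr.toEquiv.countable_iff.2 inferInstance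
  rw [latticeVertex_eq B hB heven hn A p hp]
  exact (latticeDatum B hB heven hn A p hp).isFullVertexAlgebra

end Lattice

/-! ### The Sugawara construction -/

theorem smul_dv_injective {c : Bool} {s t : ℝ} (h : s • dv c = t • dv c) : s = t := by
  cases c <;> simp_all [dv, Prod.ext_iff]

namespace LatticeDatum
variable {L E : Type*} [AddCommGroup L] [AddCommGroup E] [Module ℂ E] (D : LatticeDatum L E)

/-- The left or right component of an exponent. -/
def crd (c : Bool) (y : ℝ × ℝ) : ℝ := cond c y.1 y.2

/-- A family in the left or right part that is orthonormal and spans, expressed by the resulting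
formula for the projection. -/
structure Frame (c : Bool) where
  n : ℕ
  f : Fin n → E
  pr_f : ∀ i, D.pr c (f i) = f i
  sum_f : ∀ x, ∑ i, D.g (f i) x • f i = D.pr c x

variable {D} {c : Bool} (S : D.Frame c)

theorem Frame.sum_sq (x : E) : ∑ i, D.g (S.f i) x * D.g (S.f i) x = D.g (D.pr c x) x := by
  rw [← S.sum_f, map_sum, LinearMap.sum_apply]
  simp

/-- The Virasoro vector. -/
def Frame.ω : L →₀ Fock E := (2⁻¹ : ℂ) • ∑ i, D.h (-1) (S.f i) (D.h (-1) (S.f i) (e 0))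

/-- The Virasoro operators. -/
def Frame.vir (n : ℤ) : Module.End ℂ (L →₀ Fock E) := D.Y (-((n : ℝ) + 2) • dv c) S.ω

/-- The field of x(-1)1 is the current of x: in the normal ordering formula Y(1,z) is the identity,
so one term survives. It is the creation term of index -m-1 for m < 0 and the annihilation term of
index m for m ≥ 0. -/
theorem Y_current {x : E} (hx : D.pr c x = x) (m : ℤ) (w : L →₀ Fock E) :
    D.Y (-((m : ℝ) + 1) • dv c) (D.h (-1) x (e 0)) w = D.h m x w := by
  obtain ⟨K, hK, hKm, hKm'⟩ := ((D.Y_h c 0 x hx (e 0) w (-((m : ℝ) + 1) • dv c)).and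
    ((eventually_gt_atTop m.natAbs).and (D.h_eventually x w))).exists
  rw [show (-1 : ℤ) = -(((0 : ℕ) : ℤ) + 1) by simp, hK]
  simp only [Y_e_zero]
  rcases lt_or_ge m 0 with hm | hm
  · rw [Finset.sum_eq_single (-m - 1).toNat, Finset.sum_eq_zero, if_pos, add_zero]
    · rw [show (-((((-m - 1).toNat + 0 : ℕ) : ℤ) + 1)) = m by omega]
      simp
    · rw [show (((-m - 1).toNat : ℕ) : ℝ) = (((-m - 1).toNat : ℤ) : ℝ) by simp,
        Int.toNat_of_nonneg (by omega)]
      push_cast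
      module
    · intro i _
      rw [if_neg, smul_zero]
      intro h
      rw [← add_smul] at h
      have h2 : (-((m : ℝ) + 1) + ((i + 0 + 1 : ℕ) : ℝ)) = 0 := smul_dv_injective (h.trans (zero_smul ℝ (dv c)).symm)
      have h3 : (i : ℤ) = m := by
        have : (i : ℝ) = m := by push_cast at h2; linarith
        exact_mod_cast this
      omega
    · intro j _ hj
      rw [if_neg, map_zero, smul_zero]
      intro h
      rw [← sub_smul] at h
      have h2 : -((m : ℝ) + 1) - (j : ℝ) = 0 := smul_dv_injective (h.trans (zero_smul ℝ (dv c)).symm)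
      have h3 : (j : ℤ) = -m - 1 := by
        have : (j : ℝ) = -m - 1 := by linarith
        exact_mod_cast this
      omega
    · intro h
      rw [Finset.mem_range] at h
      omega
  · rw [Finset.sum_eq_zero, zero_add, Finset.sum_eq_single m.toNat, if_pos]
    · rw [show ((m.toNat : ℕ) : ℤ) = m by omega]
      simp
    · rw [← add_smul, show (((m.toNat + 0 + 1 : ℕ) : ℝ)) = (m : ℝ) + 1 by
        have : ((m.toNat : ℤ) : ℝ) = m := by rw [Int.toNat_of_nonneg hm]
        push_cast at this ⊢
        linarith]
      rw [neg_add_cancel, zero_smul]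
    · intro i _ hi
      rw [if_neg, smul_zero]
      intro h
      rw [← add_smul] at h
      have h2 : (-((m : ℝ) + 1) + ((i + 0 + 1 : ℕ) : ℝ)) = 0 := smul_dv_injective (h.trans (zero_smul ℝ (dv c)).symm)
      have h3 : (i : ℤ) = m := by
        have : (i : ℝ) = m := by push_cast at h2; linarith
        exact_mod_cast this
      omega
    · intro h
      rw [Finset.mem_range] at h
      omega
    · intro j _
      rw [if_neg, map_zero, smul_zero]
      intro h
      rw [← sub_smul] at h
      have h2 : -((m : ℝ) + 1) - (j : ℝ) = 0 := smul_dv_injective (h.trans (zero_smul ℝ (dv c)).symm)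
      have h3 : (j : ℤ) = -m - 1 := by
        have : (j : ℝ) = -m - 1 := by linarith
        exact_mod_cast this
      omega

/-- The Sugawara formula. -/
theorem Frame.vir_apply (n : ℤ) (w : L →₀ Fock E) : ∀ᶠ K : ℕ in atTop, S.vir n w =
    (2⁻¹ : ℂ) • ∑ i, (∑ j ∈ Finset.range K, D.h (-((j : ℤ) + 1)) (S.f i) (D.h (n + 1 + j) (S.f i) w) +
      ∑ j ∈ Finset.range K, D.h (n - j) (S.f i) (D.h j (S.f i) w)) := by
  have h1 : ∀ i, ∀ᶠ K : ℕ in atTop, D.Y (-((n : ℝ) + 2) • dv c)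
      (D.h (-1) (S.f i) (D.h (-1) (S.f i) (e 0))) w =
      ∑ j ∈ Finset.range K, D.h (-((j : ℤ) + 1)) (S.f i) (D.h (n + 1 + j) (S.f i) w) +
        ∑ j ∈ Finset.range K, D.h (n - j) (S.f i) (D.h j (S.f i) w) := by
    intro i
    filter_upwards [D.Y_h c 0 (S.f i) (S.pr_f i) (D.h (-1) (S.f i) (e 0)) w (-((n : ℝ) + 2) • dv c)]
      with K hK
    rw [show (-(((0 : ℕ) : ℤ) + 1)) = -1 by simp] at hK
    rw [hK]
    congr 1
    · refine Finset.sum_congr rfl fun j _ => ?_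
      rw [show -((n : ℝ) + 2) • dv c - (j : ℝ) • dv c = -(((n + 1 + j : ℤ) : ℝ) + 1) • dv c by
        push_cast; module, Y_current (S.pr_f i)]
      simp
    · refine Finset.sum_congr rfl fun j _ => ?_
      rw [show -((n : ℝ) + 2) • dv c + ((j + 0 + 1 : ℕ) : ℝ) • dv c =
        -(((n - j : ℤ) : ℝ) + 1) • dv c by push_cast; module, Y_current (S.pr_f i)]
      simp
  filter_upwards [eventually_all.2 h1] with K hK
  rw [Frame.vir, Frame.ω, map_smul, LinearMap.smul_apply, map_sum, LinearMap.sum_apply]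
  exact congrArg _ (Finset.sum_congr rfl fun i _ => hK i)

/-- Of the modes x(l) with l ≥ 0 only x(1) acts nontrivially on the conformal vector, contracting
with either factor and thereby cancelling the 1/2. The commutator formula then collapses to [x(m),
L(n)] = m x(m+n) on the same part and to zero on the other. -/
theorem Frame.h_ω (l : ℕ) (x : E) : D.h l x S.ω = if l = 1 then D.h (-1) (D.pr c x) (e 0) else 0 := by
  have h1 : ∀ i, D.h l x (D.h (-1) (S.f i) (D.h (-1) (S.f i) (e 0))) =
      (2 : ℂ) • (if l = 1 then D.g (S.f i) x else 0) • D.h (-1) (S.f i) (e 0) := by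
    intro i
    rw [D.h_commutator l (-1), D.h_commutator l (-1) x (S.f i) (e 0), h_natCast_e]
    have h2 : (l : ℤ) + -1 = 0 ↔ l = 1 := by omega
    simp only [h2, map_zero]
    by_cases hl : l = 1
    · subst hl
      simp [D.g_comm x]
      module
    · by_cases h0 : l = 0 <;> simp [hl, h0]
  rw [Frame.ω, map_smul, map_sum, Finset.sum_congr rfl fun i _ => h1 i, ← Finset.smul_sum, smul_smul,
    inv_mul_cancel₀ two_ne_zero, one_smul]
  split_ifs
  · rw [← S.sum_f x, map_sum, LinearMap.sum_apply]
    simp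
  · simp

/-- The commutators with the modes of the same part. -/
theorem Frame.h_vir (m n : ℤ) {x : E} (hx : D.pr c x = x) (w : L →₀ Fock E) :
    D.h m x (S.vir n w) = S.vir n (D.h m x w) + (m : ℂ) • D.h (m + n) x w := by
  obtain ⟨M, hM, hM1⟩ := ((D.commutator c x hx S.ω).and (eventually_gt_atTop 1)).exists
  rw [Frame.vir, hM, Finset.sum_eq_single 1, S.h_ω, if_pos rfl, hx, ch_one, ← Y_current hx (m + n),
      show -(((m + n : ℤ) : ℝ) + 1) • dv c = -((n : ℝ) + 2) • dv c - ((m : ℝ) - ((1 : ℕ) : ℝ)) • dv c by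
        push_cast; module]
  · simp
  · intro l _ hl
    rw [S.h_ω, if_neg hl]
    simp
  · intro h
    exact absurd (Finset.mem_range.2 hM1) h

theorem Frame.vir_h (m n : ℤ) {x : E} (hx : D.pr c x = x) (w : L →₀ Fock E) :
    S.vir n (D.h m x w) = D.h m x (S.vir n w) - (m : ℂ) • D.h (m + n) x w := by
  rw [S.h_vir m n hx, add_sub_cancel_right]

theorem Frame.vir_h_of_ne {c' : Bool} (hc : c ≠ c') (m n : ℤ) {x : E} (hx : D.pr c' x = x)
    (w : L →₀ Fock E) : S.vir n (D.h m x w) = D.h m x (S.vir n w) := by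
  obtain ⟨M, hM⟩ := (D.commutator c' x hx S.ω).exists
  rw [Frame.vir, hM, Finset.sum_eq_zero, add_zero]
  intro l _
  rw [S.h_ω, ← hx, D.pr_pr_of_ne hc]
  simp

theorem Frame.vir_vir_of_ne {c' : Bool} (hc : c ≠ c') (S' : D.Frame c') (m n : ℤ) (w : L →₀ Fock E) :
    S.vir m (S'.vir n w) = S'.vir n (S.vir m w) := by
  obtain ⟨K, h1, h2⟩ := ((S'.vir_apply n w).and (S'.vir_apply n (S.vir m w))).exists
  rw [h1, h2, map_smul, map_sum]
  simp only [map_add, map_sum, S.vir_h_of_ne hc _ _ (S'.pr_f _)]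

theorem Frame.ω_mem_U : S.ω ∈ D.U 0 ((2 : ℝ) • dv c) := by
  refine Submodule.smul_mem _ _ (Submodule.sum_mem _ fun i _ => ?_)
  have := D.h_mem_U c (-1) (S.pr_f i) (D.h_mem_U c (-1) (S.pr_f i) (D.e_mem_U 0))
  convert this using 2
  rw [wtE_zero]
  push_cast
  module

theorem Frame.vir_mem_U (n : ℤ) {δ : L} {y : ℝ × ℝ} {v : L →₀ Fock E} (hv : v ∈ D.U δ y) :
    S.vir n v ∈ D.U δ (y - (n : ℝ) • dv c) := by
  have := D.Y_mem_U (-((n : ℝ) + 2) • dv c) S.ω_mem_U hv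
  rw [zero_add, show (2 : ℝ) • dv c + y + -((n : ℝ) + 2) • dv c = y - (n : ℝ) • dv c by module] at this
  exact this

theorem Frame.vir_mem_W (n : ℤ) {y : ℝ × ℝ} {v : L →₀ Fock E} (hv : v ∈ D.W y) :
    S.vir n v ∈ D.W (y - (n : ℝ) • dv c) := by
  have := D.Y_mem_W (-((n : ℝ) + 2) • dv c) (D.U_le_W _ _ S.ω_mem_U) hv
  rw [show (2 : ℝ) • dv c + y + -((n : ℝ) + 2) • dv c = y - (n : ℝ) • dv c by module] at this
  exact this

theorem U_eq_bot_of_pos {δ : L} {n : ℤ} (hn : 0 < n) : D.U δ (D.wtE δ - (n : ℝ) • dv c) = ⊥ := by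
  refine D.U_eq_bot fun i j h => ?_
  have h1 : -(n : ℝ) • dv c = ((i : ℝ), (j : ℝ)) := by
    rw [sub_eq_add_neg] at h
    rw [neg_smul]
    exact add_left_cancel h
  have hn' : (0 : ℝ) < n := by exact_mod_cast hn
  cases c <;> simp [dv, Prod.ext_iff] at h1
  · have : (0 : ℝ) ≤ j := j.cast_nonneg
    linarith [h1.2]
  · have : (0 : ℝ) ≤ i := i.cast_nonneg
    linarith [h1.1]

theorem Frame.vir_e_pos {n : ℤ} (hn : 0 < n) (β : L) : S.vir n (e β) = 0 := by
  have := S.vir_mem_U n (D.e_mem_U β)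
  rwa [U_eq_bot_of_pos hn, Submodule.mem_bot] at this

theorem h_zero_e (x : E) (β : L) : D.h 0 x (e β) = D.g x (D.wt β) • e β := D.h_zero_single x β 1

theorem g_pr_wt_wt (c : Bool) (β : L) :
    D.g (D.pr c (D.wt β)) (D.wt β) = ((2 * crd c (D.wtE β) : ℝ) : ℂ) := by
  rw [g_pr_wt]
  cases c <;> simp [crd, wtE] <;> ring

/-- On e_β only the product of two zero modes survives, and half the sum of the squares of (fᵢ, β)
is the weight. -/
theorem Frame.vir_zero_e (β : L) : S.vir 0 (e β) = ((crd c (D.wtE β) : ℝ) : ℂ) • e β := by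
  obtain ⟨K, hK, hK0⟩ := ((S.vir_apply 0 (e β)).and (eventually_gt_atTop 0)).exists
  rw [hK]
  have h1 : ∀ i, ∑ j ∈ Finset.range K, D.h (-((j : ℤ) + 1)) (S.f i) (D.h (0 + 1 + j) (S.f i) (e β)) +
      ∑ j ∈ Finset.range K, D.h (0 - j) (S.f i) (D.h j (S.f i) (e β)) =
      (D.g (S.f i) (D.wt β) * D.g (S.f i) (D.wt β)) • e β := by
    intro i
    rw [Finset.sum_eq_zero, zero_add, Finset.sum_eq_single 0]
    · simp [h_zero_e, smul_smul]
    · intro j _ hj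
      rw [D.h_e_pos _ (by omega), map_zero]
    · intro h
      exact absurd (Finset.mem_range.2 hK0) h
    · intro j _
      rw [D.h_e_pos _ (by omega), map_zero]
  rw [Finset.sum_congr rfl fun i _ => h1 i, ← Finset.sum_smul, S.sum_sq, g_pr_wt_wt, smul_smul]
  congr 1
  push_cast
  ring

/-- Both halves of the Sugawara sum contribute their term j = 0, each fᵢ(-1)fᵢ(0)e_β; the resulting
2 cancels the 1/2. -/
theorem Frame.vir_neg_one_e (β : L) : S.vir (-1) (e β) = D.h (-1) (D.pr c (D.wt β)) (e β) := by
  obtain ⟨K, hK, hK0⟩ := ((S.vir_apply (-1) (e β)).and (eventually_gt_atTop 0)).exists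
  rw [hK]
  have h1 : ∀ i, ∑ j ∈ Finset.range K, D.h (-((j : ℤ) + 1)) (S.f i) (D.h (-1 + 1 + j) (S.f i) (e β)) +
      ∑ j ∈ Finset.range K, D.h (-1 - j) (S.f i) (D.h j (S.f i) (e β)) =
      (2 : ℂ) • D.h (-1) (D.g (S.f i) (D.wt β) • S.f i) (e β) := by
    intro i
    rw [Finset.sum_eq_single 0, Finset.sum_eq_single 0]
    · simp [h_zero_e, two_smul]
    · intro j _ hj
      rw [D.h_e_pos _ (by omega), map_zero]
    · intro h
      exact absurd (Finset.mem_range.2 hK0) h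
    · intro j _ hj
      rw [D.h_e_pos _ (by omega), map_zero]
    · intro h
      exact absurd (Finset.mem_range.2 hK0) h
  rw [Finset.sum_congr rfl fun i _ => h1 i, ← Finset.smul_sum, smul_smul,
    inv_mul_cancel₀ two_ne_zero, one_smul, ← S.sum_f, map_sum, LinearMap.sum_apply]

theorem crd_add (c : Bool) (y z : ℝ × ℝ) : crd c (y + z) = crd c y + crd c z := by cases c <;> rfl

theorem crd_smul_dv (c c' : Bool) (t : ℝ) : crd c (t • dv c') = if c = c' then t else 0 := by
  cases c <;> cases c' <;> simp [crd, dv]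

/-- Each creation operator x(-k-1) of the same part raises the eigenvalue of L(0) by k + 1, and
those of the other part leave it unchanged. -/
theorem Frame.vir_zero {δ : L} {y : ℝ × ℝ} {v : L →₀ Fock E} (hv : v ∈ D.U δ y) :
    S.vir 0 v = ((crd c y : ℝ) : ℂ) • v := by
  refine D.U_induction (motive := fun _ y v => S.vir 0 v = ((crd c y : ℝ) : ℂ) • v) ?_ ?_ ?_ ?_ ?_ hv
  · simp
  · exact S.vir_zero_e
  · intro δ y v w hv hw
    rw [map_add, hv, hw, smul_add]
  · intro δ y t v hv
    rw [map_smul, hv, smul_comm]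
  · intro c' k x δ y v hx hv _ ih
    rw [crd_add, crd_smul_dv]
    by_cases hc : c = c'
    · subst hc
      rw [S.vir_h _ _ hx, ih, map_smul, if_pos rfl, add_zero, ← sub_smul]
      congr 1
      push_cast
      ring
    · rw [S.vir_h_of_ne hc _ _ hx, ih, map_smul, if_neg hc, add_zero]

theorem Frame.vir_zero_W {y : ℝ × ℝ} {v : L →₀ Fock E} (hv : v ∈ D.W y) :
    S.vir 0 v = ((crd c y : ℝ) : ℂ) • v := by
  refine Submodule.iSup_induction (D.U · y) (motive := fun v => S.vir 0 v = ((crd c y : ℝ) : ℂ) • v) hv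
    (fun δ v hv => S.vir_zero hv) (by simp) ?_
  intro v w hv hw
  rw [map_add, hv, hw, smul_add]

end LatticeDatum

/-! ### The Virasoro relations and the translation operators -/

/-- Half of this sum is the cocycle (M³ - M)/12: its summands are the products of the two
contraction coefficients in L(M) acting on the terms of L(-M)e_β. -/
theorem sum_range_succ_mul_sub (M : ℕ) :
    ∑ j ∈ Finset.range M, ((j : ℂ) + 1) * ((M : ℂ) - 1 - j) = ((M : ℂ) ^ 3 - M) / 6 := by
  have key : ∀ (N : ℕ) (t : ℂ), ∑ j ∈ Finset.range N, ((j : ℂ) + 1) * (t - 1 - j) =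
      (N * (N + 1) / 2) * t - N * (N + 1) * (2 * N + 1) / 6 := by
    intro N t
    induction N with
    | zero => simp
    | succ N ih => rw [Finset.sum_range_succ, ih]; push_cast; ring
  rw [key]
  ring

namespace LatticeDatum
variable {L E : Type*} [AddCommGroup L] [AddCommGroup E] [Module ℂ E] {D : LatticeDatum L E}

theorem eq_zero_of_commute {T : Module.End ℂ (L →₀ Fock E)} (he : ∀ α, T (e α) = 0)
    (h : ∀ c (n : ℤ) x v, D.pr c x = x → T (D.h n x v) = D.h n x (T v)) : T = 0 := by
  refine LinearMap.ext fun v => ?_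
  induction v using D.induction with
  | e α => exact he α
  | add v w hv hw => rw [map_add, hv, hw, map_add]
  | smul t v hv => rw [map_smul, hv, map_smul]
  | h c k x v hx hv => rw [h c _ x v hx, hv]; simp

/-- The Euler operator multiplies the vector by its level, which is nonzero, while every term of it
begins with a positive mode. -/
theorem eq_zero_of_h_pos {δ : L} {y : ℝ × ℝ} {v : L →₀ Fock E} (hv : v ∈ D.U δ y) {c : Bool}
    (hy : crd c (y - D.wtE δ) ≠ 0)
    (h : ∀ (k : ℕ) x, D.pr c x = x → D.h ((k : ℤ) + 1) x v = 0) : v = 0 := by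
  obtain ⟨n, f, f', hf⟩ := D.exists_dual
  obtain ⟨K, hK⟩ := exists_nat_ge ((y - D.wtE δ).1 + (y - D.wtE δ).2)
  have := D.euler hf c hv K hK
  rw [Finset.sum_eq_zero] at this
  · refine (smul_eq_zero.1 this.symm).resolve_left ?_
    rw [Complex.ofReal_eq_zero]
    exact hy
  · intro k _
    refine Finset.sum_eq_zero fun i _ => ?_
    rw [h k _ (D.pr_pr _ _), map_zero]

variable {c : Bool} (S : D.Frame c)

/-- Since [x(k), L(n)] = k x(k+n), the terms produced by the three operators cancel and the defect
in the Virasoro relation commutes with all modes. -/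
theorem Frame.h_bracket (m n : ℤ) (c' : Bool) (k : ℤ) (x : E) (hx : D.pr c' x = x)
    (w : L →₀ Fock E) :
    S.vir m (S.vir n (D.h k x w)) - S.vir n (S.vir m (D.h k x w)) -
      ((m : ℂ) - n) • S.vir (m + n) (D.h k x w) =
    D.h k x (S.vir m (S.vir n w) - S.vir n (S.vir m w) - ((m : ℂ) - n) • S.vir (m + n) w) := by
  by_cases hc : c = c'
  · subst hc
    simp only [S.vir_h _ _ hx, map_sub, map_smul]
    rw [show k + n + m = k + m + n by ring, show k + (m + n) = k + m + n by ring]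
    push_cast
    module
  · simp only [S.vir_h_of_ne hc _ _ hx, map_sub, map_smul]

theorem Frame.bracket_mem_U (m n : ℤ) (β : L) :
    S.vir m (S.vir n (e β)) - S.vir n (S.vir m (e β)) - ((m : ℂ) - n) • S.vir (m + n) (e β) ∈
      D.U β (D.wtE β - ((m + n : ℤ) : ℝ) • dv c) := by
  have h1 := S.vir_mem_U m (S.vir_mem_U n (D.e_mem_U β))
  have h2 := S.vir_mem_U n (S.vir_mem_U m (D.e_mem_U β))
  rw [show D.wtE β - (n : ℝ) • dv c - (m : ℝ) • dv c = D.wtE β - ((m + n : ℤ) : ℝ) • dv c by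
    push_cast; module] at h1
  rw [show D.wtE β - (m : ℝ) • dv c - (n : ℝ) • dv c = D.wtE β - ((m + n : ℤ) : ℝ) • dv c by
    push_cast; module] at h2
  exact Submodule.sub_mem _ (Submodule.sub_mem _ h1 h2)
    (Submodule.smul_mem _ _ (S.vir_mem_U (m + n) (D.e_mem_U β)))

theorem Frame.vir_mul_mode_e (M : ℕ) (x : E) (hx : D.pr c x = x) (β : L) (j : ℕ) (hj : j < M) :
    S.vir M (D.h (-((j : ℤ) + 1)) x (D.h (-(M : ℤ) + 1 + j) x (e β))) =
      (((j : ℂ) + 1) * ((M : ℂ) - 1 - j) * D.g x x +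
        if j + 1 = M then (M : ℂ) * (D.g x (D.wt β) * D.g x (D.wt β)) else 0) • e β := by
  have h0 : S.vir M (D.h (-(M : ℤ) + 1 + j) x (e β)) = 0 := by
    rw [S.vir_h _ _ hx, S.vir_e_pos (by omega), map_zero, D.h_e_pos _ (by omega)]
    simp
  rw [S.vir_h _ _ hx, h0, map_zero, zero_sub]
  rw [D.h_commutator (-((j : ℤ) + 1) + M) (-(M : ℤ) + 1 + j) x x, if_pos (by ring)]
  by_cases h1 : j + 1 = M
  · rw [if_pos h1, show -((j : ℤ) + 1) + M = 0 by omega, show -(M : ℤ) + 1 + j = 0 by omega]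
    simp only [h_zero_e, map_smul, smul_smul, ← h1]
    push_cast
    module
  · rw [if_neg h1, D.h_e_pos _ (by omega), map_zero]
    push_cast
    module

/-- The terms with 0 ≤ j < M give the central contribution, with central charge ∑ (fᵢ, fᵢ). The
momentum terms add up to 2M times the weight of e_β and are cancelled by 2M L(0)e_β. -/
theorem Frame.bracket_neg_e (M : ℕ) (hM : 0 < M) (β : L) :
    S.vir M (S.vir (-(M : ℤ)) (e β)) - S.vir (-(M : ℤ)) (S.vir M (e β)) -
      ((M : ℂ) - (-(M : ℤ) : ℤ)) • S.vir (M + -(M : ℤ)) (e β) =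
    (((M : ℂ) ^ 3 - M) / 12 * ∑ i, D.g (S.f i) (S.f i)) • e β := by
  obtain ⟨K, hK, hKM⟩ := ((S.vir_apply (-(M : ℤ)) (e β)).and (eventually_ge_atTop M)).exists
  have h1 : ∀ i, S.vir M (∑ j ∈ Finset.range K, D.h (-((j : ℤ) + 1)) (S.f i)
        (D.h (-(M : ℤ) + 1 + j) (S.f i) (e β)) +
      ∑ j ∈ Finset.range K, D.h (-(M : ℤ) - j) (S.f i) (D.h j (S.f i) (e β))) =
      (((M : ℂ) ^ 3 - M) / 6 * D.g (S.f i) (S.f i) +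
        2 * (M : ℂ) * (D.g (S.f i) (D.wt β) * D.g (S.f i) (D.wt β))) • e β := by
    intro i
    have h2 : ∑ j ∈ Finset.range K, D.h (-(M : ℤ) - j) (S.f i) (D.h j (S.f i) (e β)) =
        D.h (-(M : ℤ)) (S.f i) (D.g (S.f i) (D.wt β) • e β) := by
      rw [Finset.sum_eq_single 0, Nat.cast_zero, h_zero_e, sub_zero]
      · intro j _ hj
        rw [D.h_e_pos _ (by omega), map_zero]
      · intro h
        rw [Finset.mem_range] at h
        omega
    rw [map_add, sum_range_eq_of_le _ hKM, map_sum,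
      Finset.sum_congr rfl fun j hj => S.vir_mul_mode_e M _ (S.pr_f i) β j (Finset.mem_range.1 hj),
      h2, ← Finset.sum_smul, Finset.sum_add_distrib, ← Finset.sum_mul,
      sum_range_succ_mul_sub, Finset.sum_eq_single (M - 1), if_pos (by omega)]
    · rw [map_smul, map_smul, S.vir_h _ _ (S.pr_f i), S.vir_e_pos (by omega), neg_add_cancel, h_zero_e]
      push_cast
      simp only [map_zero]
      module
    · intro j hj hj'
      rw [if_neg]
      rw [Finset.mem_range] at hj
      omega
    · intro h
      rw [Finset.mem_range] at h
      omega
    · intro j hj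
      rw [D.h_e_pos _ (by omega), map_zero]
  rw [S.vir_e_pos (n := M) (by omega), map_zero, hK, map_smul, map_sum, Finset.sum_congr rfl fun i _ => h1 i,
    ← Finset.sum_smul, Finset.sum_add_distrib, ← Finset.mul_sum, ← Finset.mul_sum, S.sum_sq,
    g_pr_wt_wt, add_neg_cancel, S.vir_zero_e]
  push_cast
  module

/-- The value of the defect on e_β has weight shifted by -(m+n). For m + n > 0 there are no such
vectors. For m + n < 0 it is killed by all positive modes of its part, yet lies above the lowest
level, so it vanishes. Only m + n = 0 needs a computation, and the case m < 0 follows from m > 0 by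
antisymmetry. -/
theorem Frame.bracket_e (m n : ℤ) (β : L) :
    S.vir m (S.vir n (e β)) - S.vir n (S.vir m (e β)) - ((m : ℂ) - n) • S.vir (m + n) (e β) =
      (if m + n = 0 then ((m : ℂ) ^ 3 - m) / 12 * ∑ i, D.g (S.f i) (S.f i) else 0) • e β := by
  rcases lt_trichotomy (m + n) 0 with h | h | h
  · rw [if_neg h.ne, zero_smul]
    refine eq_zero_of_h_pos (S.bracket_mem_U m n β) (c := c) ?_ ?_
    · rw [sub_sub_cancel_left, ← neg_smul, crd_smul_dv, if_pos rfl, neg_ne_zero]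
      exact_mod_cast h.ne
    · intro k x hx
      rw [← S.h_bracket m n c _ x hx, D.h_e_pos _ (by omega)]
      simp
  · rw [if_pos h]
    obtain rfl : n = -m := by omega
    rcases lt_trichotomy m 0 with hm | rfl | hm
    · obtain ⟨M, rfl⟩ : ∃ M : ℕ, m = -(M : ℤ) := ⟨(-m).toNat, by omega⟩
      have := S.bracket_neg_e M (by omega) β
      rw [neg_neg, neg_add_cancel, ← neg_inj]
      rw [add_neg_cancel] at this
      rw [← neg_smul]
      refine Eq.trans ?_ (this.trans ?_)
      · push_cast
        module
      · congr 1
        push_cast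
        ring
    · simp
    · obtain ⟨M, rfl⟩ : ∃ M : ℕ, m = (M : ℤ) := ⟨m.toNat, by omega⟩
      simpa using S.bracket_neg_e M (by omega) β
  · rw [if_neg h.ne', zero_smul]
    have := S.bracket_mem_U m n β
    rwa [U_eq_bot_of_pos h, Submodule.mem_bot] at this

/-- The Virasoro relations. -/
theorem Frame.virasoro (m n : ℤ) : ⁅S.vir m, S.vir n⁆ = ((m : ℂ) - n) • S.vir (m + n) +
    (if m + n = 0 then ((m : ℂ) ^ 3 - m) / 12 * ∑ i, D.g (S.f i) (S.f i) else 0) • 1 := by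
  rw [← sub_eq_zero]
  refine eq_zero_of_commute (D := D) (fun β => ?_) (fun c' k x w hx => ?_)
  · have := S.bracket_e m n β
    simp only [LinearMap.sub_apply, LinearMap.add_apply, LinearMap.smul_apply, Module.End.one_apply,
      Ring.lie_def, Module.End.mul_apply]
    rw [← sub_sub, this, sub_self]
  · have := S.h_bracket m n c' k x hx w
    simp only [LinearMap.sub_apply, LinearMap.add_apply, LinearMap.smul_apply, Module.End.one_apply,
      Ring.lie_def, Module.End.mul_apply]
    rw [← sub_sub, this, ← sub_sub, map_sub _ _ (_ • w), map_smul]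

theorem Frame.vir_vir (m n : ℤ) (w : L →₀ Fock E) : S.vir m (S.vir n w) = S.vir n (S.vir m w) +
    ((m : ℂ) - n) • S.vir (m + n) w +
    (if m + n = 0 then ((m : ℂ) ^ 3 - m) / 12 * ∑ i, D.g (S.f i) (S.f i) else 0) • w := by
  have := LinearMap.congr_fun (S.virasoro m n) w
  simp only [LinearMap.sub_apply, LinearMap.add_apply, LinearMap.smul_apply, Module.End.one_apply,
      Ring.lie_def, Module.End.mul_apply] at this
  rw [sub_eq_iff_eq_add] at this
  rw [this]
  abel

/-- The translation operator. -/
theorem Frame.Y_dv_vacuum (a : L →₀ Fock E) : D.Y (dv c) a (e 0) = S.vir (-1) a := by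
  induction a using D.induction with
  | e α =>
    have h1 := D.Y_e_e α 0 (cond c 1 0) (cond c 0 1)
    have h2 := D.em_rec (D.pr c (D.wt α)) 1
    rw [Finset.sum_range_one] at h2
    simp only [Nat.cast_one, one_smul, zero_add, Nat.sub_self, em_zero, mul_one] at h2
    rw [S.vir_neg_one_e, show (-1 : ℤ) = -(((0 : ℕ) : ℤ) + 1) by simp, e, D.h_neg_single, mul_one,
      ← h2]
    rw [pe_zero_right, zero_add, add_zero, D.A.zero_right, one_smul] at h1
    cases c <;> simpa [dv, em_zero, e] using h1
  | add v w hv hw => simp only [map_add, LinearMap.add_apply, hv, hw]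
  | smul t v hv => simp only [map_smul, LinearMap.smul_apply, hv]
  | h c' k x v hx hv =>
    obtain ⟨K, hK, hK1⟩ := ((D.Y_h c' k x hx v (e 0) (dv c)).and (eventually_gt_atTop 1)).exists
    rw [hK, Finset.sum_eq_zero (s := Finset.range K) (f := fun i => ((-1) ^ k * Nat.choose (i + k) k : ℂ) •
        D.Y (dv c + ((i + k + 1 : ℕ) : ℝ) • dv c') v (D.h i x (e 0))), add_zero]
    · by_cases hc : c = c'
      · subst hc
        -- Only j = 0 and j = 1 survive on the vacuum: they give x(-k-1)L(-1)v and (k+1) x(-k-2)v,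
        -- the two terms of L(-1)x(-k-1)v.
        rw [S.vir_h _ _ hx, ← Finset.sum_subset (Finset.range_subset_range.2 (show 2 ≤ K by omega)),
          Finset.sum_range_succ, Finset.sum_range_one, ← hv]
        · have h1 : dv c - (1 : ℝ) • dv c = 0 := by module
          simp only [Nat.cast_zero, zero_smul, sub_zero, Nat.cast_one, h1, Y_zero_vacuum]
          rw [zero_add, Nat.choose_self, add_comm 1 k, Nat.choose_succ_self_right,
            show (-((k : ℤ) + 1) + -1) = -(((k + 1 : ℕ) : ℤ) + 1) by push_cast; ring]
          push_cast
          module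
        · intro j _ hj
          rw [Y_vacuum_eq_zero, map_zero, smul_zero]
          intro n m h
          rw [Finset.mem_range, not_lt] at hj
          have hj' : (2 : ℝ) ≤ j := by exact_mod_cast hj
          have hn : (0 : ℝ) ≤ n := n.cast_nonneg
          have hm : (0 : ℝ) ≤ m := m.cast_nonneg
          cases c <;> simp [dv, Prod.ext_iff] at h <;> linarith [h.1, h.2]
      · rw [S.vir_h_of_ne hc _ _ hx, Finset.sum_eq_single 0, ← hv]
        · simp
        · intro j _ hj
          rw [Y_vacuum_eq_zero, map_zero, smul_zero]
          intro n m h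
          have hj' : (0 : ℝ) < j := by exact_mod_cast Nat.pos_of_ne_zero hj
          have hn : (0 : ℝ) ≤ n := n.cast_nonneg
          have hm : (0 : ℝ) ≤ m := m.cast_nonneg
          cases c <;> cases c' <;> simp_all [dv, Prod.ext_iff]
        · intro h
          rw [Finset.mem_range] at h
          omega
    · intro i _
      rw [h_natCast_e, map_zero]
      simp

theorem Frame.vir_neg_one_ω {c' : Bool} (hc : c ≠ c') (S' : D.Frame c') : S.vir (-1) S'.ω = 0 := by
  have h0 : S.vir (-1) (e 0) = 0 := by rw [vir_neg_one_e]; simp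
  rw [Frame.ω, map_smul, map_sum, Finset.sum_eq_zero, smul_zero]
  intro i _
  rw [S.vir_h_of_ne hc _ _ (S'.pr_f i), S.vir_h_of_ne hc _ _ (S'.pr_f i), h0, map_zero, map_zero]

/-! ### Finite-dimensional weight spaces and the full VOA -/

section Finiteness

theorem finite_of_datum (D : LatticeDatum L E) : Module.Finite ℂ E := by
  obtain ⟨n, f, f', hf⟩ := D.exists_dual
  refine ⟨Submodule.fg_def.2 ⟨Set.range f, Set.finite_range f, ?_⟩⟩
  rw [eq_top_iff]
  intro x _
  rw [← hf x]
  refine Submodule.sum_mem _ fun i _ => Submodule.smul_mem _ _ (Submodule.subset_span ⟨i, rfl⟩)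

/-- A nonempty monomial of level at most K is a generator of degree n + 1 ≤ K times a monomial of
level at most K - n - 1. -/
theorem level_fg [Module.Finite ℂ E] (K : ℕ) : (level (E := E) (K : ℤ)).FG := by
  induction K using Nat.strong_induction_on with
  | _ K ih =>
    have h1 : (Submodule.span ℂ {1} ⊔ (Finset.range K).sup fun n =>
        LinearMap.range (gen (E := E) n) * level ((K - (n + 1) : ℕ) : ℤ)).FG := by
      refine Submodule.FG.sup (Submodule.fg_span_singleton _) (Submodule.fg_finset_sup _ _ ?_)
      intro n hn
      rw [Finset.mem_range] at hn
      exact Submodule.FG.mul (Module.Finite.iff_fg.1 inferInstance) (ih _ (by omega))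
    have h2 : level (E := E) (K : ℤ) = Submodule.span ℂ {1} ⊔ (Finset.range K).sup fun n =>
        LinearMap.range (gen (E := E) n) * level ((K - (n + 1) : ℕ) : ℤ) := by
      refine le_antisymm (Submodule.span_le.2 ?_) (sup_le ?_ (Finset.sup_le ?_))
      · rintro _ ⟨_ | ⟨x, l⟩, rfl, hl⟩
        · exact Submodule.mem_sup_left (Submodule.mem_span_singleton_self 1)
        · simp only [List.map_cons, List.sum_cons, List.prod_cons] at hl ⊢
          have h0 : 0 ≤ (l.map fun x => (x.1 : ℤ) + 1).sum := by
            refine List.sum_nonneg ?_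
            intro y hy
            obtain ⟨x, -, rfl⟩ := List.mem_map.1 hy
            positivity
          have h3 : x.1 < K := by omega
          exact Submodule.mem_sup_right ((Finset.le_sup (f := fun n => LinearMap.range
            (gen (E := E) n) * level ((K - (n + 1) : ℕ) : ℤ)) (Finset.mem_range.2 h3) :) (
            Submodule.mul_mem_mul ⟨x.2, rfl⟩ (Submodule.subset_span ⟨l, rfl, by omega⟩)))
      · rw [Submodule.span_singleton_le_iff_mem]
        exact Submodule.subset_span ⟨[], rfl, by simp⟩
      · intro n hn
        rw [Finset.mem_range] at hn
        refine Submodule.mul_le.2 ?_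
        rintro _ ⟨x, rfl⟩ t ht
        have := level_mul (show gen n x ∈ level (E := E) ((n : ℤ) + 1) from
          Submodule.subset_span ⟨[(n, x)], by simp, by simp⟩) ht
        convert this using 2
        omega
    rw [h2]
    exact h1

theorem fockPart_le_level (D : LatticeDatum L E) (i : ℕ × ℕ) :
    D.fockPart i ≤ level ((i.1 + i.2 : ℕ) : ℤ) := by
  refine Submodule.span_le.2 ?_
  rintro _ ⟨l, l', -, -, h1, h2, rfl⟩
  refine Submodule.subset_span ⟨l ++ l', by simp, ?_⟩
  rw [List.map_append, List.sum_append, ← h1, ← h2]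
  push_cast
  rw [List.map_map, List.map_map]
  simp [Function.comp_def]

theorem finite_U (δ : L) (y : ℝ × ℝ) : Module.Finite ℂ (D.U δ y) := by
  have := D.finite_of_datum
  by_cases h : ∃ n m : ℕ, y = D.wtE δ + ((n : ℝ), (m : ℝ))
  · obtain ⟨n, m, rfl⟩ := h
    rw [D.U_eq δ (n, m)]
    have h1 : Module.Finite ℂ (level (E := E) ((n + m : ℕ) : ℤ)) :=
      Module.Finite.iff_fg.2 (level_fg _)
    have h2 : Module.Finite ℂ (D.fockPart (n, m)) :=
      Submodule.finiteDimensional_of_le (D.fockPart_le_level (n, m))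
    exact Module.Finite.map _ _
  · push Not at h
    rw [D.U_eq_bot h]
    infer_instance

/-- Positivity of the lattice on both parts. -/
structure IsPositive (D : LatticeDatum L E) : Prop where
  a_nonneg : ∀ α, 0 ≤ D.a α α
  b_nonneg : ∀ α, 0 ≤ D.b α α
  finite : ∀ R : ℝ, {α | D.a α α + D.b α α ≤ R}.Finite
  pr_eq_zero : ∀ c α, crd c (D.wtE α) = 0 → D.pr c (D.wt α) = 0

theorem IsPositive.le_of_ne_bot (hD : D.IsPositive) {δ : L} {y : ℝ × ℝ} (h : D.U δ y ≠ ⊥) :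
    0 ≤ y.1 ∧ 0 ≤ y.2 ∧ D.a δ δ + D.b δ δ ≤ 2 * (y.1 + y.2) := by
  obtain ⟨n, m, rfl⟩ : ∃ n m : ℕ, y = D.wtE δ + ((n : ℝ), (m : ℝ)) := by
    by_contra hc
    push Not at hc
    exact h (D.U_eq_bot hc)
  have h1 := hD.a_nonneg δ
  have h2 := hD.b_nonneg δ
  have hn : (0 : ℝ) ≤ n := n.cast_nonneg
  have hm : (0 : ℝ) ≤ m := m.cast_nonneg
  simp only [wtE, Prod.fst_add, Prod.snd_add]
  refine ⟨by linarith, by linarith, by linarith⟩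

/-- A weight bounds the positive definite norm of the charge, so only finitely many charges
contribute, each with a finite-dimensional piece. -/
theorem IsPositive.finite_W (hD : D.IsPositive) (y : ℝ × ℝ) : Module.Finite ℂ (D.W y) := by
  have h1 : D.W y = (hD.finite (2 * (y.1 + y.2))).toFinset.sup fun δ => D.U δ y := by
    refine le_antisymm (iSup_le fun δ => ?_) (Finset.sup_le fun δ _ => D.U_le_W δ y)
    by_cases h : D.U δ y = ⊥
    · rw [h]; exact bot_le
    · exact Finset.le_sup (f := fun δ => D.U δ y) (by simpa using (hD.le_of_ne_bot h).2.2)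
  rw [h1]
  exact Module.Finite.iff_fg.2 (Submodule.fg_finset_sup _ _ fun δ _ => Module.Finite.iff_fg.1 (finite_U δ y))

theorem IsPositive.W_eq_bot (hD : D.IsPositive) {y : ℝ × ℝ} (hy : y.1 < 0 ∨ y.2 < 0) :
    D.W y = ⊥ := by
  refine iSup_eq_bot.2 fun δ => ?_
  by_contra h
  have := hD.le_of_ne_bot h
  rcases hy with hy | hy <;> linarith

end Finiteness

theorem vertexData_vir (S : D.Frame true) (n : ℤ) : D.vertexData.vir S.ω n = S.vir n := by
  rw [VertexData.vir, vertexData_Y, Frame.vir]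
  congr 2
  ext <;> simp [dv]
  ring

theorem vertexData_virBar (S : D.Frame false) (n : ℤ) : D.vertexData.virBar S.ω n = S.vir n := by
  rw [VertexData.virBar, vertexData_Y, Frame.vir]
  congr 2
  ext <;> simp [dv]
  ring

theorem vertexData_D (S : D.Frame true) : D.vertexData.D = S.vir (-1) := by
  refine LinearMap.ext fun a => ?_
  change D.vertexData.Y a (-2) (-1) D.vertexData.one = _
  rw [vertexData_Y, vertexData_one, ← S.Y_dv_vacuum]
  congr 2
  norm_num [dv]

theorem vertexData_Dbar (S : D.Frame false) : D.vertexData.Dbar = S.vir (-1) := by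
  refine LinearMap.ext fun a => ?_
  change D.vertexData.Y a (-1) (-2) D.vertexData.one = _
  rw [vertexData_Y, vertexData_one, ← S.Y_dv_vacuum]
  congr 2
  norm_num [dv]

theorem isFullVOA [Countable L] (hD : D.IsPositive) (S : D.Frame true) (S' : D.Frame false) :
    D.vertexData.IsFullVOA S.ω S'.ω where
  toIsFullVertexAlgebra := D.isFullVertexAlgebra
  holomorphic := by rw [vertexData_Dbar S', S'.vir_neg_one_ω (by simp)]
  antiholomorphic := by rw [vertexData_D S, S.vir_neg_one_ω (by simp)]
  virasoro := ⟨_, by simpa only [vertexData_vir] using S.virasoro⟩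
  virasoroBar := ⟨_, by simpa only [vertexData_virBar] using S'.virasoro⟩
  D_eq := by rw [vertexData_D S, vertexData_vir]
  Dbar_eq := by rw [vertexData_Dbar S', vertexData_virBar]
  vir_zero h hbar v hv := by
    rw [vertexData_grade] at hv
    rw [vertexData_vir, S.vir_zero_W hv]
    rfl
  virBar_zero h hbar v hv := by
    rw [vertexData_grade] at hv
    rw [vertexData_virBar, S'.vir_zero_W hv]
    rfl
  finite h hbar := by
    rw [vertexData_grade]
    exact hD.finite_W _
  boundedBelow := ⟨-1, fun h hbar hh => by
    rw [vertexData_grade]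
    exact hD.W_eq_bot (hh.imp (fun h => by simp; linarith) (fun h => by simp; linarith))⟩

end LatticeDatum

/-! ### Generation by quasi-primary vectors -/

theorem exists_eq_of_injective {V : Type*} [AddCommGroup V] [Module ℂ V] (M : Submodule ℂ V)
    [Module.Finite ℂ M] (T : Module.End ℂ V) (hT : ∀ v ∈ M, T v ∈ M)
    (h0 : ∀ v ∈ M, T v = 0 → v = 0) (w : V) (hw : w ∈ M) : ∃ v ∈ M, T v = w := by
  have h1 : Function.Injective (T.restrict hT) := by
    rw [← LinearMap.ker_eq_bot, LinearMap.ker_eq_bot']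
    exact fun v hv => Subtype.ext (h0 _ v.2 (congrArg Subtype.val hv))
  obtain ⟨v, hv⟩ := LinearMap.injective_iff_surjective.1 h1 ⟨w, hw⟩
  exact ⟨v, v.2, congrArg Subtype.val hv⟩

namespace LatticeDatum
variable {L E : Type*} [AddCommGroup L] [AddCommGroup E] [Module ℂ E] {D : LatticeDatum L E}

theorem crd_sub (c : Bool) (y z : ℝ × ℝ) : crd c (y - z) = crd c y - crd c z := by cases c <;> rfl

theorem crd_dv (c : Bool) : crd c (dv c) = 1 := by cases c <;> rfl

theorem mem_U_exists_single {δ : L} {y : ℝ × ℝ} {v : L →₀ Fock E} (hv : v ∈ D.U δ y) :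
    ∃ s, v = Finsupp.single δ s := by
  refine D.U_induction (motive := fun δ _ v => ∃ s, v = Finsupp.single δ s) ?_ ?_ ?_ ?_ ?_ hv
  · exact fun δ _ => ⟨0, by simp⟩
  · exact fun α => ⟨1, rfl⟩
  · rintro δ y _ _ ⟨s, rfl⟩ ⟨t, rfl⟩
    exact ⟨s + t, by simp⟩
  · rintro δ y r _ ⟨s, rfl⟩
    exact ⟨r • s, by simp⟩
  · rintro c k x δ y _ - - - ⟨s, rfl⟩
    exact ⟨_, D.h_neg_single k x δ s⟩

theorem h_zero_of_mem_U {δ : L} {y : ℝ × ℝ} {v : L →₀ Fock E} (hv : v ∈ D.U δ y) (x : E) :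
    D.h 0 x v = D.g x (D.wt δ) • v := by
  obtain ⟨s, rfl⟩ := mem_U_exists_single hv
  exact D.h_zero_single x δ s

theorem IsPositive.crd_wtE_nonneg (hD : D.IsPositive) (c : Bool) (δ : L) : 0 ≤ crd c (D.wtE δ) := by
  have h1 := hD.a_nonneg δ
  have h2 := hD.b_nonneg δ
  cases c <;> simp only [crd, wtE, cond] <;> linarith

theorem IsPositive.W_eq_bot_of_crd (hD : D.IsPositive) {c : Bool} {y : ℝ × ℝ} (hy : crd c y < 0) :
    D.W y = ⊥ := by
  cases c
  · exact hD.W_eq_bot (Or.inr hy)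
  · exact hD.W_eq_bot (Or.inl hy)

theorem U_eq_bot_of_crd {c : Bool} {δ : L} {y : ℝ × ℝ} (hy : crd c y < crd c (D.wtE δ)) :
    D.U δ y = ⊥ := by
  refine D.U_eq_bot fun n m h => ?_
  have hn : (0 : ℝ) ≤ n := n.cast_nonneg
  have hm : (0 : ℝ) ≤ m := m.cast_nonneg
  rw [h] at hy
  cases c <;> simp only [crd, cond, Prod.fst_add, Prod.snd_add] at hy <;> linarith

variable {c : Bool} (S : D.Frame c)

/-- At relative level one, L(1)x(-1) produces x(0), which is the scalar (x,δ); it vanishes when δ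
has no component in the part under consideration. -/
theorem Frame.vir_one_eq_zero {δ : L} {y : ℝ × ℝ} {v : L →₀ Fock E} (hv : v ∈ D.U δ y)
    (h0 : D.pr c (D.wt δ) = 0) (hy : crd c (y - D.wtE δ) ≤ 1) : S.vir 1 v = 0 := by
  refine D.U_induction (motive := fun δ y v => D.pr c (D.wt δ) = 0 → crd c (y - D.wtE δ) ≤ 1 →
    S.vir 1 v = 0) ?_ ?_ ?_ ?_ ?_ hv h0 hy
  · simp
  · exact fun α _ _ => S.vir_e_pos one_pos α
  · intro δ y v w hv hw h0 hy
    rw [map_add, hv h0 hy, hw h0 hy, add_zero]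
  · intro δ y t v hv h0 hy
    rw [map_smul, hv h0 hy, smul_zero]
  · intro c' k x δ y v hx hv hy ih h0 hy'
    by_cases hc : c = c'
    · subst hc
      have h1 : 0 ≤ crd c (y - D.wtE δ) := by
        obtain ⟨n, m, rfl⟩ := hy
        rw [add_sub_cancel_left]
        cases c
        · exact m.cast_nonneg
        · exact n.cast_nonneg
      rw [add_sub_right_comm, crd_add, crd_smul_dv, if_pos rfl] at hy'
      obtain rfl : k = 0 := by
        have : ((k + 1 : ℕ) : ℝ) ≤ 1 := by linarith
        have : k + 1 ≤ 1 := by exact_mod_cast this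
        omega
      have h2 : D.g x (D.wt δ) = 0 := by rw [← hx, pr_adj, h0, map_zero]
      rw [S.vir_h _ _ hx, ih h0 (by push_cast at hy'; linarith), map_zero,
        show (-(((0 : ℕ) : ℤ) + 1) + 1) = 0 by simp, h_zero_of_mem_U hv, h2]
      simp
    · rw [S.vir_h_of_ne hc _ _ hx, ih h0, map_zero]
      rw [add_sub_right_comm, crd_add, crd_smul_dv, if_neg hc, add_zero] at hy'
      exact hy'

/-- Here L(1) maps into weight zero, where L(1)L(-1) is not injective and the correction argument
breaks down. A charge of weight zero has trivial component by positivity and the preceding lemma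
applies; a charge of positive weight has no vectors of weight zero. -/
theorem Frame.vir_one_eq_zero_of_crd (hD : D.IsPositive) {y : ℝ × ℝ} (hy : crd c y = 1)
    {v : L →₀ Fock E} (hv : v ∈ D.W y) : S.vir 1 v = 0 := by
  refine Submodule.iSup_induction (D.U · y) (motive := fun v => S.vir 1 v = 0) hv
    (fun δ v hv => ?_) (by simp) (fun v w hv hw => by rw [map_add, hv, hw, add_zero])
  rcases (hD.crd_wtE_nonneg c δ).eq_or_lt with h0 | h0
  · refine S.vir_one_eq_zero hv (hD.pr_eq_zero c δ h0.symm) ?_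
    rw [crd_sub, hy, ← h0, sub_zero]
  · have := S.vir_mem_U 1 hv
    rwa [U_eq_bot_of_crd (c := c), Submodule.mem_bot] at this
    rw [crd_sub, crd_smul_dv, if_pos rfl, hy, Int.cast_one, sub_self]
    exact h0

theorem Frame.vir_one_mem_W {y : ℝ × ℝ} {v : L →₀ Fock E} (hv : v ∈ D.W y) :
    S.vir 1 v ∈ D.W (y - dv c) := by
  simpa using S.vir_mem_W 1 hv

theorem Frame.vir_neg_one_mem_W {y : ℝ × ℝ} {v : L →₀ Fock E} (hv : v ∈ D.W y) :
    S.vir (-1) v ∈ D.W (y + dv c) := by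
  simpa using S.vir_mem_W (-1) hv

theorem Frame.vir_one_vir_neg_one {y : ℝ × ℝ} {v : L →₀ Fock E} (hv : v ∈ D.W y) :
    S.vir 1 (S.vir (-1) v) = S.vir (-1) (S.vir 1 v) + ((2 * crd c y : ℝ) : ℂ) • v := by
  rw [S.vir_vir, add_neg_cancel, S.vir_zero_W hv, if_pos rfl]
  push_cast
  module

/-- The operator L(-1)L(1) has no negative eigenvalue. If v has eigenvalue -t, then L(1)v has
eigenvalue -(t + 2h') at its lower weight h' ≥ 0, hence vanishes by induction on the weight, and
then t v = 0. -/
theorem Frame.eq_zero_of_vir (hD : D.IsPositive) (n : ℕ) : ∀ (y : ℝ × ℝ) (v : L →₀ Fock E) (t : ℝ),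
    crd c y < n → v ∈ D.W y → 0 < t → S.vir (-1) (S.vir 1 v) = -((t : ℂ) • v) → v = 0 := by
  induction n with
  | zero =>
    intro y v t hy hv _ _
    rwa [hD.W_eq_bot_of_crd (by simpa using hy), Submodule.mem_bot] at hv
  | succ n ih =>
    intro y v t hy hv ht h
    have h1 : S.vir 1 v = 0 := by
      have h2 := S.vir_one_mem_W hv
      rcases lt_or_ge (crd c (y - dv c)) 0 with h0 | h0
      · rwa [hD.W_eq_bot_of_crd h0, Submodule.mem_bot] at h2
      · refine ih _ _ (t + 2 * crd c (y - dv c)) ?_ h2 (by linarith) ?_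
        · rw [crd_sub, crd_dv]
          push_cast at hy
          linarith
        · have h3 := S.vir_one_vir_neg_one h2
          rw [h, map_neg, map_smul] at h3
          rw [eq_sub_of_add_eq h3.symm]
          push_cast
          module
    rw [h1, map_zero, eq_comm, neg_eq_zero, smul_eq_zero, Complex.ofReal_eq_zero] at h
    exact h.resolve_left ht.ne'

/-- Vectors in a stable subspace are generated by vectors annihilated by `L(1)`. -/
theorem Frame.mem_of_ker (hD : D.IsPositive) {K N : Submodule ℂ (L →₀ Fock E)}
    (hK1 : ∀ v ∈ K, S.vir 1 v ∈ K) (hK2 : ∀ v ∈ K, S.vir (-1) v ∈ K)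
    (hN : ∀ v ∈ N, S.vir (-1) v ∈ N)
    (hKN : ∀ y, ∀ v ∈ D.W y, v ∈ K → S.vir 1 v = 0 → v ∈ N) (n : ℕ) :
    ∀ (y : ℝ × ℝ), crd c y < n → ∀ v ∈ D.W y, v ∈ K → v ∈ N := by
  induction n with
  | zero =>
    intro y hy v hv _
    rw [hD.W_eq_bot_of_crd (by simpa using hy), Submodule.mem_bot] at hv
    rw [hv]
    exact zero_mem _
  | succ n ih =>
    intro y hy v hv hvK
    have h2 := S.vir_one_mem_W hv
    -- When L(1)v has weight zero or negative weight, it vanishes already. Otherwise a vector u with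
    -- L(1)L(-1)u = L(1)v is found and v - L(-1)u is killed by L(1).
    rcases lt_trichotomy (crd c (y - dv c)) 0 with h0 | h0 | h0
    · rw [hD.W_eq_bot_of_crd h0, Submodule.mem_bot] at h2
      exact hKN y v hv hvK h2
    · rw [crd_sub, crd_dv] at h0
      exact hKN y v hv hvK (S.vir_one_eq_zero_of_crd hD (by linarith) hv)
    · have hfin : Module.Finite ℂ (D.W (y - dv c)) := hD.finite_W _
      have hM : Module.Finite ℂ ↥(K ⊓ D.W (y - dv c)) := Submodule.finiteDimensional_of_le inf_le_right
      -- A kernel vector of L(1)L(-1) of weight h > 0 would be an eigenvector of L(-1)L(1) with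
      -- eigenvalue -2h; injectivity on a finite-dimensional space gives surjectivity.
      obtain ⟨u, ⟨hu1, hu2⟩, hu⟩ := exists_eq_of_injective (K ⊓ D.W (y - dv c))
        (S.vir 1 * S.vir (-1)) (fun u hu => ⟨hK1 _ (hK2 _ hu.1), by
          have := S.vir_one_mem_W (S.vir_neg_one_mem_W hu.2)
          rwa [add_sub_cancel_right] at this⟩) (fun u hu hu' => by
          refine S.eq_zero_of_vir hD n (y - dv c) u (2 * crd c (y - dv c)) ?_ hu.2 (by linarith) ?_
          · rw [crd_sub, crd_dv]
            push_cast at hy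
            linarith
          · rw [Module.End.mul_apply, S.vir_one_vir_neg_one hu.2] at hu'
            exact eq_neg_of_add_eq_zero_left hu') _ ⟨hK1 v hvK, h2⟩
      rw [Module.End.mul_apply] at hu
      have h3 : u ∈ N := ih _ (by rw [crd_sub, crd_dv]; push_cast at hy; linarith) _ hu2 hu1
      have h4 : v - S.vir (-1) u ∈ N := by
        refine hKN y _ (Submodule.sub_mem _ hv ?_) (Submodule.sub_mem _ hvK (hK2 _ hu1)) ?_
        · have := S.vir_neg_one_mem_W hu2
          rwa [sub_add_cancel] at this
        · rw [map_sub, hu, sub_self]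
      have := Submodule.add_mem _ h4 (hN _ h3)
      rwa [sub_add_cancel] at this

/-- Two passes are made. Inside the kernel of L(1), which the antiholomorphic operators preserve
because they commute with L(1), everything is generated from quasi-primary vectors. Then the whole
space is generated from the kernel of L(1). -/
theorem isQPGenerated (hD : D.IsPositive) (S : D.Frame true) (S' : D.Frame false) :
    D.vertexData.IsQPGenerated S.ω S'.ω := by
  intro N hN hL
  simp only [vertexData_vir, vertexData_virBar] at hL
  have h1 : ∀ y, ∀ v ∈ D.W y, v ∈ LinearMap.ker (S.vir 1) → v ∈ N := by
    intro y v hv hv1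
    obtain ⟨n, hn⟩ := exists_nat_gt (crd false y)
    refine S'.mem_of_ker hD (K := LinearMap.ker (S.vir 1)) ?_ ?_ (fun v hv => (hL (-1) (by simp) v hv).2) ?_
      n y hn v hv hv1
    · intro v hv
      rw [LinearMap.mem_ker] at *
      rw [S.vir_vir_of_ne (by simp), hv, map_zero]
    · intro v hv
      rw [LinearMap.mem_ker] at *
      rw [S.vir_vir_of_ne (by simp), hv, map_zero]
    · intro y v hv hv1 hv2
      refine hN y.1 y.2 ⟨⟨hv, ?_⟩, ?_⟩
      · rw [vertexData_vir]
        exact hv1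
      · rw [vertexData_virBar]
        exact hv2
  rw [eq_top_iff]
  intro v _
  refine D.U_span_induction (motive := (· ∈ N)) (fun δ y v hv => ?_)
    (fun v w hv hw => Submodule.add_mem _ hv hw) v
  obtain ⟨n, hn⟩ := exists_nat_gt (crd true y)
  exact S.mem_of_ker hD (K := ⊤) (fun _ _ => trivial) (fun _ _ => trivial)
    (fun v hv => (hL (-1) (by simp) v hv).1) (fun y v hv _ hv1 => h1 y v hv hv1) n y hn v
    (D.U_le_W _ _ hv) trivial

end LatticeDatum

/-! ### The contravariant bilinear form -/

section LiftCommute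
variable {E V : Type*} [AddCommGroup E] [Module ℂ E] [AddCommGroup V] [Module ℂ V]
  (f : (ℕ →₀ E) →ₗ[ℂ] Module.End ℂ V) (hf : ∀ v w, Commute (f v) (f w))

include hf in
theorem isMulCommutative_adjoin_range : IsMulCommutative (Algebra.adjoin ℂ (Set.range f)) :=
  Algebra.isMulCommutative_adjoin ℂ (by
    rintro _ ⟨v, rfl⟩ _ ⟨w, rfl⟩
    exact hf v w)

open scoped IsMulCommutative in
/-- The extension of a map into commuting operators to the symmetric algebra. -/
def liftCommute : Fock E →ₐ[ℂ] Module.End ℂ V :=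
  have := isMulCommutative_adjoin_range f hf
  (Algebra.adjoin ℂ (Set.range f)).val.comp
    (Fock.lift (A := Algebra.adjoin ℂ (Set.range f))
      { toFun := fun v => ⟨f v, Algebra.subset_adjoin ⟨v, rfl⟩⟩
        map_add' := fun v w => Subtype.ext (map_add _ v w)
        map_smul' := fun t v => Subtype.ext (map_smul _ t v) })

theorem liftCommute_ι (v : ℕ →₀ E) : liftCommute f hf (Fock.ι v) = f v := by
  have := isMulCommutative_adjoin_range f hf
  simp only [liftCommute, AlgHom.comp_apply, Fock.lift_ι]
  rfl

end LiftCommute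

section Augmentation
variable {E : Type*} [AddCommGroup E] [Module ℂ E]

/-- The constant term. -/
def constantTerm : Fock E →ₐ[ℂ] ℂ := Fock.lift 0

theorem constantTerm_gen (k : ℕ) (x : E) : constantTerm (gen k x) = 0 := by
  rw [constantTerm, gen, LinearMap.comp_apply, Fock.lift_ι]
  rfl

end Augmentation

namespace LatticeDatum
variable {L E : Type*} [AddCommGroup L] [AddCommGroup E] [Module ℂ E] (D : LatticeDatum L E)

/-- The operators `h(k + 1)`, with a sign. -/
def annihilation : (ℕ →₀ E) →ₗ[ℂ] Module.End ℂ (L →₀ Fock E) :=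
  Finsupp.lsum ℂ fun k => (-1 : ℂ) • D.h ((k : ℤ) + 1)

theorem annihilation_commute (v w : ℕ →₀ E) : Commute (D.annihilation v) (D.annihilation w) := by
  simp only [annihilation, Finsupp.lsum_apply, Finsupp.sum]
  refine Commute.sum_left _ _ _ fun k _ => Commute.sum_right _ _ _ fun k' _ => ?_
  refine LinearMap.ext fun u => ?_
  change (-1 : ℂ) • (D.h _ _ ((-1 : ℂ) • (D.h _ _ u))) = (-1 : ℂ) • (D.h _ _ ((-1 : ℂ) • (D.h _ _ u)))
  rw [map_smul, map_smul, D.h_commutator ((k : ℤ) + 1) ((k' : ℤ) + 1), if_neg (by omega), zero_smul,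
    add_zero]

def annihilationHom : Fock E →ₐ[ℂ] Module.End ℂ (L →₀ Fock E) :=
  liftCommute D.annihilation D.annihilation_commute

theorem annihilationHom_gen (k : ℕ) (x : E) (v : L →₀ Fock E) :
    D.annihilationHom (gen k x) v = -D.h ((k : ℤ) + 1) x v := by
  rw [annihilationHom, gen, LinearMap.comp_apply, liftCommute_ι]
  simp [annihilation]

/-- The functional dual to `e_δ`. -/
def vac (δ : L) : Module.Dual ℂ (L →₀ Fock E) := constantTerm.toLinearMap ∘ₗ Finsupp.lapply δ

theorem vac_h (δ : L) (k : ℕ) (x : E) (v : L →₀ Fock E) :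
    vac δ (D.h (-((k : ℤ) + 1)) x v) = 0 := by
  induction v using Finsupp.induction_linear with
  | zero => simp
  | add v w hv hw => rw [map_add, map_add, hv, hw, add_zero]
  | single α s =>
    classical
    rw [h_neg_single]
    simp only [vac, LinearMap.comp_apply, Finsupp.lapply_apply, Finsupp.single_apply]
    split_ifs
    · rw [AlgHom.toLinearMap_apply, map_mul, constantTerm_gen, zero_mul]
    · simp

open Classical in
theorem vac_e (δ α : L) : vac (E := E) δ (e α) = if α = δ then 1 else 0 := by
  simp only [vac, e, LinearMap.comp_apply, Finsupp.lapply_apply, Finsupp.single_apply]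
  split_ifs <;> simp

theorem vac_h_zero (δ : L) (x : E) (v : L →₀ Fock E) :
    vac δ (D.h 0 x v) = D.g x (D.wt δ) * vac δ v := by
  induction v using Finsupp.induction_linear with
  | zero => simp
  | add v w hv hw => rw [map_add, map_add, hv, hw, map_add, mul_add]
  | single α s =>
    rw [h_zero_single, map_smul, smul_eq_mul]
    by_cases h : α = δ
    · rw [h]
    · simp [vac, h]

theorem isHomogeneous_vac (δ : L) : D.IsHomogeneous (vac δ) δ (D.wtE δ) := by
  intro δ' y' v hv
  refine D.U_induction (motive := fun δ' y' v => (δ', y') ≠ (δ, D.wtE δ) → vac δ v = 0)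
    ?_ ?_ ?_ ?_ ?_ hv
  · simp
  · intro α hα
    rw [vac_e, if_neg]
    rintro rfl
    exact hα rfl
  · intro δ' y v w hv hw h
    rw [map_add, hv h, hw h, add_zero]
  · intro δ' y t v hv h
    rw [map_smul, hv h, smul_zero]
  · intro c k x δ' y v _ _ _ _ _
    exact D.vac_h δ k x v

/-- The normalization of the invariant form. -/
def κ (β : L) : ℂ := (-1) ^ ⌊(D.wtE β).1 - (D.wtE β).2⌋ * D.A.ε β (-β)

theorem κ_ne_zero (β : L) : D.κ β ≠ 0 :=
  mul_ne_zero (zpow_ne_zero _ (by norm_num)) (D.A.ne_zero _ _)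

/-- The invariant bilinear form. -/
def form : (L →₀ Fock E) →ₗ[ℂ] Module.Dual ℂ (L →₀ Fock E) :=
  Finsupp.lsum ℂ fun α => D.κ α • (vac (-α)).compRight ℂ ∘ₗ D.annihilationHom.toLinearMap

theorem form_single (α : L) (s : Fock E) (v : L →₀ Fock E) :
    D.form (Finsupp.single α s) v = D.κ α * vac (-α) (D.annihilationHom s v) := by
  simp [form]

theorem form_e (α : L) (v : L →₀ Fock E) : D.form (e α) v = D.κ α * vac (-α) v := by
  rw [e, form_single, map_one]
  rfl

theorem form_h_neg (k : ℕ) (x : E) (v w : L →₀ Fock E) :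
    D.form (D.h (-((k : ℤ) + 1)) x v) w = -D.form v (D.h ((k : ℤ) + 1) x w) := by
  induction v using Finsupp.induction_linear with
  | zero => simp
  | add v v' hv hv' =>
    rw [map_add, map_add, LinearMap.add_apply, hv, hv', map_add, LinearMap.add_apply, neg_add]
  | single α s =>
    rw [h_neg_single, form_single, form_single, mul_comm (gen k x), map_mul, Module.End.mul_apply,
      annihilationHom_gen, map_neg, map_neg, mul_neg]

/-- The form is contravariant. -/
theorem form_h (n : ℤ) (x : E) (v w : L →₀ Fock E) :
    D.form (D.h n x v) w = -D.form v (D.h (-n) x w) := by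
  rcases lt_or_ge n 0 with hn | hn
  · obtain ⟨k, rfl⟩ : ∃ k : ℕ, n = -((k : ℤ) + 1) := ⟨(-n - 1).toNat, by omega⟩
    rw [form_h_neg, neg_neg]
  · induction v using D.induction generalizing w with
    | e α =>
      rcases hn.eq_or_lt with rfl | hn
      · rw [h_zero_e, map_smul, LinearMap.smul_apply, form_e, neg_zero, form_e, vac_h_zero, map_neg,
          map_neg, smul_eq_mul]
        ring
      · obtain ⟨k, rfl⟩ : ∃ k : ℕ, n = (k : ℤ) + 1 := ⟨(n - 1).toNat, by omega⟩
        rw [D.h_e_pos _ hn, form_e, vac_h]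
        simp
    | add v v' hv hv' =>
      rw [map_add, map_add, LinearMap.add_apply, hv, hv', map_add, LinearMap.add_apply, neg_add]
    | smul t v hv => simp only [map_smul, LinearMap.smul_apply, hv, smul_neg]
    | h c k y v hy hv =>
      rw [D.h_commutator n, map_add, LinearMap.add_apply, form_h_neg, hv, form_h_neg, map_smul,
        LinearMap.smul_apply, D.h_commutator ((k : ℤ) + 1) (-n) y x w, map_add, map_smul]
      have h1 : n + -((k : ℤ) + 1) = 0 ↔ ((k : ℤ) + 1) + -n = 0 := by omega
      by_cases h2 : ((k : ℤ) + 1) + -n = 0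
      · rw [if_pos (h1.2 h2), if_pos h2, D.g_comm x y]
        have h3 : (n : ℂ) = (k : ℂ) + 1 := by
          have : n = (k : ℤ) + 1 := by omega
          rw [this]
          push_cast
          rfl
        rw [h3]
        push_cast
        simp only [smul_eq_mul]
        ring
      · rw [if_neg h2, if_neg (fun h => h2 (h1.1 h))]
        simp

theorem wtE_eq (γ : L) : D.wtE γ = (2⁻¹ : ℝ) • D.pe γ γ := by
  ext <;> simp [wtE, pe] <;> ring

theorem pe_neg_right (α β : L) : D.pe α (-β) = -D.pe α β := by
  have h := D.pe_add_right α β (-β)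
  rw [add_neg_cancel, pe_zero_right] at h
  exact (neg_eq_of_add_eq_zero_right h.symm).symm

theorem wtE_neg (β : L) : D.wtE (-β) = D.wtE β := by
  rw [wtE_eq, wtE_eq, pe_neg_right, pe_comm, pe_neg_right, neg_neg]

theorem neg_one_zpow_B_self (β : L) : (-1 : ℂ) ^ D.B β β = 1 := (D.even β).neg_one_zpow

/-- Exchanging β and -β in the cocycle costs (-1)^(β,β) = 1 because the lattice is even; the
symmetry of the form rests on this. -/
theorem κ_neg (β : L) : D.κ (-β) = D.κ β := by
  rw [κ, κ, wtE_neg, neg_neg, D.A.comm (-β) β, map_neg, LinearMap.neg_apply,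
    zpow_neg, neg_one_zpow_B_self, inv_one, one_mul]

theorem isHomogeneous_form {δ : L} {y : ℝ × ℝ} {v : L →₀ Fock E} (hv : v ∈ D.U δ y) :
    D.IsHomogeneous (D.form v) (-δ) y := by
  refine D.U_induction (motive := fun δ y v => D.IsHomogeneous (D.form v) (-δ) y)
    ?_ ?_ ?_ ?_ ?_ hv
  · intro δ y δ' y' v _ _
    simp
  · intro α δ' y' v hv h
    rw [form_e, D.isHomogeneous_vac (-α) δ' y' v hv (by rwa [wtE_neg]), mul_zero]
  · intro δ y v w hv hw δ' y' u hu h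
    rw [map_add, LinearMap.add_apply, hv δ' y' u hu h, hw δ' y' u hu h, add_zero]
  · intro δ y t v hv δ' y' u hu h
    rw [map_smul, LinearMap.smul_apply, hv δ' y' u hu h, smul_zero]
  · intro c k x δ y v hx _ _ ih δ' y' u hu h
    rw [form_h_neg, neg_eq_zero]
    have := ih.comp_h c ((k : ℤ) + 1) hx δ' y' u hu
    push_cast at this h
    exact this h

/-- Both orders of the arguments obey the same adjunction rule for the modes, which reduces the
claim to exponentials and hence to the symmetry of `κ`. -/
theorem form_comm (v w : L →₀ Fock E) : D.form v w = D.form w v := by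
  classical
  induction v using D.induction generalizing w with
  | e α =>
    induction w using D.induction with
    | e β =>
      rw [form_e, form_e, vac_e, vac_e]
      by_cases h : β = -α
      · subst h
        simp [κ_neg]
      · rw [if_neg h, if_neg fun h' => h (by rw [h', neg_neg]), mul_zero, mul_zero]
    | add v w hv hw => rw [map_add, map_add, LinearMap.add_apply, hv, hw]
    | smul t v hv => rw [map_smul, map_smul, LinearMap.smul_apply, hv]
    | h c k x v hx hv => rw [form_h_neg, D.h_e_pos _ (by omega), map_zero, form_e, vac_h]; simp
  | add v w hv hw => rw [map_add, map_add, LinearMap.add_apply, hv, hw]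
  | smul t v hv => rw [map_smul, map_smul, LinearMap.smul_apply, hv]
  | h c k x v hx hv =>
    rw [form_h_neg, hv, D.form_h, neg_neg]

variable {D}

theorem IsVacuum.eq_smul_vac {u : Module.Dual ℂ (L →₀ Fock E)} {δ : L} (hu : D.IsVacuum u)
    (h : D.IsHomogeneous u δ (D.wtE δ)) : u = u (e δ) • vac δ := by
  classical
  refine LinearMap.ext fun v => ?_
  induction v using D.induction with
  | e α =>
    rw [LinearMap.smul_apply, vac_e]
    by_cases hα : α = δ
    · simp [hα]
    · rw [if_neg hα, h α _ _ (D.e_mem_U α) fun h => hα (congrArg Prod.fst h), smul_zero]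
  | add v w hv hw => rw [map_add, map_add, hv, hw]
  | smul t v hv => rw [map_smul, map_smul, hv]
  | h c k x v hx hv => rw [hu, LinearMap.smul_apply, vac_h, smul_zero]

/-- A homogeneous vacuum functional of charge δ is a multiple of the pairing with e_(-δ), and
composing the pairing with v with x(k+1) gives the pairing with -x(-k-1)v. All homogeneous
functionals arise in this way. -/
theorem IsHomogeneous.mem_range_form {u : Module.Dual ℂ (L →₀ Fock E)} {δ : L} {y : ℝ × ℝ}
    (hu : D.IsHomogeneous u δ y) : u ∈ LinearMap.range D.form := by
  refine IsHomogeneous.induction (δ := δ) (motive := fun u => u ∈ LinearMap.range D.form)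
    (zero_mem _) (fun u u' hu hu' => add_mem hu hu') (fun t u hu => Submodule.smul_mem _ t hu)
    ?_ ?_ hu
  · intro u hu hv
    refine ⟨(u (e δ) * (D.κ (-δ))⁻¹) • e (-δ), LinearMap.ext fun v => ?_⟩
    rw [map_smul, LinearMap.smul_apply, form_e, neg_neg, smul_eq_mul, mul_assoc,
      inv_mul_cancel_left₀ (D.κ_ne_zero _)]
    exact (LinearMap.congr_fun (hv.eq_smul_vac hu) v).symm
  · rintro _ c k x hx ⟨v, rfl⟩
    refine ⟨-D.h (-((k : ℤ) + 1)) x v, LinearMap.ext fun w => ?_⟩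
    rw [map_neg, LinearMap.neg_apply, form_h_neg, neg_neg]
    rfl

variable (D)

theorem isHomogeneous_comp (u : Module.Dual ℂ (L →₀ Fock E)) (δ : L) (y : ℝ × ℝ) :
    D.IsHomogeneous (u ∘ₗ D.comp δ y) δ y := by
  intro δ' y' v hv h
  rw [LinearMap.comp_apply, D.comp_of_ne hv h, map_zero]

/-- A vector in the radical is annihilated by every homogeneous functional, since these lie in the
range and the form is symmetric; the homogeneous functionals separate vectors. -/
theorem form_injective : Function.Injective D.form := by
  rw [← LinearMap.ker_eq_bot, LinearMap.ker_eq_bot']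
  intro v hv
  refine D.eq_zero_of_comp fun δ y => ?_
  rw [← Module.forall_dual_apply_eq_zero_iff ℂ]
  intro u
  obtain ⟨w, hw⟩ := (D.isHomogeneous_comp u δ y).mem_range_form
  have := LinearMap.congr_fun hw v
  rw [form_comm, hv] at this
  exact this.symm

theorem form_mem_dual (v : L →₀ Fock E) : D.form v ∈ D.vertexData.dual := by
  refine D.U_span_induction (motive := fun v => D.form v ∈ D.vertexData.dual) (fun δ y v hv => ?_)
    (fun v w hv hw => by rw [map_add]; exact add_mem hv hw) v
  refine (Set.finite_singleton y).subset ?_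
  rintro ⟨h, hbar⟩ ⟨w, hw, h0⟩
  rw [vertexData_grade] at hw
  by_contra hne
  refine h0 (Submodule.iSup_induction (D.U · (h, hbar)) (motive := fun w => D.form v w = 0) hw
    (fun δ' w hw => D.isHomogeneous_form hv δ' _ w hw fun h => hne (congrArg Prod.snd h))
    (map_zero _) fun w w' hw hw' => by rw [map_add, hw, hw', add_zero])

-- Positivity leaves finitely many charges in each weight, so a functional supported on finitely
-- many weights is a finite sum of homogeneous functionals.
variable {D} in
theorem IsPositive.mem_range_form (hD : D.IsPositive) {u : Module.Dual ℂ (L →₀ Fock E)}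
    (hu : u ∈ D.vertexData.dual) : u ∈ LinearMap.range D.form := by
  classical
  have hfin : {x : ℝ × ℝ | ∃ v ∈ D.W x, u v ≠ 0}.Finite := hu
  have h1 : u = ∑ y ∈ hfin.toFinset, ∑ δ ∈ (hD.finite (2 * (y.1 + y.2))).toFinset,
      u ∘ₗ D.comp δ y := by
    refine LinearMap.ext fun v => ?_
    refine D.U_span_induction (motive := fun v => u v = (∑ y ∈ hfin.toFinset,
      ∑ δ ∈ (hD.finite (2 * (y.1 + y.2))).toFinset, u ∘ₗ D.comp δ y) v) (fun δ y v hv => ?_)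
      (fun v w hv hw => by rw [map_add, map_add, hv, hw]) v
    by_cases h0 : u v = 0
    · rw [h0, LinearMap.sum_apply, eq_comm]
      refine Finset.sum_eq_zero fun y' _ => ?_
      rw [LinearMap.sum_apply]
      refine Finset.sum_eq_zero fun δ' _ => ?_
      by_cases h : (δ, y) = (δ', y')
      · obtain ⟨rfl, rfl⟩ := Prod.mk.inj h
        rw [LinearMap.comp_apply, D.comp_of_mem hv, h0]
      · rw [LinearMap.comp_apply, D.comp_of_ne hv h, map_zero]
    · have hy : y ∈ hfin.toFinset := by
        rw [Set.Finite.mem_toFinset]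
        exact ⟨v, D.U_le_W _ _ hv, h0⟩
      have hδ : δ ∈ (hD.finite (2 * (y.1 + y.2))).toFinset := by
        rw [Set.Finite.mem_toFinset]
        refine (hD.le_of_ne_bot fun h => h0 ?_).2.2
        rw [h, Submodule.mem_bot] at hv
        rw [hv, map_zero]
      rw [LinearMap.sum_apply, Finset.sum_eq_single_of_mem y hy, LinearMap.sum_apply,
        Finset.sum_eq_single_of_mem δ hδ, LinearMap.comp_apply, D.comp_of_mem hv]
      · intro δ' _ h
        rw [LinearMap.comp_apply, D.comp_of_ne hv fun h' => h (congrArg Prod.fst h').symm, map_zero]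
      · intro y' _ h
        rw [LinearMap.sum_apply]
        refine Finset.sum_eq_zero fun δ' _ => ?_
        rw [LinearMap.comp_apply, D.comp_of_ne hv fun h' => h (congrArg Prod.snd h').symm, map_zero]
  rw [h1]
  exact sum_mem fun y _ => sum_mem fun δ _ => (D.isHomogeneous_comp u δ y).mem_range_form

variable {D} in
/-- The isomorphism of the space with its restricted dual. -/
def IsPositive.dualEquiv (hD : D.IsPositive) : (L →₀ Fock E) ≃ₗ[ℂ] D.vertexData.dual :=
  LinearEquiv.ofBijective (D.form.codRestrict _ D.form_mem_dual)
    ⟨fun v w h => D.form_injective (congrArg Subtype.val h), fun u => by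
      obtain ⟨v, hv⟩ := hD.mem_range_form u.2
      exact ⟨v, Subtype.ext hv⟩⟩

end LatticeDatum

/-! ### Binomial identities for contravariance -/

section Vandermonde

theorem sum_choose_succ_mul_choose (k n : ℕ) :
    ∑ m ∈ Finset.range (k + 1), (Nat.choose (k + 1) (m + 1) : ℂ) * Nat.choose n m =
      Nat.choose (n + 1 + k) k := by
  have h := ch_add_range n ((k + 1 : ℕ) : ℝ) k
  rw [← Nat.cast_add, ch_natCast] at h
  rw [show n + 1 + k = n + (k + 1) by ring, h]
  refine Finset.sum_congr rfl fun m hm => ?_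
  rw [Finset.mem_range] at hm
  rw [ch_natCast, ch_natCast, mul_comm, ← Nat.choose_symm (show k - m ≤ k + 1 by omega),
    show k + 1 - (k - m) = m + 1 by omega]

/-- Vandermonde with upper entries -(i+1) and k+1. The result is 1 for i = 0, vanishes for 1 ≤ i ≤
k, and is (-1)^k C(i-1,k) beyond, so that only the modes needed on the other side of the form
survive. -/
theorem sum_neg_one_pow_choose (k i : ℕ) :
    ∑ m ∈ Finset.range (k + 1), (Nat.choose (k + 1) (m + 1) : ℂ) * ((-1) ^ m * Nat.choose (i + m) m) =
      ch ((k : ℝ) - i) k := by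
  have h := ch_add_range (-((i : ℝ) + 1)) ((k + 1 : ℕ) : ℝ) k
  rw [show -((i : ℝ) + 1) + ((k + 1 : ℕ) : ℝ) = (k : ℝ) - i by push_cast; ring] at h
  rw [h]
  refine Finset.sum_congr rfl fun m hm => ?_
  rw [Finset.mem_range] at hm
  rw [ch_natCast, ch_neg, mul_comm, ← Nat.choose_symm (show k - m ≤ k + 1 by omega),
    show k + 1 - (k - m) = m + 1 by omega]

theorem ch_sub_succ (k n : ℕ) : ch ((k : ℝ) - (n + 1 : ℕ)) k = (-1) ^ k * Nat.choose n k := by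
  rcases lt_or_ge n k with h | h
  · rw [Nat.choose_eq_zero_of_lt h, show (k : ℝ) - (n + 1 : ℕ) = ((k - (n + 1) : ℕ) : ℝ) by
      rw [Nat.cast_sub h], ch_natCast, Nat.choose_eq_zero_of_lt (by omega)]
    simp
  · obtain ⟨d, rfl⟩ := Nat.exists_eq_add_of_le h
    rw [show (k : ℝ) - ((k + d + 1 : ℕ) : ℝ) = -((d : ℝ) + 1) by push_cast; ring, ch_neg, add_comm k d]

variable {M : Type*} [AddCommGroup M] [Module ℂ M]

theorem sum_choose_add_smul (T : ℕ → M) (m K : ℕ) (hT : ∀ i, K ≤ i → T i = 0) :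
    ∑ j ∈ Finset.range K, (Nat.choose (j + m) m : ℂ) • T (j + m) =
      ∑ j ∈ Finset.range K, (Nat.choose j m : ℂ) • T j := by
  rw [← sum_range_eq_of_le (fun j => (Nat.choose j m : ℂ) • T j) (show K ≤ m + K by omega)
    fun i hi => by rw [hT i hi, smul_zero], Finset.sum_range_add]
  rw [Finset.sum_eq_zero (s := Finset.range m), zero_add]
  · exact Finset.sum_congr rfl fun j _ => by rw [add_comm m j]
  · intro j hj
    rw [Nat.choose_eq_zero_of_lt (Finset.mem_range.1 hj), Nat.cast_zero, zero_smul]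

/-- The sequence S stands for the terms with a mode on the left of a field and T for those with a
mode on the right. The weights C(k+1,m+1) come from exp(zL(1)) acting on x(-k-1), and the isolated S
0 - T 0 is the commutator with the zero mode. The S-terms add up by Vandermonde, and the T-terms
collapse by the preceding alternating sum. -/
theorem sum_choose_identity (S T : ℕ → M) (k K : ℕ) (hS : ∀ i, K ≤ i → S i = 0)
    (hT : ∀ i, K ≤ i → T i = 0) :
    ∑ m ∈ Finset.range (k + 1), (Nat.choose (k + 1) (m + 1) : ℂ) •
      (∑ j ∈ Finset.range K, (Nat.choose (j + m) m : ℂ) • S (j + m + 1) +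
        ∑ i ∈ Finset.range K, ((-1) ^ m * Nat.choose (i + m) m : ℂ) • T i) + (S 0 - T 0) =
    ((-1) ^ k : ℂ) • ∑ j ∈ Finset.range K, (Nat.choose (j + k) k : ℂ) • T (j + k + 1) +
      ∑ i ∈ Finset.range K, (Nat.choose (i + k) k : ℂ) • S i := by
  have h1 : ∑ m ∈ Finset.range (k + 1), (Nat.choose (k + 1) (m + 1) : ℂ) •
      ∑ j ∈ Finset.range K, (Nat.choose (j + m) m : ℂ) • S (j + m + 1) + S 0 =
      ∑ i ∈ Finset.range K, (Nat.choose (i + k) k : ℂ) • S i := by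
    rw [← sum_range_eq_of_le (fun i => (Nat.choose (i + k) k : ℂ) • S i) (Nat.le_succ K)
      fun i hi => by rw [hS i hi, smul_zero], Finset.sum_range_succ' _ K, zero_add, Nat.choose_self,
      Nat.cast_one, one_smul]
    congr 1
    rw [Finset.sum_congr rfl fun m _ => congrArg _ (sum_choose_add_smul (fun j => S (j + 1)) m K
      fun i hi => hS _ (by omega))]
    simp only [Finset.smul_sum]
    rw [Finset.sum_comm]
    refine Finset.sum_congr rfl fun j _ => ?_
    simp only [smul_smul]
    rw [← Finset.sum_smul, sum_choose_succ_mul_choose]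
  have h2 : ∑ m ∈ Finset.range (k + 1), (Nat.choose (k + 1) (m + 1) : ℂ) •
      ∑ i ∈ Finset.range K, ((-1) ^ m * Nat.choose (i + m) m : ℂ) • T i - T 0 =
      ((-1) ^ k : ℂ) • ∑ j ∈ Finset.range K, (Nat.choose (j + k) k : ℂ) • T (j + k + 1) := by
    rw [Finset.sum_congr rfl fun m _ => congrArg _ (sum_range_eq_of_le
      (fun i => ((-1) ^ m * Nat.choose (i + m) m : ℂ) • T i) (Nat.le_succ K)
      fun i hi => by rw [hT i hi, smul_zero]).symm]
    simp only [Finset.smul_sum]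
    rw [Finset.sum_comm]
    simp only [smul_smul]
    rw [Finset.sum_congr rfl fun i _ => by rw [← Finset.sum_smul, sum_neg_one_pow_choose],
      Finset.sum_range_succ', Nat.cast_zero, sub_zero, ch_natCast, Nat.choose_self, Nat.cast_one,
      one_smul, add_sub_cancel_right, Finset.sum_congr rfl fun i _ => by rw [ch_sub_succ]]
    have := sum_choose_add_smul (fun j => T (j + 1)) k K fun i hi => hT _ (by omega)
    simp only [mul_smul]
    rw [← Finset.smul_sum, ← Finset.smul_sum, this]
  rw [← h1, ← h2]
  simp only [smul_add, Finset.sum_add_distrib]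
  abel

end Vandermonde

namespace LatticeDatum
variable {L E : Type*} [AddCommGroup L] [AddCommGroup E] [Module ℂ E] {D : LatticeDatum L E}

theorem h_zero_commutator (c : Bool) {x : E} (hx : D.pr c x = x) (y : ℝ × ℝ) (A w : L →₀ Fock E) :
    D.Y y (D.h 0 x A) w = D.h 0 x (D.Y y A w) - D.Y y A (D.h 0 x w) := by
  obtain ⟨M, hM, hM0⟩ := ((D.commutator c x hx A).and (eventually_gt_atTop 0)).exists
  rw [hM, Finset.sum_eq_single 0, add_sub_cancel_left, ch_zero]
  · simp
  · intro l _ hl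
    rw [Int.cast_zero, ch_zero_left, if_neg hl, zero_smul]
  · intro h
    exact absurd (Finset.mem_range.2 hM0) h

/-- The identity behind the contravariance of normally ordered products. -/
theorem sum_choose_Y_h (c : Bool) (k : ℕ) {x : E} (hx : D.pr c x = x) (A w : L →₀ Fock E)
    (t : ℝ × ℝ) : ∀ᶠ K : ℕ in atTop,
    ∑ i ∈ Finset.range (k + 2), (Nat.choose (k + 1) i : ℂ) •
      D.Y (t - (2 * ((k : ℝ) + 1) - i) • dv c) (D.h ((i : ℤ) - (k + 1)) x A) w =
    ((-1) ^ k : ℂ) • ∑ j ∈ Finset.range K, (Nat.choose (j + k) k : ℂ) •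
      D.Y (t + (j : ℝ) • dv c) A (D.h (((j + k : ℕ) : ℤ) + 1) x w) +
    ∑ i ∈ Finset.range K, (Nat.choose (i + k) k : ℂ) •
      D.h (-(i : ℤ)) x (D.Y (t - ((i + k + 1 : ℕ) : ℝ) • dv c) A w) := by
  have h1 : ∀ᶠ K : ℕ in atTop, ∀ m ∈ Finset.range (k + 1), _ :=
    (Filter.eventually_all_finset (Finset.range (k + 1))).2 fun m _ =>
      D.Y_h c m x hx A w (t - ((k : ℝ) + 2 + m) • dv c)
  filter_upwards [h1, D.h_eventually x w, D.Y_eventually A w (t - ((k : ℝ) + 1) • dv c) c]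
    with K h1 h2 h3
  have key := sum_choose_identity
    (fun M : ℕ => D.h (-(M : ℤ)) x (D.Y (t - ((M + k + 1 : ℕ) : ℝ) • dv c) A w))
    (fun i : ℕ => D.Y (t + ((i : ℝ) - (k + 1)) • dv c) A (D.h i x w)) k K
    (fun i hi => by
      rw [show t - ((i + k + 1 : ℕ) : ℝ) • dv c = t - ((k : ℝ) + 1) • dv c - (i : ℝ) • dv c by
        push_cast; module, h3 i hi, map_zero])
    (fun i hi => by rw [h2 i (by omega), map_zero])
  -- The top term i = k + 1 is the zero mode and is treated as a commutator; the remaining terms,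
  -- with i = k - m, carry the creation modes x(-m-1).
  rw [Finset.sum_range_succ, ← Finset.sum_range_reflect]
  refine Eq.trans ?_ (key.trans ?_)
  · congr 1
    · refine Finset.sum_congr rfl fun m hm => ?_
      have hm' := Finset.mem_range.1 hm
      rw [show k + 1 - 1 - m = k - m by omega, ← Nat.choose_symm (show k - m ≤ k + 1 by omega),
        show k + 1 - (k - m) = m + 1 by omega, Nat.cast_sub (show m ≤ k by omega),
        show ((k - m : ℕ) : ℤ) - (k + 1) = -((m : ℤ) + 1) by omega,
        show t - (2 * ((k : ℝ) + 1) - ((k : ℝ) - m)) • dv c = t - ((k : ℝ) + 2 + m) • dv c by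
          module, h1 m hm]
      congr 2
      · refine Finset.sum_congr rfl fun j _ => ?_
        rw [show t - ((k : ℝ) + 2 + m) • dv c - (j : ℝ) • dv c =
          t - ((j + m + 1 + k + 1 : ℕ) : ℝ) • dv c by push_cast; module]
        push_cast
        rfl
      · refine Finset.sum_congr rfl fun j _ => ?_
        rw [show t - ((k : ℝ) + 2 + m) • dv c + ((j + m + 1 : ℕ) : ℝ) • dv c =
          t + ((j : ℝ) - (k + 1)) • dv c by push_cast; module]
    · rw [Nat.choose_self, Nat.cast_one, one_smul,
        show ((k + 1 : ℕ) : ℤ) - (k + 1) = 0 by push_cast; ring, h_zero_commutator c hx,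
        show t - (2 * ((k : ℝ) + 1) - ((k + 1 : ℕ) : ℝ)) • dv c = t - ((k : ℝ) + 1) • dv c by
          push_cast; module,
        show t + (((0 : ℕ) : ℝ) - (k + 1)) • dv c = t - ((k : ℝ) + 1) • dv c by push_cast; module]
      simp
  · congr 2
    refine Finset.sum_congr rfl fun j _ => ?_
    rw [show t + (((j + k + 1 : ℕ) : ℝ) - (k + 1)) • dv c = t + (j : ℝ) • dv c by
      push_cast; module]
    push_cast
    rfl

variable {c : Bool} (S : D.Frame c)

/-- The divided powers of `L(1)`. -/
def Frame.ell (p : ℕ) : Module.End ℂ (L →₀ Fock E) := (Nat.factorial p : ℂ)⁻¹ • S.vir 1 ^ p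

theorem Frame.ell_zero (v : L →₀ Fock E) : S.ell 0 v = v := by simp [ell]

theorem Frame.succ_smul_ell (p : ℕ) (v : L →₀ Fock E) :
    ((p : ℂ) + 1) • S.ell (p + 1) v = S.vir 1 (S.ell p v) := by
  have h : ((p : ℂ) + 1) ≠ 0 := by exact_mod_cast Nat.succ_ne_zero p
  rw [ell, ell, LinearMap.smul_apply, LinearMap.smul_apply, map_smul, smul_smul, pow_succ',
    Module.End.mul_apply, Nat.factorial_succ]
  congr 1
  push_cast
  rw [mul_inv, mul_inv_cancel_left₀ h]

theorem Frame.ell_eq_zero {v : L →₀ Fock E} (hv : S.vir 1 v = 0) (p : ℕ) (hp : p ≠ 0) :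
    S.ell p v = 0 := by
  obtain ⟨p, rfl⟩ := Nat.exists_eq_succ_of_ne_zero hp
  rw [ell, LinearMap.smul_apply, pow_succ, Module.End.mul_apply, hv, map_zero, smul_zero]

theorem Frame.ell_mem_U (p : ℕ) {δ : L} {y : ℝ × ℝ} {v : L →₀ Fock E} (hv : v ∈ D.U δ y) :
    S.ell p v ∈ D.U δ (y - (p : ℝ) • dv c) := by
  refine Submodule.smul_mem _ _ ?_
  induction p with
  | zero => simpa using hv
  | succ p ih =>
    have := S.vir_mem_U 1 ih
    rw [pow_succ', Module.End.mul_apply]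
    convert this using 2
    push_cast
    module

theorem Frame.ell_eventually (v : L →₀ Fock E) : ∀ᶠ K : ℕ in atTop, ∀ p : ℕ, K ≤ p →
    S.ell p v = 0 := by
  refine D.U_span_induction (motive := fun v => ∀ᶠ K : ℕ in atTop, ∀ p : ℕ, K ≤ p → S.ell p v = 0)
    (fun δ y v hv => ?_) (fun v w hv hw => ?_) v
  · obtain ⟨n, hn⟩ := exists_nat_gt (crd c y - crd c (D.wtE δ))
    filter_upwards [eventually_ge_atTop n] with K hK p hp
    have h1 := S.ell_mem_U p hv
    rwa [U_eq_bot_of_crd (c := c), Submodule.mem_bot] at h1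
    rw [crd_sub, crd_smul_dv, if_pos rfl]
    have : (n : ℝ) ≤ p := by exact_mod_cast hK.trans hp
    linarith
  · filter_upwards [hv, hw] with K h1 h2 p hp
    rw [map_add, h1 p hp, h2 p hp, add_zero]

theorem Frame.ell_h_of_ne {c' : Bool} (hc : c ≠ c') (p : ℕ) (n : ℤ) {x : E} (hx : D.pr c' x = x)
    (v : L →₀ Fock E) : S.ell p (D.h n x v) = D.h n x (S.ell p v) := by
  rw [ell, LinearMap.smul_apply, LinearMap.smul_apply, map_smul]
  congr 1
  induction p with
  | zero => rfl
  | succ p ih => rw [pow_succ', Module.End.mul_apply, Module.End.mul_apply, ih, S.vir_h_of_ne hc _ _ hx]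

theorem Frame.ell_ell_of_ne {c' : Bool} (hc : c ≠ c') (S' : D.Frame c') (p q : ℕ)
    (v : L →₀ Fock E) : S.ell p (S'.ell q v) = S'.ell q (S.ell p v) := by
  have h : Commute (S.vir 1) (S'.vir 1) :=
    LinearMap.ext fun v => S.vir_vir_of_ne hc S' 1 1 v
  have := LinearMap.congr_fun (h.pow_pow p q).eq v
  simp only [Module.End.mul_apply] at this
  rw [ell, ell, LinearMap.smul_apply, LinearMap.smul_apply, LinearMap.smul_apply, LinearMap.smul_apply,
    map_smul, map_smul, this, smul_comm]

/-- From [L(1), x(-N+i)] = (N-i) x(-N+i+1): this is the Leibniz rule for divided powers, that is,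
the conjugation of x(-N) by exp(zL(1)). -/
theorem Frame.ell_h (p N : ℕ) {x : E} (hx : D.pr c x = x) (v : L →₀ Fock E) :
    S.ell p (D.h (-(N : ℤ)) x v) = ∑ i ∈ Finset.range (p + 1),
      (Nat.choose N i : ℂ) • D.h ((i : ℤ) - N) x (S.ell (p - i) v) := by
  induction p with
  | zero => simp [ell_zero]
  | succ p ih =>
    have h : ((p : ℂ) + 1) ≠ 0 := by exact_mod_cast Nat.succ_ne_zero p
    refine (smul_right_injective _ h) ?_
    change ((p : ℂ) + 1) • S.ell (p + 1) (D.h (-(N : ℤ)) x v) = ((p : ℂ) + 1) • _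
    rw [S.succ_smul_ell, ih, map_sum, Finset.smul_sum]
    have h1 : ∀ i ∈ Finset.range (p + 1), S.vir 1 ((Nat.choose N i : ℂ) •
        D.h ((i : ℤ) - N) x (S.ell (p - i) v)) =
        ((Nat.choose N i : ℂ) * ((p : ℂ) + 1 - i)) • D.h ((i : ℤ) - N) x (S.ell (p + 1 - i) v) +
        (((i : ℂ) + 1) * Nat.choose N (i + 1)) •
          D.h (((i + 1 : ℕ) : ℤ) - N) x (S.ell (p + 1 - (i + 1)) v) := by
      intro i hi
      have hi' := Finset.mem_range.1 hi
      have h2 := succ_mul_ch_eq N i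
      rw [ch_natCast, ch_natCast] at h2
      push_cast at h2
      rw [h2, map_smul, S.vir_h _ _ hx, ← S.succ_smul_ell, show p + 1 - i = p - i + 1 by omega,
        Nat.add_sub_add_right, map_smul,
        show ((i : ℤ) - N + 1) = ((i + 1 : ℕ) : ℤ) - N by push_cast; ring,
        Nat.cast_sub (show i ≤ p by omega)]
      push_cast
      module
    rw [Finset.sum_congr rfl h1, Finset.sum_add_distrib]
    have h3 : ∑ i ∈ Finset.range (p + 1), (((i : ℂ) + 1) * Nat.choose N (i + 1)) •
          D.h (((i + 1 : ℕ) : ℤ) - N) x (S.ell (p + 1 - (i + 1)) v) =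
        ∑ i ∈ Finset.range (p + 2), ((i : ℂ) * Nat.choose N i) •
          D.h ((i : ℤ) - N) x (S.ell (p + 1 - i) v) := by
      rw [Finset.sum_range_succ' _ (p + 1), Nat.cast_zero, zero_mul, zero_smul, add_zero]
      refine Finset.sum_congr rfl fun i _ => ?_
      push_cast
      rfl
    have h4 : ∑ i ∈ Finset.range (p + 1), ((Nat.choose N i : ℂ) * ((p : ℂ) + 1 - i)) •
          D.h ((i : ℤ) - N) x (S.ell (p + 1 - i) v) =
        ∑ i ∈ Finset.range (p + 2), ((Nat.choose N i : ℂ) * ((p : ℂ) + 1 - i)) •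
          D.h ((i : ℤ) - N) x (S.ell (p + 1 - i) v) := by
      rw [Finset.sum_range_succ _ (p + 1)]
      push_cast
      simp
    rw [h3, h4, ← Finset.sum_add_distrib]
    refine Finset.sum_congr rfl fun i _ => ?_
    module

end LatticeDatum

/-! ### Invariance of the form under all vertex operators -/

/-- The sign `(-1)^(h - h̄)`. -/
def sgn (y : ℝ × ℝ) : ℂ := (-1) ^ ⌊y.1 - y.2⌋

theorem sgn_add_smul_dv (y : ℝ × ℝ) (c : Bool) (n : ℕ) :
    sgn (y + (n : ℝ) • dv c) = (-1) ^ n * sgn y := by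
  have h0 : (-1 : ℂ) ≠ 0 := by norm_num
  cases c
  · have : (y + (n : ℝ) • dv false).1 - (y + (n : ℝ) • dv false).2 = y.1 - y.2 - (n : ℕ) := by
      simp [dv]; ring
    rw [sgn, sgn, this, Int.floor_sub_natCast, sub_eq_add_neg, zpow_add₀ h0, neg_one_zpow_neg, mul_comm]
  · have : (y + (n : ℝ) • dv true).1 - (y + (n : ℝ) • dv true).2 = y.1 - y.2 + (n : ℕ) := by
      simp [dv]; ring
    rw [sgn, sgn, this, Int.floor_add_natCast, zpow_add₀ h0, zpow_natCast, mul_comm]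

namespace LatticeDatum
variable {L E : Type*} [AddCommGroup L] [AddCommGroup E] [Module ℂ E] {D : LatticeDatum L E}

theorem wtE_sub (α : L) : ((D.wtE α).1 - (D.wtE α).2) = (D.B α α : ℝ) / 2 := by
  rw [← D.sub_eq]
  simp [wtE]
  ring

/-- The spin of e_γ is the integer (γ,γ)/2, and polarization adds (α,β). -/
theorem sgn_wtE_add (α β : L) : sgn (D.wtE (α + β)) =
    sgn (D.wtE α) * sgn (D.wtE β) * (-1) ^ D.B α β := by
  have h0 : (-1 : ℂ) ≠ 0 := by norm_num
  obtain ⟨m, hm⟩ := D.even α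
  obtain ⟨n, hn⟩ := D.even β
  have e : ∀ {γ : L} {k : ℤ}, D.B γ γ = k + k → sgn (D.wtE γ) = (-1) ^ k := by
    intro γ k h
    rw [sgn, wtE_sub, h]
    congr 1
    rw [Int.floor_eq_iff]
    push_cast
    constructor <;> linarith
  have hs : D.B (α + β) (α + β) = (m + n + D.B α β) + (m + n + D.B α β) := by
    have h1 := D.sub_eq α β
    have h2 := D.sub_eq β α
    have h3 := D.pe_comm α β
    have h4 : (D.B α β : ℝ) = D.B β α := by
      rw [← h1, ← h2]
      simp only [pe, Prod.mk.injEq] at h3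
      rw [h3.1, h3.2]
    have h5 : D.B α β = D.B β α := by exact_mod_cast h4
    simp only [map_add, LinearMap.add_apply, hm, hn, ← h5]
    ring
  rw [e hm, e hn, e hs, zpow_add₀ h0, zpow_add₀ h0]

theorem B_comm (α β : L) : D.B α β = D.B β α := by
  have h3 := D.pe_comm α β
  have h4 : (D.B α β : ℝ) = D.B β α := by
    rw [← D.sub_eq α β, ← D.sub_eq β α]
    simp only [pe, Prod.mk.injEq] at h3
    rw [h3.1, h3.2]
  exact_mod_cast h4

/-- This is contravariance on three exponentials whose charges sum to zero. It follows by bracketing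
products of e_α, e_β and e_(-α-β) in two ways; the sign built into `κ` compensates the commutation
sign (-1)^(α,β). -/
theorem ε_κ (α β : L) : D.A.ε α β * D.κ (α + β) =
    sgn (D.wtE α) * (D.A.ε α (-(α + β)) * D.κ β) := by
  have h1 := D.A.assoc α β (-(α + β))
  have h2 := D.A.assoc β (-(α + β)) α
  have h3 := D.A.comm (-(α + β)) α
  have h4 := D.A.comm (-α) α
  have hs : (-1 : ℂ) ^ D.B α β * (-1) ^ D.B α β = 1 := by
    rw [← neg_one_zpow_add]
    exact (Even.add_self _).neg_one_zpow
  have e1 : β + -(α + β) = -α := by abel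
  have e2 : -(α + β) + α = -β := by abel
  rw [e1] at h1 h2
  rw [e2] at h2
  have h5 : D.B (-(α + β)) α = -(D.B α α) + -(D.B α β) := by
    rw [map_neg, LinearMap.neg_apply, map_add, LinearMap.add_apply, B_comm β α]
    ring
  rw [h5, neg_one_zpow_add, zpow_neg, zpow_neg, neg_one_zpow_B_self, inv_one, one_mul] at h3
  rw [map_neg, LinearMap.neg_apply, zpow_neg, neg_one_zpow_B_self, inv_one, one_mul] at h4
  rw [h4, h3] at h2
  have h6 : ((-1 : ℂ) ^ D.B α β)⁻¹ = (-1) ^ D.B α β := inv_eq_of_mul_eq_one_left hs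
  rw [h6] at h2
  change _ * (sgn _ * _) = _ * (_ * (sgn _ * _))
  rw [sgn_wtE_add]
  linear_combination (sgn (D.wtE α) * sgn (D.wtE β) * (-1) ^ D.B α β) * (h1 + h2) +
    sgn (D.wtE α) * sgn (D.wtE β) * D.A.ε α (-(α + β)) * D.A.ε β (-β) * hs

theorem isVacuum_form_right (γ : L) : D.IsVacuum (D.form.flip (e γ)) := by
  intro k x v
  rw [LinearMap.flip_apply, form_h_neg, D.h_e_pos _ (by omega), map_zero, neg_zero]

theorem isVacuum_form_e (β : L) : D.IsVacuum (D.form (e β)) := by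
  intro k x v
  rw [form_e, vac_h, mul_zero]

open Classical in
theorem form_e_e (β γ : L) : D.form (e β) (e γ) = if γ = -β then D.κ β else 0 := by
  rw [form_e, vac_e, mul_ite, mul_one, mul_zero]

/-- The contravariance of the vertex operators of the `e_α`. -/
theorem form_Y_e (α : L) (z : ℝ × ℝ) (b w : L →₀ Fock E) : D.form (D.Y z (e α) b) w =
    sgn (D.wtE α) * D.form b (D.Y (-(2 : ℝ) • D.wtE α - z) (e α) w) := by
  classical
  induction b using D.induction generalizing z w with
  | e β =>
    induction w using D.induction generalizing z with
    | e γ =>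
      have h1 := (D.isVacuum_form_right γ).apply_Y_e_e α β z
      simp only [LinearMap.flip_apply] at h1
      rw [h1, (D.isVacuum_form_e β).apply_Y_e_e, form_e_e, form_e_e]
      -- Both sides pair charges summing to zero, and for such charges the leading exponents on the
      -- two sides correspond; everything else vanishes.
      by_cases hγ : γ = -(α + β)
      · subst hγ
        have h2 : -(2 : ℝ) • D.wtE α - z = D.pe α (-(α + β)) ↔ z = D.pe α β := by
          rw [pe_neg_right, pe_add_right, wtE_eq, smul_smul, show (-2 * 2⁻¹ : ℝ) = -1 by norm_num,
            neg_one_smul, neg_add, ← sub_eq_add_neg]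
          exact sub_right_inj
        simp only [h2, if_pos (show α + -(α + β) = -β by abel), if_true]
        split_ifs
        · exact D.ε_κ α β
        · simp
      · have h3 : ¬ α + γ = -β := by
          intro h
          refine hγ ?_
          rw [eq_neg_iff_add_eq_zero] at h ⊢
          rw [← h]
          abel
        rw [if_neg hγ, if_neg h3]
        simp
    | add v w hv hw => simp only [map_add, hv, hw, mul_add]
    | smul t v hv => simp only [map_smul, hv, smul_eq_mul]; ring
    | h c k x v hx hv =>
      have h1 := D.form_h ((k : ℤ) + 1) x (D.Y z (e α) (e β)) v
      have h2 := D.e_commutator c x hx ((k : ℤ) + 1) α z (e β)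
      have h3 := D.e_commutator c x hx (-((k : ℤ) + 1)) α (-(2 : ℝ) • D.wtE α - z) v
      have h4 := D.form_h ((k : ℤ) + 1) x (e β) (D.Y (-(2 : ℝ) • D.wtE α - z) (e α) v)
      rw [D.h_e_pos _ (by omega), map_zero, zero_add] at h2
      rw [h2, map_smul, LinearMap.smul_apply, hv] at h1
      rw [D.h_e_pos _ (by omega), map_zero, LinearMap.zero_apply, h3, map_add, map_smul] at h4
      rw [show -(2 : ℝ) • D.wtE α - (z - (((k : ℤ) + 1 : ℤ) : ℝ) • dv c) =
        -(2 : ℝ) • D.wtE α - z - ((-((k : ℤ) + 1) : ℤ) : ℝ) • dv c by push_cast; module] at h1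
      simp only [smul_eq_mul] at h1 h4
      linear_combination h1 - sgn (D.wtE α) * h4
  | add v w hv hw => simp only [map_add, LinearMap.add_apply, hv, hw, mul_add]
  | smul t v hv => simp only [map_smul, LinearMap.smul_apply, hv, smul_eq_mul]; ring
  | h c k x v hx hv =>
    have h1 := D.e_commutator c x hx (-((k : ℤ) + 1)) α z v
    have h2 := D.e_commutator c x hx ((k : ℤ) + 1) α (-(2 : ℝ) • D.wtE α - z) w
    have h3 := congrArg (fun u => D.form u w) h1
    have h4 := congrArg (D.form v) h2
    simp only [map_add, map_smul, LinearMap.add_apply, LinearMap.smul_apply, form_h_neg, hv,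
      smul_eq_mul] at h3 h4 ⊢
    rw [show -(2 : ℝ) • D.wtE α - (z - ((-((k : ℤ) + 1) : ℤ) : ℝ) • dv c) =
      -(2 : ℝ) • D.wtE α - z - (((k : ℤ) + 1 : ℤ) : ℝ) • dv c by push_cast; module] at h3
    linear_combination -h3 + sgn (D.wtE α) * h4

variable (S : ∀ c, D.Frame c)

/-- The right-hand side of the contravariance formula. -/
def dualSum (c : Bool) (K : ℕ) (y : ℝ × ℝ) (a : L →₀ Fock E) (z : ℝ × ℝ) (b w : L →₀ Fock E) : ℂ :=
  ∑ q ∈ Finset.range K, ∑ p ∈ Finset.range K,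
    D.form b (D.Y (-(2 : ℝ) • y + (p : ℝ) • dv c + (q : ℝ) • dv (!c) - z)
      ((S c).ell p ((S !c).ell q a)) w)

/-- The operators L(1) and L̄(1) commute, so either may be applied last. The inductive step can then
place the operator of the part containing x in the inner sum. -/
theorem dualSum_not (c : Bool) (K : ℕ) (y : ℝ × ℝ) (a : L →₀ Fock E) (z : ℝ × ℝ)
    (b w : L →₀ Fock E) : dualSum S (!c) K y a z b w = dualSum S c K y a z b w := by
  have key : ∀ c c' : Bool, c ≠ c' → ∑ q ∈ Finset.range K, ∑ p ∈ Finset.range K,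
      D.form b (D.Y (-(2 : ℝ) • y + (p : ℝ) • dv c + (q : ℝ) • dv c' - z)
        ((S c).ell p ((S c').ell q a)) w) = ∑ q ∈ Finset.range K, ∑ p ∈ Finset.range K,
      D.form b (D.Y (-(2 : ℝ) • y + (p : ℝ) • dv c' + (q : ℝ) • dv c - z)
        ((S c').ell p ((S c).ell q a)) w) := by
    intro c c' hc
    rw [Finset.sum_comm]
    refine Finset.sum_congr rfl fun p _ => Finset.sum_congr rfl fun q _ => ?_
    rw [(S c).ell_ell_of_ne hc (S c'), add_right_comm]
  cases c
  · exact key true false (by simp)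
  · exact key false true (by simp)

/-- The contravariance of the vertex operator of `a`, a vector of weight `y`. -/
def IsContravariant (y : ℝ × ℝ) (a : L →₀ Fock E) : Prop :=
  ∀ᶠ K : ℕ in atTop, ∀ z b w, D.form (D.Y z a b) w = sgn y * dualSum S true K y a z b w

theorem isContravariant_iff (c : Bool) (y : ℝ × ℝ) (a : L →₀ Fock E) : IsContravariant S y a ↔
    ∀ᶠ K : ℕ in atTop, ∀ z b w, D.form (D.Y z a b) w = sgn y * dualSum S c K y a z b w := by
  cases c
  · simp only [IsContravariant]
    have : ∀ K z b w, dualSum S false K y a z b w = dualSum S true K y a z b w :=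
      fun K z b w => dualSum_not S true K y a z b w
    simp only [this]
  · rfl

theorem isContravariant_e (α : L) : IsContravariant S (D.wtE α) (e α) := by
  filter_upwards [eventually_gt_atTop 0] with K hK z b w
  rw [form_Y_e, dualSum, Finset.sum_eq_single 0, Finset.sum_eq_single 0, Frame.ell_zero,
    Frame.ell_zero]
  · simp
  · intro p _ hp
    rw [Frame.ell_zero, Frame.ell_eq_zero _ ((S _).vir_e_pos one_pos α) p hp]
    simp
  · intro h
    exact absurd (Finset.mem_range.2 hK) h
  · intro q _ hq
    refine Finset.sum_eq_zero fun p _ => ?_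
    rw [(S (!true)).ell_eq_zero ((S _).vir_e_pos one_pos α) q hq]
    simp
  · intro h
    exact absurd (Finset.mem_range.2 hK) h

/-- The divided powers of L(1) are distributed over x(-k-1) and a by `Frame.ell_h`, those of the
other part commute with x(-k-1), and the sum over p is reorganized by the power that falls on a.
What appears is exactly the left-hand side of `sum_choose_Y_h`. -/
theorem dualSum_h (c : Bool) (k K₀ K : ℕ) {x : E} (hx : D.pr c x = x) (y : ℝ × ℝ)
    (a : L →₀ Fock E) (z : ℝ × ℝ) (b w : L →₀ Fock E) (hK : K₀ + k + 2 ≤ K)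
    (h1 : ∀ p, K₀ ≤ p → (S c).ell p a = 0) (h2 : ∀ q, K₀ ≤ q → (S !c).ell q a = 0) :
    dualSum S c K (y + ((k + 1 : ℕ) : ℝ) • dv c) (D.h (-((k : ℤ) + 1)) x a) z b w =
      ∑ q ∈ Finset.range K₀, ∑ p ∈ Finset.range K₀, D.form b (∑ i ∈ Finset.range (k + 2),
        (Nat.choose (k + 1) i : ℂ) • D.Y (-(2 : ℝ) • y + (p : ℝ) • dv c + (q : ℝ) • dv (!c) - z -
          (2 * ((k : ℝ) + 1) - i) • dv c) (D.h ((i : ℤ) - (k + 1)) x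
            ((S c).ell p ((S !c).ell q a))) w) := by
  have hc : (!c) ≠ c := by cases c <;> simp
  rw [dualSum, sum_range_eq_of_le _ (show K₀ ≤ K by omega)]
  · refine Finset.sum_congr rfl fun q _ => ?_
    let G : ℕ → ℕ → ℂ := fun i l => Nat.choose (k + 1) i * D.form b
      (D.Y (-(2 : ℝ) • y + (l : ℝ) • dv c + (q : ℝ) • dv (!c) - z -
          (2 * ((k : ℝ) + 1) - i) • dv c) (D.h ((i : ℤ) - (k + 1)) x
            ((S c).ell l ((S !c).ell q a))) w)
    have hG1 : ∀ i l, k + 2 ≤ i → G i l = 0 := by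
      intro i l hi
      simp only [G]
      rw [Nat.choose_eq_zero_of_lt (by omega), Nat.cast_zero, zero_mul]
    have hG2 : ∀ i l, K₀ ≤ l → G i l = 0 := by
      intro i l hl
      simp only [G]
      rw [(S c).ell_ell_of_ne hc.symm, h1 l hl]
      simp
    have e1 : ∀ p ∈ Finset.range K, D.form b (D.Y (-(2 : ℝ) • (y + ((k + 1 : ℕ) : ℝ) • dv c) +
        (p : ℝ) • dv c + (q : ℝ) • dv (!c) - z)
        ((S c).ell p ((S !c).ell q (D.h (-((k : ℤ) + 1)) x a))) w) =
        ∑ i ∈ Finset.range (p + 1), G i (p - i) := by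
      intro p _
      have h3 := (S c).ell_h p (k + 1) hx ((S !c).ell q a)
      rw [(S !c).ell_h_of_ne hc q _ hx, show (-((k : ℤ) + 1)) = -((k + 1 : ℕ) : ℤ) by push_cast; ring,
        h3, map_sum, LinearMap.sum_apply, map_sum]
      refine Finset.sum_congr rfl fun i hi => ?_
      have hi' := Finset.mem_range.1 hi
      rw [map_smul, LinearMap.smul_apply, map_smul, smul_eq_mul]
      simp only [G]
      rw [Nat.cast_sub (show i ≤ p by omega),
        show -(2 : ℝ) • (y + ((k + 1 : ℕ) : ℝ) • dv c) + (p : ℝ) • dv c + (q : ℝ) • dv (!c) - z =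
          -(2 : ℝ) • y + ((p : ℝ) - i) • dv c + (q : ℝ) • dv (!c) - z -
            (2 * ((k : ℝ) + 1) - i) • dv c by push_cast; module]
      push_cast
      rfl
    -- The triangular sum becomes a rectangle of i < k + 2 and l < K₀: outside it either the
    -- binomial coefficient or the divided power on a vanishes, and K ≥ K₀ + k + 2 leaves enough
    -- room.
    rw [Finset.sum_congr rfl e1, Finset.sum_range_diag_flip K G,
      sum_range_eq_of_le _ (show k + 2 ≤ K by omega) fun i hi =>
        Finset.sum_eq_zero fun l _ => hG1 i l hi]
    have e2 : ∀ i ∈ Finset.range (k + 2), ∑ l ∈ Finset.range (K - i), G i l =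
        ∑ l ∈ Finset.range K₀, G i l := by
      intro i hi
      rw [Finset.mem_range] at hi
      exact sum_range_eq_of_le _ (by omega) fun l hl => hG2 i l hl
    rw [Finset.sum_congr rfl e2, Finset.sum_comm]
    refine Finset.sum_congr rfl fun p _ => ?_
    rw [map_sum]
    refine Finset.sum_congr rfl fun i _ => ?_
    rw [map_smul, smul_eq_mul]
  · intro q hq
    refine Finset.sum_eq_zero fun p _ => ?_
    rw [(S !c).ell_h_of_ne hc q _ hx, h2 q hq]
    simp

/-- The normal ordering formula on one side and `sum_choose_Y_h` on the other reduce the claim to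
the contravariance of a, with the modes of x carried across the form by x(n)* = -x(-n). -/
theorem isContravariant_h (c : Bool) (k : ℕ) {x : E} (hx : D.pr c x = x) {y : ℝ × ℝ}
    {a : L →₀ Fock E} (ha : IsContravariant S y a) :
    IsContravariant S (y + ((k + 1 : ℕ) : ℝ) • dv c) (D.h (-((k : ℤ) + 1)) x a) := by
  rw [isContravariant_iff S c] at ha ⊢
  obtain ⟨K₀, h1, h2, h3⟩ := (ha.and (((S c).ell_eventually a).and ((S !c).ell_eventually a))).exists
  filter_upwards [eventually_ge_atTop (K₀ + k + 2)] with K hK z b w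
  rw [dualSum_h S c k K₀ K hx y a z b w hK h2 h3, sgn_add_smul_dv]
  have h4 : ∀ᶠ M : ℕ in atTop, ∀ q ∈ Finset.range K₀, ∀ p ∈ Finset.range K₀, _ :=
    (Filter.eventually_all_finset (Finset.range K₀)).2 fun q _ =>
      (Filter.eventually_all_finset (Finset.range K₀)).2 fun p _ =>
        sum_choose_Y_h c k hx ((S c).ell p ((S !c).ell q a)) w
          (-(2 : ℝ) • y + (p : ℝ) • dv c + (q : ℝ) • dv (!c) - z)
  obtain ⟨M, h4, h5⟩ := (h4.and (D.Y_h c k x hx a b z)).exists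
  rw [Finset.sum_congr rfl fun q hq => Finset.sum_congr rfl fun p hp => by rw [h4 q hq p hp], h5]
  let P : ℕ → ℕ → ℕ → ℂ := fun j q p => D.form b (D.Y (-(2 : ℝ) • y + (p : ℝ) • dv c +
    (q : ℝ) • dv (!c) - z + (j : ℝ) • dv c) ((S c).ell p ((S !c).ell q a))
      (D.h (((j + k : ℕ) : ℤ) + 1) x w))
  let Q : ℕ → ℕ → ℕ → ℂ := fun i q p => D.form b (D.h (-(i : ℤ)) x (D.Y (-(2 : ℝ) • y +
    (p : ℝ) • dv c + (q : ℝ) • dv (!c) - z - ((i + k + 1 : ℕ) : ℝ) • dv c)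
      ((S c).ell p ((S !c).ell q a)) w))
  have hP : ∀ j : ℕ, D.form (D.h (-(((j + k : ℕ) : ℤ) + 1)) x (D.Y (z - (j : ℝ) • dv c) a b)) w =
      -(sgn y * ∑ q ∈ Finset.range K₀, ∑ p ∈ Finset.range K₀, P j q p) := by
    intro j
    rw [form_h_neg, h1, dualSum]
    simp only [P, ← sub_add]
  have hQ : ∀ i : ℕ, D.form (D.Y (z + ((i + k + 1 : ℕ) : ℝ) • dv c) a (D.h i x b)) w =
      -(sgn y * ∑ q ∈ Finset.range K₀, ∑ p ∈ Finset.range K₀, Q i q p) := by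
    intro i
    rw [h1, dualSum]
    simp only [Q, ← sub_sub, D.form_h, Finset.sum_neg_distrib, mul_neg]
  have hc : ∀ F : ℕ → ℕ → ℕ → ℂ, ∑ q ∈ Finset.range K₀, ∑ p ∈ Finset.range K₀,
      ∑ j ∈ Finset.range M, F j q p =
      ∑ j ∈ Finset.range M, ∑ q ∈ Finset.range K₀, ∑ p ∈ Finset.range K₀, F j q p := by
    intro F
    rw [Finset.sum_congr rfl fun q _ => Finset.sum_comm, Finset.sum_comm]
  have hR : ∑ q ∈ Finset.range K₀, ∑ p ∈ Finset.range K₀, ((-1) ^ k * ∑ j ∈ Finset.range M,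
      Nat.choose (j + k) k * P j q p + ∑ i ∈ Finset.range M, Nat.choose (i + k) k * Q i q p) =
      (-1) ^ k * ∑ j ∈ Finset.range M, Nat.choose (j + k) k *
        ∑ q ∈ Finset.range K₀, ∑ p ∈ Finset.range K₀, P j q p +
      ∑ i ∈ Finset.range M, Nat.choose (i + k) k *
        ∑ q ∈ Finset.range K₀, ∑ p ∈ Finset.range K₀, Q i q p := by
    simp only [Finset.sum_add_distrib, ← Finset.mul_sum, hc]
  simp only [map_add, map_sum, map_smul, LinearMap.add_apply, LinearMap.sum_apply,
    LinearMap.smul_apply, smul_eq_mul, hP, hQ]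
  refine Eq.trans ?_ (congrArg _ hR.symm)
  have hs := neg_one_pow_mul_self k
  have e1 : ∑ j ∈ Finset.range M, (Nat.choose (j + k) k : ℂ) *
      -(sgn y * ∑ q ∈ Finset.range K₀, ∑ p ∈ Finset.range K₀, P j q p) =
      -(sgn y * ∑ j ∈ Finset.range M, Nat.choose (j + k) k *
        ∑ q ∈ Finset.range K₀, ∑ p ∈ Finset.range K₀, P j q p) := by
    rw [Finset.mul_sum, ← Finset.sum_neg_distrib]
    exact Finset.sum_congr rfl fun j _ => by ring
  have e2 : ∑ i ∈ Finset.range M, ((-1) ^ k * Nat.choose (i + k) k : ℂ) *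
      -(sgn y * ∑ q ∈ Finset.range K₀, ∑ p ∈ Finset.range K₀, Q i q p) =
      -((-1) ^ k * sgn y * ∑ i ∈ Finset.range M, Nat.choose (i + k) k *
        ∑ q ∈ Finset.range K₀, ∑ p ∈ Finset.range K₀, Q i q p) := by
    rw [Finset.mul_sum, ← Finset.sum_neg_distrib]
    exact Finset.sum_congr rfl fun j _ => by ring
  rw [e1, e2, pow_succ]
  linear_combination (sgn y * ∑ j ∈ Finset.range M, Nat.choose (j + k) k *
        ∑ q ∈ Finset.range K₀, ∑ p ∈ Finset.range K₀, P j q p) * hs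

theorem isContravariant_of_mem_W {y : ℝ × ℝ} {a : L →₀ Fock E} (ha : a ∈ D.W y) :
    IsContravariant S y a := by
  have hadd : ∀ (y : ℝ × ℝ) (a a' : L →₀ Fock E), IsContravariant S y a → IsContravariant S y a' →
      IsContravariant S y (a + a') := by
    intro y a a' h h'
    filter_upwards [h, h'] with K h h' z b w
    rw [map_add, LinearMap.add_apply, map_add, LinearMap.add_apply, h, h', ← mul_add, dualSum, dualSum,
      dualSum, ← Finset.sum_add_distrib]
    congr 1
    refine Finset.sum_congr rfl fun q _ => ?_
    rw [← Finset.sum_add_distrib]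
    refine Finset.sum_congr rfl fun p _ => ?_
    simp only [map_add, LinearMap.add_apply]
  have hzero : ∀ y, IsContravariant S y 0 := by
    intro y
    refine Eventually.of_forall fun K z b w => ?_
    simp [dualSum]
  refine Submodule.iSup_induction (D.U · y) (motive := IsContravariant S y) ha
    (fun δ a ha => ?_) (hzero y) (hadd y)
  refine D.U_induction (motive := fun _ y a => IsContravariant S y a) (fun _ => hzero)
    (isContravariant_e S) (fun _ => hadd) ?_ ?_ ha
  · intro _ y t a h
    filter_upwards [h] with K h z b w
    rw [map_smul, LinearMap.smul_apply, map_smul, LinearMap.smul_apply, h, dualSum, dualSum]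
    simp only [map_smul, LinearMap.smul_apply, smul_eq_mul, ← Finset.mul_sum]
    ring
  · intro c k x _ y a hx _ _ h
    exact isContravariant_h S c k hx h

theorem isSelfDual (hD : D.IsPositive) (S : D.Frame true) (S' : D.Frame false) :
    D.vertexData.IsSelfDual S.ω S'.ω := by
  refine ⟨hD.dualEquiv, fun h hbar a ha b w r s => ?_⟩
  rw [vertexData_grade] at ha
  let F : ∀ c, D.Frame c := fun c => match c with
    | true => S
    | false => S'
  obtain ⟨K, h1, h2, h3⟩ := ((isContravariant_of_mem_W F ha).and
    ((S.ell_eventually a).and (S'.ell_eventually a))).exists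
  have h4 : ∀ p q : ℕ, (-1 : ℂ) ^ ⌊h - hbar⌋ / (Nat.factorial p * Nat.factorial q) *
      D.form b (D.vertexData.Y ((D.vertexData.vir S.ω 1 ^ p) ((D.vertexData.virBar S'.ω 1 ^ q) a))
        (2 * h - p - r - 2) (2 * hbar - q - s - 2) w) =
      sgn (h, hbar) * D.form b (D.Y (-(2 : ℝ) • (h, hbar) + (p : ℝ) • dv true + (q : ℝ) • dv false -
        (-r - 1, -s - 1)) (S.ell p (S'.ell q a)) w) := by
    intro p q
    rw [vertexData_vir, vertexData_virBar, vertexData_Y, Frame.ell, Frame.ell, LinearMap.smul_apply,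
      LinearMap.smul_apply, map_smul, map_smul, map_smul, LinearMap.smul_apply, LinearMap.smul_apply,
      map_smul, map_smul, smul_eq_mul, smul_eq_mul,
      show (-(2 * h - p - r - 2) - 1, -(2 * hbar - q - s - 2) - 1) =
        -(2 : ℝ) • (h, hbar) + (p : ℝ) • dv true + (q : ℝ) • dv false - (-r - 1, -s - 1) by
        ext <;> simp [dv] <;> ring]
    change (-1 : ℂ) ^ ⌊h - hbar⌋ / _ * _ = (-1 : ℂ) ^ ⌊h - hbar⌋ * _
    rw [div_eq_mul_inv, mul_inv]
    ring
  change D.form (D.vertexData.Y a r s b) w = D.vertexData.dualAction S.ω S'.ω h hbar a r s (D.form b) w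
  rw [vertexData_Y, h1, VertexData.dualAction, finsum_congr fun x : ℕ × ℕ => h4 x.1 x.2,
    finsum_eq_sum_of_support_subset (s := Finset.range K ×ˢ Finset.range K), Finset.sum_product_right,
    dualSum, Finset.mul_sum]
  · refine Finset.sum_congr rfl fun q _ => ?_
    rw [Finset.mul_sum]
    rfl
  · rintro ⟨p, q⟩ hx
    by_contra hne
    refine hx ?_
    have h5 : S.ell p (S'.ell q a) = 0 := by
      rw [Finset.mem_coe, Finset.mem_product, Finset.mem_range, Finset.mem_range, not_and_or, not_lt,
        not_lt] at hne
      rcases hne with hp | hq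
      · rw [S.ell_ell_of_ne (by simp), h2 p hp, map_zero]
      · rw [h3 q hq, map_zero]
    simp [h5]

end LatticeDatum

/-! ### Positive projections and the lattice VOA -/

/-- A frame from an orthonormal basis. -/
def LatticeDatum.frameOfBasis {L E : Type*} [AddCommGroup L] [AddCommGroup E] [Module ℂ E]
    (D : LatticeDatum L E) {c : Bool} {k : ℕ} {V : Submodule ℂ E} (hV : D.part c = V)
    (f : Module.Basis (Fin k) ℂ V)
    (hf : ∀ i j, D.g (f i : E) (f j : E) = if i = j then 1 else 0) : D.Frame c where
  n := k
  f i := f i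
  pr_f i := D.mem_part.1 (hV ▸ (f i).2)
  sum_f x := by
    have hx : D.pr c x ∈ V := hV ▸ D.mem_part.2 (D.pr_pr c x)
    have h1 : ∀ i, D.g (f i : E) x = f.repr ⟨_, hx⟩ i := by
      intro i
      have h2 : D.pr c (f i : E) = f i := D.mem_part.1 (hV ▸ (f i).2)
      rw [← h2, D.pr_adj]
      conv_lhs => rw [show D.pr c x = ((⟨_, hx⟩ : V) : E) from rfl, ← f.sum_repr ⟨_, hx⟩]
      simp [hf, -Module.Basis.sum_repr]
    simp only [h1]
    have := congrArg (Subtype.val) (f.sum_repr ⟨_, hx⟩)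
    simpa [-Module.Basis.sum_repr] using this

/-- The integral coordinates of α are its pairings with the dual basis, so Cauchy–Schwarz bounds
them in terms of the norm of α. -/
theorem finite_le_of_posDef {L : Type*} [AddCommGroup L] [Module.Free ℤ L] [Module.Finite ℤ L]
    {G : LinearMap.BilinForm ℝ (RealSpace L)} (hG : G.IsSymm) (hpos : ∀ x, x ≠ 0 → 0 < G x x)
    (R : ℝ) : {α : L | G (toReal α) (toReal α) ≤ R}.Finite := by
  classical
  let b := Module.Free.chooseBasis ℤ L
  let c := b.baseChange ℝ
  have hn : G.Nondegenerate := by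
    refine ⟨fun x hx => ?_, fun x hx => ?_⟩ <;>
    · by_contra h
      exact (hpos x h).ne' (hx x)
  have h0 : ∀ x, 0 ≤ G x x := fun x => by
    rcases eq_or_ne x 0 with rfl | h
    · simp
    · exact (hpos x h).le
  let e := G.dualBasis hn c
  have h1 : ∀ α i, G (e i) (toReal α) = b.repr α i := by
    intro α i
    have h2 : toReal α = ∑ j, (b.repr α j : ℝ) • c j := by
      conv_lhs => rw [← b.sum_repr α]
      simp only [toReal, TensorProduct.tmul_sum, c, Module.Basis.baseChange_apply]
      refine Finset.sum_congr rfl fun j _ => ?_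
      rw [TensorProduct.smul_tmul', TensorProduct.tmul_smul, TensorProduct.smul_tmul']
      simp
    rw [h2, map_sum]
    simp [e, LinearMap.BilinForm.apply_dualBasis_left]
  let M : _ → ℤ := fun i => ⌈G (e i) (e i) * R⌉
  refine Set.Finite.of_injOn (f := fun α i => b.repr α i) (t := Set.Icc (-M) M) ?_ ?_
    (Set.finite_Icc _ _)
  · intro α hα
    have key : ∀ i, |b.repr α i| ≤ M i := by
      intro i
      have h2 := LinearMap.BilinForm.apply_sq_le_of_symm G h0 (LinearMap.BilinForm.isSymm_iff.1 hG) (e i) (toReal α)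
      rw [h1] at h2
      have h3 : ((b.repr α i : ℝ)) ^ 2 ≤ G (e i) (e i) * R :=
        h2.trans (mul_le_mul_of_nonneg_left hα (h0 _))
      -- For an integer the absolute value is at most the square, so the bound on the square can be
      -- used directly without a root.
      have h4 : |b.repr α i| ≤ (b.repr α i) ^ 2 := by
        rw [← sq_abs]
        have := abs_nonneg (b.repr α i)
        rcases this.eq_or_lt with h | h
        · rw [← h]; simp
        · nlinarith
      have h5 : (((b.repr α i) ^ 2 : ℤ) : ℝ) ≤ M i := by
        push_cast
        exact h3.trans (Int.le_ceil _)
      exact h4.trans (by exact_mod_cast h5)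
    exact ⟨fun i => (abs_le.1 (key i)).1, fun i => (abs_le.1 (key i)).2⟩
  · intro α _ β _ h
    exact b.repr.injective (Finsupp.ext fun i => congrFun h i)

section PositiveProjection
variable {H : Type*} [AddCommGroup H] [Module ℝ H] {Q : LinearMap.BilinForm ℝ H}
  {p : Module.End ℝ H}

theorem apply_nonneg_of_mem_positiveProjections (hp : p ∈ positiveProjections Q) (x : H) :
    0 ≤ Q (p x) (p x) ∧ (Q (p x) (p x) = 0 → p x = 0) := by
  have h1 : p x ∈ LinearMap.ker (1 - p) := by
    simp [apply_apply_of_mem_orthogonalProjections hp.1]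
  rcases eq_or_ne (p x) 0 with h | h
  · simp [h]
  · have := hp.2.1 _ h1 h
    exact ⟨this.le, fun h => absurd h this.ne'⟩

theorem apply_nonpos_of_mem_positiveProjections (hp : p ∈ positiveProjections Q) (x : H) :
    Q (x - p x) (x - p x) ≤ 0 ∧ (Q (x - p x) (x - p x) = 0 → x - p x = 0) := by
  have h1 : x - p x ∈ LinearMap.ker p := by
    simp [apply_apply_of_mem_orthogonalProjections hp.1]
  rcases eq_or_ne (x - p x) 0 with h | h
  · simp [h]
  · have := hp.2.2 _ h1 h
    exact ⟨this.le, fun h => absurd h this.ne⟩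

/-- Twisting reverses the sign on the negative part, so both summands are nonnegative and vanish
together only at zero. -/
theorem twistedForm_pos (hp : p ∈ positiveProjections Q) (x : H) (hx : x ≠ 0) :
    0 < twistedForm Q p x x := by
  obtain ⟨h1, h2⟩ := apply_nonneg_of_mem_positiveProjections hp x
  obtain ⟨h3, h4⟩ := apply_nonpos_of_mem_positiveProjections hp x
  rw [twistedForm_apply]
  by_contra h
  have h5 := h2 (by linarith)
  have h6 := h4 (by linarith)
  exact hx (by simpa [h5] using h6)

end PositiveProjection

section Lattice
variable {L : Type*} [AddCommGroup L] [Module.Free ℤ L] [Module.Finite ℤ L]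
  (B : LinearMap.BilinForm ℤ L) (hB : B.IsSymm) (heven : ∀ α, Even (B α α))
  (hn : (realForm B).Nondegenerate) (A : TwistedGroupAlgebra B) (p : Module.End ℝ (RealSpace L))

theorem leftPairing_eq (hp : p ∈ orthogonalProjections (realForm B)) (α : L) :
    leftPairing B p α α = realForm B (p (toReal α)) (p (toReal α)) := by
  simp [leftPairing, twistedForm_apply, apply_apply_of_mem_orthogonalProjections hp]

theorem rightPairing_eq (hp : p ∈ orthogonalProjections (realForm B)) (α : L) :
    rightPairing B p α α =
      -realForm B (toReal α - p (toReal α)) (toReal α - p (toReal α)) := by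
  simp [rightPairing, twistedForm_apply, apply_apply_of_mem_orthogonalProjections hp]

theorem latticeDatum_isPositive (hp : p ∈ positiveProjections (realForm B)) :
    (latticeDatum B hB heven hn A p hp.1).IsPositive where
  a_nonneg α := by
    change 0 ≤ leftPairing B p α α
    rw [leftPairing_eq B p hp.1]
    exact (apply_nonneg_of_mem_positiveProjections hp _).1
  b_nonneg α := by
    change 0 ≤ rightPairing B p α α
    rw [rightPairing_eq B p hp.1]
    exact neg_nonneg.2 (apply_nonpos_of_mem_positiveProjections hp _).1
  finite R := by
    refine (finite_le_of_posDef (twistedForm_isSymm (realForm_isSymm hB)) (twistedForm_pos hp)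
      R).subset fun α hα => ?_
    change leftPairing B p α α + rightPairing B p α α ≤ R at hα
    rw [leftPairing_eq B p hp.1, rightPairing_eq B p hp.1] at hα
    rwa [Set.mem_ofPred_eq, twistedForm_apply, sub_eq_add_neg]
  pr_eq_zero c α h := by
    cases c
    · have h1 : rightPairing B p α α / 2 = 0 := h
      rw [rightPairing_eq B p hp.1] at h1
      have h2 := (apply_nonpos_of_mem_positiveProjections hp _).2 (by linarith)
      change (1 : ℂ) ⊗ₜ toReal α - complexProj p ((1 : ℂ) ⊗ₜ toReal α) = 0
      rw [complexProj_tmul, ← TensorProduct.tmul_sub, h2, TensorProduct.tmul_zero]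
    · have h1 : leftPairing B p α α / 2 = 0 := h
      rw [leftPairing_eq B p hp.1] at h1
      have h2 := (apply_nonneg_of_mem_positiveProjections hp _).2 (by linarith)
      change complexProj p ((1 : ℂ) ⊗ₜ toReal α) = 0
      rw [complexProj_tmul, h2, TensorProduct.tmul_zero]

include hB heven hn in
theorem latticeVertex_isFullVOA (hp : p ∈ positiveProjections (realForm B)) {k l : ℕ}
    (hl : Module.Basis (Fin k) ℂ (leftSpace p)) (hr : Module.Basis (Fin l) ℂ (rightSpace p))
    (h1 : IsOrthonormal B p (fun i => (hl i : ComplexSpace L)))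
    (h2 : IsOrthonormal B p (fun j => (hr j : ComplexSpace L))) :
    (latticeVertex p A).IsFullVOA (conformalVector B p fun i => hl i)
        (conformalVector B p fun j => hr j) ∧
      (latticeVertex p A).IsSelfDual (conformalVector B p fun i => hl i)
        (conformalVector B p fun j => hr j) ∧
      (latticeVertex p A).IsQPGenerated (conformalVector B p fun i => hl i)
        (conformalVector B p fun j => hr j) := by
  have : Countable L := (Module.Free.chooseBasis ℤ L).repr.toEquiv.countable_iff.2 inferInstance
  have hD := latticeDatum_isPositive B hB heven hn A p hp
  let S := (latticeDatum B hB heven hn A p hp.1).frameOfBasis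
    (latticeDatum_part_true B hB heven hn A p hp.1) hl h1
  let S' := (latticeDatum B hB heven hn A p hp.1).frameOfBasis
    (latticeDatum_part_false B hB heven hn A p hp.1) hr h2
  rw [latticeVertex_eq B hB heven hn A p hp.1]
  exact ⟨LatticeDatum.isFullVOA (hD := hD) (S := S) (S' := S'), LatticeDatum.isSelfDual (hD := hD) (S := S) (S' := S'),
    LatticeDatum.isQPGenerated (hD := hD) (S := S) (S' := S')⟩

end Lattice

/-! ### The pseudo-orthogonal group and its orbit map -/

section SignMatrix
variable (n m : ℕ)

theorem signMatrix_mul_self : signMatrix n m * signMatrix n m = 1 := by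
  simp [signMatrix, Matrix.fromBlocks_multiply]

theorem signMatrix_transpose : (signMatrix n m).transpose = signMatrix n m := by
  simp [signMatrix, Matrix.fromBlocks_transpose]

theorem blockProj_mul_self : blockProj n m * blockProj n m = blockProj n m := by
  simp [blockProj, Matrix.fromBlocks_multiply]

theorem signMatrix_eq : signMatrix n m = 2 • blockProj n m - 1 := by
  rw [← Matrix.fromBlocks_one, blockProj, signMatrix, Matrix.fromBlocks_smul,
    sub_eq_add_neg, Matrix.fromBlocks_neg, Matrix.fromBlocks_add]
  simp [two_smul]

variable {n m}

open scoped MatrixOrder in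
/-- A positive definite matrix in the pseudo-orthogonal group is a square in it. -/
theorem exists_sqrt_pseudoOrthogonal {N : Matrix (Fin n ⊕ Fin m) (Fin n ⊕ Fin m) ℝ}
    (hN : N.PosDef) (h : N * signMatrix n m * N = signMatrix n m) :
    ∃ R : Matrix (Fin n ⊕ Fin m) (Fin n ⊕ Fin m) ℝ, R.transpose = R ∧ R * R = N ∧
      R * signMatrix n m * R = signMatrix n m := by
  set J := signMatrix n m with hJ
  have hJJ : J * J = 1 := signMatrix_mul_self n m
  have hJt : J.transpose = J := signMatrix_transpose n m
  have h0 : 0 ≤ N := hN.posSemidef.nonneg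
  let R := CFC.sqrt N
  have hR : R * R = N := CFC.sqrt_mul_sqrt_self N
  have hR0 : 0 ≤ R := CFC.sqrt_nonneg N
  have hRp : R.PosSemidef := Matrix.nonneg_iff_posSemidef.1 hR0
  have hRt : R.transpose = R := by
    have := hRp.isHermitian.eq
    rwa [Matrix.conjTranspose_eq_transpose_of_trivial] at this
  have hu : IsUnit R.det := by
    have : IsUnit N.det := (Matrix.isUnit_iff_isUnit_det N).1 hN.isUnit
    rw [← hR, Matrix.det_mul] at this
    exact isUnit_of_mul_isUnit_left this
  -- The matrix JRJ is positive and its square is JNJ = N⁻¹, so uniqueness of the positive square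
  -- root identifies it with R⁻¹; this says that R preserves J.
  have h1 : 0 ≤ J * R * J := by
    have := (hRp.conjTranspose_mul_mul_same J).nonneg
    rwa [Matrix.conjTranspose_eq_transpose_of_trivial, hJt] at this
  have h2 : 0 ≤ R⁻¹ := hRp.inv.nonneg
  have h3 : (J * R * J) * (J * R * J) = R⁻¹ * R⁻¹ := by
    have e1 : (J * R * J) * (J * R * J) = J * N * J := by
      calc _ = J * R * (J * J) * R * J := by simp only [Matrix.mul_assoc]
        _ = _ := by rw [hJJ, Matrix.mul_one, Matrix.mul_assoc J, hR]
    rw [e1, ← Matrix.mul_inv_rev, hR]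
    refine (Matrix.inv_eq_left_inv ?_).symm
    calc _ = J * (N * J * N) := by simp only [Matrix.mul_assoc]
      _ = _ := by rw [h, hJJ]
  have h4 : J * R * J = R⁻¹ := (CFC.mul_self_eq_mul_self_iff _ _ h1 h2).1 h3
  refine ⟨R, hRt, hR, ?_⟩
  calc R * J * R = J * (J * R * J) * R := by
        simp only [← Matrix.mul_assoc]; rw [hJJ, Matrix.one_mul]
    _ = J := by rw [h4, Matrix.mul_assoc, Matrix.nonsing_inv_mul _ hu, Matrix.mul_one]

theorem inv_val_eq (g : pseudoOrthogonal n m) :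
    g⁻¹.1.val = signMatrix n m * g.1.val.transpose * signMatrix n m := by
  have h1 : g.1.val.transpose * signMatrix n m * g.1.val = signMatrix n m := g.2
  have h2 : g.1.val * g⁻¹.1.val = 1 := by
    rw [← Matrix.GeneralLinearGroup.coe_mul, ← Subgroup.coe_mul, mul_inv_cancel]; rfl
  calc _ = signMatrix n m * signMatrix n m * g⁻¹.1.val := by
        rw [signMatrix_mul_self, Matrix.one_mul]
    _ = signMatrix n m * (g.1.val.transpose * signMatrix n m * g.1.val) * g⁻¹.1.val := by rw [h1]
    _ = signMatrix n m * g.1.val.transpose * signMatrix n m * (g.1.val * g⁻¹.1.val) := by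
        simp only [Matrix.mul_assoc]
    _ = _ := by rw [h2, Matrix.mul_one]

theorem val_mul_inv_val (g : pseudoOrthogonal n m) : g.1.val * g⁻¹.1.val = 1 := by
  rw [← Matrix.GeneralLinearGroup.coe_mul, ← Subgroup.coe_mul, mul_inv_cancel]; rfl

theorem inv_val_mul_val (g : pseudoOrthogonal n m) : g⁻¹.1.val * g.1.val = 1 := by
  rw [← Matrix.GeneralLinearGroup.coe_mul, ← Subgroup.coe_mul, inv_mul_cancel]; rfl

/-- The conjugate of the standard projection. -/
def conjProj (g : pseudoOrthogonal n m) : Matrix (Fin n ⊕ Fin m) (Fin n ⊕ Fin m) ℝ :=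
  g.1.val * blockProj n m * g⁻¹.1.val

/-- Twice the projection minus one is the reflection gJg⁻¹, and g⁻¹ = J gᵀ J. The orbit map thus
becomes g ↦ g gᵀ after an injective affine change of coordinates. -/
theorem two_conjProj (g : pseudoOrthogonal n m) :
    (2 • conjProj g - 1) * signMatrix n m = g.1.val * g.1.val.transpose := by
  have h : 2 • conjProj g - 1 = g.1.val * signMatrix n m * g⁻¹.1.val := by
    rw [signMatrix_eq, Matrix.mul_sub, Matrix.sub_mul, Matrix.mul_one, val_mul_inv_val, conjProj,
      Matrix.mul_smul, Matrix.smul_mul]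
  rw [h, inv_val_eq]
  calc _ = g.1.val * (signMatrix n m * signMatrix n m) * g.1.val.transpose *
        (signMatrix n m * signMatrix n m) := by simp only [Matrix.mul_assoc]
    _ = _ := by rw [signMatrix_mul_self, Matrix.mul_one, Matrix.mul_one]

/-- Commuting with the block projection forces the off-diagonal blocks to vanish; the isometry
condition then makes the diagonal blocks orthogonal. -/
theorem mem_blockOrthogonal_iff (g : pseudoOrthogonal n m) :
    g ∈ blockOrthogonal n m ↔ g.1.val * blockProj n m = blockProj n m * g.1.val := by
  constructor
  · rintro ⟨a, -, d, -, hg⟩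
    simp [hg, blockProj, Matrix.fromBlocks_multiply]
  · intro h
    have h1 : g.1.val.transpose * signMatrix n m * g.1.val = signMatrix n m := g.2
    rw [← Matrix.fromBlocks_toBlocks g.1.val, blockProj, Matrix.fromBlocks_multiply,
      Matrix.fromBlocks_multiply, Matrix.fromBlocks_inj] at h
    have h12 : g.1.val.toBlocks₁₂ = 0 := by simpa using h.2.1.symm
    have h21 : g.1.val.toBlocks₂₁ = 0 := by simpa using h.2.2.1
    rw [← Matrix.fromBlocks_toBlocks g.1.val, h12, h21, signMatrix, Matrix.fromBlocks_transpose,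
      Matrix.fromBlocks_multiply, Matrix.fromBlocks_multiply, Matrix.fromBlocks_inj] at h1
    refine ⟨g.1.val.toBlocks₁₁, (Matrix.mem_orthogonalGroup_iff' _ _).2 ?_, g.1.val.toBlocks₂₂,
      (Matrix.mem_orthogonalGroup_iff' _ _).2 ?_, ?_⟩
    · simpa using h1.1
    · simpa using h1.2.2.2
    · conv_lhs => rw [← Matrix.fromBlocks_toBlocks g.1.val, h12, h21]

theorem conjProj_eq_iff (g k : pseudoOrthogonal n m) :
    conjProj g = conjProj k ↔ g⁻¹ * k ∈ blockOrthogonal n m := by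
  rw [mem_blockOrthogonal_iff]
  have e : (g⁻¹ * k).1.val = g⁻¹.1.val * k.1.val := rfl
  rw [e, conjProj, conjProj]
  constructor
  · intro h
    calc g⁻¹.1.val * k.1.val * blockProj n m
        = g⁻¹.1.val * (k.1.val * blockProj n m * k⁻¹.1.val) * k.1.val := by
          simp only [Matrix.mul_assoc]; rw [inv_val_mul_val, Matrix.mul_one]
      _ = (g⁻¹.1.val * g.1.val) * blockProj n m * g⁻¹.1.val * k.1.val := by
          rw [← h]; simp only [Matrix.mul_assoc]
      _ = _ := by rw [inv_val_mul_val, Matrix.one_mul, Matrix.mul_assoc]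
  · intro h
    calc g.1.val * blockProj n m * g⁻¹.1.val
        = g.1.val * (blockProj n m * (g⁻¹.1.val * k.1.val)) * k⁻¹.1.val := by
          simp only [Matrix.mul_assoc]; rw [val_mul_inv_val, Matrix.mul_one]
      _ = (g.1.val * g⁻¹.1.val) * k.1.val * blockProj n m * k⁻¹.1.val := by
          rw [← h]; simp only [Matrix.mul_assoc]
      _ = _ := by rw [val_mul_inv_val, Matrix.one_mul]

/-- Inversion of matrices is continuous at invertible ones, so the topology of the group is the
subspace topology of the matrices, and the defining equation is closed and forces invertibility. -/
theorem isClosedEmbedding_val :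
    Topology.IsClosedEmbedding fun g : pseudoOrthogonal n m => g.1.val := by
  have h1 : Topology.IsEmbedding
      (Units.val : (Matrix (Fin n ⊕ Fin m) (Fin n ⊕ Fin m) ℝ)ˣ → _) := by
    refine Units.isEmbedding_val_mk' (f := fun M => M⁻¹) ?_ fun u => (Matrix.coe_units_inv u).symm
    intro M hM
    refine ContinuousAt.continuousWithinAt (continuousAt_matrix_inv M ?_)
    have : M.det ≠ 0 := ((Matrix.isUnit_iff_isUnit_det M).1 hM).ne_zero
    simpa only [Ring.inverse_eq_inv'] using continuousAt_inv₀ this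
  refine ⟨h1.comp Topology.IsEmbedding.subtypeVal, ?_⟩
  have h2 : Set.range (fun g : pseudoOrthogonal n m => g.1.val) =
      {M | M.transpose * signMatrix n m * M = signMatrix n m} := by
    ext M
    constructor
    · rintro ⟨g, rfl⟩
      exact g.2
    · intro hM
      have h3 : signMatrix n m * M.transpose * signMatrix n m * M = 1 := by
        rw [← signMatrix_mul_self, Matrix.mul_assoc, Matrix.mul_assoc, ← Matrix.mul_assoc _ _ M, hM]
      exact ⟨⟨⟨M, _, mul_eq_one_comm.1 h3, h3⟩, hM⟩, rfl⟩
  change IsClosed (Set.range (fun g : pseudoOrthogonal n m => g.1.val))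
  rw [h2]
  exact isClosed_eq (by fun_prop) continuous_const

/-- The trace of M Mᵀ is the sum of the squares of the entries, so preimages of bounded sets are
bounded. -/
theorem isProperMap_mul_transpose {I : Type*} [Fintype I] :
    IsProperMap fun M : Matrix I I ℝ => M * M.transpose := by
  have : CompactlyCoherentSpace (Matrix I I ℝ) :=
    inferInstanceAs (CompactlyCoherentSpace (I → I → ℝ))
  refine isProperMap_iff_isCompact_preimage.2 ⟨by fun_prop, fun K hK => ?_⟩
  have hc : Continuous fun N : Matrix I I ℝ => ∑ i, N i i := by fun_prop
  obtain ⟨C, hC⟩ := (hK.image hc).bddAbove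
  have h1 : IsCompact (Set.pi Set.univ fun _ : I => Set.pi Set.univ fun _ : I =>
      Set.Icc (-(C + 1)) (C + 1)) :=
    isCompact_univ_pi fun _ => isCompact_univ_pi fun _ => isCompact_Icc
  refine h1.of_isClosed_subset (hK.isClosed.preimage (by fun_prop)) fun (M : Matrix I I ℝ) hM i _ j _ => ?_
  have h2 : ∑ i, (M * M.transpose) i i ≤ C := hC ⟨_, hM, rfl⟩
  have h3 : M i j ^ 2 ≤ C := by
    refine le_trans ?_ h2
    have e : ∀ i, (M * M.transpose) i i = ∑ j, M i j ^ 2 := fun i => by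
      simp [Matrix.mul_apply, sq]
    simp only [e]
    exact (Finset.single_le_sum (f := fun j => M i j ^ 2) (fun _ _ => sq_nonneg _)
      (Finset.mem_univ j)).trans (Finset.single_le_sum (f := fun i => ∑ j, M i j ^ 2)
        (fun _ _ => Finset.sum_nonneg fun _ _ => sq_nonneg _) (Finset.mem_univ i))
  have h4 : (0 : ℝ) ≤ C := (sq_nonneg _).trans h3
  constructor <;> nlinarith [sq_nonneg (M i j)]

theorem two_conjProj_injective : Function.Injective
    fun M : Matrix (Fin n ⊕ Fin m) (Fin n ⊕ Fin m) ℝ => (2 • M - 1) * signMatrix n m := by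
  intro M N h
  have h1 : (2 • M - 1) * signMatrix n m * signMatrix n m =
    (2 • N - 1) * signMatrix n m * signMatrix n m := congrArg (· * signMatrix n m) h
  rw [Matrix.mul_assoc, Matrix.mul_assoc, signMatrix_mul_self, Matrix.mul_one, Matrix.mul_one,
    sub_left_inj, ← Nat.cast_smul_eq_nsmul ℝ, ← Nat.cast_smul_eq_nsmul ℝ] at h1
  exact smul_right_injective _ (by norm_num) h1

/-- Followed by the continuous injection M ↦ (2M-1)J, the map becomes g ↦ g gᵀ, a proper map
restricted to a closed subset. -/
theorem isProperMap_conjProj : IsProperMap (conjProj (n := n) (m := m)) := by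
  have hc : Continuous (conjProj (n := n) (m := m)) := by
    have := (isClosedEmbedding_val (n := n) (m := m)).continuous
    have h2 : Continuous fun g : pseudoOrthogonal n m => g⁻¹.1.val := by
      simp only [inv_val_eq]
      fun_prop
    unfold conjProj
    fun_prop
  refine isProperMap_of_comp_of_inj
    (g := fun M => (2 • M - 1) * signMatrix n m) hc (by fun_prop) ?_ ?_
  · have : (fun M => (2 • M - 1) * signMatrix n m) ∘ conjProj (n := n) (m := m) =
        (fun M => M * M.transpose) ∘ fun g : pseudoOrthogonal n m => g.1.val :=
      funext two_conjProj
    rw [this]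
    exact isProperMap_mul_transpose.comp isClosedEmbedding_val.isProperMap
  · exact two_conjProj_injective

end SignMatrix

theorem conj_mem_positiveProjections {H : Type*} [AddCommGroup H] [Module ℝ H]
    {Q : LinearMap.BilinForm ℝ H} {p s t : Module.End ℝ H} (hst : s * t = 1) (hts : t * s = 1)
    (ht : ∀ x y, Q (t x) (t y) = Q x y) (hp : p ∈ positiveProjections Q) :
    s * p * t ∈ positiveProjections Q := by
  have hts' : ∀ x, t (s x) = x := LinearMap.congr_fun hts
  have hst' : ∀ x, s (t x) = x := LinearMap.congr_fun hst
  have h1 : ∀ x ∈ LinearMap.ker (s * p * t), t x ∈ LinearMap.ker p := by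
    intro x hx
    have hx : s (p (t x)) = 0 := hx
    rw [LinearMap.mem_ker, ← hts' (p (t x)), hx, map_zero]
  have h2 : ∀ x ∈ LinearMap.ker (1 - s * p * t), t x ∈ LinearMap.ker (1 - p) := by
    intro x hx
    have hx : x - s (p (t x)) = 0 := hx
    change t x - p (t x) = 0
    rw [← hts' (p (t x)), ← map_sub, hx, map_zero]
  have h3 : ∀ x, x ≠ 0 → t x ≠ 0 := fun x hx h => hx (by rw [← hst' x, h, map_zero])
  refine ⟨⟨?_, fun x hx y hy => ?_⟩, fun x hx h => ?_, fun x hx h => ?_⟩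
  · calc _ = s * p * (t * s) * p * t := by simp only [mul_assoc]
      _ = s * (p * p) * t := by rw [hts, mul_one]; simp only [mul_assoc]
      _ = _ := by rw [hp.1.1]
  · rw [← ht]
    exact hp.1.2 _ (h1 x hx) _ (h2 y hy)
  · rw [← ht]
    exact hp.2.1 _ (h2 x hx) (h3 x h)
  · rw [← ht]
    exact hp.2.2 _ (h1 x hx) (h3 x h)

/-! ### Transitivity and the homeomorphism -/

section Coordinates
variable {H : Type*} [AddCommGroup H] [Module ℝ H] {Q : LinearMap.BilinForm ℝ H} {n m : ℕ}
  {b : Module.Basis (Fin n ⊕ Fin m) ℝ H}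

theorem apply_eq_dotProduct (hb : ∀ i j, Q (b i) (b j) = signMatrix n m i j) (x y : H) :
    Q x y = b.equivFun x ⬝ᵥ (signMatrix n m).mulVec (b.equivFun y) := by
  conv_lhs => rw [← b.sum_equivFun x, ← b.sum_equivFun y]
  simp only [map_sum, map_smul, LinearMap.sum_apply, LinearMap.smul_apply, hb, smul_eq_mul,
    dotProduct, Matrix.mulVec, Finset.mul_sum]
  rw [Finset.sum_comm]
  exact Finset.sum_congr rfl fun i _ => Finset.sum_congr rfl fun j _ => by ring

theorem apply_eq_sum (hb : ∀ i j, Q (b i) (b j) = signMatrix n m i j) (x y : H) :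
    Q x y = ∑ i, b.repr x (.inl i) * b.repr y (.inl i) -
      ∑ j, b.repr x (.inr j) * b.repr y (.inr j) := by
  rw [apply_eq_dotProduct hb, signMatrix, Matrix.fromBlocks_mulVec]
  simp [dotProduct, Matrix.neg_mulVec, sub_eq_add_neg]

theorem equivFun_toLin (M : Matrix (Fin n ⊕ Fin m) (Fin n ⊕ Fin m) ℝ) (x : H) :
    b.equivFun (Matrix.toLin b b M x) = M.mulVec (b.equivFun x) := by
  have := LinearMap.toMatrix_mulVec_repr b b (Matrix.toLin b b M) x
  rw [LinearMap.toMatrix_toLin] at this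
  exact this.symm

theorem toLin_blockProj_mem (hb : ∀ i j, Q (b i) (b j) = signMatrix n m i j) :
    Matrix.toLin b b (blockProj n m) ∈ positiveProjections Q := by
  have h0 : ∀ x, b.repr (Matrix.toLin b b (blockProj n m) x) =
      (Sum.elim (fun i => b.repr x (.inl i)) 0 : Fin n ⊕ Fin m → ℝ) := by
    intro x
    refine (equivFun_toLin (b := b) (blockProj n m) x).trans ?_
    rw [blockProj, Matrix.fromBlocks_mulVec]
    simp
    rfl
  have h1 : ∀ x ∈ LinearMap.ker (Matrix.toLin b b (blockProj n m)), ∀ i,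
      b.repr x (.inl i) = 0 := by
    intro x hx i
    have := congrFun (h0 x) (.inl i)
    rw [LinearMap.mem_ker.1 hx] at this
    simpa using this.symm
  have h2 : ∀ x ∈ LinearMap.ker (1 - Matrix.toLin b b (blockProj n m)), ∀ j,
      b.repr x (.inr j) = 0 := by
    intro x hx j
    have := congrFun (h0 x) (.inr j)
    have hx : x - Matrix.toLin b b (blockProj n m) x = 0 := hx
    rw [← sub_eq_zero.1 hx] at this
    simpa using this
  have h3 : ∀ x, x ≠ 0 → ∃ i, b.repr x i ≠ 0 := by
    intro x hx
    by_contra! h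
    exact hx (b.repr.map_eq_zero_iff.1 (Finsupp.ext h))
  refine ⟨⟨?_, fun x hx y hy => ?_⟩, fun x hx h => ?_, fun x hx h => ?_⟩
  · rw [Module.End.mul_eq_comp, ← Matrix.toLin_mul, blockProj_mul_self]
  · rw [apply_eq_sum hb]
    simp [h1 x hx, h2 y hy]
  · obtain ⟨i | j, hi⟩ := h3 x h
    · rw [apply_eq_sum hb]
      simp only [h2 x hx, mul_zero, Finset.sum_const_zero, sub_zero]
      exact Finset.sum_pos' (fun _ _ => mul_self_nonneg _) ⟨i, Finset.mem_univ i, mul_self_pos.2 hi⟩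
    · exact absurd (h2 x hx j) hi
  · obtain ⟨i | j, hi⟩ := h3 x h
    · exact absurd (h1 x hx i) hi
    · rw [apply_eq_sum hb]
      simp only [h1 x hx, mul_zero, Finset.sum_const_zero, zero_sub, neg_neg_iff_pos]
      exact Finset.sum_pos' (fun _ _ => mul_self_nonneg _)
        ⟨j, Finset.mem_univ j, mul_self_pos.2 hi⟩

theorem toLin_conjProj_mem (hb : ∀ i j, Q (b i) (b j) = signMatrix n m i j)
    (g : pseudoOrthogonal n m) : Matrix.toLin b b (conjProj g) ∈ positiveProjections Q := by
  have h : Matrix.toLin b b (conjProj g) = Matrix.toLin b b g.1.val *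
      Matrix.toLin b b (blockProj n m) * Matrix.toLin b b g⁻¹.1.val := by
    rw [conjProj, Matrix.toLin_mul b b b, Matrix.toLin_mul b b b]; rfl
  rw [h]
  refine conj_mem_positiveProjections ?_ ?_ ?_ (toLin_blockProj_mem hb)
  · rw [Module.End.mul_eq_comp, ← Matrix.toLin_mul, val_mul_inv_val, Matrix.toLin_one]; rfl
  · rw [Module.End.mul_eq_comp, ← Matrix.toLin_mul, inv_val_mul_val, Matrix.toLin_one]; rfl
  · intro x y
    have h1 : g⁻¹.1.val.transpose * signMatrix n m * g⁻¹.1.val = signMatrix n m := g⁻¹.2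
    rw [apply_eq_dotProduct hb, apply_eq_dotProduct hb, equivFun_toLin, equivFun_toLin,
      Matrix.mulVec_mulVec, ← Matrix.vecMul_transpose, ← Matrix.dotProduct_mulVec,
      Matrix.mulVec_mulVec, ← Matrix.mul_assoc, h1]

/-- With S the matrix of 2p - 1, the matrix JS represents the twisted form, hence is symmetric and
positive definite, and S² = 1 puts it in the pseudo-orthogonal group. Its square root R there
provides the conjugating element. -/
theorem exists_conjProj (hQ : Q.IsSymm) (hb : ∀ i j, Q (b i) (b j) = signMatrix n m i j)
    {p : Module.End ℝ H} (hp : p ∈ positiveProjections Q) :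
    ∃ g : pseudoOrthogonal n m, Matrix.toLin b b (conjProj g) = p := by
  set J := signMatrix n m with hJ
  have hJJ : J * J = 1 := signMatrix_mul_self n m
  have hJt : J.transpose = J := signMatrix_transpose n m
  let M := LinearMap.toMatrix b b p
  have hM : Matrix.toLin b b M = p := Matrix.toLin_toMatrix b b p
  have hMM : M * M = M := by
    rw [← LinearMap.toMatrix_comp b b b, ← Module.End.mul_eq_comp, hp.1.1]
  let S := 2 • M - 1
  have hS : S * S = 1 := by
    simp only [S, mul_sub, sub_mul, mul_one, one_mul, smul_mul_smul_comm, hMM]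
    module
  have hSx : ∀ x, b.equivFun ((2 : ℝ) • p x - x) = S.mulVec (b.equivFun x) := by
    intro x
    rw [map_sub, map_smul, ← hM, equivFun_toLin, Matrix.sub_mulVec, Matrix.one_mulVec,
      ← Nat.cast_smul_eq_nsmul ℝ, Matrix.smul_mulVec]
    simp
  have key : ∀ x y, twistedForm Q p x y = b.equivFun x ⬝ᵥ (J * S).mulVec (b.equivFun y) := by
    intro x y
    rw [twistedForm_eq hQ hp.1, apply_eq_dotProduct hb, hSx, Matrix.mulVec_mulVec]
  have hsymm : (J * S).transpose = J * S := by
    ext i j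
    have h1 := key (b i) (b j)
    have h2 := key (b j) (b i)
    rw [(twistedForm_isSymm hQ).eq] at h2
    rw [h1] at h2
    have e : ∀ i, b.equivFun (b i) = Pi.single i 1 := fun i => by
      simp [Finsupp.single_eq_pi_single]
    rw [e, e] at h2
    simpa using h2.symm
  have hpos : (J * S).PosDef := by
    refine Matrix.PosDef.of_dotProduct_mulVec_pos ?_ fun v hv => ?_
    · rw [Matrix.IsHermitian, Matrix.conjTranspose_eq_transpose_of_trivial, hsymm]
    · have := twistedForm_pos hp (b.equivFun.symm v) (b.equivFun.symm.map_ne_zero_iff.2 hv)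
      rwa [key, LinearEquiv.apply_symm_apply] at this
  have hN : (J * S) * J * (J * S) = J := by
    calc _ = J * S * (J * J) * S := by simp only [Matrix.mul_assoc]
      _ = _ := by rw [hJJ, Matrix.mul_one, Matrix.mul_assoc, hS, Matrix.mul_one]
  obtain ⟨R, hRt, hR, hRJ⟩ := exists_sqrt_pseudoOrthogonal hpos hN
  rw [← hJ] at hRJ
  have h1 : (J * R * J) * R = 1 := by
    rw [Matrix.mul_assoc, Matrix.mul_assoc, ← Matrix.mul_assoc R, hRJ, hJJ]
  have hg : (J * R * J).transpose * J * (J * R * J) = J := by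
    rw [Matrix.transpose_mul, Matrix.transpose_mul, hRt, hJt]
    calc _ = J * R * (J * J) * J * R * J := by simp only [Matrix.mul_assoc]
      _ = J * (R * J * R) * J := by rw [hJJ, Matrix.mul_one]; simp only [Matrix.mul_assoc]
      _ = _ := by rw [hRJ, hJJ, Matrix.one_mul]
  -- The element is JRJ, with inverse R, so that g gᵀ = J R² J = J(JS)J = SJ, as `two_conjProj`
  -- demands.
  let g : pseudoOrthogonal n m := ⟨⟨J * R * J, R, h1, mul_eq_one_comm.1 h1⟩, hg⟩
  refine ⟨g, ?_⟩
  rw [← hM]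
  congr 1
  refine two_conjProj_injective ?_
  refine (two_conjProj g).trans ?_
  change (J * R * J) * (J * R * J).transpose = S * J
  rw [Matrix.transpose_mul, Matrix.transpose_mul, hRt, hJt]
  have e : J * S = S.transpose * J := by
    rw [← hsymm, Matrix.transpose_mul, hJt]
  calc _ = J * R * (J * J) * R * J := by simp only [Matrix.mul_assoc]
    _ = J * (R * R) * J := by rw [hJJ, Matrix.mul_one, Matrix.mul_assoc J R]
    _ = (J * J) * S * J := by rw [hR]; simp only [Matrix.mul_assoc]
    _ = _ := by rw [hJJ, Matrix.one_mul]

/-- The Grassmannian of positive projections as a homogeneous space. -/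
theorem exists_homeomorph_positiveProjection (hQ : Q.IsSymm)
    (hb : ∀ i j, Q (b i) (b j) = signMatrix n m i j) :
    ∃ Φ : (pseudoOrthogonal n m ⧸ blockOrthogonal n m) ≃ₜ PositiveProjection Q,
      ∀ g : pseudoOrthogonal n m,
        (Φ g).1 = Matrix.toLin b b (g.1.val * blockProj n m * g⁻¹.1.val) := by
  -- For the module topology every linear map is continuous, so passing to matrices and back is a
  -- homeomorphism.
  let _ : TopologicalSpace (Module.End ℝ H) := moduleTopology ℝ (Module.End ℝ H)
  have : IsModuleTopology ℝ (Module.End ℝ H) := ⟨rfl⟩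
  have : ContinuousAdd (Module.End ℝ H) := IsModuleTopology.toContinuousAdd ℝ _
  have : IsModuleTopology ℝ (Matrix (Fin n ⊕ Fin m) (Fin n ⊕ Fin m) ℝ) :=
    inferInstanceAs (IsModuleTopology ℝ (Fin n ⊕ Fin m → Fin n ⊕ Fin m → ℝ))
  have hind : Topology.IsInducing (Subtype.val : PositiveProjection Q → Module.End ℝ H) := ⟨rfl⟩
  have hlin : Continuous (Matrix.toLin b b) :=
    IsModuleTopology.continuous_of_linearMap (Matrix.toLin b b).toLinearMap
  have hmat : Continuous (LinearMap.toMatrix b b) :=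
    IsModuleTopology.continuous_of_linearMap (LinearMap.toMatrix b b).toLinearMap
  let f : pseudoOrthogonal n m → PositiveProjection Q :=
    fun g => ⟨Matrix.toLin b b (conjProj g), toLin_conjProj_mem hb g⟩
  -- Properness is inherited from the matrix-valued orbit map, since taking matrices is continuous
  -- and injective.
  have hf : IsProperMap f := by
    refine isProperMap_of_comp_of_inj (g := fun q : PositiveProjection Q =>
      LinearMap.toMatrix b b q.1) ?_ (hmat.comp hind.continuous) ?_ ?_
    · exact hind.continuous_iff.2 (hlin.comp isProperMap_conjProj.continuous)
    · convert isProperMap_conjProj (n := n) (m := m) using 1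
      exact funext fun g => LinearMap.toMatrix_toLin b b (conjProj g)
    · exact (LinearMap.toMatrix b b).injective.comp Subtype.val_injective
  have hfib : ∀ g k, f g = f k ↔ g⁻¹ * k ∈ blockOrthogonal n m := by
    intro g k
    rw [← conjProj_eq_iff]
    exact Subtype.ext_iff.trans (Matrix.toLin b b).injective.eq_iff
  let φ : (pseudoOrthogonal n m ⧸ blockOrthogonal n m) → PositiveProjection Q :=
    fun q => Quotient.liftOn' q f fun g k h => (hfib g k).2 (QuotientGroup.leftRel_apply.1 h)
  have hφ : Function.Bijective φ := by
    constructor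
    · intro q q'
      induction q using QuotientGroup.induction_on with
      | H g =>
        induction q' using QuotientGroup.induction_on with
        | H k => exact fun h => QuotientGroup.eq.2 ((hfib g k).1 h)
    · rintro ⟨p, hp⟩
      obtain ⟨g, hg⟩ := exists_conjProj hQ hb hp
      exact ⟨g, Subtype.ext hg⟩
  have hcont : Continuous φ := hf.continuous.quotient_liftOn' _
  -- The image under φ of a closed set is the image under the proper map f of its preimage in the
  -- group; a continuous closed bijection is a homeomorphism.
  have hclosed : IsClosedMap φ := by
    intro C hC
    have : φ '' C = f '' (QuotientGroup.mk ⁻¹' C) := by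
      change φ '' C = (φ ∘ QuotientGroup.mk) '' (QuotientGroup.mk ⁻¹' C)
      rw [Set.image_comp, Set.image_preimage_eq _ QuotientGroup.mk_surjective]
    rw [this]
    exact hf.isClosedMap _ (hC.preimage continuous_quot_mk)
  exact ⟨(Equiv.ofBijective φ hφ).toHomeomorphOfContinuousClosed hcont hclosed, fun g => rfl⟩

end Coordinates

end FullVertex
end

theorem mainTheorem5 {L : Type*} [AddCommGroup L] [Module.Free ℤ L] [Module.Finite ℤ L]
    (B : LinearMap.BilinForm ℤ L) (hsymm : B.IsSymm) (heven : ∀ α, Even (B α α))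
    (hnondeg : (realForm B).Nondegenerate) (A : TwistedGroupAlgebra B) :
    (∀ p ∈ orthogonalProjections (realForm B), (latticeVertex p A).IsFullVertexAlgebra) ∧
    (∀ p ∈ positiveProjections (realForm B), ∀ (k l : ℕ)
      (hl : Module.Basis (Fin k) ℂ (leftSpace p)) (hr : Module.Basis (Fin l) ℂ (rightSpace p)),
      IsOrthonormal B p (fun i => (hl i : ComplexSpace L)) →
      IsOrthonormal B p (fun j => (hr j : ComplexSpace L)) →
      (latticeVertex p A).IsFullVOA (conformalVector B p fun i => hl i)
        (conformalVector B p fun j => hr j) ∧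
      (latticeVertex p A).IsSelfDual (conformalVector B p fun i => hl i)
        (conformalVector B p fun j => hr j) ∧
      (latticeVertex p A).IsQPGenerated (conformalVector B p fun i => hl i)
        (conformalVector B p fun j => hr j)) ∧
    (∀ (n m : ℕ) (b : Module.Basis (Fin n ⊕ Fin m) ℝ (RealSpace L)),
      (∀ i j, realForm B (b i) (b j) = signMatrix n m i j) →
      ∃ Φ : (pseudoOrthogonal n m ⧸ blockOrthogonal n m) ≃ₜ PositiveProjection (realForm B),
        ∀ g : pseudoOrthogonal n m,
          (Φ g).1 = Matrix.toLin b b (g.1.val * blockProj n m * g⁻¹.1.val)) := by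
  refine ⟨fun p hp => latticeVertex_isFullVertexAlgebra B hsymm heven hnondeg A p hp,
    fun p hp k l hl hr h1 h2 => latticeVertex_isFullVOA B hsymm heven hnondeg A p hp hl hr h1 h2,
    fun n m b hb => exists_homeomorph_positiveProjection (realForm_isSymm hsymm) hb⟩
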